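/- **Conventions.** Put $y=z/(1-z)$, $\bar y=\bar z/(1-\bar z)$, $h_{ij}=h_i-h_j$, $(x)_n=\Gamma(x+n)/\Gamma(x)$, and $$k^{r,s}_{2h}(z)=z^h(1-z)^{-r}{}_2F_1(h-r,h+s;2h;z),\qquad \kappa^{r,s}_j(h)=\frac{(-1)^j(h-r)_j(h-s)_j}{(2h)_j\,j!},$$ $$S^{r,s}_a(h)=\frac{1}{\Gamma(-a-r)\Gamma(-a-s)}\frac{\Gamma(h-r)\Gamma(h-s)}{\Gamma(2h-1)}\frac{\Gamma(h-a-1)}{\Gamma(h+a+1)},$$ $$K^{r,s}_k(h)=\frac{\Gamma(r-s)\Gamma(1+s-r)}{\Gamma(k+1)\Gamma(k+1+s-r)}\frac{\Gamma(2h)}{\Gamma(h-r)\Gamma(h-s)}\frac{\Gamma(h+k-r)}{\Gamma(h-k+r)},\qquad Q^r_k(h)=\lim_{s\to r}(s-r)K^{r,s}_k(h).$$ For weights $h_1,\dots,h_4,h_a$ let $$\beta^{1234}_a(n)=\sum_{k=0}^nK^{h_{32},h_{14}}_k(h_a)\,S^{h_{12},h_{34}}_{-k-h_1-h_2}(h_1+h_2+n),$$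 and let $\hat\beta^{1234}_a(n)$ be $\beta^{1234}_a(n)$ if $h_1+h_2\ne h_3+h_4$, and the same sum with $Q^{h_{32}}_k(h_a)$ in place of $K^{h_{32},h_{14}}_k(h_a)$ if $h_1+h_2=h_3+h_4$. Let $\alpha^{1234}_a(h)$ denote the formal large-$h$ series $\sum_{m\ge0}\kappa_m^{h_{32},h_{14}}(h_a)\,S^{h_{12},h_{34}}_{h_a+m-h_1-h_3}(h)$, and $$\gamma_{1234;abcd}(m)=\sum_{n=0}^m\frac{\beta^{bd12}_a(n)\,\beta^{db34}_c(n)}{S^{h_{bd},h_{db}}_{-h_b-h_d}(h_b+h_d+n)}\,\kappa^{h_{12},h_{34}}_{m-n}(h_b+h_d+n).$$ Let $\hat\gamma$ be the same with $\hat\beta$ in place of $\beta$, and let $q_{1234;abcd}\in\{0,1,2\}$ be the number of the two equalities $h_b+h_d=h_1+h_2$, $h_b+h_d=h_3+h_4$ that hold. Barred indices mean that the weights $\bar h$ are used. The sign $\sim$ means equality of expansions to all orders in $1/h$ as $h\to\infty$. Terms $y^e$ with $e\in(-r+\mathbb N)\cup(-s+\mathbb N)$ and $y^e\log y$ with $e\in(-r+\mathbb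 N)\cap(-s+\mathbb N)$ are called Casimir-regular for blocks $k^{r,s}$. The Casimir-singular part of a function of $y$ is its asymptotic expansion as $y\to0^+$ modulo these terms. **Data.** Operators have real weights $(h,\bar h)$ with integer spin $\ell=h-\bar h$, and three-point coefficients satisfy $f_{ijk}=f_{kij}=(-1)^{\ell_i+\ell_j+\ell_k}f_{jik}$. Take the box diagram with external operators $1,2,3,4$ and internal operators $a$ (between the vertices of $1,2$), $b$ ($2,3$), $c$ ($3,4$), $d$ ($4,1$). Assume that the weights $\bar h$ are admissible for $(1234;abcd)$ and that the weights $h$ are admissible for $(3214;badc)$. Here weights are admissible for $(1234;abcd)$ if none of $2h_a,2h_b,2h_c,2h_d$, $2(h_b+h_d)-1$, $h_d+h_a-h_1$, $h_b+h_c-h_3$, $h_b+h_d-h_{12}$, $h_b+h_d-h_{34}$ is a non-positive integer, and each of $h_b+h_d-h_1-h_2$, $h_b+h_d-h_3-h_4$ is either $0$ or not an integer. Write $q=q_{3214;badc}$ and $\bar q=q_{\bar1\bar2\bar3\bar4;\bar a\bar b\bar c\bar d}$. *Reading as $[bd]_n$ exchange in the $12\to34$ channel.* Let $L_n,R_n,W_n,\delta_n$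 be any functions of $h$ (standing for $\lambda_{bd[bd]_n}\lambda_{12[bd]_n}$, $\lambda_{db[bd]_n}\lambda_{34[bd]_n}$, $\lambda_{db[bd]_n}\lambda_{bd[bd]_n}$ and half the anomalous dimension of $[bd]_n$) such that $$W_n\sim S^{h_{bd},h_{db}}_{-h_b-h_d}(h)\,S^{\bar h_{bd},\bar h_{db}}_{-\bar h_b-\bar h_d}(\bar h_b+\bar h_d+n),$$ $$L_n\delta_n^{\epsilon}\sim f_{d1a}f_{a2b}\,\alpha^{bd12}_a(h)\,\hat\beta^{\bar b\bar d\bar1\bar2}_{\bar a}(n),\qquad R_n\delta_n^{\epsilon'}\sim f_{b3c}f_{c4d}\,\alpha^{db34}_c(h)\,\hat\beta^{\bar d\bar b\bar3\bar4}_{\bar c}(n),$$ where $\epsilon=1$ if $\bar h_b+\bar h_d=\bar h_1+\bar h_2$ and $\epsilon=0$ otherwise, and $\epsilon'$ is defined likewise with $\bar h_3+\bar h_4$. For any starting weights $h_0(n)>0$, the reading is the contribution of order $\delta^{\bar q}$ to the $12\to34$ side of the crossing equation, $$\bar y^{-\bar h_1-\bar h_3}\sum_{n\ge0}\ \sum_{h\in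 h_0(n)+\mathbb N}\frac{L_nR_n}{W_n}(h)\,\delta_n(h)^{\bar q}\;k^{h_{12},h_{34}}_{2h}(1-z)\;\frac1{\bar q!}\,\partial_{\bar h}^{\bar q}k^{\bar h_{12},\bar h_{34}}_{2\bar h}(\bar z)\Big|_{\bar h=\bar h_b+\bar h_d+n},$$ where the sum over $n$ is understood order by order in $\bar y$. Its Casimir-singular part is taken in $\bar y$ with respect to $k^{\bar h_{32},\bar h_{14}}$ and in $y$ with respect to $k^{h_{12},h_{34}}$. *Reading as $[ac]_m$ exchange in the $23\to14$ channel.* This is the previous reading after $1\leftrightarrow3$, $a\leftrightarrow b$, $c\leftrightarrow d$ and exchange of the roles of $(h,y)$ and $(\bar h,\bar y)$, multiplied by the sign $(-1)^{\ell_1+\ell_2+\ell_3+\ell_4}$ that relates $f_{32\mathcal O}f_{14\mathcal O}$ to the product $f_{23\mathcal O}f_{41\mathcal O}$ in the crossing equation. **Theorem.** 1. If $q=0$, then $$\frac{\alpha^{bd12}_a(h)\,\alpha^{db34}_c(h)}{S^{h_{bd},h_{db}}_{-h_b-h_d}(h)}\sim\sum_{m\ge0}\gamma_{3214;badc}(m)\,S^{h_{12},h_{34}}_{h_a+h_c-h_1-h_3+m}(h)$$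 (for any functions that represent the two series $\alpha$; only the condition on the weights $h$ is needed). 2. $\hat\gamma_{\bar1\bar2\bar3\bar4;\bar a\bar b\bar c\bar d}(n)$ is the limit of $\varepsilon^{\bar q}\,\gamma_{\bar1\bar2\bar3\bar4;\bar a\bar b\bar c\bar d}(n)$ when $\bar h_b,\bar h_d$ are shifted by amounts that tend to $0$ and have sum $\varepsilon\neq0$. Similarly $\hat\gamma_{3214;badc}(m)$ is the limit of $\varepsilon^q\gamma_{3214;badc}(m)$ under shifts of $h_a,h_c$. 3. In both readings all sums over the large weight converge, and both readings have the same Casimir-singular part $$f_{d1a}f_{a2b}f_{b3c}f_{c4d}\sum_{m,n\ge0}\hat\gamma_{3214;badc}(m)\,\hat\gamma_{\bar1\bar2\bar3\bar4;\bar a\bar b\bar c\bar d}(n)\;y^{h_a+h_c-h_1-h_3+m}\frac{\log^q y}{q!}\;\bar y^{\bar h_b+\bar h_d-\bar h_1-\bar h_3+n}\frac{\log^{\bar q}\bar y}{\bar q!}.$$ Its coefficients are invariant under $(1,a,d,m,h)\leftrightarrow(3,b,c,n,\bar h)$ combined with multiplication by $(-1)^{\ell_1+\ell_2+\ell_3+\ell_4}$.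 4. (Second-order exponentiation.) Let $\bar h_b+\bar h_d=\bar h_1+\bar h_2=\bar h_3+\bar h_4$, and let $L_n\delta_n$ and $R_n\delta_n$ be given by sums over finite non-empty sets of operators $a\in X$ and $c\in X'$, all satisfying the assumptions above. Then the order-$\delta^2$ term of the $[bd]_n$ exchange has as its Casimir-singular part the sum over $(a,c)\in X\times X'$ of the series in 3, with $\log^2\bar y/2$, and each summand equals the Casimir-singular part of the corresponding $[ac]_m$ exchange in the $23\to14$ channel. In particular this holds for $\langle\phi_1\phi_2\phi_2\phi_1\rangle$ with $b=2$, $d=1$, $X=X'$ and $L_n=R_n=W_n=\lambda^2_n$: if $\delta_n$ is determined at first order by $\lambda_n^2\delta_n\sim\sum_{a\in X}f_{11a}f_{a22}\,\alpha^{2112}_a(h)\,\hat\beta^{\bar2\bar1\bar1\bar2}_{\bar a}(n)$, then the term $\tfrac12\lambda_n^2\delta_n^2\,\partial^2_{\bar h}k_{2\bar h}$ reproduces the $\log^2\bar y$ terms required by the crossed channel. -/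

import Mathlib

noncomputable section

namespace BoxDiagram

open Filter Asymptotics Topology

/-! ### `SL(2,ℝ)` blocks and the elementary coefficients -/

/-- The block `k_{2h}^{r,s}(z) = z^h (1-z)^{-r} ₂F₁(h-r, h+s; 2h; z)`. -/
def block (r s h z : ℝ) : ℝ :=
  z ^ h * (1 - z) ^ (-r) * ordinaryHypergeometric (h - r) (h + s) (2 * h) z

/-- The rising factorial `(x)_n`. -/
def poch (x : ℝ) (n : ℕ) : ℝ := (ascPochhammer ℝ n).eval x

/-- The coefficient of `y^{h+j}`, `y = z/(1-z)`, in the expansion of `k_{2h}^{r,s}(z)`. -/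
def blockCoeff (r s h : ℝ) (j : ℕ) : ℝ :=
  poch (h - r) j * poch (h - s) j / (poch (2 * h) j * (j.factorial : ℝ)) * (-1) ^ j

/-- The coefficients `S_a^{r,s}(h)`. -/
def S (r s a h : ℝ) : ℝ :=
  1 / (Real.Gamma (-a - r) * Real.Gamma (-a - s)) *
    (Real.Gamma (h - r) * Real.Gamma (h - s) / Real.Gamma (2 * h - 1)) *
    (Real.Gamma (h - a - 1) / Real.Gamma (h + a + 1))

/-- The coefficient `K_k^{r,s}(h)` of `y^{k-r}` in `k_{2h}^{r,s}(1-z)` for `r - s ∉ ℤ`. -/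
def K (r s : ℝ) (k : ℕ) (h : ℝ) : ℝ :=
  Real.Gamma (r - s) * Real.Gamma (1 + s - r) /
      (Real.Gamma (k + 1) * Real.Gamma (k + 1 + s - r)) *
    (Real.Gamma (2 * h) / (Real.Gamma (h - r) * Real.Gamma (h - s))) *
    (Real.Gamma (h + k - r) / Real.Gamma (h - k + r))

/-- The coefficient of `y^{k-r} log y` in `k_{2h}^{r,r}(1-z)`; it is the limit of
`(s - r) K_k^{r,s}(h)` as `s → r`. -/
def Q (r : ℝ) (k : ℕ) (h : ℝ) : ℝ :=
  -(Real.Gamma (2 * h) / (Real.Gamma (k + 1) ^ 2 * Real.Gamma (h - r) ^ 2)) *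
    (Real.Gamma (h + k - r) / Real.Gamma (h - k + r))

/-- `β^{1234}_a(n)`. -/
def beta (x₁ x₂ x₃ x₄ xa : ℝ) (n : ℕ) : ℝ :=
  ∑ k ∈ Finset.range (n + 1),
    K (x₃ - x₂) (x₁ - x₄) k xa * S (x₁ - x₂) (x₃ - x₄) (-k - x₁ - x₂) (x₁ + x₂ + n)

/-- The analogue of `β^{1234}_a(n)` that multiplies a logarithm when `x₁ + x₂ = x₃ + x₄`. -/
def betaLog (x₁ x₂ x₃ x₄ xa : ℝ) (n : ℕ) : ℝ :=
  ∑ k ∈ Finset.range (n + 1),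
    Q (x₃ - x₂) k xa * S (x₁ - x₂) (x₃ - x₄) (-k - x₁ - x₂) (x₁ + x₂ + n)

/-- `β`, or its logarithmic version in the degenerate case `x₁ + x₂ = x₃ + x₄`. -/
def leadBeta (x₁ x₂ x₃ x₄ xa : ℝ) (n : ℕ) : ℝ :=
  if x₁ + x₂ = x₃ + x₄ then betaLog x₁ x₂ x₃ x₄ xa n else beta x₁ x₂ x₃ x₄ xa n

/-! ### Box diagrams -/

/-- Labels of a box diagram: external legs `1,2,3,4`, and internal legs `a` (joining the vertices
of `1` and `2`), `b` (joining `2,3`), `c` (joining `3,4`), `d` (joining `4,1`). -/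
structure Box (α : Type*) where
  (e₁ e₂ e₃ e₄ a b c d : α)

namespace Box

variable {α β : Type*}

def map (g : α → β) (B : Box α) : Box β :=
  ⟨g B.e₁, g B.e₂, g B.e₃, g B.e₄, g B.a, g B.b, g B.c, g B.d⟩

/-- The relabelling `1 ↔ 3`, `a ↔ b`, `d ↔ c`, i.e. `1234;abcd ↦ 3214;badc`. -/
def cross (B : Box α) : Box α :=
  ⟨B.e₃, B.e₂, B.e₁, B.e₄, B.b, B.a, B.d, B.c⟩

/-- Replace the legs `a` and `c`. -/
def withAC (B : Box α) (a c : α) : Box α :=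
  ⟨B.e₁, B.e₂, B.e₃, B.e₄, a, B.b, c, B.d⟩

end Box

/-- `γ_{1234;abcd}(m)`. -/
def gamma (w : Box ℝ) (m : ℕ) : ℝ :=
  ∑ n ∈ Finset.range (m + 1),
    beta w.b w.d w.e₁ w.e₂ w.a n * beta w.d w.b w.e₃ w.e₄ w.c n /
        S (w.b - w.d) (w.d - w.b) (-w.b - w.d) (w.b + w.d + n) *
      blockCoeff (w.e₁ - w.e₂) (w.e₃ - w.e₄) (w.b + w.d + n) (m - n)

/-- `γ_{1234;abcd}(m)` with every `β` replaced by `leadBeta`. -/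
def gammaLead (w : Box ℝ) (m : ℕ) : ℝ :=
  ∑ n ∈ Finset.range (m + 1),
    leadBeta w.b w.d w.e₁ w.e₂ w.a n * leadBeta w.d w.b w.e₃ w.e₄ w.c n /
        S (w.b - w.d) (w.d - w.b) (-w.b - w.d) (w.b + w.d + n) *
      blockCoeff (w.e₁ - w.e₂) (w.e₃ - w.e₄) (w.b + w.d + n) (m - n)

/-- The number of degeneracies `b + d = 1 + 2`, `d + b = 3 + 4`: the order of the pole of `γ` and
the power of the logarithm. -/
def mult (w : Box ℝ) : ℕ :=
  (if w.b + w.d = w.e₁ + w.e₂ then 1 else 0) + (if w.d + w.b = w.e₃ + w.e₄ then 1 else 0)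

/-- Shift the weights of `b` and `d`. -/
def shiftBD (w : Box ℝ) (t : ℝ × ℝ) : Box ℝ :=
  { w with b := w.b + t.1, d := w.d + t.2 }

/-- `x` is not a pole of the Gamma function. -/
def NotPole (x : ℝ) : Prop := ∀ k : ℕ, x ≠ -(k : ℝ)

/-- No Gamma function that enters `γ` is evaluated at a pole, and each of `b + d - 1 - 2` and
`b + d - 3 - 4` is either a non-integer or exactly zero. -/
structure Admissible (w : Box ℝ) : Prop where
  a : NotPole (2 * w.a)
  b : NotPole (2 * w.b)
  c : NotPole (2 * w.c)
  d : NotPole (2 * w.d)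
  bd : NotPole (2 * (w.b + w.d) - 1)
  da1 : NotPole (w.d + w.a - w.e₁)
  bc3 : NotPole (w.b + w.c - w.e₃)
  bd12 : NotPole (w.b + w.d - (w.e₁ - w.e₂))
  bd34 : NotPole (w.b + w.d - (w.e₃ - w.e₄))
  res12 : w.b + w.d = w.e₁ + w.e₂ ∨ ∀ k : ℤ, w.b + w.d - w.e₁ - w.e₂ ≠ k
  res34 : w.d + w.b = w.e₃ + w.e₄ ∨ ∀ k : ℤ, w.d + w.b - w.e₃ - w.e₄ ≠ k

/-! ### Asymptotic expansions -/

/-- `p(h) ∼ ∑_{i ∈ I} ∑_m c_i(m) S^{r,s}_{a_i + m}(h)` to all orders in `1/h` as `h → ∞`.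
(Note that `S_a^{r,s}(h)` is of order `Γ(h-r) Γ(h-s) / Γ(2h-1) * h^{-2a-2}`.) -/
def HasLargeWeightExpansion {ι : Type*} (r s : ℝ) (p : ℝ → ℂ) (I : Finset ι) (a : ι → ℝ)
    (c : ι → ℕ → ℂ) : Prop :=
  ∀ N : ℕ, ∃ M₀ : ℕ, ∀ M ≥ M₀,
    (fun h : ℝ => p h - ∑ i ∈ I, ∑ m ∈ Finset.range M, c i m * (S r s (a i + m) h : ℂ))
      =O[atTop] fun h : ℝ =>
        Real.Gamma (h - r) * Real.Gamma (h - s) / Real.Gamma (2 * h - 1) * (h ^ N)⁻¹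

/-- The formal sum with partial sums `F M` has, as `y → 0+`, the Casimir-singular part
`∑_{i ∈ I} ∑_m c_i(m) y^{a_i + m} (log y)^{q_i} / q_i!` with respect to blocks `k^{r,s}`: it has
this expansion to all orders modulo Casimir-regular terms. Casimir-regular are the powers `y^e`
with `e ∈ -r + ℕ` or `e ∈ -s + ℕ`, and `y^e log y` with `e` in both sets. -/
def HasCasimirSingularPart {ι : Type*} (r s : ℝ) (F : ℕ → ℝ → ℂ) (I : Finset ι) (a : ι → ℝ)
    (q : ι → ℕ) (c : ι → ℕ → ℂ) : Prop :=
  ∃ u v w : ℕ → ℂ, (∀ k : ℕ, (¬ ∃ j : ℕ, (k : ℝ) - r = (j : ℝ) - s) → w k = 0) ∧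
    ∀ N : ℕ, ∃ M₀ : ℕ, ∀ M ≥ M₀,
      (fun y : ℝ => F M y
          - ∑ i ∈ I, ∑ m ∈ Finset.range M,
              c i m * ((y ^ (a i + m) * Real.log y ^ q i / ((q i).factorial : ℝ) : ℝ) : ℂ)
          - ∑ k ∈ Finset.range M,
              (u k * ((y ^ ((k : ℝ) - r) : ℝ) : ℂ) + v k * ((y ^ ((k : ℝ) - s) : ℝ) : ℂ)
                + w k * ((y ^ ((k : ℝ) - r) * Real.log y : ℝ) : ℂ)))
        =O[𝓝[>] 0] fun y : ℝ => y ^ N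

/-! ### Two-dimensional OPE data and double-twist exchange -/

/-- Weights, spins and three-point coefficients of a set of operators. -/
structure OPEData (Op : Type*) where
  h : Op → ℝ
  hbar : Op → ℝ
  spin : Op → ℤ
  f : Op → Op → Op → ℂ
  spin_eq : ∀ o, h o - hbar o = spin o
  f_swap : ∀ i j k, f i j k = (-1) ^ (spin i + spin j + spin k) * f j i k
  f_cyc : ∀ i j k, f i j k = f k i j

namespace OPEData

variable {Op : Type*}

/-- Exchange of the holomorphic and antiholomorphic sectors. -/
def conj (D : OPEData Op) : OPEData Op where
  h := D.hbar
  hbar := D.h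
  spin o := -D.spin o
  f := D.f
  spin_eq o := by
    have := D.spin_eq o
    push_cast
    linarith
  f_swap i j k := by
    have e : -D.spin i + -D.spin j + -D.spin k = -(D.spin i + D.spin j + D.spin k) := by ring
    rw [e, zpow_neg, ← inv_zpow, D.f_swap i j k]
    norm_num
  f_cyc := D.f_cyc

/-- The sign `(-1)^{ℓ₁+ℓ₂+ℓ₃+ℓ₄}` that relates `f_{23𝒪} f_{41𝒪}` to `f_{32𝒪} f_{14𝒪}`. -/
def phase (D : OPEData Op) (B : Box Op) : ℂ :=
  (-1) ^ (D.spin B.e₁ + D.spin B.e₂ + D.spin B.e₃ + D.spin B.e₄)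

/-- The coefficient of `y^{h_a+h_c-h₁-h₃+m} ȳ^{h̄_b+h̄_d-h̄₁-h̄₃+n}` (times the logarithms of the
degenerate cases, normalised as `log^q / q!`) in the double expansion of the box diagram. -/
def boxCoeff (D : OPEData Op) (B : Box Op) (m n : ℕ) : ℂ :=
  D.f B.d B.e₁ B.a * D.f B.a B.e₂ B.b * D.f B.b B.e₃ B.c * D.f B.c B.e₄ B.d *
    (gammaLead (B.map D.h).cross m : ℂ) * (gammaLead (B.map D.hbar) n : ℂ)

/-- Large-spin data of the family `[bd]_n`, as functions of `n` and of the holomorphic weight: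
`L = λ_{bd[bd]_n} λ_{12[bd]_n}`, `R = λ_{db[bd]_n} λ_{34[bd]_n}`, `W = λ_{db[bd]_n} λ_{bd[bd]_n}`,
and the shift `δ` of the antiholomorphic weight `h̄_b + h̄_d + n` (half the anomalous dimension).
`L` is sourced by the exchange of the operators `a ∈ Xa`, `R` by that of `c ∈ Xc`, and `W` by
the identity. If `h̄_b + h̄_d = h̄₁ + h̄₂`, the exchange of `a` gives a logarithm, which determines
the product `L δ` instead of `L`; likewise for `R` if `h̄_d + h̄_b = h̄₃ + h̄₄`.
The legs `B.a` and `B.c` are not used. -/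
structure IsDoubleTwistFamily (D : OPEData Op) (B : Box Op) (Xa Xc : Finset Op)
    (L R W δ : ℕ → ℝ → ℂ) : Prop where
  left : ∀ n, HasLargeWeightExpansion (D.h B.b - D.h B.d) (D.h B.e₁ - D.h B.e₂)
    (fun h => L n h * δ n h ^ (if D.hbar B.b + D.hbar B.d = D.hbar B.e₁ + D.hbar B.e₂
      then 1 else 0))
    Xa (fun a => D.h a - D.h B.b - D.h B.e₁)
    (fun a m => D.f B.d B.e₁ a * D.f a B.e₂ B.b *
      (blockCoeff (D.h B.e₁ - D.h B.d) (D.h B.b - D.h B.e₂) (D.h a) m : ℂ) *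
      (leadBeta (D.hbar B.b) (D.hbar B.d) (D.hbar B.e₁) (D.hbar B.e₂) (D.hbar a) n : ℂ))
  right : ∀ n, HasLargeWeightExpansion (D.h B.d - D.h B.b) (D.h B.e₃ - D.h B.e₄)
    (fun h => R n h * δ n h ^ (if D.hbar B.d + D.hbar B.b = D.hbar B.e₃ + D.hbar B.e₄
      then 1 else 0))
    Xc (fun c => D.h c - D.h B.d - D.h B.e₃)
    (fun c m => D.f B.b B.e₃ c * D.f c B.e₄ B.d *
      (blockCoeff (D.h B.e₃ - D.h B.b) (D.h B.d - D.h B.e₄) (D.h c) m : ℂ) *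
      (leadBeta (D.hbar B.d) (D.hbar B.b) (D.hbar B.e₃) (D.hbar B.e₄) (D.hbar c) n : ℂ))
  norm : ∀ n, HasLargeWeightExpansion (D.h B.b - D.h B.d) (D.h B.d - D.h B.b) (W n)
    (Finset.univ : Finset Unit) (fun _ => -D.h B.b - D.h B.d)
    (fun _ m => if m = 0 then
      (S (D.hbar B.b - D.hbar B.d) (D.hbar B.d - D.hbar B.b) (-D.hbar B.b - D.hbar B.d)
        (D.hbar B.b + D.hbar B.d + n) : ℂ) else 0)

/-- The sum over `h ∈ h₀ + ℕ` of `p(h) k_{2h}^{h₁₂,h₃₄}(1-z)`, where `1 - z = 1/(1+y)`. -/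
def blockSum (D : OPEData Op) (B : Box Op) (p : ℝ → ℂ) (h₀ y : ℝ) : ℂ :=
  ∑' ℓ : ℕ, p (h₀ + ℓ) *
    (block (D.h B.e₁ - D.h B.e₂) (D.h B.e₃ - D.h B.e₄) (h₀ + ℓ) (1 / (1 + y)) : ℂ)

/-- The term of order `δ^q` in the contribution of the family `[bd]_n` to the `12 → 34` side
`ȳ^{-h̄₁-h̄₃} ∑ f_{12𝒪} f_{34𝒪} k_{2h}^{h₁₂,h₃₄}(1-z) k_{2h̄}^{h̄₁₂,h̄₃₄}(z̄)` of the crossing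
equation, expanded around `h̄ = h̄_b + h̄_d + n`. Here `p(h) = λ_{12[bd]_n} λ_{34[bd]_n} δ^q`, and
`1 - z = 1/(1+y)`, `z̄ = ȳ/(1+ȳ)`. -/
def exchangeTerm (D : OPEData Op) (B : Box Op) (q : ℕ) (p : ℕ → ℝ → ℂ) (h₀ : ℕ → ℝ)
    (n : ℕ) (y ybar : ℝ) : ℂ :=
  ((ybar ^ (-D.hbar B.e₁ - D.hbar B.e₃) : ℝ) : ℂ) * blockSum D B (p n) (h₀ n) y *
    ((iteratedDeriv q (fun x => block (D.hbar B.e₁ - D.hbar B.e₂) (D.hbar B.e₃ - D.hbar B.e₄) x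
        (ybar / (1 + ybar))) (D.hbar B.b + D.hbar B.d + n) / (q.factorial : ℝ) : ℝ) : ℂ)

/-- The exchange of the families `[bd]_n`, `n = 0, 1, …`, at order `δ^q`, in the `12 → 34` channel
(times a constant `κ`) has the Casimir-singular part
`∑_{(a,c) ∈ X} ∑_{m,n} C_{a,c}(m,n) y^{h_a+h_c-h₁-h₃+m} (log y)^{q'} / q'!
  * ȳ^{h̄_b+h̄_d-h̄₁-h̄₃+n} (log ȳ)^q / q!`, with `q'` the number of degeneracies
`h_a + h_c = h₃ + h₂`, `h_a + h_c = h₁ + h₄`: the sums over `h` converge, the sum over `n` is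
expanded order by order in `ȳ` modulo terms that are Casimir-regular for the blocks
`k^{h̄₃₂,h̄₁₄}(1-z̄)` of the crossed channel, and each coefficient, a function of `y`, is expanded
modulo terms that are Casimir-regular for the blocks `k^{h₁₂,h₃₄}(1-z)`. -/
def HasExchangeSingularPart (D : OPEData Op) (B : Box Op) (q : ℕ) (p : ℕ → ℝ → ℂ)
    (h₀ : ℕ → ℝ) (κ : ℂ) (X : Finset (Op × Op)) (C : Op × Op → ℕ → ℕ → ℂ) : Prop :=
  (∀ n, ∀ y > 0, Summable fun ℓ : ℕ => p n (h₀ n + ℓ) *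
    (block (D.h B.e₁ - D.h B.e₂) (D.h B.e₃ - D.h B.e₄) (h₀ n + ℓ) (1 / (1 + y)) : ℂ)) ∧
  ∃ Φ : ℕ → ℝ → ℂ,
    (∀ y > 0, HasCasimirSingularPart (D.hbar B.e₃ - D.hbar B.e₂) (D.hbar B.e₁ - D.hbar B.e₄)
      (fun M ybar => κ * ∑ n ∈ Finset.range M, exchangeTerm D B q p h₀ n y ybar)
      (Finset.univ : Finset Unit)
      (fun _ => D.hbar B.b + D.hbar B.d - D.hbar B.e₁ - D.hbar B.e₃) (fun _ => q)
      (fun _ n => Φ n y)) ∧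
    ∀ n, HasCasimirSingularPart (D.h B.e₁ - D.h B.e₂) (D.h B.e₃ - D.h B.e₄) (fun _ => Φ n) X
      (fun x => D.h x.1 + D.h x.2 - D.h B.e₁ - D.h B.e₃)
      (fun x => mult (((B.withAC x.1 x.2).map D.h).cross)) (fun x m => C x m n)

/-- The box diagram `B`, read as `[bd]_n` exchange in the `12 → 34` channel and multiplied by `κ`,
has the Casimir-singular part with coefficients `C m n`: this holds for whatever functions have the
large-spin expansions due to the exchange of `a` and `c`, and wherever the sums over `h` start. -/
def ReadingHasSingularPart (D : OPEData Op) (B : Box Op) (κ : ℂ) (C : ℕ → ℕ → ℂ) : Prop :=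
  ∀ (L R W δ : ℕ → ℝ → ℂ) (h₀ : ℕ → ℝ), (∀ n, 0 < h₀ n) →
    IsDoubleTwistFamily D B {B.a} {B.c} L R W δ →
    HasExchangeSingularPart D B (mult (B.map D.hbar))
      (fun n h => L n h * R n h / W n h * δ n h ^ mult (B.map D.hbar)) h₀ κ {(B.a, B.c)}
      (fun _ => C)

end OPEData

end BoxDiagram

end

/-! The two readings agree because the coefficients γ have a closed form that appears from two
unrelated sources.

The algebraic source is the sum over n that defines γ. By `leadBeta_eq` each β(n) is, up to Gamma
factors, a terminating ₄F₃ of Racah type, that is, a combination of the polynomials (-n)_k (g+n)_k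
in n. The block coefficients together with the normalisation form the kernel that inverts the
expansion of y^{x+K} in blocks, so the sum over n extracts one coefficient of the linearised product
of two such polynomials (`sum_racah_mul_racah`). A Biedenharn–Elliott type identity, obtained from
repeated Saalschütz sums (`racahProd_eq_prodCoeff`), evaluates it. The outcome is `gammaLead_eq`:
γ(m) is a product of two factors Γ(σ-m), replaced by residues up to sign in the degenerate cases,
with `boxConst` and the regular expression `boxProd`.

The analytic source is the large-weight limit. Up to a weight that factors out, S_a(h) is a constant
times T_a(h) = Γ(h-a-1)/Γ(h+a+1). The quotient T_e T_{e'} / T_{e''} has an asymptotic series in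
T_{e+e'-e''+j} with Pochhammer coefficients, because the truncated series satisfies the first-order
difference equation of the quotient up to one term (`gammaQuot_mul_div_expansion`). Multiplying the
series of the two exchanges and dividing by that of the identity yields `boxProd` of the crossed box
(`hasQuotExpansion_box`). Away from degeneracies the two Γ(σ-m) are cancelled by the reciprocal
Gamma functions inside S, which is the large-weight identity.

Sums over h of T_e(h) times blocks supply the factors Γ(σ-m) in position space. The Casimir equation
is split into two first-order Euler equations. A contiguous relation telescopes the sum F_e, so that
(y∂_y - e)F_e is a boundary term, and (e+r)(e+s)F_e = y F_{e-1} holds modulo Casimir-regular terms.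
The coefficient of y^e for very negative e is found by a Bohr–Mollerup argument and is
Γ(-e-r)Γ(-e-s) (`BlockBound.hasLead`); the recursion carries it to all e. At a pole of these Gamma
functions the Euler equations are resonant and produce log y or log²y/2. Remainders that decay fast
in h are Casimir-regular to high order, since the Casimir operator may be applied to them many times
(`BlockBound.exists_decay_mem`).

In the other cross ratio the block at h̄ = h̄_b + h̄_d + n and its weight derivatives are expanded
at small ȳ. The top power of the logarithm multiplies the undifferentiated block coefficients, while
all lower powers are Casimir-regular exactly because of the degeneracy that makes a logarithm
appear. Summing over n gives γ̂ in the barred weights, so the coefficient of the double series is a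
product of two γ̂ and four three-point coefficients.

The second reading is the first one for the crossed box with the two sectors exchanged. It has the
same coefficients up to the sign from reversing the three-point couplings (`boxCoeff_cross`). At
second order only (Lδ)(Rδ)/W enters, which is bilinear in the exchanged operators, so first-order
data fix the log² terms. -/

namespace BoxDiagram

open Filter Asymptotics Topology

/-! ### Rising factorials -/

@[simp] theorem poch_zero (x : ℝ) : poch x 0 = 1 := by simp [poch]

theorem poch_succ (x : ℝ) (n : ℕ) : poch x (n + 1) = poch x n * (x + n) := by
  simp [poch, ascPochhammer_succ_eval]

theorem poch_add (x : ℝ) (m n : ℕ) : poch x (m + n) = poch x m * poch (x + m) n := by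
  induction n with
  | zero => simp
  | succ n ih =>
    rw [← add_assoc, poch_succ, ih, poch_succ]
    push_cast
    ring

theorem poch_succ_left (x : ℝ) (n : ℕ) : poch x (n + 1) = x * poch (x + 1) n := by
  rw [add_comm n 1, poch_add]
  have : poch x 1 = x := by simpa using poch_succ x 0
  rw [this]
  simp

theorem poch_one_sub (x : ℝ) (n : ℕ) : poch (1 - x - n) n = (-1) ^ n * poch x n := by
  induction n generalizing x with
  | zero => simp
  | succ n ih =>
    rw [poch_succ_left, poch_succ x n]
    have := ih x
    have e : (1 : ℝ) - x - ((n + 1 : ℕ) : ℝ) + 1 = 1 - x - n := by push_cast; ring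
    rw [e, this]
    push_cast
    ring

theorem poch_neg_nat {n k : ℕ} (hk : k ≤ n) :
    poch (-(n : ℝ)) k = (-1) ^ k * (n.factorial : ℝ) / ((n - k).factorial : ℝ) := by
  induction k with
  | zero => simp [Nat.factorial_ne_zero]
  | succ k ih =>
    rw [poch_succ, ih (by omega)]
    obtain ⟨j, rfl⟩ := Nat.exists_eq_add_of_le hk
    have e1 : k + 1 + j - k = j + 1 := by omega
    have e2 : k + 1 + j - (k + 1) = j := by omega
    rw [e1, e2, Nat.factorial_succ]
    have hj : (j.factorial : ℝ) ≠ 0 := by positivity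
    have hj1 : ((j : ℝ) + 1) ≠ 0 := by positivity
    push_cast
    field_simp
    ring

theorem poch_neg_nat_of_lt {n k : ℕ} (hk : n < k) : poch (-(n : ℝ)) k = 0 := by
  obtain ⟨j, rfl⟩ := Nat.exists_eq_add_of_lt hk
  rw [show n + j + 1 = (n + 1) + j by ring, poch_add, poch_succ]
  simp

theorem poch_ne_zero {x : ℝ} (hx : NotPole x) (n : ℕ) : poch x n ≠ 0 := by
  induction n with
  | zero => simp
  | succ n ih =>
    rw [poch_succ]
    refine mul_ne_zero ih fun h => hx n ?_
    linarith

theorem NotPole.add_nat {x : ℝ} (hx : NotPole x) (n : ℕ) : NotPole (x + n) := by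
  intro k hk
  apply hx (k + n)
  push_cast
  linarith

/-! ### Terminating hypergeometric summation formulas. -/

/-- The terminating Saalschütz sum, in polynomial form. -/
theorem poch_mul_poch_eq_sum (y y' X : ℝ) (N : ℕ) :
    poch (y + X) N * poch (y' + X) N = ∑ i ∈ Finset.range (N + 1),
      (N.choose i : ℝ) * poch y i * poch y' i * poch X (N - i) * poch (y + y' + X + i) (N - i) := by
  induction N with
  | zero => simp
  | succ N ih =>
    -- The new factors of the left side split, for every i, as (y+X+N)(y'+X+N) = (y+i)(y'+i) +
    -- (X+N-i)(y+y'+X+N+i). The two summands extend the i-th term to `U i` and `V i`.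
    set U : ℕ → ℝ := fun i => (N.choose i : ℝ) * poch y (i + 1) * poch y' (i + 1) * poch X (N - i) *
      poch (y + y' + X + i) (N - i) with hU
    set V : ℕ → ℝ := fun i => (N.choose i : ℝ) * poch y i * poch y' i * poch X (N + 1 - i) *
      poch (y + y' + X + i) (N - i) * (y + y' + X + N + i) with hV
    have hL : poch (y + X) (N + 1) * poch (y' + X) (N + 1) =
        ∑ i ∈ Finset.range (N + 1), (U i + V i) := by
      rw [poch_succ, poch_succ]
      calc _ = (poch (y + X) N * poch (y' + X) N) * ((y + X + N) * (y' + X + N)) := by ring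
        _ = _ := by
          rw [ih, Finset.sum_mul]
          refine Finset.sum_congr rfl fun i hi => ?_
          have hi' : i ≤ N := by simpa [Nat.lt_succ_iff] using hi
          have e : N + 1 - i = (N - i) + 1 := by omega
          simp only [hU, hV, poch_succ, e]
          have : ((N - i : ℕ) : ℝ) = N - i := by push_cast [hi']; ring
          rw [this]
          ring
    have hV0 : V (N + 1) = 0 := by simp [hV]
    rw [hL, Finset.sum_add_distrib, Finset.sum_range_succ' _ (N + 1)]
    -- `V` is shifted by one so that `V (i + 1)` meets `U i`: both contain (y)_{i+1} (y')_{i+1}, and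
    -- Pascal's rule merges their binomials.
    have hVs : ∑ i ∈ Finset.range (N + 1), V i = (∑ i ∈ Finset.range (N + 1), V (i + 1)) + V 0 := by
      rw [← Finset.sum_range_succ' V (N + 1), Finset.sum_range_succ V (N + 1), hV0, add_zero]
    rw [hVs, ← add_assoc, ← Finset.sum_add_distrib]
    congr 1
    · refine Finset.sum_congr rfl fun i hi => ?_
      have hi' : i ≤ N := by simpa [Nat.lt_succ_iff] using hi
      simp only [hU, hV]
      rcases hi'.eq_or_lt with rfl | hlt
      · simp
      · obtain ⟨L, rfl⟩ := Nat.exists_eq_add_of_lt hlt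
        have e1 : i + L + 1 - i = L + 1 := by omega
        have e2 : i + L + 1 - (i + 1) = L := by omega
        have e3 : i + L + 1 + 1 - (i + 1) = L + 1 := by omega
        rw [e1, e2, e3, Nat.choose_succ_succ (i + L + 1) i]
        have hc : ((i + L + 1).choose (i + 1) : ℝ) * (i + 1) = ((i + L + 1).choose i : ℝ) * (L + 1) := by
          have := Nat.choose_succ_right_eq (i + L + 1) i
          rw [e1] at this
          exact_mod_cast this
        rw [poch_succ_left (y + y' + X + i) L, poch_succ (y + y' + X + _) L]
        push_cast
        rw [show y + y' + X + (i : ℝ) + 1 = y + y' + X + (i + 1) by ring]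
        linear_combination (poch y (i + 1) * poch y' (i + 1) * poch X (L + 1) *
          poch (y + y' + X + (i + 1)) L) * hc
    · simp only [hV]
      simp [poch_succ]
      ring

/-- The terminating Saalschütz sum, in alternating form. -/
theorem sum_alternating_poch (g w δ c : ℝ) (N : ℕ) (h : c + δ = g + w - N + 1) :
    ∑ s ∈ Finset.range (N + 1), (-1) ^ s * (N.choose s : ℝ) * poch g s * poch w s *
      poch (c + s) (N - s) * poch (δ + s) (N - s) = poch (c - w) N * poch (δ - w) N := by
  -- With X = 1-δ-N the reflection of rising factorials turns (X)_{N-s} into ±(δ+s)_{N-s}, and the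
  -- balance condition `h` turns g+w+X into c.
  have key := poch_mul_poch_eq_sum g w (1 - δ - N) N
  have e1 : g + (1 - δ - N) = c - w := by linarith
  have e2 : w + (1 - δ - N) = 1 - (δ - w) - N := by ring
  rw [e1, e2, poch_one_sub] at key
  have e3 : ∀ s ∈ Finset.range (N + 1), (N.choose s : ℝ) * poch g s * poch w s *
      poch (1 - δ - N) (N - s) * poch (g + w + (1 - δ - N) + s) (N - s) =
      (-1) ^ N * ((-1) ^ s * (N.choose s : ℝ) * poch g s * poch w s *
      poch (c + s) (N - s) * poch (δ + s) (N - s)) := by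
    intro s hs
    have hs' : s ≤ N := by simpa [Nat.lt_succ_iff] using hs
    obtain ⟨L, rfl⟩ := Nat.exists_eq_add_of_le hs'
    have e4 : s + L - s = L := by omega
    have e5 : (1 - δ - ((s + L : ℕ) : ℝ)) = 1 - (δ + s) - L := by push_cast; ring
    have e6 : g + w + (1 - δ - ((s + L : ℕ) : ℝ)) + s = c + s := by linarith
    rw [e6, e4, e5, poch_one_sub, pow_add]
    have : ((-1 : ℝ) ^ s) * (-1) ^ s = 1 := by rw [← mul_pow]; simp
    linear_combination (-(-1 : ℝ) ^ L * ((s + L).choose s : ℝ) * poch g s * poch w s *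
      poch (c + s) L * poch (δ + s) L) * this
  rw [Finset.sum_congr rfl e3, ← Finset.mul_sum] at key
  have h1 : ((-1 : ℝ) ^ N) * (-1) ^ N = 1 := by rw [← mul_pow]; simp
  linear_combination (-(-1 : ℝ) ^ N) * key - (∑ s ∈ Finset.range (N + 1), (-1) ^ s *
    (N.choose s : ℝ) * poch g s * poch w s * poch (c + s) (N - s) * poch (δ + s) (N - s)) * h1
    + (poch (c - w) N * poch (δ - w) N) * h1

/-- The Chu–Vandermonde sum. -/
theorem sum_choose_poch_div {b c : ℝ} (hc : NotPole c) (N : ℕ) :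
    ∑ s ∈ Finset.range (N + 1), (-1) ^ s * (N.choose s : ℝ) * (poch b s / poch c s) =
      poch (c - b) N / poch c N := by
  induction N generalizing c b with
  | zero => simp
  | succ N ih =>
    -- Pascal's rule rewrites the alternating sum of order N+1 as one of order N over the
    -- differences f(s) - f(s+1). For the ratio (b)_s/(c)_s this difference is again such a ratio
    -- with c+1 in place of c, hence the induction over all c.
    have hrec : ∀ f : ℕ → ℝ, ∑ s ∈ Finset.range (N + 1 + 1), (-1) ^ s * ((N + 1).choose s : ℝ) * f s
        = ∑ s ∈ Finset.range (N + 1), (-1) ^ s * (N.choose s : ℝ) * (f s - f (s + 1)) := by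
      intro f
      rw [Finset.sum_range_succ']
      have h1 : ∑ s ∈ Finset.range (N + 1), (-1) ^ s * (N.choose s : ℝ) * f s =
          (∑ s ∈ Finset.range (N + 1), (-1) ^ (s + 1) * (N.choose (s + 1) : ℝ) * f (s + 1)) + f 0 := by
        rw [Finset.sum_range_succ', Finset.sum_range_succ _ N]
        simp
      simp only [mul_sub, Finset.sum_sub_distrib]
      rw [h1]
      simp only [Nat.choose_succ_succ, Nat.cast_add, pow_succ]
      simp
      rw [← Finset.sum_neg_distrib, ← Finset.sum_neg_distrib, add_sub_right_comm,
        ← Finset.sum_sub_distrib]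
      congr 1
      exact Finset.sum_congr rfl fun s _ => by ring
    rw [hrec]
    have hc1 : NotPole (c + 1) := by simpa using hc.add_nat 1
    have hc0 : c ≠ 0 := by simpa using hc 0
    have hstep : ∀ s : ℕ, poch b s / poch c s - poch b (s + 1) / poch c (s + 1) =
        (c - b) / c * (poch b s / poch (c + 1) s) := by
      intro s
      have h1 := poch_ne_zero hc s
      have h2 := poch_ne_zero hc1 s
      have h3 : c + s ≠ 0 := by
        intro h
        exact hc s (by linarith)
      have h4 : c * poch (c + 1) s = poch c s * (c + s) := by
        rw [← poch_succ_left, poch_succ]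
      rw [poch_succ, poch_succ]
      have h5 : poch (c + 1) s = poch c s * (c + s) / c := by
        field_simp
        linarith
      rw [h5]
      field_simp
      ring
    simp only [hstep]
    have : ∀ s, (-1) ^ s * (N.choose s : ℝ) * ((c - b) / c * (poch b s / poch (c + 1) s)) =
      (c - b) / c * ((-1) ^ s * (N.choose s : ℝ) * (poch b s / poch (c + 1) s)) := fun s => by ring
    simp only [this]
    rw [← Finset.mul_sum, ih hc1, poch_succ_left, poch_succ_left c]
    rw [show c - b + 1 = c + 1 - b by ring]
    field_simp

/-! ### Inversion of the block expansion and linearisation -/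

theorem NotPole.ne_zero {x : ℝ} (hx : NotPole x) : x ≠ 0 := by simpa using hx 0

theorem NotPole.add_ne_zero {x : ℝ} (hx : NotPole x) (n : ℕ) : x + n ≠ 0 :=
  (hx.add_nat n).ne_zero

/-- The summands are differences of the right-hand side. At n = L+1 the binomial on the right
vanishes, and this vanishing is what the orthogonality below rests on. -/
theorem sum_range_alternating_telescope {u : ℝ} (hu : NotPole u) (L n : ℕ) :
    ∑ i ∈ Finset.range (n + 1), (-1) ^ i * ((L + 1).choose i : ℝ) * (u + 2 * i) /
      poch (u + i) (L + 2) = (-1) ^ n * (L.choose n : ℝ) / poch (u + n + 1) (L + 1) := by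
  induction n with
  | zero =>
    have h1 := hu.ne_zero
    have h2 : poch (u + 1) (L + 1) ≠ 0 := poch_ne_zero (by simpa using hu.add_nat 1) _
    simp [poch_succ_left u (L + 1)]
    field_simp
  | succ n ih =>
    rw [Finset.sum_range_succ, ih]
    have hv : NotPole (u + n + 1) := by
      have := hu.add_nat (n + 1)
      push_cast at this
      rwa [← add_assoc] at this
    have hv' : NotPole (u + n + 1 + 1) := by simpa using hv.add_nat 1
    have h1 := hv.ne_zero
    have h2 : poch (u + n + 1 + 1) (L + 1) ≠ 0 := poch_ne_zero hv' _
    have h3 : poch (u + n + 1) (L + 1) ≠ 0 := poch_ne_zero hv _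
    have h4 : u + n + 1 + ((L + 1 : ℕ) : ℝ) ≠ 0 := hv.add_ne_zero _
    have e : u + ((n + 1 : ℕ) : ℝ) = u + n + 1 := by push_cast; ring
    have h5 : poch (u + n + 1) (L + 2) = poch (u + n + 1) (L + 1) * (u + n + 1 + ((L + 1 : ℕ) : ℝ)) :=
      poch_succ _ _
    have h6 : poch (u + n + 1) (L + 2) = (u + n + 1) * poch (u + n + 1 + 1) (L + 1) :=
      poch_succ_left _ _
    have hc : (L.choose (n + 1) : ℝ) * (n + 1) = (L.choose n : ℝ) * (L - n) := by
      rcases le_or_gt n L with h | h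
      · have := Nat.choose_succ_right_eq L n
        have h' : ((L - n : ℕ) : ℝ) = L - n := by push_cast [h]; ring
        rw [← h']
        exact_mod_cast this
      · simp [Nat.choose_eq_zero_of_lt h, Nat.choose_eq_zero_of_lt (Nat.lt_succ_of_lt h)]
    rw [e, Nat.choose_succ_succ]
    have h7 : poch (u + n + 1 + 1) (L + 1) =
        poch (u + n + 1) (L + 1) * (u + n + 1 + ((L + 1 : ℕ) : ℝ)) / (u + n + 1) := by
      field_simp
      linarith
    rw [h5, h7]
    push_cast at h4 ⊢
    field_simp
    rw [pow_succ]
    linear_combination ((-1 : ℝ) ^ n) * (-hc)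

/-- Orthogonality that inverts `y^{x+K} ↦ k_{x+n}`. -/
theorem sum_inverse_blockCoeff {g : ℝ} (hg : NotPole g) (K M : ℕ) :
    ∑ n ∈ Finset.range (M + 1), (-1) ^ (M - n) * (poch (-(n : ℝ)) K * poch (g + n) K) /
      (poch (g + n) n * poch (g + 1 + 2 * n) (M - n) * n.factorial * (M - n).factorial) =
      if K = M then (-1) ^ M else 0 := by
  rcases lt_or_ge M K with h | h
  · rw [if_neg (by omega)]
    refine Finset.sum_eq_zero fun n hn => ?_
    rw [poch_neg_nat_of_lt (by simp at hn; omega)]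
    simp
  obtain ⟨L, rfl⟩ := Nat.exists_eq_add_of_le h
  rw [add_assoc, Finset.sum_range_add, Finset.sum_eq_zero, zero_add]
  swap
  · intro n hn
    rw [poch_neg_nat_of_lt (by simpa using hn)]
    simp
  have hu : NotPole (g + 2 * K) := by
    have := hg.add_nat (2 * K)
    push_cast at this
    exact this
  -- The terms n < K contain (-n)_K = 0. With n = K+i the remaining Pochhammers telescope into the
  -- summand of the previous lemma at u = g+2K.
  have hterm : ∀ i ∈ Finset.range (L + 1), (-1) ^ (K + L - (K + i)) *
      (poch (-((K + i : ℕ) : ℝ)) K * poch (g + (K + i : ℕ)) K) /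
      (poch (g + (K + i : ℕ)) (K + i) * poch (g + 1 + 2 * (K + i : ℕ)) (K + L - (K + i)) *
        (K + i).factorial * (K + L - (K + i)).factorial) =
      (-1) ^ (K + L) / L.factorial * ((-1) ^ i * (L.choose i : ℝ) * (g + 2 * K + 2 * i) /
        poch (g + 2 * K + i) (L + 1)) := by
    intro i hi
    have hi' : i ≤ L := by simpa [Nat.lt_succ_iff] using hi
    obtain ⟨J, rfl⟩ := Nat.exists_eq_add_of_le hi'
    have e1 : K + (i + J) - (K + i) = J := by omega
    have hgn : NotPole (g + (K + i : ℕ)) := hg.add_nat _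
    rw [e1, poch_neg_nat (by omega), show K + i - K = i by omega]
    have hgK := poch_ne_zero hgn K
    have hgKi := poch_ne_zero hgn (K + i)
    have hu2 : g + 2 * K + 2 * i ≠ 0 := by
      have := hu.add_ne_zero (2 * i)
      push_cast at this
      exact this
    have hJ : poch (g + 1 + 2 * (K + i : ℕ)) J ≠ 0 := by
      refine poch_ne_zero ?_ J
      have := hg.add_nat (1 + 2 * (K + i))
      push_cast at this ⊢
      rwa [← add_assoc] at this
    have hL : poch (g + 2 * K + i) (i + J + 1) ≠ 0 := poch_ne_zero (hu.add_nat i) _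
    have key : poch (g + (K + i : ℕ)) (K + i) * poch (g + 1 + 2 * (K + i : ℕ)) J *
        (g + 2 * K + 2 * i) = poch (g + (K + i : ℕ)) K * poch (g + 2 * K + i) (i + J + 1) := by
      have k1 := poch_add (g + (K + i : ℕ)) (K + i) (J + 1)
      have k2 := poch_add (g + (K + i : ℕ)) K (i + J + 1)
      rw [show K + (i + J + 1) = K + i + (J + 1) by ring, k1] at k2
      rw [poch_succ_left] at k2
      push_cast at k2 ⊢
      rw [show g + (K + i) + (K : ℝ) = g + 2 * K + i by ring,
        show g + ((K : ℝ) + i) + (K + i) = g + 2 * K + 2 * i by ring,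
        show g + 2 * K + 2 * (i : ℝ) + 1 = g + 1 + 2 * (K + i) by ring] at k2
      linarith
    have hch : ((i + J).choose i : ℝ) = (i + J).factorial / (i.factorial * J.factorial) := by
      rw [Nat.cast_choose ℝ (by omega : i ≤ i + J)]
      simp
    rw [hch]
    have h1 : poch (g + (K + i : ℕ)) K / (poch (g + (K + i : ℕ)) (K + i) *
        poch (g + 1 + 2 * (K + i : ℕ)) J) = (g + 2 * K + 2 * i) /
          poch (g + 2 * K + i) (i + J + 1) := by
      rw [div_eq_div_iff (mul_ne_zero hgKi hJ) hL]
      linarith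
    have hf1 : ((K + i).factorial : ℝ) ≠ 0 := by positivity
    have hf2 : (i.factorial : ℝ) ≠ 0 := by positivity
    have hf3 : (J.factorial : ℝ) ≠ 0 := by positivity
    have hf4 : ((i + J).factorial : ℝ) ≠ 0 := by positivity
    have hs : ((-1 : ℝ) ^ (K + (i + J))) * (-1) ^ i = (-1) ^ J * (-1) ^ K := by
      have : ((-1 : ℝ) ^ i) * (-1) ^ i = 1 := by rw [← mul_pow]; simp
      rw [pow_add, pow_add]
      linear_combination ((-1 : ℝ) ^ K * (-1) ^ J) * this
    calc _ = ((-1) ^ J * (-1) ^ K) / (i.factorial * J.factorial) *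
          (poch (g + (K + i : ℕ)) K / (poch (g + (K + i : ℕ)) (K + i) *
        poch (g + 1 + 2 * (K + i : ℕ)) J)) := by
          field_simp
      _ = _ := by
          rw [h1, ← hs]
          field_simp
  rw [Finset.sum_congr rfl hterm, ← Finset.mul_sum]
  -- For K = M a single term is left, with value a sign; for K < M the telescoped sum stops at a
  -- vanishing binomial.
  cases L with
  | zero =>
    simpa [poch_succ] using hu.ne_zero
  | succ L =>
    rw [if_neg (by omega)]
    have := sum_range_alternating_telescope hu L (L + 1)
    rw [this]
    simp

/-- Saalschütz with X = -i moves the arguments -ν+i and g+ν+i back to -ν and g+ν, and its remaining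
argument g+i+j is free of ν. Hence the polynomials (-ν)_k (g+ν)_k multiply with structure constants
that do not depend on ν. -/
theorem poch_pair_mul (g ν : ℝ) (i l : ℕ) :
    (poch (-ν) i * poch (g + ν) i) * (poch (-ν) l * poch (g + ν) l) =
      ∑ j ∈ Finset.range (l + 1), (l.choose j : ℝ) * poch (-(i : ℝ)) (l - j) *
        poch (g + i + j) (l - j) * (poch (-ν) (i + j) * poch (g + ν) (i + j)) := by
  have := poch_mul_poch_eq_sum (-ν + i) (g + ν + i) (-(i : ℝ)) l
  rw [show -ν + (i : ℝ) + -(i : ℝ) = -ν by ring, show g + ν + (i : ℝ) + -(i : ℝ) = g + ν by ring]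
    at this
  rw [this, Finset.mul_sum]
  refine Finset.sum_congr rfl fun j _ => ?_
  rw [poch_add, poch_add, show -ν + (i : ℝ) + (g + ν + i) + -i + j = g + i + j by ring]
  ring

/-- The Racah-type polynomial `₄F₃(-n, g+n, x, x'; …)` with the coefficients not depending on `n`
collected in `p`. -/
noncomputable def racah (g : ℝ) (p : ℕ → ℝ) (n : ℕ) : ℝ :=
  ∑ k ∈ Finset.range (n + 1), poch (-(n : ℝ)) k * poch (g + n) k * p k

theorem racah_eq {g : ℝ} {p : ℕ → ℝ} {n M : ℕ} (h : n ≤ M) :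
    racah g p n = ∑ k ∈ Finset.range (M + 1), poch (-(n : ℝ)) k * poch (g + n) k * p k := by
  unfold racah
  refine Finset.sum_subset (by simpa using h) fun k _ hk => ?_
  rw [poch_neg_nat_of_lt (by simpa using hk)]
  simp

/-- The expansion coefficients of a product of two Racah-type polynomials. -/
noncomputable def racahProd (g : ℝ) (p q : ℕ → ℝ) (M : ℕ) : ℝ :=
  ∑ i ∈ Finset.range (M + 1), ∑ s ∈ Finset.range (i + 1),
    (-1) ^ s * poch (g + M) s * i.factorial * (M - i + s).factorial /
      ((M - i).factorial * (i - s).factorial * s.factorial) * p (M - i + s) * q i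

/-- After linearisation by `poch_pair_mul`, the orthogonality `sum_inverse_blockCoeff` keeps only
the terms of total degree i + j = M, so the sum over n disappears. -/
theorem sum_racah_mul_racah {g : ℝ} (hg : NotPole g) (p q : ℕ → ℝ) (M : ℕ) :
    ∑ n ∈ Finset.range (M + 1), (-1) ^ (M - n) * (racah g p n * racah g q n) /
      (poch (g + n) n * poch (g + 1 + 2 * n) (M - n) * n.factorial * (M - n).factorial) =
      (-1) ^ M * racahProd g p q M := by
  set W : ℕ → ℝ := fun n => (-1) ^ (M - n) /
    (poch (g + n) n * poch (g + 1 + 2 * n) (M - n) * n.factorial * (M - n).factorial) with hW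
  have horth : ∀ K, ∑ n ∈ Finset.range (M + 1), W n * (poch (-(n : ℝ)) K * poch (g + n) K) =
      if K = M then (-1) ^ M else 0 := by
    intro K
    rw [← sum_inverse_blockCoeff hg K M]
    exact Finset.sum_congr rfl fun n _ => by simp only [hW]; ring
  have h1 : ∀ n ∈ Finset.range (M + 1), (-1) ^ (M - n) * (racah g p n * racah g q n) /
      (poch (g + n) n * poch (g + 1 + 2 * n) (M - n) * n.factorial * (M - n).factorial) =
      ∑ i ∈ Finset.range (M + 1), ∑ l ∈ Finset.range (M + 1), ∑ j ∈ Finset.range (l + 1),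
        (q i * p l * ((l.choose j : ℝ) * poch (-(i : ℝ)) (l - j) *
        poch (g + i + j) (l - j))) * (W n * (poch (-(n : ℝ)) (i + j) * poch (g + n) (i + j))) := by
    intro n hn
    have hn' : n ≤ M := by simpa [Nat.lt_succ_iff] using hn
    rw [racah_eq hn', racah_eq hn', mul_comm (Finset.sum _ _) (Finset.sum _ _),
      Finset.sum_mul_sum, Finset.mul_sum, Finset.sum_div]
    refine Finset.sum_congr rfl fun i _ => ?_
    rw [Finset.mul_sum, Finset.sum_div]
    refine Finset.sum_congr rfl fun l _ => ?_
    have := poch_pair_mul g n i l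
    calc _ = W n * q i * p l * ((poch (-(n : ℝ)) i * poch (g + n) i) *
          (poch (-(n : ℝ)) l * poch (g + n) l)) := by simp only [hW]; ring
      _ = _ := by
        rw [this, Finset.mul_sum]
        exact Finset.sum_congr rfl fun j _ => by ring
  rw [Finset.sum_congr rfl h1, Finset.sum_comm]
  unfold racahProd
  rw [Finset.mul_sum]
  refine Finset.sum_congr rfl fun i hi => ?_
  have hi' : i ≤ M := by simpa [Nat.lt_succ_iff] using hi
  rw [Finset.sum_comm]
  have h2 : ∀ l ∈ Finset.range (M + 1), ∑ n ∈ Finset.range (M + 1), ∑ j ∈ Finset.range (l + 1),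
        (q i * p l * ((l.choose j : ℝ) * poch (-(i : ℝ)) (l - j) *
        poch (g + i + j) (l - j))) * (W n * (poch (-(n : ℝ)) (i + j) * poch (g + n) (i + j))) =
      if M - i ≤ l then (-1) ^ M * (q i * p l * ((l.choose (M - i) : ℝ) *
        poch (-(i : ℝ)) (l - (M - i)) * poch (g + M) (l - (M - i)))) else 0 := by
    intro l _
    rw [Finset.sum_comm]
    simp only [← Finset.mul_sum, horth]
    have : ∀ j, (i + j = M) = (j = M - i) := fun j => by
      apply propext; omega
    simp only [this, mul_ite, mul_zero, Finset.sum_ite_eq', Finset.mem_range, Nat.lt_succ_iff]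
    refine if_congr Iff.rfl ?_ rfl
    rw [show g + (i : ℝ) + ((M - i : ℕ) : ℝ) = g + M by push_cast [hi']; ring]
    ring
  -- Only l ≥ M - i can reach degree M, so l is replaced by M - i + s.
  rw [Finset.sum_congr rfl h2, show M + 1 = (M - i) + (i + 1) by omega, Finset.sum_range_add,
    Finset.sum_eq_zero, zero_add, Finset.mul_sum]
  swap
  · intro l hl
    rw [if_neg (by simp at hl; omega)]
  refine Finset.sum_congr rfl fun s hs => ?_
  have hs' : s ≤ i := by simpa [Nat.lt_succ_iff] using hs
  rw [if_pos (by omega), show M - i + s - (M - i) = s by omega, poch_neg_nat hs',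
    Nat.cast_choose ℝ (by omega : M - i ≤ M - i + s), show M - i + s - (M - i) = s by omega]
  field_simp

/-! ### The Biedenharn–Elliott type identity by repeated Saalschütz summation. -/

/-- A two-fold Saalschütz sum. -/
theorem double_saalschutz {α γ : ℝ} (hα : NotPole α) (hγ : NotPole γ) (x w : ℝ) (j : ℕ) :
    ∑ p ∈ Finset.range (j + 1), ∑ s ∈ Finset.range (j - p + 1),
      (-1) ^ s * poch (α + γ + j - 1) s * poch w (p + s) * poch x (j - p) *
        poch (α + w + p + s) (j - p - s) * poch (γ + x + (j - p : ℕ)) p /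
        (poch γ (p + s) * poch α (j - p) * s.factorial * p.factorial * (j - p - s).factorial) =
      poch (x + w) j / j.factorial := by
  -- At fixed p the sum over s is the alternating Saalschütz sum of order j - p. Its value
  -- (γ-w)_{j-p} (α)_{j-p} cancels the denominator (α)_{j-p}.
  have hin : ∀ p ∈ Finset.range (j + 1), ∑ s ∈ Finset.range (j - p + 1),
      (-1) ^ s * poch (α + γ + j - 1) s * poch w (p + s) * poch x (j - p) *
        poch (α + w + p + s) (j - p - s) * poch (γ + x + (j - p : ℕ)) p /
        (poch γ (p + s) * poch α (j - p) * s.factorial * p.factorial * (j - p - s).factorial) =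
      poch w p * poch (γ - w) (j - p) * poch x (j - p) * poch (γ + x + (j - p : ℕ)) p /
        (poch γ j * p.factorial * (j - p).factorial) := by
    intro p hp
    have hp' : p ≤ j := by simpa [Nat.lt_succ_iff] using hp
    obtain ⟨N, rfl⟩ := Nat.exists_eq_add_of_le hp'
    have e1 : p + N - p = N := by omega
    rw [e1]
    have key := sum_alternating_poch (α + γ + (p + N : ℕ) - 1) (w + p) (α + w + p) (γ + p) N
      (by push_cast; ring)
    rw [show γ + (p : ℝ) - (w + p) = γ - w by ring, show α + w + (p : ℝ) - (w + p) = α by ring] at key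
    have hγp := poch_ne_zero hγ p
    have hαN := poch_ne_zero hα N
    have hγpN : poch (γ + p) N ≠ 0 := poch_ne_zero (hγ.add_nat p) N
    have hterm : ∀ s ∈ Finset.range (N + 1),
      (-1) ^ s * poch (α + γ + (p + N : ℕ) - 1) s * poch w (p + s) * poch x N *
        poch (α + w + p + s) (N - s) * poch (γ + x + N) p /
        (poch γ (p + s) * poch α N * s.factorial * p.factorial * (N - s).factorial) =
      (poch w p * poch x N * poch (γ + x + N) p / (poch γ p * poch (γ + p) N * poch α N *
        p.factorial * N.factorial)) * ((-1) ^ s * (N.choose s : ℝ) *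
        poch (α + γ + (p + N : ℕ) - 1) s * poch (w + p) s *
      poch (γ + p + s) (N - s) * poch (α + w + p + s) (N - s)) := by
      intro s hs
      have hs' : s ≤ N := by simpa [Nat.lt_succ_iff] using hs
      obtain ⟨L, rfl⟩ := Nat.exists_eq_add_of_le hs'
      have e2 : s + L - s = L := by omega
      rw [e2, Nat.cast_choose ℝ (by omega : s ≤ s + L), e2, poch_add w, poch_add γ p s,
        poch_add (γ + p) s L]
      rw [poch_add (γ + p) s L] at hγpN
      have := left_ne_zero_of_mul hγpN
      have := right_ne_zero_of_mul hγpN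
      field_simp
    rw [Finset.sum_congr rfl hterm, ← Finset.mul_sum, key, poch_add γ p N]
    field_simp
  rw [Finset.sum_congr rfl hin]
  -- The sum over p that remains is the polynomial Saalschütz sum read backwards, with index j - p.
  have hout := poch_mul_poch_eq_sum (γ - w) x w j
  rw [show γ - w + w = γ by ring] at hout
  have hγj := poch_ne_zero hγ j
  rw [eq_div_iff (by positivity), ← mul_right_inj' hγj, hout]
  rw [Finset.sum_mul, Finset.mul_sum, ← Finset.sum_range_reflect]
  refine Finset.sum_congr rfl fun p hp => ?_
  have hp' : p ≤ j := by simpa [Nat.lt_succ_iff] using hp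
  obtain ⟨N, rfl⟩ := Nat.exists_eq_add_of_le hp'
  have e1 : p + N + 1 - 1 - p = N := by omega
  have e2 : p + N - N = p := by omega
  have e3 : p + N - p = N := by omega
  rw [e1, e2, e3, Nat.cast_choose ℝ (by omega : p ≤ p + N), e3,
    show γ - w + x + w + (p : ℝ) = γ + x + p by ring]
  field_simp

/-- The denominators cancel the first l factors of (B+C)_M (B'+C)_M, and the shifted factors that
remain are expanded by Saalschütz with X = C + l. This clears the denominators of `racahProd`. -/
theorem poch_div_expand {B B' C : ℝ} (h1 : NotPole (B + C)) (h2 : NotPole (B' + C)) {l M : ℕ}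
    (hl : l ≤ M) :
    poch (B + C) M * poch (B' + C) M * (poch C l / (poch (B + C) l * poch (B' + C) l)) =
      ∑ m ∈ Finset.range (M - l + 1), ((M - l).choose m : ℝ) * poch B m * poch B' m *
        poch C (M - m) * poch (B + B' + C + l + m) (M - l - m) := by
  obtain ⟨N, rfl⟩ := Nat.exists_eq_add_of_le hl
  have e : l + N - l = N := by omega
  rw [e, poch_add (B + C), poch_add (B' + C)]
  have key := poch_mul_poch_eq_sum B B' (C + l) N
  have h3 := poch_ne_zero h1 l
  have h4 := poch_ne_zero h2 l
  rw [show B + (C + l) = B + C + l by ring, show B' + (C + l) = B' + C + l by ring] at key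
  calc _ = poch C l * (poch (B + C + l) N * poch (B' + C + l) N) := by field_simp
    _ = _ := by
      rw [key, Finset.mul_sum]
      refine Finset.sum_congr rfl fun m hm => ?_
      have hm' : m ≤ N := by simpa [Nat.lt_succ_iff] using hm
      rw [show l + N - m = l + (N - m) by omega, poch_add C,
        show B + B' + (C + l) + (m : ℝ) = B + B' + C + l + m by ring]
      ring

/-- The coefficients of the product of two large-weight expansions, up to a sign and a constant. -/
noncomputable def prodCoeff (A A' B B' C C' D D' α γ : ℝ) (M : ℕ) : ℝ :=
  ∑ m ∈ Finset.range (M + 1), ∑ k ∈ Finset.range (M - m + 1),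
    poch A (M - k) * poch C (M - m) * poch A' m * poch C' k * poch (A' + C' + m + k) (M - m - k) *
      (poch B m * poch B' m) * (poch D k * poch D' k) /
      ((M - m - k).factorial * m.factorial * k.factorial * poch α m * poch γ k)

/-- The summand of `racahProd` after expansion of its coefficients. -/
noncomputable def racahSummand (A A' B B' C C' D D' α γ : ℝ) (M i s m k : ℕ) : ℝ :=
  (-1) ^ s * poch (α + γ - 1 + M) s / ((M - i).factorial * (i - s).factorial * s.factorial) *
    (poch C' (M - i + s) / poch γ (M - i + s)) * (poch A' i / poch α i) *
    ((((i - s).choose m : ℝ) * poch B m * poch B' m *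
      poch C (M - m) * poch (α + C' + (M - i + s : ℕ) + m) (i - s - m)) *
     (((M - i).choose k : ℝ) * poch D k * poch D' k *
      poch A (M - k) * poch (γ + A' + i + k) (M - i - k)))

/-- Both coefficient sequences are expanded by `poch_div_expand`, at the price of two new indices m
and k. The balance conditions `hB` and `hD` make α + C' and γ + A' appear, as the double Saalschütz
sum requires. -/
theorem racahProd_eq_sum_summand {A A' B B' C C' D D' α γ : ℝ}
    (h1 : NotPole (B + C)) (h2 : NotPole (B' + C)) (h3 : NotPole (D + A)) (h4 : NotPole (D' + A))
    (hB : B + B' + C = α + C') (hD : D + D' + A = γ + A') (M : ℕ) :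
    poch (B + C) M * poch (B' + C) M * (poch (D + A) M * poch (D' + A) M) *
      racahProd (α + γ - 1)
        (fun l => poch C l * poch C' l / (poch (B + C) l * poch (B' + C) l * poch γ l * l.factorial))
        (fun i => poch A i * poch A' i / (poch (D + A) i * poch (D' + A) i * poch α i * i.factorial))
        M = ∑ i ∈ Finset.range (M + 1), ∑ s ∈ Finset.range (i + 1),
          ∑ m ∈ Finset.range (i - s + 1), ∑ k ∈ Finset.range (M - i + 1),
            racahSummand A A' B B' C C' D D' α γ M i s m k := by
  unfold racahProd
  rw [Finset.mul_sum]
  refine Finset.sum_congr rfl fun i hi => ?_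
  rw [Finset.mul_sum]
  refine Finset.sum_congr rfl fun s hs => ?_
  have hi' : i ≤ M := by simpa [Nat.lt_succ_iff] using hi
  have hs' : s ≤ i := by simpa [Nat.lt_succ_iff] using hs
  have hBC := poch_div_expand h1 h2 (by omega : M - i + s ≤ M)
  have hDA := poch_div_expand h3 h4 hi'
  rw [show M - (M - i + s) = i - s by omega, hB] at hBC
  rw [hD] at hDA
  simp only [racahSummand]
  simp_rw [← Finset.mul_sum, ← Finset.sum_mul]
  rw [← hBC, ← hDA]
  have hl0 : ((M - i + s).factorial : ℝ) ≠ 0 := by positivity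
  have hi0 : (i.factorial : ℝ) ≠ 0 := by positivity
  generalize (M - i + s).factorial = l! at hl0 ⊢
  generalize i.factorial = i! at hi0 ⊢
  simp only [div_eq_mul_inv, mul_inv]
  linear_combination (poch (B + C) M * poch (B' + C) M * (poch (D + A) M * poch (D' + A) M) *
    ((-1) ^ s * poch (α + γ - 1 + M) s * (((M - i).factorial : ℝ)⁻¹ * ((i - s).factorial : ℝ)⁻¹ *
    (s.factorial : ℝ)⁻¹)) * (poch C (M - i + s) * poch C' (M - i + s) *
    ((poch (B + C) (M - i + s))⁻¹ * (poch (B' + C) (M - i + s))⁻¹ * (poch γ (M - i + s))⁻¹)) *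
    (poch A i * poch A' i * ((poch (D + A) i)⁻¹ * (poch (D' + A) i)⁻¹ * (poch α i)⁻¹))) *
    ((l! : ℝ) * (l! : ℝ)⁻¹ * mul_inv_cancel₀ hi0 + mul_inv_cancel₀ hl0)

/-- At fixed m and k the original indices, with i = M-k-p, enter only through `double_saalschutz`
with α, A' shifted by m and γ, C' shifted by k. -/
theorem sum_racahSummand {α γ : ℝ} (hα : NotPole α) (hγ : NotPole γ) (A A' B B' C C' D D' : ℝ)
    {M m k : ℕ} (hm' : m ≤ M) (hk' : k ≤ M - m) :
    poch A (M - k) * poch C (M - m) * poch A' m * poch C' k * poch (A' + C' + m + k) (M - m - k) *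
      (poch B m * poch B' m) * (poch D k * poch D' k) /
      ((M - m - k).factorial * m.factorial * k.factorial * poch α m * poch γ k) =
      ∑ p ∈ Finset.range (M - m - k + 1), ∑ s ∈ Finset.range (M - m - k - p + 1),
        racahSummand A A' B B' C C' D D' α γ M (M - k - p) s m k := by
  obtain ⟨j, rfl⟩ : ∃ j, M = m + k + j := ⟨M - m - k, by omega⟩
  have e0 : m + k + j - m - k = j := by omega
  have e1 : m + k + j - k = m + j := by omega
  have e2 : m + k + j - m = k + j := by omega
  have ds := double_saalschutz (hα.add_nat m) (hγ.add_nat k) (A' + m) (C' + k) j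
  rw [e0, e1, e2]
  have hαm := poch_ne_zero hα m
  have hγk := poch_ne_zero hγ k
  rw [show A' + C' + (m : ℝ) + k = A' + m + (C' + k) by ring]
  calc _ = poch A (m + j) * poch C (k + j) * poch A' m * poch C' k *
    (poch B m * poch B' m) * (poch D k * poch D' k) /
    (m.factorial * k.factorial * poch α m * poch γ k) *
      (poch (A' + m + (C' + k)) j / j.factorial) := by field_simp
    _ = _ := by
      rw [← ds, Finset.mul_sum]
      refine Finset.sum_congr rfl fun p hp => ?_
      rw [Finset.mul_sum]
      refine Finset.sum_congr rfl fun s hs => ?_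
      have hp' : p ≤ j := by simpa [Nat.lt_succ_iff] using hp
      have hs' : s ≤ j - p := by simpa [Nat.lt_succ_iff] using hs
      obtain ⟨q, rfl⟩ : ∃ q, j = p + s + q := ⟨j - p - s, by omega⟩
      simp only [racahSummand]
      have a1 : m + (p + s + q) - p = m + (s + q) := by omega
      have a2 : m + k + (p + s + q) - (m + (s + q)) = k + p := by omega
      have a3 : m + (s + q) - s = m + q := by omega
      have a4 : m + q - m = q := by omega
      have a5 : k + p - k = p := by omega
      have a6 : p + s + q - p = s + q := by omega
      have a7 : s + q - s = q := by omega
      have a8 : m + k + (p + s + q) - k = m + (p + s + q) := by omega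
      have a9 : m + k + (p + s + q) - m = k + (p + s + q) := by omega
      rw [a1, a2, a3, a4, a5, a6, a7, a8, a9, Nat.cast_choose ℝ (by omega : m ≤ m + q), a4,
        Nat.cast_choose ℝ (by omega : k ≤ k + p), a5, add_assoc k p s, poch_add C' k (p + s),
        poch_add γ k (p + s), poch_add A' m (s + q), poch_add α m (s + q)]
      have hαm2 : poch (α + m) (s + q) ≠ 0 := poch_ne_zero (hα.add_nat m) _
      have hγk2 : poch (γ + k) (p + s) ≠ 0 := poch_ne_zero (hγ.add_nat k) _
      have b1 : α + (m : ℝ) + (γ + k) + (p + s + q : ℕ) - 1 =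
        α + γ - 1 + (m + k + (p + s + q) : ℕ) := by push_cast; ring
      have b2 : α + (m : ℝ) + (C' + k) + p + s = α + C' + (k + (p + s) : ℕ) + m := by
        push_cast; ring
      have b3 : γ + (k : ℝ) + (A' + m) + (s + q : ℕ) = γ + A' + (m + (s + q) : ℕ) + k := by
        push_cast; ring
      rw [b1, b2, b3]
      have hu : ((m + q).factorial : ℝ) * ((m + q).factorial : ℝ)⁻¹ = 1 :=
        mul_inv_cancel₀ (by positivity)
      have hv : ((k + p).factorial : ℝ) * ((k + p).factorial : ℝ)⁻¹ = 1 :=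
        mul_inv_cancel₀ (by positivity)
      simp only [div_eq_mul_inv, mul_inv]
      generalize poch (α + γ - 1 + (m + k + (p + s + q) : ℕ)) s = z1
      generalize poch (α + C' + (k + (p + s) : ℕ) + m) q = z2
      generalize poch (γ + A' + (m + (s + q) : ℕ) + k) p = z3
      generalize poch (C' + k) (p + s) = z4
      generalize poch (A' + m) (s + q) = z5
      generalize (poch (γ + k) (p + s))⁻¹ = z6
      generalize (poch (α + m) (s + q))⁻¹ = z7
      generalize poch A (m + (p + s + q)) = z8
      generalize poch C (k + (p + s + q)) = z9
      generalize ((m + q).factorial : ℝ)⁻¹ = u' at hu ⊢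
      generalize ((m + q).factorial : ℝ) = u at hu ⊢
      generalize ((k + p).factorial : ℝ)⁻¹ = v' at hv ⊢
      generalize ((k + p).factorial : ℝ) = v at hv ⊢
      have huv : u * u' * (v * v') = 1 := by rw [hu, hv, one_mul]
      rw [← mul_one (z8 * z9 * _ * _ * _ * _ * _), ← huv]
      ring

/-- A Biedenharn–Elliott type identity. -/
theorem racahProd_eq_prodCoeff {A A' B B' C C' D D' α γ : ℝ} (hα : NotPole α) (hγ : NotPole γ)
    (h1 : NotPole (B + C)) (h2 : NotPole (B' + C)) (h3 : NotPole (D + A)) (h4 : NotPole (D' + A))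
    (hB : B + B' + C = α + C') (hD : D + D' + A = γ + A') (M : ℕ) :
    poch (B + C) M * poch (B' + C) M * (poch (D + A) M * poch (D' + A) M) *
      racahProd (α + γ - 1)
        (fun l => poch C l * poch C' l / (poch (B + C) l * poch (B' + C) l * poch γ l * l.factorial))
        (fun i => poch A i * poch A' i / (poch (D + A) i * poch (D' + A) i * poch α i * i.factorial))
        M = prodCoeff A A' B B' C C' D D' α γ M := by
  rw [racahProd_eq_sum_summand h1 h2 h3 h4 hB hD]
  unfold prodCoeff
  rw [Finset.sum_congr rfl fun m hm => Finset.sum_congr rfl fun k hk =>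
    sum_racahSummand hα hγ A A' B B' C C' D D' (by simpa [Nat.lt_succ_iff] using hm)
      (by simpa [Nat.lt_succ_iff] using hk)]
  simp only [Finset.sum_sigma']
  -- Exchange of the order of summation: with p = M-k-i the conditions s + m ≤ i and k ≤ M-i become
  -- m + k + p + s ≤ M.
  refine Finset.sum_nbij' (fun x => ⟨x.2.2.1, x.2.2.2, M - x.2.2.2 - x.1, x.2.1⟩)
    (fun x => ⟨M - x.2.1 - x.2.2.1, x.2.2.2, x.1, x.2.1⟩) ?_ ?_ ?_ ?_ ?_
  · rintro ⟨i, s, m, k⟩ h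
    simp only [Finset.mem_sigma, Finset.mem_range] at h ⊢
    omega
  · rintro ⟨m, k, p, s⟩ h
    simp only [Finset.mem_sigma, Finset.mem_range] at h ⊢
    omega
  · rintro ⟨i, s, m, k⟩ h
    simp only [Finset.mem_sigma, Finset.mem_range] at h ⊢
    rw [show M - k - (M - k - i) = i by omega]
  · rintro ⟨m, k, p, s⟩ h
    simp only [Finset.mem_sigma, Finset.mem_range] at h ⊢
    rw [show M - k - (M - k - p) = p by omega]
  · rintro ⟨i, s, m, k⟩ h
    simp only [Finset.mem_sigma, Finset.mem_range] at h ⊢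
    rw [show M - k - (M - k - i) = i by omega]

/-! ### Gamma functions at shifted arguments -/

theorem Gamma_add_nat {x : ℝ} (hx : NotPole x) (n : ℕ) :
    Real.Gamma (x + n) = poch x n * Real.Gamma x := by
  induction n with
  | zero => simp
  | succ n ih =>
    rw [Nat.cast_succ, ← add_assoc, Real.Gamma_add_one (hx.add_ne_zero n), ih, poch_succ]
    ring

theorem NotPole.Gamma_ne_zero {x : ℝ} (hx : NotPole x) : Real.Gamma x ≠ 0 :=
  Real.Gamma_ne_zero hx

/-- No condition on x is needed: `Real.Gamma` has the value 0 at its poles, so its inverse there is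
the value of the entire function 1/Γ. The same applies to the shift by n below. -/
theorem inv_Gamma_eq (x : ℝ) : (Real.Gamma x)⁻¹ = x * (Real.Gamma (x + 1))⁻¹ := by
  rcases eq_or_ne x 0 with rfl | hx
  · simp [Real.Gamma_zero]
  · rw [Real.Gamma_add_one hx, mul_inv, ← mul_assoc, mul_inv_cancel₀ hx, one_mul]

theorem inv_Gamma_sub_nat (x : ℝ) (n : ℕ) :
    (Real.Gamma (x - n))⁻¹ = (-1) ^ n * poch (1 - x) n * (Real.Gamma x)⁻¹ := by
  induction n with
  | zero => simp
  | succ n ih =>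
    rw [inv_Gamma_eq, show x - ((n + 1 : ℕ) : ℝ) + 1 = x - n by push_cast; ring, ih, poch_succ]
    push_cast
    ring

theorem inv_Gamma_add_nat {x : ℝ} (hx : NotPole x) (n : ℕ) :
    (Real.Gamma (x + n))⁻¹ = (Real.Gamma x)⁻¹ / poch x n := by
  rw [Gamma_add_nat hx, mul_inv]
  ring

/-- `Γ(σ) Γ(1-σ)`, with the residue at `σ = 0` up to sign as its value there. -/
noncomputable def omega (σ : ℝ) : ℝ :=
  if σ = 0 then -1 else Real.Gamma σ * Real.Gamma (1 - σ)

/-- `Γ(σ-m)`, with the residue up to sign as its value at `σ = 0`. -/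
noncomputable def gammaShift (σ : ℝ) (m : ℕ) : ℝ :=
  omega σ * (-1) ^ m * (Real.Gamma (1 - σ + m))⁻¹

/-- `σ` is zero or not an integer. -/
def Resonant (σ : ℝ) : Prop := σ = 0 ∨ ∀ k : ℤ, σ ≠ k

theorem Resonant.notPole {σ : ℝ} (h : Resonant σ) : NotPole (1 - σ) := by
  intro k hk
  rcases h with rfl | h
  · have : (0 : ℝ) ≤ k := by positivity
    linarith
  · exact h (1 + k) (by push_cast; linarith)

/-- The reflection Γ(σ-m) Γ(1-σ+m) = (-1)^m Γ(σ) Γ(1-σ) isolates the whole singularity at σ = 0 in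
the factor `omega`. -/
theorem gammaShift_eq {σ : ℝ} (h : ∀ k : ℤ, σ ≠ k) (m : ℕ) :
    gammaShift σ m = Real.Gamma (σ - m) := by
  have h0 : σ ≠ 0 := by simpa using h 0
  have h1 : NotPole σ := fun k hk => h (-k) (by push_cast; exact hk)
  have h2 : NotPole (1 - σ) := Resonant.notPole (Or.inr h)
  have h3 := inv_Gamma_sub_nat σ m
  have h4 := Gamma_add_nat h2 m
  have h5 := poch_ne_zero h2 m
  unfold gammaShift omega
  rw [if_neg h0, h4, ← inv_inv (Real.Gamma (σ - m)), h3]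
  have := h1.Gamma_ne_zero
  have := h2.Gamma_ne_zero
  have hs : ((-1 : ℝ) ^ m) ≠ 0 := pow_ne_zero _ (by norm_num)
  have hs2 : ((-1 : ℝ) ^ m) ^ 2 = 1 := by rw [← pow_mul, mul_comm, pow_mul]; simp
  field_simp
  exact hs2

/-! ### The coefficients β as Racah-type polynomials and the closed form of γ. -/

/-- The part of `leadBeta` that does not depend on `n`. -/
noncomputable def betaConst (x₁ x₂ x₃ x₄ xa : ℝ) : ℝ :=
  Real.Gamma (2 * xa) * (Real.Gamma (xa + x₄ - x₁))⁻¹ * (Real.Gamma (xa + x₃ - x₂))⁻¹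

/-- The right-hand side is literally that of `Q_eq`, because `omega` takes the value -1 at zero.
From here on the degenerate and the generic case are treated by one computation. -/
theorem K_eq {x₁ x₂ x₃ x₄ xa : ℝ} (h : ∀ k : ℤ, x₃ + x₄ - x₁ - x₂ ≠ k)
    (hC : NotPole (xa + x₂ - x₃)) (k : ℕ) :
    K (x₃ - x₂) (x₁ - x₄) k xa = omega (x₃ + x₄ - x₁ - x₂) *
      (Real.Gamma (1 - (x₃ + x₄ - x₁ - x₂)))⁻¹ * betaConst x₁ x₂ x₃ x₄ xa *
      ((-1) ^ k * (poch (xa + x₂ - x₃) k * poch (x₂ - xa - x₃ + 1) k) /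
        (k.factorial * poch (x₁ + x₂ - x₃ - x₄ + 1) k)) := by
  have h0 : x₃ + x₄ - x₁ - x₂ ≠ 0 := by simpa using h 0
  have h2 : NotPole (1 - (x₃ + x₄ - x₁ - x₂)) := Resonant.notPole (Or.inr h)
  have e1 : x₃ - x₂ - (x₁ - x₄) = x₃ + x₄ - x₁ - x₂ := by ring
  have e2 : 1 + (x₁ - x₄) - (x₃ - x₂) = 1 - (x₃ + x₄ - x₁ - x₂) := by ring
  have e3 : (k : ℝ) + 1 + (x₁ - x₄) - (x₃ - x₂) = 1 - (x₃ + x₄ - x₁ - x₂) + k := by ring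
  have e4 : xa - (x₃ - x₂) = xa + x₂ - x₃ := by ring
  have e5 : xa - (x₁ - x₄) = xa + x₄ - x₁ := by ring
  have e6 : xa + k - (x₃ - x₂) = xa + x₂ - x₃ + k := by ring
  have e7 : xa - k + (x₃ - x₂) = xa + x₃ - x₂ - k := by ring
  have e8 : x₁ + x₂ - x₃ - x₄ + 1 = 1 - (x₃ + x₄ - x₁ - x₂) := by ring
  have e9 : x₂ - xa - x₃ + 1 = 1 - (xa + x₃ - x₂) := by ring
  unfold K omega betaConst
  rw [if_neg h0, e1, e2, e3, e4, e5, e6, e7, e8, e9, Gamma_add_nat hC,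
    div_eq_mul_inv (poch (xa + x₂ - x₃) k * _), inv_Gamma_sub_nat, Gamma_add_nat h2,
    Real.Gamma_nat_eq_factorial]
  have := hC.Gamma_ne_zero
  have := h2.Gamma_ne_zero
  field_simp

theorem Q_eq {x₁ x₂ x₃ x₄ xa : ℝ} (h : x₁ + x₂ = x₃ + x₄)
    (hC : NotPole (xa + x₂ - x₃)) (k : ℕ) :
    Q (x₃ - x₂) k xa = omega (x₃ + x₄ - x₁ - x₂) *
      (Real.Gamma (1 - (x₃ + x₄ - x₁ - x₂)))⁻¹ * betaConst x₁ x₂ x₃ x₄ xa *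
      ((-1) ^ k * (poch (xa + x₂ - x₃) k * poch (x₂ - xa - x₃ + 1) k) /
        (k.factorial * poch (x₁ + x₂ - x₃ - x₄ + 1) k)) := by
  have h0 : x₃ + x₄ - x₁ - x₂ = 0 := by linarith
  have e4 : xa - (x₃ - x₂) = xa + x₂ - x₃ := by ring
  have e5 : xa + x₄ - x₁ = xa + x₂ - x₃ := by linarith
  have e6 : xa + k - (x₃ - x₂) = xa + x₂ - x₃ + k := by ring
  have e7 : xa - k + (x₃ - x₂) = xa + x₃ - x₂ - k := by ring
  have e8 : x₁ + x₂ - x₃ - x₄ + 1 = 1 := by linarith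
  have e9 : x₂ - xa - x₃ + 1 = 1 - (xa + x₃ - x₂) := by ring
  have hp : poch 1 k = k.factorial := by
    have := Gamma_add_nat (x := 1) (fun j hj => by have : (0:ℝ) ≤ j := by positivity
                                                   linarith) k
    rw [Real.Gamma_one, mul_one] at this
    rw [← this, add_comm, Real.Gamma_nat_eq_factorial]
  unfold Q omega betaConst
  rw [if_pos h0, h0, e4, e5, e6, e7, e8, e9, Gamma_add_nat hC, sub_zero, Real.Gamma_one, hp,
    div_eq_mul_inv (poch (xa + x₂ - x₃) k * _), inv_Gamma_sub_nat, Real.Gamma_nat_eq_factorial]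
  have := hC.Gamma_ne_zero
  field_simp

theorem S_eq {x₁ x₂ x₃ x₄ : ℝ} (h2 : NotPole (2 * x₂)) (hg : NotPole (2 * (x₁ + x₂) - 1))
    (hE : NotPole (x₁ + x₂ - (x₃ - x₄))) {k n : ℕ} (hk : k ≤ n) :
    S (x₁ - x₂) (x₃ - x₄) (-k - x₁ - x₂) (x₁ + x₂ + n) =
      poch (2 * x₂) n * poch (x₁ + x₂ - (x₃ - x₄)) n * poch (2 * (x₁ + x₂) - 1 + n) k /
      (poch (2 * x₂) k * poch (x₁ + x₂ - (x₃ - x₄)) k * poch (2 * (x₁ + x₂) - 1 + n) n *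
        (n - k).factorial) := by
  have e1 : -(-(k : ℝ) - x₁ - x₂) - (x₁ - x₂) = 2 * x₂ + k := by ring
  have e2 : -(-(k : ℝ) - x₁ - x₂) - (x₃ - x₄) = x₁ + x₂ - (x₃ - x₄) + k := by ring
  have e3 : x₁ + x₂ + n - (x₁ - x₂) = 2 * x₂ + n := by ring
  have e4 : x₁ + x₂ + n - (x₃ - x₄) = x₁ + x₂ - (x₃ - x₄) + n := by ring
  have e5 : 2 * (x₁ + x₂ + n) - 1 = 2 * (x₁ + x₂) - 1 + n + n := by ring
  have e6 : x₁ + x₂ + n - (-(k : ℝ) - x₁ - x₂) - 1 = 2 * (x₁ + x₂) - 1 + n + k := by ring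
  have e7 : x₁ + x₂ + n + (-(k : ℝ) - x₁ - x₂) + 1 = ((n - k : ℕ) : ℝ) + 1 := by
    push_cast [hk]; ring
  unfold S
  rw [e1, e2, e3, e4, e5, e6, e7, Gamma_add_nat h2, Gamma_add_nat h2, Gamma_add_nat hE,
    Gamma_add_nat hE, Gamma_add_nat (hg.add_nat n) n, Gamma_add_nat (hg.add_nat n) k,
    Real.Gamma_nat_eq_factorial]
  have := h2.Gamma_ne_zero
  have := hE.Gamma_ne_zero
  have := (hg.add_nat n).Gamma_ne_zero
  have := poch_ne_zero h2 k
  have := poch_ne_zero hE k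
  field_simp

/-- The factor 1/(n-k)! of S and the sign of K combine to (-n)_k / n!, and the numerator of S
supplies (g+n)_k with g = 2(x₁+x₂)-1. The rest of the summand depends on k alone, so the sum over k
is a Racah-type polynomial in n. -/
theorem leadBeta_eq {x₁ x₂ x₃ x₄ xa : ℝ} (hσ : Resonant (x₃ + x₄ - x₁ - x₂))
    (h2 : NotPole (2 * x₂)) (hg : NotPole (2 * (x₁ + x₂) - 1))
    (hE : NotPole (x₁ + x₂ - (x₃ - x₄))) (hC : NotPole (xa + x₂ - x₃)) (n : ℕ) :
    leadBeta x₁ x₂ x₃ x₄ xa n = omega (x₃ + x₄ - x₁ - x₂) *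
      (Real.Gamma (1 - (x₃ + x₄ - x₁ - x₂)))⁻¹ * betaConst x₁ x₂ x₃ x₄ xa *
      (poch (2 * x₂) n * poch (x₁ + x₂ - (x₃ - x₄)) n /
        (poch (2 * (x₁ + x₂) - 1 + n) n * n.factorial)) *
      racah (2 * (x₁ + x₂) - 1) (fun k => poch (xa + x₂ - x₃) k * poch (x₂ - xa - x₃ + 1) k /
        (poch (x₁ + x₂ - (x₃ - x₄)) k * poch (x₁ + x₂ - x₃ - x₄ + 1) k * poch (2 * x₂) k *
          k.factorial)) n := by
  have hE3 : NotPole (x₁ + x₂ - x₃ - x₄ + 1) := by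
    have := hσ.notPole
    rwa [show x₁ + x₂ - x₃ - x₄ + 1 = 1 - (x₃ + x₄ - x₁ - x₂) by ring]
  have hlead : leadBeta x₁ x₂ x₃ x₄ xa n = ∑ k ∈ Finset.range (n + 1),
      omega (x₃ + x₄ - x₁ - x₂) *
      (Real.Gamma (1 - (x₃ + x₄ - x₁ - x₂)))⁻¹ * betaConst x₁ x₂ x₃ x₄ xa *
      ((-1) ^ k * (poch (xa + x₂ - x₃) k * poch (x₂ - xa - x₃ + 1) k) /
        (k.factorial * poch (x₁ + x₂ - x₃ - x₄ + 1) k)) *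
      S (x₁ - x₂) (x₃ - x₄) (-k - x₁ - x₂) (x₁ + x₂ + n) := by
    unfold leadBeta
    split_ifs with h
    · exact Finset.sum_congr rfl fun k _ => by rw [Q_eq h hC]
    · refine Finset.sum_congr rfl fun k _ => ?_
      rw [K_eq (hσ.resolve_left fun h' => h (by linarith)) hC]
  rw [hlead]
  unfold racah
  rw [Finset.mul_sum]
  refine Finset.sum_congr rfl fun k hk => ?_
  have hk' : k ≤ n := by simpa [Nat.lt_succ_iff] using hk
  rw [S_eq h2 hg hE hk', poch_neg_nat hk']
  have hn : (n.factorial : ℝ) * (n.factorial : ℝ)⁻¹ = 1 := mul_inv_cancel₀ (by positivity)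
  simp only [div_eq_mul_inv, mul_inv]
  generalize omega (x₃ + x₄ - x₁ - x₂) * (Real.Gamma (1 - (x₃ + x₄ - x₁ - x₂)))⁻¹ *
    betaConst x₁ x₂ x₃ x₄ xa = z
  generalize (poch (2 * (x₁ + x₂) - 1 + n) n)⁻¹ = z1
  generalize poch (2 * (x₁ + x₂) - 1 + n) k = z2
  generalize (n.factorial : ℝ)⁻¹ = u' at hn ⊢
  generalize (n.factorial : ℝ) = u at hn ⊢
  rw [← mul_one (z * _ * _), ← hn]
  ring

theorem S_norm_eq {x₁ x₂ : ℝ} (h1 : NotPole (2 * x₁)) (h2 : NotPole (2 * x₂))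
    (hg : NotPole (2 * (x₁ + x₂) - 1)) (n : ℕ) :
    S (x₁ - x₂) (x₂ - x₁) (-x₁ - x₂) (x₁ + x₂ + n) =
      poch (2 * x₂) n * poch (2 * x₁) n / (poch (2 * (x₁ + x₂) - 1 + n) n * n.factorial) := by
  have hE : NotPole (x₁ + x₂ - (x₂ - x₁)) := by
    rwa [show x₁ + x₂ - (x₂ - x₁) = 2 * x₁ by ring]
  have := S_eq (x₃ := x₂) (x₄ := x₁) h2 hg hE (Nat.zero_le n)
  rw [show x₁ + x₂ - (x₂ - x₁) = 2 * x₁ by ring] at this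
  simpa using this

/-- The constant in front of `γ`. -/
noncomputable def boxConst (w : Box ℝ) : ℝ :=
  betaConst w.b w.d w.e₁ w.e₂ w.a * betaConst w.d w.b w.e₃ w.e₄ w.c

/-- The coefficient of `T_{E+M}` in the product of the two large-weight series. -/
noncomputable def boxProd (w : Box ℝ) (M : ℕ) : ℝ :=
  (-1) ^ M * prodCoeff (w.c + w.b - w.e₃) (w.b - w.c - w.e₃ + 1) (w.b + w.e₂ - w.a)
    (w.b - w.a - w.e₂ + 1) (w.a + w.d - w.e₁) (w.d - w.a - w.e₁ + 1) (w.d + w.e₄ - w.c)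
    (w.d - w.c - w.e₄ + 1) (2 * w.b) (2 * w.d) M

theorem Admissible.resonant12 {w : Box ℝ} (hw : Admissible w) :
    Resonant (w.e₁ + w.e₂ - w.b - w.d) := by
  rcases hw.res12 with h | h
  · left; linarith
  · right
    intro k hk
    exact h (-k) (by push_cast; linarith)

theorem Admissible.resonant34 {w : Box ℝ} (hw : Admissible w) :
    Resonant (w.e₃ + w.e₄ - w.d - w.b) := by
  rcases hw.res34 with h | h
  · left; linarith
  · right
    intro k hk
    exact h (-k) (by push_cast; linarith)

/-- The normalisation S cancels the prefactors (2b)_n (2d)_n of the two β, and the Pochhammers of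
the block coefficient extend those of order n to order M. What remains is the kernel of
`sum_racah_mul_racah` with g = 2(b+d)-1. -/
theorem gammaLead_eq_racahProd {w : Box ℝ} (hw : Admissible w) (M : ℕ) :
    gammaLead w M = (omega (w.e₁ + w.e₂ - w.b - w.d) *
      (Real.Gamma (1 - (w.e₁ + w.e₂ - w.b - w.d)))⁻¹ * betaConst w.b w.d w.e₁ w.e₂ w.a *
      (omega (w.e₃ + w.e₄ - w.d - w.b) *
      (Real.Gamma (1 - (w.e₃ + w.e₄ - w.d - w.b)))⁻¹ * betaConst w.d w.b w.e₃ w.e₄ w.c)) * (poch (w.b + w.d - (w.e₁ - w.e₂)) M *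
      poch (w.d + w.b - (w.e₃ - w.e₄)) M) * ((-1) ^ M * racahProd (2 * (w.b + w.d) - 1)
      (fun k => poch (w.a + w.d - w.e₁) k * poch (w.d - w.a - w.e₁ + 1) k /
        (poch (w.b + w.d - (w.e₁ - w.e₂)) k * poch (w.b + w.d - w.e₁ - w.e₂ + 1) k *
          poch (2 * w.d) k * k.factorial))
      (fun k => poch (w.c + w.b - w.e₃) k * poch (w.b - w.c - w.e₃ + 1) k /
        (poch (w.d + w.b - (w.e₃ - w.e₄)) k * poch (w.d + w.b - w.e₃ - w.e₄ + 1) k *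
          poch (2 * w.b) k * k.factorial)) M) := by
  have hg : NotPole (2 * (w.b + w.d) - 1) := hw.bd
  have hg' : NotPole (2 * (w.d + w.b) - 1) := by rw [add_comm w.d]; exact hw.bd
  have hb : NotPole (2 * w.b) := hw.b
  have hd : NotPole (2 * w.d) := hw.d
  have hE1 : NotPole (w.b + w.d - (w.e₁ - w.e₂)) := hw.bd12
  have hE2 : NotPole (w.d + w.b - (w.e₃ - w.e₄)) := by rw [add_comm w.d]; exact hw.bd34
  have hC : NotPole (w.a + w.d - w.e₁) := by rw [add_comm w.a]; exact hw.da1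
  have hA : NotPole (w.c + w.b - w.e₃) := by rw [add_comm w.c]; exact hw.bc3
  have hσ := hw.resonant12
  have hσ' := hw.resonant34
  set p : ℕ → ℝ := fun k => poch (w.a + w.d - w.e₁) k * poch (w.d - w.a - w.e₁ + 1) k /
        (poch (w.b + w.d - (w.e₁ - w.e₂)) k * poch (w.b + w.d - w.e₁ - w.e₂ + 1) k *
          poch (2 * w.d) k * k.factorial) with hp
  set q : ℕ → ℝ := fun k => poch (w.c + w.b - w.e₃) k * poch (w.b - w.c - w.e₃ + 1) k /
        (poch (w.d + w.b - (w.e₃ - w.e₄)) k * poch (w.d + w.b - w.e₃ - w.e₄ + 1) k *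
          poch (2 * w.b) k * k.factorial) with hq
  rw [← sum_racah_mul_racah hg p q M, Finset.mul_sum]
  unfold gammaLead
  refine Finset.sum_congr rfl fun n hn => ?_
  have hn' : n ≤ M := by simpa [Nat.lt_succ_iff] using hn
  obtain ⟨J, rfl⟩ := Nat.exists_eq_add_of_le hn'
  rw [show n + J - n = J by omega]
  rw [leadBeta_eq hσ hd hg hE1 hC, leadBeta_eq hσ' hb hg' hE2 hA, S_norm_eq hb hd hg]
  rw [← hp, ← hq, add_comm w.d w.b]
  unfold blockCoeff
  rw [poch_add _ n J, poch_add (w.b + w.d - (w.e₃ - w.e₄)) n J,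
    show w.b + w.d + n - (w.e₁ - w.e₂) = w.b + w.d - (w.e₁ - w.e₂) + n by ring,
    show w.b + w.d + n - (w.e₃ - w.e₄) = w.b + w.d - (w.e₃ - w.e₄) + n by ring,
    show 2 * (w.b + w.d + n) = 2 * (w.b + w.d) - 1 + 1 + 2 * n by ring]
  have h1 := poch_ne_zero hb n
  have h2 := poch_ne_zero hd n
  have h3 := poch_ne_zero (hg.add_nat n) n
  have h4 : (n.factorial : ℝ) ≠ 0 := by positivity
  generalize racah (2 * (w.b + w.d) - 1) p n = R1
  generalize racah (2 * (w.b + w.d) - 1) q n = R2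
  generalize omega (w.e₁ + w.e₂ - w.b - w.d) *
      (Real.Gamma (1 - (w.e₁ + w.e₂ - w.b - w.d)))⁻¹ * betaConst w.b w.d w.e₁ w.e₂ w.a = k1
  generalize omega (w.e₃ + w.e₄ - w.d - w.b) *
      (Real.Gamma (1 - (w.e₃ + w.e₄ - w.d - w.b)))⁻¹ * betaConst w.d w.b w.e₃ w.e₄ w.c = k2
  generalize poch (2 * (w.b + w.d) - 1 + n) n = k5 at h3 ⊢
  generalize poch (2 * w.b) n = k6 at h1 ⊢
  generalize poch (2 * w.d) n = k7 at h2 ⊢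
  generalize poch (w.b + w.d - (w.e₁ - w.e₂)) n = k8
  generalize poch (w.b + w.d - (w.e₃ - w.e₄)) n = k9
  generalize poch (w.b + w.d - (w.e₁ - w.e₂) + n) J = k10
  generalize poch (w.b + w.d - (w.e₃ - w.e₄) + n) J = k11
  generalize poch (2 * (w.b + w.d) - 1 + 1 + 2 * n) J = k12
  generalize (n.factorial : ℝ) = k13 at h4 ⊢
  field_simp

-- The central formula. The denominators (1-σ)_M of the Biedenharn–Elliott identity join 1/Γ(1-σ) to
-- form the two `gammaShift` factors, so all dependence on a degeneracy sits in these factors while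
-- `boxConst` and `boxProd` stay regular.
set_option maxHeartbeats 1000000 in
theorem gammaLead_eq {w : Box ℝ} (hw : Admissible w) (M : ℕ) :
    gammaLead w M = gammaShift (w.e₁ + w.e₂ - w.b - w.d) M *
      gammaShift (w.e₃ + w.e₄ - w.d - w.b) M * (boxConst w * boxProd w M) := by
  have hb : NotPole (2 * w.b) := hw.b
  have hd : NotPole (2 * w.d) := hw.d
  have hE1 : NotPole (w.b + w.d - (w.e₁ - w.e₂)) := hw.bd12
  have hE2 : NotPole (w.d + w.b - (w.e₃ - w.e₄)) := by rw [add_comm w.d]; exact hw.bd34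
  have hE3 := hw.resonant12.notPole
  have hE4 := hw.resonant34.notPole
  have key := racahProd_eq_prodCoeff (A := w.c + w.b - w.e₃) (A' := w.b - w.c - w.e₃ + 1)
    (B := w.b + w.e₂ - w.a) (B' := w.b - w.a - w.e₂ + 1) (C := w.a + w.d - w.e₁)
    (C' := w.d - w.a - w.e₁ + 1) (D := w.d + w.e₄ - w.c) (D' := w.d - w.c - w.e₄ + 1) hb hd
    (by convert hE1 using 1; ring) (by convert hE3 using 1; ring) (by convert hE2 using 1; ring)
    (by convert hE4 using 1; ring) (by ring) (by ring) M
  rw [show w.b + w.e₂ - w.a + (w.a + w.d - w.e₁) = w.b + w.d - (w.e₁ - w.e₂) by ring,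
    show w.b - w.a - w.e₂ + 1 + (w.a + w.d - w.e₁) = w.b + w.d - w.e₁ - w.e₂ + 1 by ring,
    show w.d + w.e₄ - w.c + (w.c + w.b - w.e₃) = w.d + w.b - (w.e₃ - w.e₄) by ring,
    show w.d - w.c - w.e₄ + 1 + (w.c + w.b - w.e₃) = w.d + w.b - w.e₃ - w.e₄ + 1 by ring,
    show 2 * w.b + 2 * w.d - 1 = 2 * (w.b + w.d) - 1 by ring] at key
  have e3 : w.b + w.d - w.e₁ - w.e₂ + 1 = 1 - (w.e₁ + w.e₂ - w.b - w.d) := by ring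
  have e4 : w.d + w.b - w.e₃ - w.e₄ + 1 = 1 - (w.e₃ + w.e₄ - w.d - w.b) := by ring
  rw [gammaLead_eq_racahProd hw]
  unfold gammaShift boxConst boxProd
  rw [← key, inv_Gamma_add_nat hE3, inv_Gamma_add_nat hE4, e3, e4]
  have h1 := poch_ne_zero hE3 M
  have h2 := poch_ne_zero hE4 M
  have hs2 : ((-1 : ℝ) ^ M) * (-1) ^ M = 1 := by rw [← mul_pow]; simp
  generalize racahProd _ _ _ M = R
  generalize poch (1 - (w.e₁ + w.e₂ - w.b - w.d)) M = k1 at h1 ⊢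
  generalize poch (1 - (w.e₃ + w.e₄ - w.d - w.b)) M = k2 at h2 ⊢
  generalize poch (w.b + w.d - (w.e₁ - w.e₂)) M = k3
  generalize poch (w.d + w.b - (w.e₃ - w.e₄)) M = k4
  generalize ((-1 : ℝ)) ^ M = ε at hs2 ⊢
  generalize (Real.Gamma (1 - (w.e₁ + w.e₂ - w.b - w.d)))⁻¹ = k5
  generalize (Real.Gamma (1 - (w.e₃ + w.e₄ - w.d - w.b)))⁻¹ = k6
  generalize omega (w.e₁ + w.e₂ - w.b - w.d) = k7
  generalize omega (w.e₃ + w.e₄ - w.d - w.b) = k8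
  generalize betaConst w.b w.d w.e₁ w.e₂ w.a = k9
  generalize betaConst w.d w.b w.e₃ w.e₄ w.c = k10
  clear key
  have e : k7 * ε * (k5 / k1) * (k8 * ε * (k6 / k2)) *
      (k9 * k10 * (ε * (k3 * k1 * (k4 * k2) * R))) = (ε * ε) * (k1 / k1) * (k2 / k2) *
      (k7 * k5 * k9 * (k8 * k6 * k10) * (k3 * k4) * (ε * R)) := by ring
  rw [e, hs2, div_self h1, div_self h2]
  ring

theorem gamma_eq_gammaLead {w : Box ℝ} (h : mult w = 0) (m : ℕ) : gamma w m = gammaLead w m := by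
  unfold mult at h
  have h1 : ¬ w.b + w.d = w.e₁ + w.e₂ := fun h' => by simp [h'] at h
  have h2 : ¬ w.d + w.b = w.e₃ + w.e₄ := fun h' => by simp [h'] at h
  unfold gamma gammaLead leadBeta
  simp only [if_neg h1, if_neg h2]

/-! ### The degenerate coefficients as limits -/

theorem continuous_inv_Gamma : Continuous fun x : ℝ => (Real.Gamma x)⁻¹ := by
  have h : Continuous fun x : ℝ => ((Complex.Gamma (x : ℂ))⁻¹).re :=
    Complex.continuous_re.comp
      (Complex.differentiable_one_div_Gamma.continuous.comp Complex.continuous_ofReal)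
  refine h.congr fun x => ?_
  rw [Complex.Gamma_ofReal, ← Complex.ofReal_inv, Complex.ofReal_re]

theorem NotPole.continuousAt_Gamma {x : ℝ} (hx : NotPole x) : ContinuousAt Real.Gamma x :=
  (Real.differentiableAt_Gamma hx).continuousAt

theorem continuous_poch (n : ℕ) : Continuous fun x : ℝ => poch x n :=
  Polynomial.continuous _

section Limits

variable {ι : Type*} {l : Filter ι}

theorem tendsto_inv_Gamma {f : ι → ℝ} {x : ℝ} (hf : Tendsto f l (𝓝 x)) :
    Tendsto (fun t => (Real.Gamma (f t))⁻¹) l (𝓝 (Real.Gamma x)⁻¹) :=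
  (continuous_inv_Gamma.tendsto x).comp hf

theorem tendsto_Gamma {f : ι → ℝ} {x : ℝ} (hx : NotPole x) (hf : Tendsto f l (𝓝 x)) :
    Tendsto (fun t => Real.Gamma (f t)) l (𝓝 (Real.Gamma x)) :=
  hx.continuousAt_Gamma.tendsto.comp hf

theorem tendsto_poch {f : ι → ℝ} {x : ℝ} (n : ℕ) (hf : Tendsto f l (𝓝 x)) :
    Tendsto (fun t => poch (f t) n) l (𝓝 (poch x n)) :=
  ((continuous_poch n).tendsto x).comp hf

/-- Since 1/Γ is continuous everywhere, only the Gamma functions of the numerator must avoid poles.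
Γ(2h-1) stands in a denominator and imposes nothing. -/
theorem tendsto_S {r s a h : ι → ℝ} {r₀ s₀ a₀ h₀ : ℝ} (hr : Tendsto r l (𝓝 r₀))
    (hs : Tendsto s l (𝓝 s₀)) (ha : Tendsto a l (𝓝 a₀)) (hh : Tendsto h l (𝓝 h₀))
    (h1 : NotPole (h₀ - r₀)) (h2 : NotPole (h₀ - s₀)) (h3 : NotPole (h₀ - a₀ - 1)) :
    Tendsto (fun t => S (r t) (s t) (a t) (h t)) l (𝓝 (S r₀ s₀ a₀ h₀)) := by
  have e : ∀ r s a h : ℝ, S r s a h = ((Real.Gamma (-a - r))⁻¹ * (Real.Gamma (-a - s))⁻¹) *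
      (Real.Gamma (h - r) * Real.Gamma (h - s) * (Real.Gamma (2 * h - 1))⁻¹) *
      (Real.Gamma (h - a - 1) * (Real.Gamma (h + a + 1))⁻¹) := by
    intro r s a h
    unfold S
    simp only [div_eq_mul_inv, mul_inv, one_mul]
  simp only [e]
  refine ((Tendsto.mul ?_ ?_).mul (Tendsto.mul (Tendsto.mul ?_ ?_) ?_)).mul (Tendsto.mul ?_ ?_)
  · exact tendsto_inv_Gamma (ha.neg.sub hr)
  · exact tendsto_inv_Gamma (ha.neg.sub hs)
  · exact tendsto_Gamma h1 (hh.sub hr)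
  · exact tendsto_Gamma h2 (hh.sub hs)
  · exact tendsto_inv_Gamma ((hh.const_mul 2).sub tendsto_const_nhds)
  · exact tendsto_Gamma h3 ((hh.sub ha).sub tendsto_const_nhds)
  · exact tendsto_inv_Gamma ((hh.add ha).add tendsto_const_nhds)

/-- The regular factor of `K`. -/
noncomputable def regK (r s : ℝ) (k : ℕ) (h : ℝ) : ℝ :=
  (Real.Gamma (k + 1))⁻¹ * (Real.Gamma (k + 1 + s - r))⁻¹ *
    (Real.Gamma (2 * h) * (Real.Gamma (h - r))⁻¹ * (Real.Gamma (h - s))⁻¹) *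
    (Real.Gamma (h + k - r) * (Real.Gamma (h - k + r))⁻¹)

theorem K_eq_regK (r s : ℝ) (k : ℕ) (h : ℝ) :
    K r s k h = Real.Gamma (r - s) * Real.Gamma (1 + s - r) * regK r s k h := by
  unfold K regK
  simp only [div_eq_mul_inv, mul_inv]
  ring

theorem Q_eq_regK (r : ℝ) (k : ℕ) (h : ℝ) : Q r k h = -regK r r k h := by
  unfold Q regK
  rw [add_sub_cancel_right]
  simp only [div_eq_mul_inv, mul_inv, pow_two]
  ring

theorem tendsto_regK {r s : ι → ℝ} {r₀ s₀ h : ℝ} (hr : Tendsto r l (𝓝 r₀))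
    (hs : Tendsto s l (𝓝 s₀)) (k : ℕ) (h1 : NotPole (h + k - r₀)) :
    Tendsto (fun t => regK (r t) (s t) k h) l (𝓝 (regK r₀ s₀ k h)) := by
  unfold regK
  refine ((tendsto_const_nhds.mul ?_).mul ((tendsto_const_nhds.mul ?_).mul ?_)).mul
    (Tendsto.mul ?_ ?_)
  · exact tendsto_inv_Gamma ((tendsto_const_nhds.add hs).sub hr)
  · exact tendsto_inv_Gamma (tendsto_const_nhds.sub hr)
  · exact tendsto_inv_Gamma (tendsto_const_nhds.sub hs)
  · exact tendsto_Gamma h1 (tendsto_const_nhds.sub hr)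
  · exact tendsto_inv_Gamma (tendsto_const_nhds.add hr)

/-- In the degenerate case r - s equals -(u+v), and (u+v) Γ(-(u+v)) = -Γ(1-(u+v)) tends to -1. One
power of u+v thus removes the pole of K and leaves Q with its sign. -/
theorem tendsto_beta {x₁ x₂ x₃ x₄ xa : ℝ} (hσ : Resonant (x₃ + x₄ - x₁ - x₂))
    (h2 : NotPole (2 * x₂)) (hg : NotPole (2 * (x₁ + x₂) - 1))
    (hE : NotPole (x₁ + x₂ - (x₃ - x₄))) (hC : NotPole (xa + x₂ - x₃)) {u v : ι → ℝ}
    (hu : Tendsto u l (𝓝 0)) (hv : Tendsto v l (𝓝 0)) (huv : ∀ᶠ t in l, u t + v t ≠ 0) (n : ℕ) :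
    Tendsto (fun t => (u t + v t) ^ (if x₁ + x₂ = x₃ + x₄ then 1 else 0) *
      beta (x₁ + u t) (x₂ + v t) x₃ x₄ xa n) l (𝓝 (leadBeta x₁ x₂ x₃ x₄ xa n)) := by
  have hu1 : Tendsto (fun t => x₁ + u t) l (𝓝 x₁) := by simpa using hu.const_add x₁
  have hv1 : Tendsto (fun t => x₂ + v t) l (𝓝 x₂) := by simpa using hv.const_add x₂
  have hSt : ∀ k : ℕ, Tendsto (fun t => S (x₁ + u t - (x₂ + v t)) (x₃ - x₄)
      (-k - (x₁ + u t) - (x₂ + v t)) (x₁ + u t + (x₂ + v t) + n)) l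
      (𝓝 (S (x₁ - x₂) (x₃ - x₄) (-k - x₁ - x₂) (x₁ + x₂ + n))) := by
    intro k
    refine tendsto_S (hu1.sub hv1) tendsto_const_nhds ((tendsto_const_nhds.sub hu1).sub hv1)
      ((hu1.add hv1).add tendsto_const_nhds) ?_ ?_ ?_
    · convert h2.add_nat n using 1; ring
    · convert hE.add_nat n using 1; ring
    · convert hg.add_nat (n + k) using 1
      push_cast
      ring
  have hr : Tendsto (fun t => x₃ - (x₂ + v t)) l (𝓝 (x₃ - x₂)) := tendsto_const_nhds.sub hv1
  have hs : Tendsto (fun t => x₁ + u t - x₄) l (𝓝 (x₁ - x₄)) := hu1.sub tendsto_const_nhds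
  have hR : ∀ k : ℕ, Tendsto (fun t => regK (x₃ - (x₂ + v t)) (x₁ + u t - x₄) k xa) l
      (𝓝 (regK (x₃ - x₂) (x₁ - x₄) k xa)) := by
    intro k
    refine tendsto_regK hr hs k ?_
    convert hC.add_nat k using 1
    ring
  have h01 : NotPole 1 := fun k hk => by
    have : (0 : ℝ) ≤ k := by positivity
    linarith
  unfold leadBeta beta betaLog
  split_ifs with h
  · simp only [Finset.mul_sum]
    refine tendsto_finsetSum _ fun k _ => ?_
    have hsr : x₁ - x₄ = x₃ - x₂ := by linarith
    have huv0 : Tendsto (fun t => u t + v t) l (𝓝 0) := by simpa using hu.add hv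
    have hpole : Tendsto (fun t => (-Real.Gamma (1 - (u t + v t))) *
        Real.Gamma (1 + (u t + v t)) * regK (x₃ - (x₂ + v t)) (x₁ + u t - x₄) k xa) l
        (𝓝 (-Real.Gamma 1 * Real.Gamma 1 * regK (x₃ - x₂) (x₁ - x₄) k xa)) := by
      refine (Tendsto.mul (Tendsto.neg ?_) ?_).mul (hR k)
      · exact tendsto_Gamma h01 (by simpa using huv0.const_sub 1)
      · exact tendsto_Gamma h01 (by simpa using huv0.const_add 1)
    have := hpole.mul (hSt k)
    rw [Real.Gamma_one, hsr] at this
    rw [Q_eq_regK]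
    refine (this.congr' ?_).trans (by simp)
    filter_upwards [huv] with t ht
    rw [K_eq_regK, pow_one, show x₃ - (x₂ + v t) - (x₁ + u t - x₄) = -(u t + v t) by linarith,
      show 1 + (x₁ + u t - x₄) - (x₃ - (x₂ + v t)) = 1 + (u t + v t) by linarith]
    have e : Real.Gamma (1 - (u t + v t)) = -(u t + v t) * Real.Gamma (-(u t + v t)) := by
      rw [← Real.Gamma_add_one (neg_ne_zero.mpr ht)]
      congr 1
      ring
    rw [e]
    ring
  · have hσ' := hσ.resolve_left fun h' => h (by linarith)
    simp only [pow_zero, one_mul]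
    refine tendsto_finsetSum _ fun k _ => Tendsto.mul ?_ (hSt k)
    simp only [K_eq_regK]
    refine (Tendsto.mul ?_ ?_).mul (hR k)
    · refine tendsto_Gamma (fun j hj => hσ' (-j) ?_) (hr.sub hs)
      push_cast
      linarith
    · refine tendsto_Gamma (fun j hj => hσ' (1 + j) ?_) ((hs.const_add 1).sub hr)
      push_cast
      linarith

theorem tendsto_blockCoeff {r s : ℝ} {h : ι → ℝ} {h₀ : ℝ} (hh : Tendsto h l (𝓝 h₀))
    (h0 : NotPole (2 * h₀)) (j : ℕ) :
    Tendsto (fun t => blockCoeff r s (h t) j) l (𝓝 (blockCoeff r s h₀ j)) := by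
  unfold blockCoeff
  refine Tendsto.mul (Tendsto.div (Tendsto.mul ?_ ?_) (Tendsto.mul ?_ tendsto_const_nhds) ?_)
    tendsto_const_nhds
  · exact tendsto_poch j (hh.sub tendsto_const_nhds)
  · exact tendsto_poch j (hh.sub tendsto_const_nhds)
  · exact tendsto_poch j (hh.const_mul 2)
  · exact mul_ne_zero (poch_ne_zero h0 j) (by positivity)

end Limits

/-- Each degenerate β absorbs one power of t.1 + t.2. The second β carries b and d in reverse order
and so sees the shifts reversed; the normalisation has a nonzero limit. -/
theorem tendsto_gamma {w : Box ℝ} (hw : Admissible w) (m : ℕ) :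
    Tendsto (fun t : ℝ × ℝ => (t.1 + t.2) ^ mult w * gamma (shiftBD w t) m)
      (𝓝[{t | t.1 + t.2 ≠ 0}] 0) (𝓝 (gammaLead w m)) := by
  have hg : NotPole (2 * (w.b + w.d) - 1) := hw.bd
  have hg' : NotPole (2 * (w.d + w.b) - 1) := by rw [add_comm w.d]; exact hw.bd
  have hE2 : NotPole (w.d + w.b - (w.e₃ - w.e₄)) := by rw [add_comm w.d]; exact hw.bd34
  have hC : NotPole (w.a + w.d - w.e₁) := by rw [add_comm w.a]; exact hw.da1
  have hA : NotPole (w.c + w.b - w.e₃) := by rw [add_comm w.c]; exact hw.bc3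
  set l : Filter (ℝ × ℝ) := 𝓝[{t | t.1 + t.2 ≠ 0}] 0
  have h1 : Tendsto (fun t : ℝ × ℝ => t.1) l (𝓝 0) :=
    (continuous_fst.tendsto (0 : ℝ × ℝ)).mono_left nhdsWithin_le_nhds
  have h2 : Tendsto (fun t : ℝ × ℝ => t.2) l (𝓝 0) :=
    (continuous_snd.tendsto (0 : ℝ × ℝ)).mono_left nhdsWithin_le_nhds
  have hne : ∀ᶠ t : ℝ × ℝ in l, t.1 + t.2 ≠ 0 := eventually_mem_nhdsWithin
  have hne' : ∀ᶠ t : ℝ × ℝ in l, t.2 + t.1 ≠ 0 := hne.mono fun t ht => by rwa [add_comm]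
  have hb1 : Tendsto (fun t : ℝ × ℝ => w.b + t.1) l (𝓝 w.b) := by simpa using h1.const_add w.b
  have hd1 : Tendsto (fun t : ℝ × ℝ => w.d + t.2) l (𝓝 w.d) := by simpa using h2.const_add w.d
  unfold gamma gammaLead
  simp only [Finset.mul_sum]
  refine tendsto_finsetSum _ fun n hn => ?_
  have hn' : n ≤ m := by simpa [Nat.lt_succ_iff] using hn
  have t1 := tendsto_beta hw.resonant12 hw.d hg hw.bd12 hC h1 h2 hne n
  have t2 := tendsto_beta hw.resonant34 hw.b hg' hE2 hA h2 h1 hne' n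
  have hS0 : S (w.b - w.d) (w.d - w.b) (-w.b - w.d) (w.b + w.d + n) ≠ 0 := by
    rw [S_norm_eq hw.b hw.d hg]
    exact div_ne_zero (mul_ne_zero (poch_ne_zero hw.d n) (poch_ne_zero hw.b n))
      (mul_ne_zero (poch_ne_zero (hg.add_nat n) n) (by positivity))
  have t3 : Tendsto (fun t : ℝ × ℝ => S (w.b + t.1 - (w.d + t.2)) (w.d + t.2 - (w.b + t.1))
      (-(w.b + t.1) - (w.d + t.2)) (w.b + t.1 + (w.d + t.2) + n)) l
      (𝓝 (S (w.b - w.d) (w.d - w.b) (-w.b - w.d) (w.b + w.d + n))) := by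
    refine tendsto_S (hb1.sub hd1) (hd1.sub hb1) (hb1.neg.sub hd1)
      ((hb1.add hd1).add tendsto_const_nhds) ?_ ?_ ?_
    · convert hw.d.add_nat n using 1; ring
    · convert hw.b.add_nat n using 1; ring
    · convert hg.add_nat n using 1; ring
  have t4 : Tendsto (fun t : ℝ × ℝ => blockCoeff (w.e₁ - w.e₂) (w.e₃ - w.e₄)
      (w.b + t.1 + (w.d + t.2) + n) (m - n)) l
      (𝓝 (blockCoeff (w.e₁ - w.e₂) (w.e₃ - w.e₄) (w.b + w.d + n) (m - n))) := by
    refine tendsto_blockCoeff ((hb1.add hd1).add tendsto_const_nhds) ?_ _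
    convert hg.add_nat (1 + 2 * n) using 1
    push_cast
    ring
  refine (((t1.mul t2).div t3 hS0).mul t4).congr fun t => ?_
  simp only [mult, shiftBD, Pi.div_apply]
  rw [pow_add, add_comm t.2 t.1]
  ring

/-! ### Ratios of Gamma functions at large argument -/

/-- Log-convexity of Γ between x and x+1 (Wendel's inequality). -/
theorem Gamma_add_le {x a : ℝ} (hx : 0 < x) (ha : 0 ≤ a) (ha1 : a ≤ 1) :
    Real.Gamma (x + a) ≤ Real.Gamma x * x ^ a := by
  rcases ha.eq_or_lt with rfl | ha
  · simp
  rcases ha1.eq_or_lt with rfl | ha1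
  · rw [Real.Gamma_add_one hx.ne', Real.rpow_one, mul_comm]
  have h := Real.Gamma_mul_add_mul_le_rpow_Gamma_mul_rpow_Gamma hx (by linarith : 0 < x + 1)
    (by linarith : 0 < 1 - a) ha (by ring)
  have hG := Real.Gamma_pos_of_pos hx
  rw [show (1 - a) * x + a * (x + 1) = x + a by ring, Real.Gamma_add_one hx.ne',
    Real.mul_rpow hx.le hG.le, mul_left_comm, ← Real.rpow_add hG] at h
  rw [mul_comm]
  simpa using h

/-- Wendel's inequality at x + a with the complementary step 1 - a. -/
theorem le_Gamma_add {x a : ℝ} (hx : 0 < x) (ha : 0 ≤ a) (ha1 : a ≤ 1) :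
    Real.Gamma x * x ≤ Real.Gamma (x + a) * (x + a) ^ (1 - a) := by
  have h := Gamma_add_le (x := x + a) (a := 1 - a) (by linarith) (by linarith) (by linarith)
  rw [show x + a + (1 - a) = x + 1 by ring, Real.Gamma_add_one hx.ne'] at h
  linarith

theorem tendsto_add_const_div (b : ℝ) : Tendsto (fun h : ℝ => (h + b) / h) atTop (𝓝 1) := by
  have h0 : Tendsto (fun h : ℝ => 1 + b / h) atTop (𝓝 1) := by
    simpa using (tendsto_const_nhds.add
      (tendsto_const_nhds.div_atTop tendsto_id : Tendsto (fun h : ℝ => b / h) atTop (𝓝 0))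
      : Tendsto (fun h : ℝ => 1 + b / h) atTop (𝓝 (1 + 0)))
  refine h0.congr' ?_
  filter_upwards [eventually_gt_atTop 0] with h hh
  field_simp

/-- For 0 ≤ a ≤ 1 the ratio is squeezed by the two Wendel bounds. The functional equation carries
the limit from a to a+1 and back, hence from the fractional part to every real a. -/
theorem tendsto_Gamma_ratio (a : ℝ) :
    Tendsto (fun h : ℝ => Real.Gamma (h + a) / Real.Gamma h * h ^ (-a)) atTop (𝓝 1) := by
  have hq := tendsto_add_const_div
  have hstep : ∀ b : ℝ,
      (Tendsto (fun h : ℝ => Real.Gamma (h + b) / Real.Gamma h * h ^ (-b)) atTop (𝓝 1) ↔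
      Tendsto (fun h : ℝ => Real.Gamma (h + (b + 1)) / Real.Gamma h * h ^ (-(b + 1)))
        atTop (𝓝 1)) := by
    intro b
    have e : (fun h : ℝ => Real.Gamma (h + (b + 1)) / Real.Gamma h * h ^ (-(b + 1))) =ᶠ[atTop]
        fun h => (Real.Gamma (h + b) / Real.Gamma h * h ^ (-b)) * ((h + b) / h) := by
      filter_upwards [eventually_gt_atTop 0, eventually_gt_atTop (-b)] with h hh hb
      rw [← add_assoc, Real.Gamma_add_one (by linarith), neg_add, Real.rpow_add hh,
        Real.rpow_neg_one]
      ring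
    rw [tendsto_congr' e]
    constructor
    · intro h
      simpa using h.mul (hq b)
    · intro h
      have h2 := h.div (hq b) one_ne_zero
      rw [div_one] at h2
      refine h2.congr' ?_
      filter_upwards [eventually_gt_atTop 0, eventually_gt_atTop (-b)] with h hh hb
      have : h + b ≠ 0 := by linarith
      simp only [Pi.div_apply]
      field_simp
  have hbase : ∀ b : ℝ, 0 ≤ b → b ≤ 1 →
      Tendsto (fun h : ℝ => Real.Gamma (h + b) / Real.Gamma h * h ^ (-b)) atTop (𝓝 1) := by
    intro b hb hb1
    have hlow : Tendsto (fun h : ℝ => ((h + b) / h) ^ (-(1 - b))) atTop (𝓝 1) := by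
      have := (hq b).rpow_const (p := -(1 - b)) (Or.inl one_ne_zero)
      simpa using this
    refine tendsto_of_tendsto_of_tendsto_of_le_of_le' hlow tendsto_const_nhds ?_ ?_
    · filter_upwards [eventually_gt_atTop 0] with h hh
      have hG := Real.Gamma_pos_of_pos hh
      have h1 := le_Gamma_add hh hb hb1
      rw [Real.div_rpow (by linarith) hh.le, Real.rpow_neg (by linarith : 0 ≤ h + b),
        Real.rpow_neg hh.le, Real.rpow_neg hh.le, Real.rpow_sub hh, Real.rpow_one]
      have hp : 0 < (h + b) ^ (1 - b) := Real.rpow_pos_of_pos (by linarith) _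
      have hp' : 0 < h ^ b := Real.rpow_pos_of_pos hh _
      rw [inv_div_inv, div_div, ← div_eq_mul_inv, div_div, div_le_div_iff₀ (by positivity)
        (by positivity)]
      nlinarith [mul_le_mul_of_nonneg_right h1 hp'.le]
    · filter_upwards [eventually_gt_atTop 0] with h hh
      have hG := Real.Gamma_pos_of_pos hh
      have hp' : 0 < h ^ b := Real.rpow_pos_of_pos hh _
      rw [Real.rpow_neg hh.le, ← div_eq_mul_inv, div_div, div_le_one (by positivity)]
      exact Gamma_add_le hh hb hb1
  have hint : ∀ (n : ℤ) (b : ℝ), 0 ≤ b → b ≤ 1 →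
      Tendsto (fun h : ℝ => Real.Gamma (h + (b + n)) / Real.Gamma h * h ^ (-(b + n)))
        atTop (𝓝 1) := by
    intro n b hb hb1
    induction n using Int.induction_on with
    | zero => simpa using hbase b hb hb1
    | succ n ih =>
      have := (hstep _).1 ih
      push_cast
      simpa [add_assoc] using this
    | pred n ih =>
      refine (hstep _).2 ?_
      have e : b + ((-(n : ℤ) - 1 : ℤ) : ℝ) + 1 = b + ((-(n : ℤ) : ℤ) : ℝ) := by push_cast; ring
      simpa only [e] using ih
  have := hint ⌊a⌋ (Int.fract a) (Int.fract_nonneg a) (Int.fract_lt_one a).le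
  simpa only [Int.fract_add_floor] using this

/-- The ratio `Γ(h-e-1) / Γ(h+e+1)`. -/
noncomputable def gammaQuot (e h : ℝ) : ℝ := Real.Gamma (h - e - 1) / Real.Gamma (h + e + 1)

/-- The weight `Γ(h-r) Γ(h-s) / Γ(2h-1)`. -/
noncomputable def blockWeight (r s h : ℝ) : ℝ :=
  Real.Gamma (h - r) * Real.Gamma (h - s) / Real.Gamma (2 * h - 1)

theorem S_eq_gammaQuot (r s a h : ℝ) :
    S r s a h = (Real.Gamma (-a - r))⁻¹ * (Real.Gamma (-a - s))⁻¹ * gammaQuot a h *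
      blockWeight r s h := by
  unfold S gammaQuot blockWeight
  rw [one_div, mul_inv]
  ring

theorem eventually_blockWeight_pos (r s : ℝ) : ∀ᶠ h in atTop, 0 < blockWeight r s h := by
  filter_upwards [eventually_gt_atTop r, eventually_gt_atTop s, eventually_gt_atTop 1]
    with h h1 h2 h3
  unfold blockWeight
  have := Real.Gamma_pos_of_pos (sub_pos.2 h1)
  have := Real.Gamma_pos_of_pos (sub_pos.2 h2)
  have := Real.Gamma_pos_of_pos (by linarith : 0 < 2 * h - 1)
  positivity

theorem gammaQuot_pos {e h : ℝ} (h1 : e + 1 < h) (h2 : -e - 1 < h) : 0 < gammaQuot e h :=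
  div_pos (Real.Gamma_pos_of_pos (by linarith)) (Real.Gamma_pos_of_pos (by linarith))

theorem eventually_gammaQuot_pos (e : ℝ) : ∀ᶠ h in atTop, 0 < gammaQuot e h := by
  filter_upwards [eventually_gt_atTop (e + 1), eventually_gt_atTop (-e - 1)] with h h1 h2
  exact gammaQuot_pos h1 h2

theorem tendsto_gammaQuot (e : ℝ) :
    Tendsto (fun h : ℝ => gammaQuot e h * h ^ (2 * e + 2)) atTop (𝓝 1) := by
  have h1 := tendsto_Gamma_ratio (-e - 1)
  have h2 := tendsto_Gamma_ratio (e + 1)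
  have h := h1.div h2 one_ne_zero
  rw [div_one] at h
  refine h.congr' ?_
  filter_upwards [eventually_gt_atTop 0] with x hx
  have hG := (Real.Gamma_pos_of_pos hx).ne'
  have hp : x ^ (-(e + 1)) ≠ 0 := (Real.rpow_pos_of_pos hx _).ne'
  simp only [Pi.div_apply, gammaQuot]
  rw [show x + (-e - 1) = x - e - 1 by ring, show x + (e + 1) = x + e + 1 by ring,
    show -(-e - 1) = (2 * e + 2) + -(e + 1) by ring, Real.rpow_add hx]
  field_simp

theorem gammaQuot_isBigO (e : ℝ) :
    gammaQuot e =O[atTop] fun h : ℝ => h ^ (-(2 * e + 2)) := by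
  have h1 := (tendsto_gammaQuot e).isBigO_one ℝ
  have h2 := h1.mul (isBigO_refl (fun h : ℝ => h ^ (-(2 * e + 2))) atTop)
  refine (h2.congr' ?_ ?_)
  · filter_upwards [eventually_gt_atTop 0] with x hx
    rw [mul_assoc, ← Real.rpow_add hx]
    simp
  · filter_upwards with x
    simp

theorem inv_gammaQuot_isBigO (e : ℝ) :
    (fun h => (gammaQuot e h)⁻¹) =O[atTop] fun h : ℝ => h ^ (2 * e + 2) := by
  have h1 := ((tendsto_gammaQuot e).inv₀ one_ne_zero).isBigO_one ℝ
  have h2 := h1.mul (isBigO_refl (fun h : ℝ => h ^ (2 * e + 2)) atTop)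
  refine (h2.congr' ?_ ?_)
  · filter_upwards [eventually_gt_atTop 0] with x hx
    have hp : x ^ (2 * e + 2) ≠ 0 := (Real.rpow_pos_of_pos hx _).ne'
    rw [mul_inv, mul_assoc, inv_mul_cancel₀ hp, mul_one]
  · filter_upwards with x
    simp

theorem rpow_isBigO_rpow_atTop {a b : ℝ} (h : a ≤ b) :
    (fun x : ℝ => x ^ a) =O[atTop] fun x : ℝ => x ^ b := by
  refine IsBigO.of_bound 1 ?_
  filter_upwards [eventually_ge_atTop 1] with x hx
  rw [one_mul, Real.norm_of_nonneg (by positivity), Real.norm_of_nonneg (by positivity)]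
  exact Real.rpow_le_rpow_of_exponent_le hx h

theorem gammaQuot_add_one {e h : ℝ} (h1 : h ≠ e + 1) (h2 : h ≠ -e - 1) :
    gammaQuot e (h + 1) = (h - e - 1) / (h + e + 1) * gammaQuot e h := by
  unfold gammaQuot
  rw [show h + 1 - e - 1 = (h - e - 1) + 1 by ring, Real.Gamma_add_one (by grind),
    show h + 1 + e + 1 = (h + e + 1) + 1 by ring, Real.Gamma_add_one (by grind)]
  field_simp

theorem gammaQuot_sub_one {e h : ℝ} (h1 : h ≠ e + 1) (h2 : h ≠ -e) :
    gammaQuot (e - 1) h = (h - e - 1) * (h + e) * gammaQuot e h := by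
  unfold gammaQuot
  rw [show h - (e - 1) - 1 = (h - e - 1) + 1 by ring, Real.Gamma_add_one (by grind),
    show h + (e - 1) + 1 = h + e by ring, Real.Gamma_add_one (s := h + e) (by grind)]
  have : h + e ≠ 0 := by grind
  field_simp

/-! ### The asymptotic series of a quotient of Gamma ratios. -/

/-- The coefficients in the expansion of `T_e T_{e'} / T_{e''}` in `T_{e+e'-e''+j}`, where
`T_e` is `gammaQuot e`. -/
noncomputable def quotCoeff (e e' e'' : ℝ) (j : ℕ) : ℝ :=
  (-1) ^ j * poch (e' - e'') j * poch (e - e'') j * poch (e + e' + 2) j / (j.factorial : ℝ)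

theorem quotCoeff_succ (e e' e'' : ℝ) (j : ℕ) :
    (j + 1) * quotCoeff e e' e'' (j + 1) =
      -((e' - e'' + j) * (e - e'' + j) * (e + e' + 2 + j)) * quotCoeff e e' e'' j := by
  unfold quotCoeff
  rw [poch_succ, poch_succ, poch_succ, Nat.factorial_succ]
  have : (j.factorial : ℝ) ≠ 0 := by positivity
  push_cast
  field_simp
  ring

theorem quotCoeff_difference (e e' e'' : ℝ) (N : ℕ) {h : ℝ}
    (hh : |e + e' - e''| + N + 2 < h) :
    (h + e + 1) * (h + e' + 1) * (h - e'' - 1) *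
        ∑ j ∈ Finset.range N, quotCoeff e e' e'' j * gammaQuot (e + e' - e'' + j) (h + 1) -
      (h - e - 1) * (h - e' - 1) * (h + e'' + 1) *
        ∑ j ∈ Finset.range N, quotCoeff e e' e'' j * gammaQuot (e + e' - e'' + j) h =
    N * quotCoeff e e' e'' N *
      (2 * h * (h - (e + e' - e'' + N) - 1) * gammaQuot (e + e' - e'' + N) h) := by
  induction N with
  | zero => simp
  | succ N ih =>
    have hE1 := le_abs_self (e + e' - e'')
    have hE2 := neg_abs_le (e + e' - e'')
    push_cast at hh
    have hN : (0 : ℝ) ≤ N := Nat.cast_nonneg N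
    have ih' := ih (by linarith)
    rw [Finset.sum_range_succ, Finset.sum_range_succ]
    have hs := quotCoeff_succ e e' e'' N
    set E := e + e' - e'' with hE
    set P1 := ∑ j ∈ Finset.range N, quotCoeff e e' e'' j * gammaQuot (E + j) (h + 1)
    set P0 := ∑ j ∈ Finset.range N, quotCoeff e e' e'' j * gammaQuot (E + j) h
    rw [gammaQuot_add_one (by linarith) (by linarith)]
    have h2 := gammaQuot_sub_one (e := E + N + 1) (h := h) (by linarith) (by linarith)
    rw [show E + N + 1 - 1 = E + N by ring] at h2
    push_cast
    rw [hs, show E + (N + 1) = E + N + 1 by ring]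
    have hne : h + (E + N + 1) ≠ 0 := by linarith
    have hne2 : h + (E + N) + 1 ≠ 0 := by linarith
    have ih2 : (h + e + 1) * (h + e' + 1) * (h - e'' - 1) * P1 =
      (h - e - 1) * (h - e' - 1) * (h + e'' + 1) * P0 + N * quotCoeff e e' e'' N *
      (2 * h * (h - (E + N) - 1) * gammaQuot (E + N) h) := by linarith
    rw [mul_add _ P1, mul_add _ P0, ih2, h2]
    generalize quotCoeff e e' e'' N = q
    generalize gammaQuot (E + N + 1) h = t
    have he'' : e'' = e + e' - E := by rw [hE]; ring
    rw [he'']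
    field_simp
    ring

/-- A function on a half line whose forward differences are `O(h^{-k-1})` and which tends to `1`
is `1 + O(h^{-k})`. -/
theorem isBigO_of_forward_difference {ρ : ℝ → ℝ} {k : ℕ} (hk : 0 < k)
    (hlim : Tendsto ρ atTop (𝓝 1))
    (hd : (fun h => ρ (h + 1) - ρ h) =O[atTop] fun h : ℝ => (h ^ (k + 1))⁻¹) :
    (fun h => ρ h - 1) =O[atTop] fun h : ℝ => (h ^ k)⁻¹ := by
  obtain ⟨C, hC, hb⟩ := hd.exists_pos
  rw [isBigOWith_iff, eventually_atTop] at hb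
  obtain ⟨H, hH⟩ := hb
  -- A forward difference of size x^{-k-1} is dominated by a difference of 2^{k+1} x^{-k}: Bernoulli
  -- gives (x+1)^k - x^k ≥ x^k/x, and (x+1)^k ≤ 2^k x^k.
  have key : ∀ x : ℝ, 1 ≤ x → (x ^ (k + 1))⁻¹ ≤ 2 ^ (k + 1) * ((x ^ k)⁻¹ - ((x + 1) ^ k)⁻¹) := by
    intro x hx
    have hx0 : 0 < x := by linarith
    have h1 : x ^ k * (1 + k / x) ≤ (x + 1) ^ k := by
      have := one_add_mul_le_pow (a := 1 / x) (by linarith [one_div_pos.2 hx0]) k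
      calc x ^ k * (1 + k / x) = x ^ k * (1 + k * (1 / x)) := by ring
        _ ≤ x ^ k * (1 + 1 / x) ^ k := by gcongr
        _ = (x + 1) ^ k := by
          rw [← mul_pow]
          congr 1
          field_simp
    have hk1 : (1 : ℝ) ≤ k := by exact_mod_cast hk
    have h2 : x ^ k / x ≤ (x + 1) ^ k - x ^ k := by
      have : x ^ k * (1 / x) ≤ x ^ k * (k / x) := by gcongr
      have e : x ^ k * (1 / x) = x ^ k / x := by ring
      nlinarith
    have h3 : (x + 1) ^ k ≤ 2 ^ k * x ^ k := by
      rw [← mul_pow]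
      gcongr
      linarith
    have hp : 0 < x ^ k := by positivity
    have hp1 : 0 < (x + 1) ^ k := by positivity
    rw [inv_sub_inv hp.ne' hp1.ne', pow_succ, mul_inv]
    have h4 : (x ^ k)⁻¹ * x⁻¹ * (x ^ k * (x + 1) ^ k) ≤ 2 ^ (k + 1) * ((x + 1) ^ k - x ^ k) := by
      have e : (x ^ k)⁻¹ * x⁻¹ * (x ^ k * (x + 1) ^ k) = (x + 1) ^ k / x := by field_simp
      rw [e]
      calc (x + 1) ^ k / x ≤ 2 ^ k * x ^ k / x := by gcongr
        _ = 2 ^ k * (x ^ k / x) := by ring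
        _ ≤ 2 ^ (k + 1) * (x ^ k / x) := by
          gcongr
          · norm_num
          · omega
        _ ≤ _ := by gcongr
    rw [← mul_div_assoc, le_div_iff₀ (by positivity)]
    exact h4
  refine IsBigO.of_bound (C * 2 ^ (k + 1)) ?_
  filter_upwards [eventually_ge_atTop (max H 1)] with h hh
  have hH0 : H ≤ h := le_trans (le_max_left _ _) hh
  have h10 : 1 ≤ h := le_trans (le_max_right _ _) hh
  set g : ℝ → ℝ := fun x => C * 2 ^ (k + 1) * (x ^ k)⁻¹ with hg
  have hstep : ∀ ℓ : ℕ, |ρ (h + ℓ + 1) - ρ (h + ℓ)| ≤ g (h + ℓ) - g (h + ℓ + 1) := by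
    intro ℓ
    have hl : (0 : ℝ) ≤ ℓ := Nat.cast_nonneg ℓ
    have h1 := hH (h + ℓ) (by linarith)
    have h2 := key (h + ℓ) (by linarith)
    rw [Real.norm_eq_abs, Real.norm_of_nonneg (by positivity)] at h1
    calc _ ≤ _ := h1
      _ ≤ C * (2 ^ (k + 1) * (((h + ℓ) ^ k)⁻¹ - ((h + ℓ + 1) ^ k)⁻¹)) := by gcongr
      _ = _ := by simp only [hg]; ring
  have hshift : Tendsto (fun ℓ : ℕ => h + (ℓ : ℝ)) atTop atTop :=
    tendsto_atTop_add_const_left _ _ tendsto_natCast_atTop_atTop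
  have hglim : Tendsto g atTop (𝓝 0) := by
    have : Tendsto (fun x : ℝ => (x ^ k)⁻¹) atTop (𝓝 0) :=
      tendsto_inv_atTop_zero.comp (tendsto_pow_atTop hk.ne')
    simpa [hg] using this.const_mul (C * 2 ^ (k + 1))
  -- Along h + ℕ the function ρ + g decreases and ρ - g increases, and both tend to 1. Their values
  -- at h therefore enclose 1, which is the bound |ρ(h) - 1| ≤ g(h).
  have hup : Antitone fun ℓ : ℕ => ρ (h + ℓ) + g (h + ℓ) := by
    refine antitone_nat_of_succ_le fun ℓ => ?_
    have := (abs_le.1 (hstep ℓ)).2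
    push_cast
    rw [← add_assoc]
    linarith
  have hdn : Monotone fun ℓ : ℕ => ρ (h + ℓ) - g (h + ℓ) := by
    refine monotone_nat_of_le_succ fun ℓ => ?_
    have := (abs_le.1 (hstep ℓ)).1
    push_cast
    rw [← add_assoc]
    linarith
  have l1 : Tendsto (fun ℓ : ℕ => ρ (h + ℓ) + g (h + ℓ)) atTop (𝓝 1) := by
    simpa using (hlim.comp hshift).add (hglim.comp hshift)
  have l2 : Tendsto (fun ℓ : ℕ => ρ (h + ℓ) - g (h + ℓ)) atTop (𝓝 1) := by
    simpa using (hlim.comp hshift).sub (hglim.comp hshift)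
  have b1 := hup.le_of_tendsto l1 0
  have b2 := hdn.ge_of_tendsto l2 0
  simp only [Nat.cast_zero, add_zero] at b1 b2
  rw [Real.norm_eq_abs, Real.norm_of_nonneg (by positivity), abs_le]
  constructor
  · simp only [hg] at b1; linarith
  · simp only [hg] at b2; linarith

theorem add_const_isBigO (b : ℝ) : (fun h : ℝ => h + b) =O[atTop] fun h : ℝ => h := by
  have h := ((tendsto_add_const_div b).isBigO_one ℝ).mul (isBigO_refl (fun h : ℝ => h) atTop)
  refine h.congr' ?_ ?_
  · filter_upwards [eventually_gt_atTop 0] with x hx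
    field_simp
  · filter_upwards with x
    simp

theorem inv_add_const_isBigO (b : ℝ) :
    (fun h : ℝ => (h + b)⁻¹) =O[atTop] fun h : ℝ => h⁻¹ := by
  have h := (((tendsto_add_const_div b).inv₀ one_ne_zero).isBigO_one ℝ).mul
    (isBigO_refl (fun h : ℝ => h⁻¹) atTop)
  refine h.congr' ?_ ?_
  · filter_upwards [eventually_gt_atTop 0] with x hx
    field_simp
  · filter_upwards with x
    simp

theorem gammaQuot_mul_div_isBigO (e e' e'' : ℝ) :
    (fun h => gammaQuot e h * gammaQuot e' h / gammaQuot e'' h)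
      =O[atTop] fun h : ℝ => h ^ (-(2 * (e + e' - e'') + 2)) := by
  have h := ((gammaQuot_isBigO e).mul (gammaQuot_isBigO e')).mul (inv_gammaQuot_isBigO e'')
  refine h.congr' ?_ ?_
  · filter_upwards with x
    rw [div_eq_mul_inv]
  · filter_upwards [eventually_gt_atTop 0] with x hx
    rw [← Real.rpow_add hx, ← Real.rpow_add hx]
    congr 1
    ring

/-- The ratio of the truncated series to the quotient tends to 1. By `quotCoeff_difference` its
forward differences are O(h^{-2N-1}), so it is 1 + O(h^{-2N}). Order zero is separate because the
summation of differences needs a positive power. -/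
theorem gammaQuot_mul_div_expansion (e e' e'' : ℝ) (N : ℕ) :
    (fun h => gammaQuot e h * gammaQuot e' h / gammaQuot e'' h -
        ∑ j ∈ Finset.range N, quotCoeff e e' e'' j * gammaQuot (e + e' - e'' + j) h)
      =O[atTop] fun h : ℝ => h ^ (-(2 * (e + e' - e'' + N) + 2)) := by
  rcases Nat.eq_zero_or_pos N with rfl | hN
  · simpa using gammaQuot_mul_div_isBigO e e' e''
  set E := e + e' - e'' with hE
  set F : ℝ → ℝ := fun h => gammaQuot e h * gammaQuot e' h / gammaQuot e'' h with hF
  set P : ℝ → ℝ := fun h => ∑ j ∈ Finset.range N, quotCoeff e e' e'' j * gammaQuot (E + j) h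
    with hP
  have hFpos : ∀ᶠ h in atTop, 0 < F h := by
    filter_upwards [eventually_gammaQuot_pos e, eventually_gammaQuot_pos e',
      eventually_gammaQuot_pos e''] with h h1 h2 h3
    simp only [hF]
    positivity
  have hFlim : Tendsto (fun h => F h * h ^ (2 * E + 2)) atTop (𝓝 1) := by
    have := ((tendsto_gammaQuot e).mul (tendsto_gammaQuot e')).div (tendsto_gammaQuot e'')
      one_ne_zero
    rw [mul_one, div_one] at this
    refine this.congr' ?_
    filter_upwards [eventually_gt_atTop 0] with x hx
    simp only [Pi.div_apply, hF]
    have e1 : x ^ (2 * E + 2) = x ^ (2 * e + 2) * x ^ (2 * e' + 2) / x ^ (2 * e'' + 2) := by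
      rw [← Real.rpow_add hx, ← Real.rpow_sub hx]
      congr 1
      rw [hE]; ring
    rw [e1]
    ring
  have hFinv : (fun h => (F h)⁻¹) =O[atTop] fun h : ℝ => h ^ (2 * E + 2) := by
    have h1 := ((hFlim.inv₀ one_ne_zero).isBigO_one ℝ).mul
      (isBigO_refl (fun h : ℝ => h ^ (2 * E + 2)) atTop)
    refine h1.congr' ?_ ?_
    · filter_upwards [eventually_gt_atTop 0] with x hx
      have hp : x ^ (2 * E + 2) ≠ 0 := (Real.rpow_pos_of_pos hx _).ne'
      rw [mul_inv, mul_assoc, inv_mul_cancel₀ hp, mul_one]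
    · filter_upwards with x
      simp
  have hPlim : Tendsto (fun h => P h * h ^ (2 * E + 2)) atTop (𝓝 1) := by
    have : ∀ j ∈ Finset.range N, Tendsto (fun h : ℝ => quotCoeff e e' e'' j * gammaQuot (E + j) h *
        h ^ (2 * E + 2)) atTop (𝓝 (if j = 0 then 1 else 0)) := by
      intro j _
      split_ifs with hj
      · subst hj
        simpa [quotCoeff, poch_zero] using tendsto_gammaQuot E
      · have h1 := (tendsto_gammaQuot (E + j)).const_mul (quotCoeff e e' e'' j)
        have hj0 : 0 < (j : ℝ) := by positivity
        have h2 := h1.mul (tendsto_rpow_neg_atTop (y := 2 * j) (by linarith))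
        rw [mul_zero] at h2
        refine h2.congr' ?_
        filter_upwards [eventually_gt_atTop 0] with x hx
        rw [mul_assoc, mul_assoc, ← Real.rpow_add hx, mul_assoc]
        congr 3
        ring
    have h2 := tendsto_finsetSum _ this
    rw [Finset.sum_ite_eq' (Finset.range N) 0 (fun _ => (1 : ℝ))] at h2
    simp only [Finset.mem_range, hN, if_true] at h2
    refine h2.congr fun x => ?_
    rw [hP, Finset.sum_mul]
  have hρlim : Tendsto (fun h => P h / F h) atTop (𝓝 1) := by
    have := hPlim.div hFlim one_ne_zero
    rw [div_one] at this
    refine this.congr' ?_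
    filter_upwards [eventually_gt_atTop 0] with x hx
    have hp : x ^ (2 * E + 2) ≠ 0 := (Real.rpow_pos_of_pos hx _).ne'
    simp only [Pi.div_apply]
    rw [mul_div_mul_right _ _ hp]
  -- Power counting: the defect has a quadratic prefactor, T_{E+N}/F is of order h^{-2N}, and a
  -- cubic polynomial is divided out, which leaves h^{-2N-1}.
  have hdiff : (fun h => P (h + 1) / F (h + 1) - P h / F h) =O[atTop]
      fun h : ℝ => (h ^ (2 * N + 1))⁻¹ := by
    have e1 : (fun h => P (h + 1) / F (h + 1) - P h / F h) =ᶠ[atTop] fun h =>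
        (N * quotCoeff e e' e'' N) * (2 * h * (h - (E + N) - 1)) * gammaQuot (E + N) h *
          (F h)⁻¹ * ((h - e - 1) * (h - e' - 1) * (h + e'' + 1))⁻¹ := by
      filter_upwards [hFpos, (tendsto_atTop_add_const_right atTop (1 : ℝ) tendsto_id).eventually
        hFpos, eventually_gt_atTop (|e + e' - e''| + N + 2), eventually_gt_atTop (|e| + 1),
        eventually_gt_atTop (|e'| + 1), eventually_gt_atTop (|e''| + 1)]
        with h hF0 hF1 hh he he' he''
      simp only [id] at hF1
      have a1 := abs_le.1 (le_refl |e|)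
      have a2 := abs_le.1 (le_refl |e'|)
      have a3 := abs_le.1 (le_refl |e''|)
      have hB : (h - e - 1) * (h - e' - 1) * (h + e'' + 1) ≠ 0 :=
        mul_ne_zero (mul_ne_zero (by linarith) (by linarith)) (by linarith)
      have hrec : (h + e + 1) * (h + e' + 1) * (h - e'' - 1) * F (h + 1) =
          (h - e - 1) * (h - e' - 1) * (h + e'' + 1) * F h := by
        have n1 : h + e + 1 ≠ 0 := by linarith
        have n2 : h + e' + 1 ≠ 0 := by linarith
        have n3 : h + e'' + 1 ≠ 0 := by linarith
        have n4 : h - e'' - 1 ≠ 0 := by linarith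
        have n5 : gammaQuot e'' h ≠ 0 := (gammaQuot_pos (by linarith) (by linarith)).ne'
        simp only [hF]
        rw [gammaQuot_add_one (e := e) (by linarith) (by linarith),
          gammaQuot_add_one (e := e') (by linarith) (by linarith),
          gammaQuot_add_one (e := e'') (by linarith) (by linarith)]
        field_simp
      have hd := quotCoeff_difference e e' e'' N hh
      rw [← hE] at hd
      change (h + e + 1) * (h + e' + 1) * (h - e'' - 1) * P (h + 1) -
        (h - e - 1) * (h - e' - 1) * (h + e'' + 1) * P h = _ at hd
      generalize P (h + 1) = p1 at *
      generalize P h = p0 at *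
      generalize F (h + 1) = f1 at *
      generalize F h = f0 at *
      generalize (h + e + 1) * (h + e' + 1) * (h - e'' - 1) = A at *
      generalize (h - e - 1) * (h - e' - 1) * (h + e'' + 1) = B at *
      generalize gammaQuot (E + N) h = t at *
      have n0 := hF0.ne'
      have n1 := hF1.ne'
      field_simp
      have hA : A = B * f0 / f1 := by rw [eq_div_iff n1]; exact hrec
      rw [hA] at hd
      field_simp at hd
      linarith
    refine IsBigO.congr' ?_ e1.symm EventuallyEq.rfl
    have h1 := ((isBigO_const_mul_self (N * quotCoeff e e' e'' N) (fun _ : ℝ => (1 : ℝ)) atTop).mul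
      (((isBigO_const_mul_self 2 (fun h : ℝ => h) atTop).mul
        (add_const_isBigO (-(E + N) - 1))))).mul (gammaQuot_isBigO (E + N))
    have h2 := (h1.mul hFinv).mul (((inv_add_const_isBigO (-e - 1)).mul
      (inv_add_const_isBigO (-e' - 1))).mul (inv_add_const_isBigO (e'' + 1)))
    refine h2.congr' ?_ ?_
    · filter_upwards with h
      rw [mul_inv, mul_inv]
      simp only [← add_sub_assoc, ← sub_eq_add_neg, ← add_assoc, mul_one]
    · filter_upwards [eventually_gt_atTop 0] with h hh
      have e2 : h ^ (-(2 * (E + N) + 2)) * h ^ (2 * E + 2) = (h ^ (2 * N))⁻¹ := by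
        rw [← Real.rpow_add hh, ← Real.rpow_natCast, ← Real.rpow_neg hh.le]
        congr 1
        push_cast
        ring
      rw [one_mul, mul_assoc (h * h), e2, pow_succ]
      field_simp
  have hfin := (isBigO_of_forward_difference (k := 2 * N) (by omega) hρlim hdiff).mul
    (gammaQuot_mul_div_isBigO e e' e'')
  refine (hfin.neg_left).congr' ?_ ?_
  · filter_upwards [hFpos] with h hh
    change -((P h / F h - 1) * F h) = F h - P h
    field_simp
    ring
  · filter_upwards [eventually_gt_atTop 0] with h hh
    rw [← Real.rpow_natCast, ← Real.rpow_neg hh.le, ← Real.rpow_add hh]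
    congr 1
    push_cast
    rw [← hE]
    ring

/-! ### Large-weight expansions -/

/-- `f(h) ∼ ∑_{i ∈ I} ∑_m c_i(m) T_{a_i + m}(h)` to all orders, with `T_e = gammaQuot e`. -/
def HasQuotExpansion {ι : Type*} (f : ℝ → ℂ) (I : Finset ι) (a : ι → ℝ) (c : ι → ℕ → ℂ) : Prop :=
  ∀ N : ℕ, ∃ M₀ : ℕ, ∀ M ≥ M₀,
    (fun h : ℝ => f h - ∑ i ∈ I, ∑ m ∈ Finset.range M, c i m * (gammaQuot (a i + m) h : ℂ))
      =O[atTop] fun h : ℝ => (h ^ N)⁻¹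

section

variable {ι κ : Type*} {I : Finset ι} {J : Finset κ}

theorem isBigO_ofReal_left {l : Filter ℝ} {f g : ℝ → ℝ} :
    (fun x => (f x : ℂ)) =O[l] g ↔ f =O[l] g := by
  rw [← isBigO_norm_left]
  simp only [Complex.norm_real]
  exact isBigO_norm_left

/-- The weight is positive for large h and can be divided out, and the reciprocal Gamma constants of
S pass into the coefficients. Only expansions in the ratios T_e remain to be multiplied. -/
theorem hasLargeWeightExpansion_iff {r s : ℝ} {p : ℝ → ℂ} {a : ι → ℝ} {c : ι → ℕ → ℂ} :
    HasLargeWeightExpansion r s p I a c ↔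
      HasQuotExpansion (fun h => p h / (blockWeight r s h : ℂ)) I a (fun i m => c i m *
        (((Real.Gamma (-(a i + m) - r))⁻¹ * (Real.Gamma (-(a i + m) - s))⁻¹ : ℝ) : ℂ)) := by
  have key : ∀ M : ℕ, (fun h : ℝ => p h / (blockWeight r s h : ℂ) - ∑ i ∈ I,
      ∑ m ∈ Finset.range M, c i m *
        (((Real.Gamma (-(a i + m) - r))⁻¹ * (Real.Gamma (-(a i + m) - s))⁻¹ : ℝ) : ℂ) *
        (gammaQuot (a i + m) h : ℂ)) =ᶠ[atTop] fun h => (blockWeight r s h : ℂ)⁻¹ *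
      (p h - ∑ i ∈ I, ∑ m ∈ Finset.range M, c i m * (S r s (a i + m) h : ℂ)) := by
    intro M
    filter_upwards [eventually_blockWeight_pos r s] with h hh
    have hne : (blockWeight r s h : ℂ) ≠ 0 := by exact_mod_cast hh.ne'
    rw [mul_sub, Finset.mul_sum, div_eq_inv_mul]
    congr 1
    refine Finset.sum_congr rfl fun i _ => ?_
    rw [Finset.mul_sum]
    refine Finset.sum_congr rfl fun m _ => ?_
    rw [S_eq_gammaQuot]
    push_cast
    field_simp
  have hW := eventually_blockWeight_pos r s
  unfold HasLargeWeightExpansion HasQuotExpansion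
  refine forall_congr' fun N => exists_congr fun M₀ => forall_congr' fun M => forall_congr' fun _ => ?_
  rw [isBigO_congr (key M) EventuallyEq.rfl]
  constructor
  · intro h
    have h1 : (fun h => (blockWeight r s h : ℂ)⁻¹) =O[atTop] fun h => (blockWeight r s h)⁻¹ := by
      simpa using isBigO_ofReal_left.2 (isBigO_refl (fun h => (blockWeight r s h)⁻¹) atTop)
    refine (h1.mul h).congr' EventuallyEq.rfl ?_
    filter_upwards [hW] with x hx
    change (blockWeight r s x)⁻¹ * (blockWeight r s x * (x ^ N)⁻¹) = _
    rw [inv_mul_cancel_left₀ hx.ne']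
  · intro h
    have h1 := isBigO_ofReal_left.2 (isBigO_refl (fun h => blockWeight r s h) atTop)
    refine (h1.mul h).congr' ?_ EventuallyEq.rfl
    filter_upwards [hW] with x hx
    rw [mul_inv_cancel_left₀ (by exact_mod_cast hx.ne')]

theorem rpow_isBigO_natPow {a : ℝ} {n : ℕ} (h : a ≤ n) :
    (fun x : ℝ => x ^ a) =O[atTop] fun x : ℝ => x ^ n := by
  simpa only [Real.rpow_natCast] using rpow_isBigO_rpow_atTop h

theorem rpow_isBigO_inv_natPow {a : ℝ} {n : ℕ} (h : a ≤ -(n : ℝ)) :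
    (fun x : ℝ => x ^ a) =O[atTop] fun x : ℝ => (x ^ n)⁻¹ := by
  refine (rpow_isBigO_rpow_atTop h).congr' EventuallyEq.rfl ?_
  filter_upwards [eventually_ge_atTop 0] with x hx
  rw [Real.rpow_neg hx, Real.rpow_natCast]

theorem natPow_isBigO_natPow {m n : ℕ} (h : m ≤ n) :
    (fun x : ℝ => x ^ m) =O[atTop] fun x : ℝ => x ^ n := by
  have := rpow_isBigO_rpow_atTop (Nat.cast_le (α := ℝ).2 h)
  simpa only [Real.rpow_natCast] using this

theorem HasQuotExpansion.isBigO {f : ℝ → ℂ} {a : ι → ℝ} {c : ι → ℕ → ℂ}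
    (h : HasQuotExpansion f I a c) : ∃ P : ℕ, f =O[atTop] fun h : ℝ => h ^ P := by
  obtain ⟨M, hM⟩ := h 0
  have h1 := hM M le_rfl
  have h2 : ∃ P : ℕ, ∀ i ∈ I, -(2 * a i + 2) ≤ (P : ℝ) := by
    obtain ⟨B, hB⟩ := (I.image fun i => -(2 * a i + 2)).bddAbove
    obtain ⟨P, hP⟩ := exists_nat_ge B
    exact ⟨P, fun i hi => (hB (by simpa using ⟨i, hi, rfl⟩)).trans hP⟩
  obtain ⟨P, hP⟩ := h2
  refine ⟨P, ?_⟩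
  have h3 : (fun h : ℝ => ∑ i ∈ I, ∑ m ∈ Finset.range M, c i m * (gammaQuot (a i + m) h : ℂ))
      =O[atTop] fun h : ℝ => h ^ P := by
    refine IsBigO.fun_sum fun i hi => IsBigO.fun_sum fun m _ => IsBigO.const_mul_left ?_ _
    refine isBigO_ofReal_left.2 ((gammaQuot_isBigO _).trans (rpow_isBigO_natPow ?_))
    have := hP i hi
    have hm : (0 : ℝ) ≤ m := Nat.cast_nonneg m
    linarith
  have h4 : (fun h : ℝ => (h ^ 0)⁻¹) =O[atTop] fun h : ℝ => h ^ P := by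
    simpa using natPow_isBigO_natPow (Nat.zero_le P)
  simpa using (h1.trans h4).add h3

theorem HasQuotExpansion.congr {f g : ℝ → ℂ} {a : ι → ℝ} {c : ι → ℕ → ℂ}
    (h : HasQuotExpansion f I a c)
    (hfg : ∀ N : ℕ, (fun x => g x - f x) =O[atTop] fun h : ℝ => (h ^ N)⁻¹) :
    HasQuotExpansion g I a c := by
  intro N
  obtain ⟨M₀, h0⟩ := h N
  refine ⟨M₀, fun M hM => ?_⟩
  refine ((hfg N).add (h0 M hM)).congr_left fun x => ?_
  ring

/-- Diagonal summation with L = m + k + j, used twice. For m + k ≥ M truncated subtraction makes the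
inner range empty, so k may run over the full range. -/
theorem sum_range_triple {A : Type*} [AddCommMonoid A] (G : ℕ → ℕ → ℕ → A) (M : ℕ) :
    ∑ L ∈ Finset.range M, ∑ m ∈ Finset.range (L + 1), ∑ k ∈ Finset.range (L - m + 1),
        G m k (L - m - k) =
      ∑ m ∈ Finset.range M, ∑ k ∈ Finset.range M, ∑ j ∈ Finset.range (M - m - k), G m k j := by
  rw [Finset.sum_range_diag_flip M fun m n => ∑ k ∈ Finset.range (n + 1), G m k (n - k)]
  refine Finset.sum_congr rfl fun m _ => ?_
  rw [Finset.sum_range_diag_flip (M - m) (G m)]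
  refine Finset.sum_subset (Finset.range_mono (Nat.sub_le _ _)) fun k _ hk => ?_
  rw [Finset.mem_range, not_lt] at hk
  rw [Nat.sub_eq_zero_of_le hk]
  simp

/-- Both truncations are multiplied term by term, and the term (m,k) is expanded only to j < M-m-k,
so that every discarded contribution has total order at least M. -/
theorem HasQuotExpansion.mul_div {f g : ℝ → ℂ} {a : ι → ℝ} {c : ι → ℕ → ℂ} {b : κ → ℝ}
    {d : κ → ℕ → ℂ} (hf : HasQuotExpansion f I a c) (hg : HasQuotExpansion g J b d) (e : ℝ) :
    HasQuotExpansion (fun h => f h * g h / (gammaQuot e h : ℂ)) (I ×ˢ J)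
      (fun x => a x.1 + b x.2 - e)
      (fun x L => ∑ m ∈ Finset.range (L + 1), ∑ k ∈ Finset.range (L - m + 1),
        c x.1 m * d x.2 k * (quotCoeff (a x.1 + m) (b x.2 + k) e (L - m - k) : ℂ)) := by
  intro N
  obtain ⟨Pf, hPf⟩ := hf.isBigO
  obtain ⟨Pg, hPg⟩ := hg.isBigO
  obtain ⟨Q, hQ⟩ := exists_nat_ge (2 * e + 2)
  have hT : (fun h => (gammaQuot e h : ℂ)⁻¹) =O[atTop] fun h : ℝ => h ^ Q := by
    have := (inv_gammaQuot_isBigO e).trans (rpow_isBigO_natPow hQ)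
    rw [← isBigO_ofReal_left] at this
    simpa using this
  -- The surplus orders pay for the polynomial growth of f, of g and of 1/T_e in the remainder (fg -
  -- f_M g_M)/T_e.
  obtain ⟨Mf, hMf⟩ := hf (N + Pf + Pg + Q)
  obtain ⟨Mg, hMg⟩ := hg (N + Pf + Pg + Q)
  obtain ⟨M1, hM1⟩ : ∃ M1 : ℕ, ∀ x ∈ I ×ˢ J, (N : ℝ) - (2 * (a x.1 + b x.2 - e) + 2) ≤ 2 * M1 := by
    obtain ⟨B, hB⟩ :=
      ((I ×ˢ J).image fun x => (N : ℝ) - (2 * (a x.1 + b x.2 - e) + 2)).bddAbove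
    obtain ⟨P, hP⟩ := exists_nat_ge B
    refine ⟨P, fun x hx => ?_⟩
    have h1 := hB (Finset.mem_coe.2 (Finset.mem_image.2 ⟨x, hx, rfl⟩))
    have : (0 : ℝ) ≤ P := Nat.cast_nonneg P
    linarith
  refine ⟨max (max Mf Mg) M1, fun M hM => ?_⟩
  have hf' := hMf M (by omega)
  have hg' := hMg M (by omega)
  have hM1' : (M1 : ℝ) ≤ M := by exact_mod_cast (by omega : M1 ≤ M)
  set fM : ℝ → ℂ := fun h => ∑ i ∈ I, ∑ m ∈ Finset.range M, c i m * (gammaQuot (a i + m) h : ℂ)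
    with hfM
  set gM : ℝ → ℂ := fun h => ∑ i ∈ J, ∑ m ∈ Finset.range M, d i m * (gammaQuot (b i + m) h : ℂ)
    with hgM
  have hrem : (fun h => (f h * g h - fM h * gM h) * (gammaQuot e h : ℂ)⁻¹) =O[atTop]
      fun h : ℝ => (h ^ N)⁻¹ := by
    have hsmall : (fun h : ℝ => (h ^ (N + Pf + Pg + Q))⁻¹) =O[atTop] fun _ : ℝ => (1 : ℝ) := by
      refine IsBigO.of_bound 1 ?_
      filter_upwards [eventually_ge_atTop 1] with x hx
      rw [Real.norm_of_nonneg (by positivity), norm_one, one_mul]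
      exact inv_le_one_of_one_le₀ (one_le_pow₀ hx)
    have p0 : (fun _ : ℝ => (1 : ℝ)) =O[atTop] fun h : ℝ => h ^ (Pf + Pg) := by
      simpa using natPow_isBigO_natPow (Nat.zero_le (Pf + Pg))
    have b1 := (hPf.trans (natPow_isBigO_natPow (Nat.le_add_right Pf Pg))).mul hg'
    have b2 := (hPg.trans (natPow_isBigO_natPow (Nat.le_add_left Pg Pf))).mul hf'
    have b3 := (hf'.trans (hsmall.trans p0)).mul hg'
    have b4 := ((b1.add b2).sub b3).mul hT
    refine b4.congr' ?_ ?_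
    · filter_upwards with x
      change (f x * (g x - gM x) + g x * (f x - fM x) - (f x - fM x) * (g x - gM x)) * _ = _
      ring
    · filter_upwards [eventually_gt_atTop 0] with x hx
      rw [show N + Pf + Pg + Q = N + (Pf + Pg) + Q by ring, pow_add _ _ Q, pow_add _ N]
      field_simp
  have hmain : (fun h => ∑ x ∈ I ×ˢ J, ∑ m ∈ Finset.range M, ∑ k ∈ Finset.range M,
      c x.1 m * d x.2 k * ((gammaQuot (a x.1 + m) h * gammaQuot (b x.2 + k) h / gammaQuot e h -
        ∑ j ∈ Finset.range (M - m - k), quotCoeff (a x.1 + m) (b x.2 + k) e j *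
          gammaQuot (a x.1 + m + (b x.2 + k) - e + j) h : ℝ) : ℂ)) =O[atTop]
      fun h : ℝ => (h ^ N)⁻¹ := by
    refine IsBigO.fun_sum fun x hx => IsBigO.fun_sum fun m _ => IsBigO.fun_sum fun k _ =>
      IsBigO.const_mul_left ?_ _
    refine isBigO_ofReal_left.2 ((gammaQuot_mul_div_expansion _ _ _ _).trans
      (rpow_isBigO_inv_natPow ?_))
    have h1 := hM1 x hx
    have h2 : (M : ℝ) ≤ m + k + ((M - m - k : ℕ) : ℝ) := by
      exact_mod_cast (by omega : M ≤ m + k + (M - m - k))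
    linarith
  refine (hrem.add hmain).congr_left fun h => ?_
  have e1 : ∑ x ∈ I ×ˢ J, ∑ L ∈ Finset.range M, (∑ m ∈ Finset.range (L + 1),
      ∑ k ∈ Finset.range (L - m + 1), c x.1 m * d x.2 k *
        (quotCoeff (a x.1 + m) (b x.2 + k) e (L - m - k) : ℂ)) *
        (gammaQuot (a x.1 + b x.2 - e + L) h : ℂ) =
      ∑ x ∈ I ×ˢ J, ∑ m ∈ Finset.range M, ∑ k ∈ Finset.range M,
        ∑ j ∈ Finset.range (M - m - k), c x.1 m * d x.2 k *
        (quotCoeff (a x.1 + m) (b x.2 + k) e j : ℂ) *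
        (gammaQuot (a x.1 + m + (b x.2 + k) - e + j) h : ℂ) := by
    refine Finset.sum_congr rfl fun x _ => ?_
    rw [← sum_range_triple]
    refine Finset.sum_congr rfl fun L _ => ?_
    rw [Finset.sum_mul]
    refine Finset.sum_congr rfl fun m hm => ?_
    rw [Finset.sum_mul]
    refine Finset.sum_congr rfl fun k hk => ?_
    have h1 : m + k + (L - m - k) = L := by
      rw [Finset.mem_range] at hm hk
      omega
    have h2 : (m : ℝ) + k + ((L - m - k : ℕ) : ℝ) = L := by exact_mod_cast h1
    congr 3
    linarith
  have e2 : fM h * gM h * (gammaQuot e h : ℂ)⁻¹ = ∑ x ∈ I ×ˢ J, ∑ m ∈ Finset.range M,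
      ∑ k ∈ Finset.range M, c x.1 m * d x.2 k *
      ((gammaQuot (a x.1 + m) h * gammaQuot (b x.2 + k) h / gammaQuot e h : ℝ) : ℂ) := by
    rw [hfM, hgM, Finset.sum_mul_sum, ← Finset.sum_product', Finset.sum_mul]
    refine Finset.sum_congr rfl fun x _ => ?_
    rw [Finset.sum_mul_sum, Finset.sum_mul]
    refine Finset.sum_congr rfl fun m _ => ?_
    rw [Finset.sum_mul]
    refine Finset.sum_congr rfl fun k _ => ?_
    push_cast
    rw [div_eq_mul_inv]
    ring
  beta_reduce
  rw [e1, sub_mul, e2, div_eq_mul_inv, sub_add, sub_right_inj]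
  rw [← Finset.sum_sub_distrib]
  refine Finset.sum_congr rfl fun x _ => ?_
  rw [← Finset.sum_sub_distrib]
  refine Finset.sum_congr rfl fun m _ => ?_
  rw [← Finset.sum_sub_distrib]
  refine Finset.sum_congr rfl fun k _ => ?_
  rw [← mul_sub, ← Complex.ofReal_sub, sub_sub_cancel, Complex.ofReal_sum, Finset.mul_sum]
  refine Finset.sum_congr rfl fun j _ => ?_
  push_cast
  ring

/-- Since V/T_e tends to w ≠ 0 faster than any power, replacing wT_e by V in a denominator changes a
polynomially bounded quotient only beyond all orders. -/
theorem HasQuotExpansion.mul_div_of_isBigO {f g V : ℝ → ℂ} {a : ι → ℝ} {c : ι → ℕ → ℂ} {b : κ → ℝ}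
    {d : κ → ℕ → ℂ} (hf : HasQuotExpansion f I a c) (hg : HasQuotExpansion g J b d) (e : ℝ)
    {w : ℂ} (hw : w ≠ 0)
    (hV : ∀ N : ℕ, (fun h => V h - w * (gammaQuot e h : ℂ)) =O[atTop] fun h : ℝ => (h ^ N)⁻¹) :
    HasQuotExpansion (fun h => f h * g h / V h) (I ×ˢ J)
      (fun x => a x.1 + b x.2 - e)
      (fun x L => w⁻¹ * ∑ m ∈ Finset.range (L + 1), ∑ k ∈ Finset.range (L - m + 1),
        c x.1 m * d x.2 k * (quotCoeff (a x.1 + m) (b x.2 + k) e (L - m - k) : ℂ)) := by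
  have h0 := hf.mul_div hg e
  have h1 : HasQuotExpansion (fun h => w⁻¹ * (f h * g h / (gammaQuot e h : ℂ))) (I ×ˢ J)
      (fun x => a x.1 + b x.2 - e)
      (fun x L => w⁻¹ * ∑ m ∈ Finset.range (L + 1), ∑ k ∈ Finset.range (L - m + 1),
        c x.1 m * d x.2 k * (quotCoeff (a x.1 + m) (b x.2 + k) e (L - m - k) : ℂ)) := by
    intro N
    obtain ⟨M₀, hM₀⟩ := h0 N
    refine ⟨M₀, fun M hM => ((hM₀ M hM).const_mul_left w⁻¹).congr_left fun h => ?_⟩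
    rw [mul_sub, Finset.mul_sum]
    congr 1
    refine Finset.sum_congr rfl fun x _ => ?_
    rw [Finset.mul_sum]
    refine Finset.sum_congr rfl fun m _ => ?_
    rw [mul_assoc]
  refine h1.congr fun N => ?_
  obtain ⟨P, hP⟩ := h0.isBigO
  obtain ⟨Q, hQ⟩ := exists_nat_ge (2 * e + 2)
  have hT : (fun h => (gammaQuot e h : ℂ)⁻¹) =O[atTop] fun h : ℝ => h ^ Q := by
    have := (inv_gammaQuot_isBigO e).trans (rpow_isBigO_natPow hQ)
    rw [← isBigO_ofReal_left] at this
    simpa using this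
  have hq : ∀ N, (fun h => V h * (gammaQuot e h : ℂ)⁻¹ - w) =O[atTop]
      fun h : ℝ => (h ^ N)⁻¹ := by
    intro N
    refine ((hV (N + Q)).mul hT).congr' ?_ ?_
    · filter_upwards [eventually_gammaQuot_pos e] with x hx
      have : (gammaQuot e x : ℂ) ≠ 0 := by exact_mod_cast hx.ne'
      field_simp
    · filter_upwards [eventually_gt_atTop 0] with x hx
      rw [pow_add]
      field_simp
  have hlim : Tendsto (fun h => V h * (gammaQuot e h : ℂ)⁻¹) atTop (𝓝 w) := by
    have h2 : Tendsto (fun h : ℝ => (h ^ 1)⁻¹) atTop (𝓝 0) :=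
      tendsto_inv_atTop_zero.comp (tendsto_pow_atTop one_ne_zero)
    have := ((hq 1).trans_tendsto h2).add_const w
    simpa using this
  have hinv := (hlim.inv₀ hw).isBigO_one ℝ
  have hb := ((hP.mul hinv).mul (hq (N + P))).const_mul_left (-w⁻¹)
  refine hb.congr' ?_ ?_
  · filter_upwards [eventually_gammaQuot_pos e, hlim.eventually_ne hw] with x hx hne
    have h2 : (gammaQuot e x : ℂ) ≠ 0 := by exact_mod_cast hx.ne'
    have h3 : V x ≠ 0 := fun h => hne (by rw [h, zero_mul])
    field_simp
    ring
  · filter_upwards [eventually_gt_atTop 0] with x hx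
    rw [pow_add]
    field_simp

end

/-! ### The product of two exchange series and the large-weight identity. -/

/-- Reciprocal Gamma functions at arguments lowered by m or k become signed Pochhammers. Together
with those of the block coefficients and of `quotCoeff` they are, term by term, the Pochhammers of
`prodCoeff` for the crossed box. -/
theorem sum_largeWeight_coeff (w : Box ℝ) (M : ℕ) :
    ∑ m ∈ Finset.range (M + 1), ∑ k ∈ Finset.range (M - m + 1),
      (blockCoeff (w.e₁ - w.d) (w.b - w.e₂) w.a m *
        ((Real.Gamma (-(w.a - w.b - w.e₁ + m) - (w.b - w.d)))⁻¹ *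
          (Real.Gamma (-(w.a - w.b - w.e₁ + m) - (w.e₁ - w.e₂)))⁻¹)) *
      (blockCoeff (w.e₃ - w.b) (w.d - w.e₄) w.c k *
        ((Real.Gamma (-(w.c - w.d - w.e₃ + k) - (w.d - w.b)))⁻¹ *
          (Real.Gamma (-(w.c - w.d - w.e₃ + k) - (w.e₃ - w.e₄)))⁻¹)) *
      quotCoeff (w.a - w.b - w.e₁ + m) (w.c - w.d - w.e₃ + k) (-w.b - w.d) (M - m - k) =
    ((Real.Gamma (w.e₁ + w.d - w.a))⁻¹ * (Real.Gamma (w.b + w.e₂ - w.a))⁻¹ *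
      (Real.Gamma (w.e₃ + w.b - w.c))⁻¹ * (Real.Gamma (w.d + w.e₄ - w.c))⁻¹) *
      boxProd w.cross M := by
  unfold boxProd prodCoeff Box.cross
  simp only [Finset.mul_sum]
  refine Finset.sum_congr rfl fun m hm => Finset.sum_congr rfl fun k hk => ?_
  rw [Finset.mem_range] at hm hk
  obtain ⟨j, rfl⟩ : ∃ j, M = m + k + j := ⟨M - m - k, by omega⟩
  rw [show m + k + j - m - k = j by omega, show m + k + j - k = m + j by omega,
    show m + k + j - m = k + j by omega]
  have g1 := inv_Gamma_sub_nat (w.e₁ + w.d - w.a) m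
  have g2 := inv_Gamma_sub_nat (w.b + w.e₂ - w.a) m
  have g3 := inv_Gamma_sub_nat (w.e₃ + w.b - w.c) k
  have g4 := inv_Gamma_sub_nat (w.d + w.e₄ - w.c) k
  rw [show -(w.a - w.b - w.e₁ + m) - (w.b - w.d) = w.e₁ + w.d - w.a - m by ring, g1,
    show -(w.a - w.b - w.e₁ + m) - (w.e₁ - w.e₂) = w.b + w.e₂ - w.a - m by ring, g2,
    show -(w.c - w.d - w.e₃ + k) - (w.d - w.b) = w.e₃ + w.b - w.c - k by ring, g3,
    show -(w.c - w.d - w.e₃ + k) - (w.e₃ - w.e₄) = w.d + w.e₄ - w.c - k by ring, g4]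
  unfold blockCoeff quotCoeff
  rw [show w.a - w.b - w.e₁ + m - (-w.b - w.d) = w.d + w.a - w.e₁ + m by ring,
    show w.c - w.d - w.e₃ + k - (-w.b - w.d) = w.b + w.c - w.e₃ + k by ring,
    show w.a - (w.e₁ - w.d) = w.d + w.a - w.e₁ by ring,
    show w.a - (w.b - w.e₂) = w.a + w.e₂ - w.b by ring,
    show w.c - (w.e₃ - w.b) = w.b + w.c - w.e₃ by ring,
    show w.c - (w.d - w.e₄) = w.c + w.e₄ - w.d by ring,
    show 1 - (w.e₁ + w.d - w.a) = w.a - w.d - w.e₁ + 1 by ring,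
    show 1 - (w.b + w.e₂ - w.a) = w.a - w.b - w.e₂ + 1 by ring,
    show 1 - (w.e₃ + w.b - w.c) = w.c - w.b - w.e₃ + 1 by ring,
    show 1 - (w.d + w.e₄ - w.c) = w.c - w.d - w.e₄ + 1 by ring,
    show w.a - w.b - w.e₁ + m + (w.c - w.d - w.e₃ + k) + 2 =
      w.a - w.d - w.e₁ + 1 + (w.c - w.b - w.e₃ + 1) + m + k by ring,
    poch_add (w.d + w.a - w.e₁) m j, poch_add (w.b + w.c - w.e₃) k j, pow_add, pow_add]
  have s1 : ((-1 : ℝ) ^ m) * (-1) ^ m = 1 := by rw [← mul_pow]; simp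
  have s2 : ((-1 : ℝ) ^ k) * (-1) ^ k = 1 := by rw [← mul_pow]; simp
  simp only [div_eq_mul_inv, mul_inv]
  generalize ((-1 : ℝ) ^ m) = x at *
  generalize ((-1 : ℝ) ^ k) = y at *
  have s3 : x ^ 3 = x := by rw [pow_succ, pow_two, s1, one_mul]
  have s4 : y ^ 3 = y := by rw [pow_succ, pow_two, s2, one_mul]
  ring_nf
  simp only [s3, s4]

/-- The product of the large-weight series of two exchanges, divided by that of the identity. -/
theorem hasQuotExpansion_box {ι κ : Type*} {I : Finset ι} {J : Finset κ} (w : Box ℝ)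
    (hb : NotPole (2 * w.b)) (hd : NotPole (2 * w.d)) {xa : ι → ℝ} {xc : κ → ℝ} {fa : ι → ℂ}
    {fc : κ → ℂ} {L R W : ℝ → ℂ} {w₀ : ℂ} (hw₀ : w₀ ≠ 0)
    (hL : HasLargeWeightExpansion (w.b - w.d) (w.e₁ - w.e₂) L I (fun i => xa i - w.b - w.e₁)
      (fun i m => fa i * (blockCoeff (w.e₁ - w.d) (w.b - w.e₂) (xa i) m : ℂ)))
    (hR : HasLargeWeightExpansion (w.d - w.b) (w.e₃ - w.e₄) R J (fun i => xc i - w.d - w.e₃)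
      (fun i m => fc i * (blockCoeff (w.e₃ - w.b) (w.d - w.e₄) (xc i) m : ℂ)))
    (hW : HasLargeWeightExpansion (w.b - w.d) (w.d - w.b) W (Finset.univ : Finset Unit)
      (fun _ => -w.b - w.d) (fun _ m => if m = 0 then w₀ else 0)) :
    HasQuotExpansion (fun h => L h * R h / W h / (blockWeight (w.e₁ - w.e₂) (w.e₃ - w.e₄) h : ℂ))
      (I ×ˢ J) (fun x => xa x.1 + xc x.2 - w.e₁ - w.e₃)
      (fun x M => fa x.1 * fc x.2 / w₀ *
        ((boxConst (w.withAC (xa x.1) (xc x.2)).cross *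
          boxProd (w.withAC (xa x.1) (xc x.2)).cross M : ℝ) : ℂ)) := by
  rw [hasLargeWeightExpansion_iff] at hL hR hW
  -- The constant in S_{-b-d}: dividing by the series of the identity produces the factors Γ(2b)
  -- Γ(2d) of `boxConst` for the crossed box.
  set g₀ : ℝ := (Real.Gamma (2 * w.d))⁻¹ * (Real.Gamma (2 * w.b))⁻¹ with hg₀
  have hg₀' : (g₀ : ℂ) ≠ 0 := by
    exact_mod_cast mul_ne_zero (inv_ne_zero hd.Gamma_ne_zero) (inv_ne_zero hb.Gamma_ne_zero)
  have hV : ∀ N : ℕ, (fun h => W h / (blockWeight (w.b - w.d) (w.d - w.b) h : ℂ) -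
      (w₀ * g₀) * (gammaQuot (-w.b - w.d) h : ℂ)) =O[atTop] fun h : ℝ => (h ^ N)⁻¹ := by
    intro N
    obtain ⟨M₀, hM⟩ := hW N
    refine (hM (M₀ + 1) (by omega)).congr_left fun h => ?_
    simp only [Finset.univ_unique, Finset.sum_singleton, Finset.sum_range_succ', ite_mul, zero_mul,
      Nat.add_eq_zero_iff, one_ne_zero, and_false, if_false, Finset.sum_const_zero, if_true,
      Nat.cast_zero, add_zero, zero_add, hg₀]
    rw [show -(-w.b - w.d) - (w.b - w.d) = 2 * w.d by ring,
      show -(-w.b - w.d) - (w.d - w.b) = 2 * w.b by ring]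
  have h1 := hL.mul_div_of_isBigO hR (-w.b - w.d) (mul_ne_zero hw₀ hg₀') hV
  have h2 := h1.congr (g := fun h => L h * R h / W h /
      (blockWeight (w.e₁ - w.e₂) (w.e₃ - w.e₄) h : ℂ)) fun N => by
    refine (isBigO_zero _ _).congr' ?_ EventuallyEq.rfl
    filter_upwards [eventually_blockWeight_pos (w.b - w.d) (w.d - w.b),
      eventually_blockWeight_pos (w.e₁ - w.e₂) (w.e₃ - w.e₄),
      eventually_blockWeight_pos (w.b - w.d) (w.e₁ - w.e₂),
      eventually_blockWeight_pos (w.d - w.b) (w.e₃ - w.e₄)] with h a1 a2 a3 a4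
    -- The weights of the two exchanges and of the identity recombine exactly into the weight of the
    -- external block, since each is a product of one Gamma function per superscript.
    have e : blockWeight (w.b - w.d) (w.e₁ - w.e₂) h * blockWeight (w.d - w.b) (w.e₃ - w.e₄) h =
        blockWeight (w.b - w.d) (w.d - w.b) h * blockWeight (w.e₁ - w.e₂) (w.e₃ - w.e₄) h := by
      unfold blockWeight
      ring
    have e' : (blockWeight (w.b - w.d) (w.e₁ - w.e₂) h : ℂ) *
        (blockWeight (w.d - w.b) (w.e₃ - w.e₄) h : ℂ) =
        (blockWeight (w.b - w.d) (w.d - w.b) h : ℂ) *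
        (blockWeight (w.e₁ - w.e₂) (w.e₃ - w.e₄) h : ℂ) := by exact_mod_cast e
    have b1 : (blockWeight (w.b - w.d) (w.d - w.b) h : ℂ) ≠ 0 := by exact_mod_cast a1.ne'
    have b2 : (blockWeight (w.e₁ - w.e₂) (w.e₃ - w.e₄) h : ℂ) ≠ 0 := by exact_mod_cast a2.ne'
    rw [div_mul_div_comm, e', eq_comm, sub_eq_zero]
    rcases eq_or_ne (W h) 0 with h0 | h0
    · simp [h0]
    · field_simp
  convert h2 using 1
  · funext x
    ring
  · funext x M
    have key := sum_largeWeight_coeff (w.withAC (xa x.1) (xc x.2)) M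
    simp only [Box.withAC] at key
    have e : ∀ m k : ℕ, fa x.1 * (blockCoeff (w.e₁ - w.d) (w.b - w.e₂) (xa x.1) m : ℂ) *
        (((Real.Gamma (-(xa x.1 - w.b - w.e₁ + m) - (w.b - w.d)))⁻¹ *
          (Real.Gamma (-(xa x.1 - w.b - w.e₁ + m) - (w.e₁ - w.e₂)))⁻¹ : ℝ) : ℂ) *
        (fc x.2 * (blockCoeff (w.e₃ - w.b) (w.d - w.e₄) (xc x.2) k : ℂ) *
        (((Real.Gamma (-(xc x.2 - w.d - w.e₃ + k) - (w.d - w.b)))⁻¹ *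
          (Real.Gamma (-(xc x.2 - w.d - w.e₃ + k) - (w.e₃ - w.e₄)))⁻¹ : ℝ) : ℂ)) *
        (quotCoeff (xa x.1 - w.b - w.e₁ + m) (xc x.2 - w.d - w.e₃ + k) (-w.b - w.d)
          (M - m - k) : ℂ) = fa x.1 * fc x.2 *
      (((blockCoeff (w.e₁ - w.d) (w.b - w.e₂) (xa x.1) m *
        ((Real.Gamma (-(xa x.1 - w.b - w.e₁ + m) - (w.b - w.d)))⁻¹ *
          (Real.Gamma (-(xa x.1 - w.b - w.e₁ + m) - (w.e₁ - w.e₂)))⁻¹)) *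
      (blockCoeff (w.e₃ - w.b) (w.d - w.e₄) (xc x.2) k *
        ((Real.Gamma (-(xc x.2 - w.d - w.e₃ + k) - (w.d - w.b)))⁻¹ *
          (Real.Gamma (-(xc x.2 - w.d - w.e₃ + k) - (w.e₃ - w.e₄)))⁻¹)) *
      quotCoeff (xa x.1 - w.b - w.e₁ + m) (xc x.2 - w.d - w.e₃ + k) (-w.b - w.d)
        (M - m - k) : ℝ) : ℂ) := by
      intro m k
      push_cast
      ring
    simp only [e, ← Finset.mul_sum, ← Complex.ofReal_sum]
    rw [key]
    have gb := hb.Gamma_ne_zero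
    have gd := hd.Gamma_ne_zero
    have e2 : boxConst (w.withAC (xa x.1) (xc x.2)).cross * boxProd (w.withAC (xa x.1) (xc x.2)).cross M =
        g₀⁻¹ * ((Real.Gamma (w.e₁ + w.d - xa x.1))⁻¹ * (Real.Gamma (w.b + w.e₂ - xa x.1))⁻¹ *
      (Real.Gamma (w.e₃ + w.b - xc x.2))⁻¹ * (Real.Gamma (w.d + w.e₄ - xc x.2))⁻¹ *
      boxProd (w.withAC (xa x.1) (xc x.2)).cross M) := by
      simp only [boxConst, betaConst, Box.cross, Box.withAC, hg₀, mul_inv, inv_inv]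
      rw [add_comm w.e₁, add_comm w.e₃]
      ring
    rw [e2, Complex.ofReal_mul (g₀⁻¹), mul_inv w₀, Complex.ofReal_inv]
    simp only [Box.withAC]
    ring

theorem withAC_self {α : Type*} (B : Box α) : B.withAC B.a B.c = B := rfl

/-- The large-weight identity. -/
theorem hasLargeWeightExpansion_gamma {w : Box ℝ} (hw : Admissible w.cross)
    (h0 : mult w.cross = 0) {A C : ℝ → ℂ}
    (hA : HasLargeWeightExpansion (w.b - w.d) (w.e₁ - w.e₂) A (Finset.univ : Finset Unit)
      (fun _ => w.a - w.b - w.e₁) (fun _ m => (blockCoeff (w.e₁ - w.d) (w.b - w.e₂) w.a m : ℂ)))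
    (hC : HasLargeWeightExpansion (w.d - w.b) (w.e₃ - w.e₄) C (Finset.univ : Finset Unit)
      (fun _ => w.c - w.d - w.e₃) (fun _ m => (blockCoeff (w.e₃ - w.b) (w.d - w.e₄) w.c m : ℂ))) :
    HasLargeWeightExpansion (w.e₁ - w.e₂) (w.e₃ - w.e₄)
      (fun h => A h * C h / (S (w.b - w.d) (w.d - w.b) (-w.b - w.d) h : ℂ))
      (Finset.univ : Finset Unit) (fun _ => w.a + w.c - w.e₁ - w.e₃)
      (fun _ m => (gamma w.cross m : ℂ)) := by
  have hW : HasLargeWeightExpansion (w.b - w.d) (w.d - w.b)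
      (fun h => (S (w.b - w.d) (w.d - w.b) (-w.b - w.d) h : ℂ)) (Finset.univ : Finset Unit)
      (fun _ => -w.b - w.d) (fun _ m => if m = 0 then 1 else 0) := by
    intro N
    refine ⟨1, fun M hM => ?_⟩
    obtain ⟨M, rfl⟩ : ∃ k, M = k + 1 := ⟨M - 1, by omega⟩
    refine (isBigO_zero _ _).congr_left fun h => ?_
    simp
  have h1 := hasQuotExpansion_box (I := Finset.univ) (J := Finset.univ) w hw.a hw.c
    (xa := fun _ => w.a) (xc := fun _ => w.c) (fa := fun _ => 1) (fc := fun _ => 1) one_ne_zero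
    (by simpa only [one_mul] using hA) (by simpa only [one_mul] using hC) hW
  have hne1 : ∀ k : ℤ, w.e₃ + w.e₂ - w.a - w.c ≠ k := by
    intro k hk
    rcases hw.res12 with h | h
    · simp only [mult, Box.cross] at h0 h
      simp [h] at h0
    · exact h (-k) (by simp only [Box.cross]; push_cast; linarith)
  have hne2 : ∀ k : ℤ, w.e₁ + w.e₄ - w.c - w.a ≠ k := by
    intro k hk
    rcases hw.res34 with h | h
    · simp only [mult, Box.cross] at h0 h
      simp [h] at h0
    · exact h (-k) (by simp only [Box.cross]; push_cast; linarith)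
  -- Without degeneracies the factors Γ(σ-m) of γ are nonzero. They cancel the reciprocal Gamma
  -- constants of S, which leaves `boxConst` times `boxProd`.
  have hG : ∀ {x : ℝ}, (∀ k : ℤ, x ≠ k) → ∀ m : ℕ, Real.Gamma (x - m) ≠ 0 := by
    intro x hx m
    refine Real.Gamma_ne_zero fun k hk => hx (m - k) ?_
    push_cast
    linarith
  rw [hasLargeWeightExpansion_iff]
  intro N
  obtain ⟨M₀, hM⟩ := h1 N
  refine ⟨M₀, fun M hM' => (hM M hM').congr_left fun h => ?_⟩
  simp only [Finset.univ_unique, Finset.singleton_product_singleton, Finset.sum_singleton]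
  congr 1
  refine Finset.sum_congr rfl fun m _ => ?_
  rw [gamma_eq_gammaLead h0, gammaLead_eq hw]
  simp only [withAC_self]
  have e1 := gammaShift_eq (σ := w.cross.e₁ + w.cross.e₂ - w.cross.b - w.cross.d) hne1 m
  have e2 := gammaShift_eq (σ := w.cross.e₃ + w.cross.e₄ - w.cross.d - w.cross.b) hne2 m
  rw [e1, e2]
  simp only [Box.cross]
  have n1 := hG hne1 m
  have n2 := hG hne2 m
  rw [show -(w.a + w.c - w.e₁ - w.e₃ + m) - (w.e₁ - w.e₂) = w.e₃ + w.e₂ - w.a - w.c - m by ring,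
    show -(w.a + w.c - w.e₁ - w.e₃ + m) - (w.e₃ - w.e₄) = w.e₁ + w.e₄ - w.c - w.a - m by ring]
  rw [one_mul, div_one, one_mul]
  congr 1
  rw [← Complex.ofReal_mul]
  congr 1
  field_simp

/-! ### Locally uniformly summable families on the half line -/

/-- The family `f` is summable, with a uniform bound on compact subsets of the open half line. -/
def LocSummable {E : Type*} [NormedAddCommGroup E] (f : ℕ → ℝ → E) : Prop :=
  ∀ δ > 0, ∃ v : ℕ → ℝ, Summable v ∧ ∀ n, ∀ y ∈ Set.Ioo δ δ⁻¹, ‖f n y‖ ≤ v n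

section LocSummable

variable {E : Type*} [NormedAddCommGroup E] {f g : ℕ → ℝ → E}

theorem exists_mem_Ioo_inv {y : ℝ} (hy : 0 < y) : ∃ δ > 0, y ∈ Set.Ioo δ δ⁻¹ := by
  refine ⟨min (y / 2) (y⁻¹ / 2), by positivity, ?_, ?_⟩
  · exact (min_le_left _ _).trans_lt (by linarith)
  · rw [lt_inv_comm₀ hy (by positivity)]
    have : 0 < y⁻¹ := by positivity
    exact (min_le_right _ _).trans_lt (by linarith)

theorem exists_bound_Ioo {φ : ℝ → ℝ} (hφ : ContinuousOn φ (Set.Ioi 0)) {δ : ℝ} (hδ : 0 < δ) :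
    ∃ C > 0, ∀ y ∈ Set.Ioo δ δ⁻¹, |φ y| ≤ C := by
  obtain ⟨C, hC⟩ := (isCompact_Icc (a := δ) (b := δ⁻¹)).exists_bound_of_continuousOn
    (hφ.mono fun y hy => lt_of_lt_of_le hδ hy.1)
  refine ⟨max C 1, by positivity, fun y hy => ?_⟩
  exact (hC y (Set.Ioo_subset_Icc_self hy)).trans (le_max_left _ _)

theorem LocSummable.summable [CompleteSpace E] (hf : LocSummable f) {y : ℝ} (hy : 0 < y) :
    Summable fun n => f n y := by
  obtain ⟨δ, hδ, hyδ⟩ := exists_mem_Ioo_inv hy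
  obtain ⟨v, hv, hb⟩ := hf δ hδ
  exact .of_norm_bounded hv fun n => hb n y hyδ

theorem LocSummable.add (hf : LocSummable f) (hg : LocSummable g) :
    LocSummable fun n y => f n y + g n y := by
  intro δ hδ
  obtain ⟨v, hv, hb⟩ := hf δ hδ
  obtain ⟨v', hv', hb'⟩ := hg δ hδ
  exact ⟨fun n => v n + v' n, hv.add hv', fun n y hy =>
    (norm_add_le _ _).trans (add_le_add (hb n y hy) (hb' n y hy))⟩

theorem LocSummable.smul [NormedSpace ℝ E] {φ : ℝ → ℝ} (hφ : ContinuousOn φ (Set.Ioi 0))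
    (hf : LocSummable f) : LocSummable fun n y => φ y • f n y := by
  intro δ hδ
  obtain ⟨v, hv, hb⟩ := hf δ hδ
  obtain ⟨C, hC, hCb⟩ := exists_bound_Ioo hφ hδ
  refine ⟨fun n => C * v n, hv.mul_left C, fun n y hy => ?_⟩
  rw [norm_smul]
  exact mul_le_mul (hCb y hy) (hb n y hy) (norm_nonneg _) hC.le

theorem LocSummable.mono {F : Type*} [NormedAddCommGroup F] {g : ℕ → ℝ → F} (hg : LocSummable g)
    (h : ∀ n, ∀ y > 0, ‖f n y‖ ≤ ‖g n y‖) : LocSummable f := by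
  intro δ hδ
  obtain ⟨v, hv, hb⟩ := hg δ hδ
  exact ⟨v, hv, fun n y hy => (h n y (hδ.trans hy.1)).trans (hb n y hy)⟩

theorem LocSummable.hasDerivAt [NormedSpace ℝ E] [CompleteSpace E] {f' : ℕ → ℝ → E}
    (hf : LocSummable f) (hf' : LocSummable f')
    (hd : ∀ n, ∀ y > 0, HasDerivAt (f n) (f' n y) y) {y : ℝ} (hy : 0 < y) :
    HasDerivAt (fun z => ∑' n, f n z) (∑' n, f' n y) y := by
  obtain ⟨δ, hδ, hyδ⟩ := exists_mem_Ioo_inv hy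
  obtain ⟨v, hv, hb⟩ := hf' δ hδ
  exact hasDerivAt_tsum_of_isPreconnected hv isOpen_Ioo isPreconnected_Ioo
    (fun n z hz => hd n z (hδ.trans hz.1)) hb hyδ (hf.summable hy) hyδ

/-- The power (n+1)^P is at most P! times the binomial C(n+P,P), whose generating series is known in
closed form. The next lemma bounds the sum in the same way. -/
theorem summable_pow_mul_geometric (P : ℕ) {x : ℝ} (hx : 0 ≤ x) (hx1 : x < 1) :
    Summable fun n : ℕ => ((n : ℝ) + 1) ^ P * x ^ n := by
  have h := summable_choose_mul_geometric_of_norm_lt_one P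
    (r := x) (by rwa [Real.norm_of_nonneg hx])
  refine (h.mul_left (P.factorial : ℝ)).of_nonneg_of_le (fun n => by positivity) fun n => ?_
  rw [← mul_assoc]
  gcongr
  have := Nat.pow_succ_le_ascFactorial (n + 1) P
  rw [Nat.ascFactorial_eq_factorial_mul_choose] at this
  exact_mod_cast this

theorem tsum_pow_mul_geometric_le (P : ℕ) {x : ℝ} (hx : 0 ≤ x) (hx1 : x < 1) :
    ∑' n : ℕ, ((n : ℝ) + 1) ^ P * x ^ n ≤ P.factorial * ((1 - x) ^ (P + 1))⁻¹ := by
  have hx' : ‖x‖ < 1 := by rwa [Real.norm_of_nonneg hx]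
  have h := summable_choose_mul_geometric_of_norm_lt_one P (r := x) hx'
  have e := tsum_choose_mul_geometric_of_norm_lt_one P (r := x) hx'
  rw [← one_div, ← e, ← tsum_mul_left]
  refine (summable_pow_mul_geometric P hx hx1).tsum_le_tsum (fun n => ?_) (h.mul_left _)
  rw [← mul_assoc]
  gcongr
  have := Nat.pow_succ_le_ascFactorial (n + 1) P
  rw [Nat.ascFactorial_eq_factorial_mul_choose] at this
  exact_mod_cast this

theorem locSummable_of_geometric {φ : ℝ → ℝ} (hφ : ContinuousOn φ (Set.Ioi 0)) {P : ℕ}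
    (hb : ∀ n : ℕ, ∀ y > 0, ‖f n y‖ ≤ φ y * (((n : ℝ) + 1) ^ P * ((1 + y)⁻¹) ^ n)) :
    LocSummable f := by
  intro δ hδ
  obtain ⟨C, hC, hCb⟩ := exists_bound_Ioo hφ hδ
  have h1 : (1 + δ)⁻¹ < 1 := inv_lt_one_of_one_lt₀ (by linarith)
  refine ⟨fun n => C * (((n : ℝ) + 1) ^ P * ((1 + δ)⁻¹) ^ n),
    (summable_pow_mul_geometric P (by positivity) h1).mul_left C, fun n y hy => ?_⟩
  have hy0 : 0 < y := hδ.trans hy.1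
  refine (hb n y hy0).trans ?_
  have h2 : φ y ≤ C := (le_abs_self _).trans (hCb y hy)
  have h3 : (1 + y)⁻¹ ≤ (1 + δ)⁻¹ := by
    have := hy.1
    gcongr
  exact mul_le_mul h2 (by gcongr) (by positivity) hC.le

end LocSummable

/-! ### Sequences of polynomial growth -/

/-- Sequences of at most polynomial growth. -/
def PolyBdd {E : Type*} [NormedAddCommGroup E] (c : ℕ → E) : Prop :=
  ∃ (C : ℝ) (P : ℕ), 0 ≤ C ∧ ∀ n, ‖c n‖ ≤ C * ((n : ℝ) + 1) ^ P

section PolyBdd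

variable {c d : ℕ → ℝ}

theorem PolyBdd.add {E : Type*} [NormedAddCommGroup E] {c d : ℕ → E} (hc : PolyBdd c)
    (hd : PolyBdd d) : PolyBdd fun n => c n + d n := by
  obtain ⟨C, P, hC, hP⟩ := hc
  obtain ⟨D, Q, hD, hQ⟩ := hd
  refine ⟨C + D, P + Q, by positivity, fun n => ?_⟩
  have h1 : (1 : ℝ) ≤ (n : ℝ) + 1 := by linarith [Nat.cast_nonneg (α := ℝ) n]
  calc ‖c n + d n‖ ≤ C * ((n : ℝ) + 1) ^ P + D * ((n : ℝ) + 1) ^ Q :=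
        (norm_add_le _ _).trans (add_le_add (hP n) (hQ n))
    _ ≤ C * ((n : ℝ) + 1) ^ (P + Q) + D * ((n : ℝ) + 1) ^ (P + Q) := by
        gcongr <;> first | exact h1 | omega
    _ = _ := by ring

theorem PolyBdd.mul {E : Type*} [NormedRing E] {c d : ℕ → E} (hc : PolyBdd c) (hd : PolyBdd d) :
    PolyBdd fun n => c n * d n := by
  obtain ⟨C, P, hC, hP⟩ := hc
  obtain ⟨D, Q, hD, hQ⟩ := hd
  refine ⟨C * D, P + Q, by positivity, fun n => ?_⟩
  calc ‖c n * d n‖ ≤ (C * ((n : ℝ) + 1) ^ P) * (D * ((n : ℝ) + 1) ^ Q) :=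
        (norm_mul_le _ _).trans (mul_le_mul (hP n) (hQ n) (norm_nonneg _) (by positivity))
    _ = _ := by ring

theorem polyBdd_const {E : Type*} [NormedAddCommGroup E] (a : E) : PolyBdd fun _ : ℕ => a :=
  ⟨‖a‖, 0, norm_nonneg a, fun n => by simp⟩

theorem polyBdd_natCast : PolyBdd fun n : ℕ => (n : ℝ) :=
  ⟨1, 1, zero_le_one, fun n => by
    rw [Real.norm_of_nonneg (Nat.cast_nonneg n)]
    linarith⟩

theorem polyBdd_add_natCast (a : ℝ) : PolyBdd fun n : ℕ => a + n :=
  (polyBdd_const a).add polyBdd_natCast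

theorem PolyBdd.shift (hc : PolyBdd c) : PolyBdd fun n => if n = 0 then 0 else c (n - 1) := by
  obtain ⟨C, P, hC, hP⟩ := hc
  refine ⟨C, P, hC, fun n => ?_⟩
  beta_reduce
  split_ifs with h
  · simp only [norm_zero]; positivity
  · refine (hP (n - 1)).trans ?_
    gcongr
    exact_mod_cast Nat.sub_le n 1

end PolyBdd

/-! ### The blocks as power series in `1 / (1 + y)` -/

/-- The function `y^{-r} (1+y)^{-ν}`. -/
noncomputable def blockMono (r ν y : ℝ) : ℝ := y ^ (-r) * (1 + y) ^ (-ν)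

/-- The series `∑ c_n y^{-r} (1+y)^{-μ-n}`. -/
noncomputable def blockSeries (r μ : ℝ) (c : ℕ → ℝ) (y : ℝ) : ℝ :=
  ∑' n, c n * blockMono r (μ + n) y

theorem blockMono_pos (r ν : ℝ) {y : ℝ} (hy : 0 < y) : 0 < blockMono r ν y := by
  unfold blockMono
  positivity

theorem blockMono_add_nat (r μ : ℝ) (n : ℕ) {y : ℝ} (hy : 0 < y) :
    blockMono r (μ + n) y = blockMono r μ y * ((1 + y)⁻¹) ^ n := by
  unfold blockMono
  rw [neg_add, Real.rpow_add (by linarith), Real.rpow_neg (by linarith) (n : ℝ),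
    Real.rpow_natCast, inv_pow]
  ring

theorem continuousOn_blockMono (r ν : ℝ) : ContinuousOn (blockMono r ν) (Set.Ioi 0) := by
  unfold blockMono
  refine ContinuousOn.mul ?_ ?_
  · exact continuousOn_id.rpow_const fun y hy => Or.inl (ne_of_gt hy)
  · refine (continuousOn_const.add continuousOn_id).rpow_const fun y hy => Or.inl ?_
    have : (0 : ℝ) < y := hy
    change (1 : ℝ) + y ≠ 0
    positivity

theorem hasDerivAt_blockMono (r ν : ℝ) {y : ℝ} (hy : 0 < y) :
    HasDerivAt (blockMono r ν) (y⁻¹ * (-r * blockMono r ν y - ν * (y / (1 + y) * blockMono r ν y)))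
      y := by
  have h1 := Real.hasDerivAt_rpow_const (x := y) (p := -r) (Or.inl hy.ne')
  have h2 := (Real.hasDerivAt_rpow_const (x := 1 + y) (p := -ν)
    (Or.inl (by positivity))).comp y ((hasDerivAt_id y).const_add 1)
  have h3 := h1.mul h2
  refine h3.congr_deriv ?_
  unfold blockMono
  rw [Real.rpow_sub_one hy.ne', Real.rpow_sub_one (by positivity)]
  simp only [Function.comp]
  field_simp
  ring

theorem locSummable_blockSeries {r μ : ℝ} {c : ℕ → ℝ} (hc : PolyBdd c) :
    LocSummable fun n y => c n * blockMono r (μ + n) y := by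
  obtain ⟨C, P, hC, hP⟩ := hc
  refine locSummable_of_geometric (φ := fun y => C * blockMono r μ y) (P := P)
    (continuousOn_const.mul (continuousOn_blockMono r μ)) fun n y hy => ?_
  rw [norm_mul, Real.norm_of_nonneg (blockMono_pos _ _ hy).le, blockMono_add_nat r μ n hy]
  have := (blockMono_pos r μ hy).le
  calc ‖c n‖ * (blockMono r μ y * ((1 + y)⁻¹) ^ n)
      ≤ (C * ((n : ℝ) + 1) ^ P) * (blockMono r μ y * ((1 + y)⁻¹) ^ n) := by
        gcongr
        exact hP n
    _ = _ := by ring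

theorem summable_blockSeries {r μ : ℝ} {c : ℕ → ℝ} (hc : PolyBdd c) {y : ℝ} (hy : 0 < y) :
    Summable fun n : ℕ => c n * blockMono r (μ + n) y :=
  (locSummable_blockSeries hc).summable hy

theorem hasDerivAt_blockSeries {r μ : ℝ} {c : ℕ → ℝ} (hc : PolyBdd c) {y : ℝ} (hy : 0 < y) :
    HasDerivAt (blockSeries r μ c) (y⁻¹ * (-r * blockSeries r μ c y -
      y / (1 + y) * blockSeries r μ (fun n => (μ + n) * c n) y)) y := by
  have hc' : PolyBdd fun n : ℕ => (μ + n) * c n := (polyBdd_add_natCast μ).mul hc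
  have l1 : LocSummable fun (n : ℕ) (y : ℝ) => c n * (y⁻¹ * (-r * blockMono r (μ + n) y -
      (μ + n) * (y / (1 + y) * blockMono r (μ + n) y))) := by
    have a1 := (locSummable_blockSeries (r := r) (μ := μ) hc).smul (φ := fun y => y⁻¹ * -r)
      ((continuousOn_id.inv₀ fun y hy => ne_of_gt hy).mul continuousOn_const)
    have a2 := (locSummable_blockSeries (r := r) (μ := μ) hc').smul (φ := fun y => -(1 + y)⁻¹)
      ((continuousOn_const.add continuousOn_id).inv₀ (fun y hy => by
        have : (0 : ℝ) < y := hy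
        change (1 : ℝ) + y ≠ 0
        positivity)).neg
    refine (a1.add a2).mono fun n y hy => le_of_eq ?_
    congr 1
    simp only [smul_eq_mul]
    field_simp
    ring
  have h := (locSummable_blockSeries (r := r) (μ := μ) hc).hasDerivAt l1
    (fun n y hy => (hasDerivAt_blockMono r (μ + n) hy).const_mul (c n)) hy
  refine h.congr_deriv ?_
  unfold blockSeries
  rw [← tsum_mul_left, ← tsum_mul_left, ← ((summable_blockSeries hc hy).mul_left _).tsum_sub
    ((summable_blockSeries hc' hy).mul_left _), ← tsum_mul_left]
  refine tsum_congr fun n => ?_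
  ring

theorem blockSeries_add {r μ : ℝ} {c d : ℕ → ℝ} (hc : PolyBdd c) (hd : PolyBdd d) {y : ℝ}
    (hy : 0 < y) : blockSeries r μ (fun n => c n + d n) y =
      blockSeries r μ c y + blockSeries r μ d y := by
  unfold blockSeries
  rw [← (summable_blockSeries hc hy).tsum_add (summable_blockSeries hd hy)]
  refine tsum_congr fun n => ?_
  ring

theorem blockSeries_const_mul {r μ a : ℝ} {c : ℕ → ℝ} {y : ℝ} :
    blockSeries r μ (fun n => a * c n) y = a * blockSeries r μ c y := by
  unfold blockSeries
  rw [← tsum_mul_left]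
  refine tsum_congr fun n => ?_
  ring

theorem blockSeries_shift {r μ : ℝ} {c : ℕ → ℝ} (hc : PolyBdd c) {y : ℝ} (hy : 0 < y) :
    blockSeries r μ (fun n => if n = 0 then 0 else c (n - 1)) y = blockSeries r (μ + 1) c y := by
  unfold blockSeries
  rw [(summable_blockSeries hc.shift hy).tsum_eq_zero_add]
  simp only [if_true, zero_mul, zero_add, Nat.add_eq_zero_iff, one_ne_zero, and_false, if_false,
    Nat.add_sub_cancel]
  refine tsum_congr fun n => ?_
  push_cast
  congr 2
  ring

theorem blockSeries_add_one {r μ : ℝ} {c : ℕ → ℝ} {y : ℝ} (hy : 0 < y) :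
    blockSeries r (μ + 1) c y = (1 + y)⁻¹ * blockSeries r μ c y := by
  unfold blockSeries
  rw [← tsum_mul_left]
  refine tsum_congr fun n => ?_
  rw [blockMono_add_nat _ _ n hy, blockMono_add_nat _ _ n hy]
  have := blockMono_add_nat r μ 1 hy
  rw [Nat.cast_one, pow_one] at this
  rw [this]
  ring

/-- The hypergeometric recursion of the coefficients of a block in powers of `1 / (1 + y)`. -/
def IsBlockSeq (r s h : ℝ) (c : ℕ → ℝ) : Prop :=
  ∀ n : ℕ, (2 * h + n) * (n + 1) * c (n + 1) = (h - r + n) * (h + s + n) * c n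

/-- The coefficients of `(y ∂_y + s) F` if `F` has the coefficients `c`. -/
noncomputable def casimirSeq (r s h : ℝ) (c : ℕ → ℝ) (n : ℕ) : ℝ :=
  -(h - s + n) * c n + if n = 0 then 0 else (h - r + (n - 1 : ℕ)) * c (n - 1)

theorem polyBdd_casimirSeq {r s h : ℝ} {c : ℕ → ℝ} (hc : PolyBdd c) :
    PolyBdd (casimirSeq r s h c) := by
  unfold casimirSeq
  have h1 := ((polyBdd_const (-1 : ℝ)).mul (polyBdd_add_natCast (h - s))).mul hc
  have h2 := ((polyBdd_add_natCast (h - r)).mul hc).shift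
  simpa only [neg_one_mul] using h1.add h2

/-- The second-order hypergeometric equation in factorised form: a further first-order operator
applied to `casimirSeq` returns the original sequence times the Casimir eigenvalue. -/
theorem IsBlockSeq.casimirSeq_mul {r s h : ℝ} {c : ℕ → ℝ} (hc : IsBlockSeq r s h c) (n : ℕ) :
    (h + s - 1 + n) * casimirSeq r s h c n = -((h * (h - 1) + s * (1 - s)) * c n) := by
  unfold casimirSeq
  cases n with
  | zero => simp; ring
  | succ n =>
    have := hc n
    simp only [Nat.add_eq_zero_iff, one_ne_zero, and_false, if_false, Nat.add_sub_cancel]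
    push_cast
    linear_combination -this

/-- Differentiation brings down y/(1+y) = 1 - 1/(1+y), and the factor 1/(1+y) is a shift of the
index; this is the origin of the two terms of `casimirSeq`. -/
theorem blockSeries_casimirSeq {r s h : ℝ} {c : ℕ → ℝ} (hc : PolyBdd c) {y : ℝ} (hy : 0 < y) :
    blockSeries r (h - r) (casimirSeq r s h c) y = (s - r) * blockSeries r (h - r) c y -
      y / (1 + y) * blockSeries r (h - r) (fun n => (h - r + n) * c n) y := by
  have hν : PolyBdd fun n : ℕ => (h - r + n) * c n := (polyBdd_add_natCast (h - r)).mul hc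
  have e : casimirSeq r s h c = fun n : ℕ => ((s - r) * c n + -1 * ((h - r + n) * c n)) +
      (if n = 0 then 0 else (h - r + (n - 1 : ℕ)) * c (n - 1)) := by
    funext n
    unfold casimirSeq
    ring
  rw [e, blockSeries_add (((polyBdd_const _).mul hc).add ((polyBdd_const _).mul hν)) hν.shift hy,
    blockSeries_add ((polyBdd_const _).mul hc) ((polyBdd_const _).mul hν) hy,
    blockSeries_const_mul, blockSeries_const_mul, blockSeries_shift hν hy, blockSeries_add_one hy]
  field_simp
  ring

theorem hasDerivAt_blockSeries_casimir {r s h : ℝ} {c : ℕ → ℝ} (hc : PolyBdd c) {y : ℝ}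
    (hy : 0 < y) : HasDerivAt (blockSeries r (h - r) c) (y⁻¹ *
      (blockSeries r (h - r) (casimirSeq r s h c) y - s * blockSeries r (h - r) c y)) y := by
  refine (hasDerivAt_blockSeries hc hy).congr_deriv ?_
  rw [blockSeries_casimirSeq hc hy]
  ring

/-- With X = (y∂_y + s)F the Casimir equation becomes a first-order system. The source of (y∂_y +
r)X carries a factor y, so each passage through the system improves the order at y = 0. -/
theorem IsBlockSeq.hasDerivAt_casimir {r s h : ℝ} {c : ℕ → ℝ} (hcs : IsBlockSeq r s h c)
    (hc : PolyBdd c) {y : ℝ} (hy : 0 < y) :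
    HasDerivAt (blockSeries r (h - r) (casimirSeq r s h c)) (y⁻¹ *
      (-r * blockSeries r (h - r) (casimirSeq r s h c) y + y / (1 + y) *
        ((h * (h - 1) + s * (1 - s)) * blockSeries r (h - r) c y +
          (r + s - 1) * blockSeries r (h - r) (casimirSeq r s h c) y))) y := by
  have hd := polyBdd_casimirSeq (r := r) (s := s) (h := h) hc
  refine (hasDerivAt_blockSeries hd hy).congr_deriv ?_
  have e : (fun n : ℕ => (h - r + n) * casimirSeq r s h c n) = fun n =>
      -(h * (h - 1) + s * (1 - s)) * c n + -(r + s - 1) * casimirSeq r s h c n := by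
    funext n
    linear_combination hcs.casimirSeq_mul n
  rw [e, blockSeries_add ((polyBdd_const _).mul hc) ((polyBdd_const _).mul hd) hy,
    blockSeries_const_mul, blockSeries_const_mul]
  ring

theorem IsBlockSeq.polyBdd {r s h : ℝ} (hh : 0 < h) {c : ℕ → ℝ} (hc : IsBlockSeq r s h c) :
    PolyBdd c := by
  -- P is chosen so that |(h-r+n)(h+s+n)| ≤ (2h+n)(n+1+P). Then |c(n+1)/c(n)| ≤ 1 + P/(n+1) ≤ (1 +
  -- 1/(n+1))^P by Bernoulli, which telescopes to (n+1)^P.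
  obtain ⟨P, hP⟩ := exists_nat_ge (|r| + |s| + (h + |r|) * (h + |s|) / (2 * h))
  refine ⟨|c 0|, P, abs_nonneg _, fun n => ?_⟩
  induction n with
  | zero => simp
  | succ n ih =>
    have hn : (0 : ℝ) ≤ n := Nat.cast_nonneg n
    have hq : 0 ≤ (h + |r|) * (h + |s|) / (2 * h) := by positivity
    have h1 : |(h - r + n) * (h + s + n)| ≤ (2 * h + n) * (n + 1 + P) := by
      rw [abs_mul]
      have a1 : |h - r + n| ≤ n + h + |r| := by
        rw [abs_le]
        constructor <;> linarith [neg_abs_le r, le_abs_self r]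
      have a2 : |h + s + n| ≤ n + h + |s| := by
        rw [abs_le]
        constructor <;> linarith [neg_abs_le s, le_abs_self s]
      have a3 : (h + |r|) * (h + |s|) ≤ 2 * h * P := by
        have : (h + |r|) * (h + |s|) / (2 * h) ≤ P := by
          linarith [abs_nonneg r, abs_nonneg s]
        rw [div_le_iff₀ (by positivity)] at this
        linarith
      have a4 : n * (|r| + |s|) ≤ n * P := by
        gcongr
        linarith
      calc |h - r + n| * |h + s + n| ≤ (n + h + |r|) * (n + h + |s|) :=
            mul_le_mul a1 a2 (abs_nonneg _) (by positivity)
        _ ≤ _ := by nlinarith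
    have h2 : |c (n + 1)| ≤ (1 + P / ((n : ℝ) + 1)) * |c n| := by
      have h3 : (2 * h + n) * (n + 1) * |c (n + 1)| ≤ (2 * h + n) * (n + 1 + P) * |c n| := by
        have := congrArg abs (hc n)
        rw [abs_mul, abs_mul _ (c n), abs_of_pos (by positivity : 0 < (2 * h + n) * ((n : ℝ) + 1))]
          at this
        rw [this]
        gcongr
      have h4 : (1 + P / ((n : ℝ) + 1)) * |c n| = (n + 1 + P) * |c n| / (n + 1) := by
        field_simp
      rw [h4, le_div_iff₀ (by positivity)]
      have h5 : 0 < 2 * h + n := by positivity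
      refine le_of_mul_le_mul_left ?_ h5
      linarith
    have h3 : (1 + P / ((n : ℝ) + 1)) ≤ (1 + 1 / ((n : ℝ) + 1)) ^ P := by
      have := one_add_mul_le_pow (a := 1 / ((n : ℝ) + 1)) (by
        have : 0 < 1 / ((n : ℝ) + 1) := by positivity
        linarith) P
      calc _ = 1 + P * (1 / ((n : ℝ) + 1)) := by ring
        _ ≤ _ := this
    rw [Real.norm_eq_abs] at ih ⊢
    calc |c (n + 1)| ≤ (1 + 1 / ((n : ℝ) + 1)) ^ P * (|c 0| * ((n : ℝ) + 1) ^ P) := by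
          refine h2.trans (mul_le_mul h3 ih (abs_nonneg _) (by positivity))
      _ = |c 0| * ((1 + 1 / ((n : ℝ) + 1)) * (n + 1)) ^ P := by rw [mul_pow]; ring
      _ = _ := by
        congr 2
        push_cast
        field_simp

/-- The coefficients of the block in powers of `1 / (1 + y)`. -/
noncomputable def blockSeq (r s h : ℝ) (n : ℕ) : ℝ :=
  poch (h - r) n * poch (h + s) n / (poch (2 * h) n * (n.factorial : ℝ))

theorem isBlockSeq_blockSeq {r s h : ℝ} (hh : NotPole (2 * h)) :
    IsBlockSeq r s h (blockSeq r s h) := by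
  intro n
  unfold blockSeq
  rw [poch_succ, poch_succ, poch_succ, Nat.factorial_succ]
  have h1 := poch_ne_zero hh n
  have h2 : 2 * h + n ≠ 0 := hh.add_ne_zero n
  push_cast
  field_simp

theorem notPole_of_pos {x : ℝ} (hx : 0 < x) : NotPole x := by
  intro k hk
  have : (0 : ℝ) ≤ k := Nat.cast_nonneg k
  linarith

theorem block_eq_blockSeries {r s h y : ℝ} (hy : 0 < y) :
    block r s h (1 / (1 + y)) = blockSeries r (h - r) (blockSeq r s h) y := by
  unfold block blockSeries
  rw [ordinaryHypergeometric_eq_tsum]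
  beta_reduce
  rw [← tsum_mul_left]
  refine tsum_congr fun n => ?_
  rw [blockMono_add_nat r (h - r) n hy]
  have e : (1 / (1 + y)) ^ h * (1 - 1 / (1 + y)) ^ (-r) = blockMono r (h - r) y := by
    unfold blockMono
    have e1 : 1 - 1 / (1 + y) = y * (1 + y)⁻¹ := by field_simp; ring
    rw [e1, Real.mul_rpow hy.le (by positivity), one_div, Real.inv_rpow (by positivity),
      Real.inv_rpow (by positivity), ← Real.rpow_neg (by positivity),
      ← Real.rpow_neg (by positivity), mul_left_comm, ← Real.rpow_add (by positivity)]
    congr 2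
    ring
  rw [e]
  unfold blockSeq poch
  rw [one_div, smul_eq_mul, div_eq_mul_inv, mul_inv]
  ring

/-! ### Expansions in powers and logarithms at the origin -/

/-- The function `y^ε (log y)^j`, for `k = (ε, j)`. -/
noncomputable def powLog (k : ℝ × ℕ) (y : ℝ) : ℂ := ((y ^ k.1 * Real.log y ^ k.2 : ℝ) : ℂ)

/-- The functions that are `O(y^M)` as `y → 0+`. -/
def bigOClass (M : ℝ) : Submodule ℂ (ℝ → ℂ) where
  carrier := {f | f =O[𝓝[>] 0] fun y : ℝ => y ^ M}
  add_mem' := fun hf hg => hf.add hg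
  zero_mem' := isBigO_zero _ _
  smul_mem' := fun c _ hf => hf.const_mul_left c

theorem mem_bigOClass {M : ℝ} {f : ℝ → ℂ} :
    f ∈ bigOClass M ↔ f =O[𝓝[>] 0] fun y : ℝ => y ^ M := Iff.rfl

/-- Linear combinations of the functions `powLog k`, `k ∈ T`, up to `O(y^M)` as `y → 0+`. -/
def expClass (T : Set (ℝ × ℕ)) (M : ℝ) : Submodule ℂ (ℝ → ℂ) :=
  Submodule.span ℂ (powLog '' T) ⊔ bigOClass M

theorem rpow_isBigO_rpow_zero {a b : ℝ} (h : b ≤ a) :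
    (fun x : ℝ => x ^ a) =O[𝓝[>] 0] fun x : ℝ => x ^ b := by
  refine IsBigO.of_bound 1 ?_
  filter_upwards [Ioo_mem_nhdsGT (zero_lt_one (α := ℝ))] with x hx
  have := hx.1
  rw [one_mul, Real.norm_of_nonneg (by positivity), Real.norm_of_nonneg (by positivity)]
  exact Real.rpow_le_rpow_of_exponent_ge hx.1 hx.2.le h

theorem bigOClass_anti {M M' : ℝ} (h : M' ≤ M) : bigOClass M ≤ bigOClass M' :=
  fun _ hf => IsBigO.trans hf (rpow_isBigO_rpow_zero h)

theorem expClass_mono {T T' : Set (ℝ × ℕ)} {M M' : ℝ} (hT : T ⊆ T') (h : M' ≤ M) :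
    expClass T M ≤ expClass T' M' :=
  sup_le_sup (Submodule.span_mono (Set.image_mono hT)) (bigOClass_anti h)

theorem powLog_mem {T : Set (ℝ × ℕ)} {M : ℝ} {k : ℝ × ℕ} (hk : k ∈ T) : powLog k ∈ expClass T M :=
  Submodule.mem_sup_left (Submodule.subset_span ⟨k, hk, rfl⟩)

theorem mem_expClass_of_isBigO {T : Set (ℝ × ℕ)} {M : ℝ} {f : ℝ → ℂ}
    (hf : f =O[𝓝[>] 0] fun y : ℝ => y ^ M) : f ∈ expClass T M :=
  Submodule.mem_sup_right hf

theorem expClass_congr {T : Set (ℝ × ℕ)} {M : ℝ} {f g : ℝ → ℂ} (hf : f ∈ expClass T M)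
    (h : ∀ y > 0, g y = f y) : g ∈ expClass T M := by
  have : g = f + (g - f) := by ring
  rw [this]
  refine add_mem hf (mem_expClass_of_isBigO ?_)
  refine (isBigO_zero _ _).congr' ?_ EventuallyEq.rfl
  filter_upwards [self_mem_nhdsWithin] with y hy
  simp [h y hy]

theorem isBigO_powLog {k : ℝ × ℕ} {M : ℝ} (h : M < k.1) :
    powLog k =O[𝓝[>] 0] fun y : ℝ => y ^ M := by
  unfold powLog
  rw [isBigO_ofReal_left]
  rcases Nat.eq_zero_or_pos k.2 with h0 | h0
  · simp only [h0, pow_zero, mul_one]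
    exact rpow_isBigO_rpow_zero h.le
  have hk : (0 : ℝ) < k.2 := by exact_mod_cast h0
  have h1 : (M - k.1) / k.2 < 0 := div_neg_of_neg_of_pos (by linarith) hk
  have h2 := ((isLittleO_log_rpow_nhdsGT_zero h1).isBigO.pow k.2)
  refine ((isBigO_refl (fun y : ℝ => y ^ k.1) (𝓝[>] 0)).mul h2).congr' EventuallyEq.rfl ?_
  filter_upwards [self_mem_nhdsWithin] with y hy
  rw [← Real.rpow_natCast, ← Real.rpow_mul (le_of_lt hy), ← Real.rpow_add hy]
  congr 1
  field_simp
  ring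

theorem hasDerivAt_powLog (ε : ℝ) (j : ℕ) {y : ℝ} (hy : 0 < y) :
    HasDerivAt (powLog (ε, j)) ((y : ℂ)⁻¹ * (ε * powLog (ε, j) y + j * powLog (ε, j - 1) y)) y := by
  unfold powLog
  have h1 := (Real.hasDerivAt_rpow_const (x := y) (p := ε) (Or.inl hy.ne')).mul
    ((Real.hasDerivAt_log hy.ne').pow j)
  refine (h1.ofReal_comp).congr_deriv ?_
  rw [Real.rpow_sub_one hy.ne']
  push_cast
  simp only [Pi.pow_apply]
  push_cast
  have : (y : ℂ) ≠ 0 := by exact_mod_cast hy.ne'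
  field_simp

/-- The translate of a set of exponents under multiplication by `y`. -/
def shiftSet (T : Set (ℝ × ℕ)) : Set (ℝ × ℕ) := {k | (k.1 - 1, k.2) ∈ T}

theorem powLog_shift (k : ℝ × ℕ) {y : ℝ} (hy : 0 < y) :
    (y : ℂ) * powLog k y = powLog (k.1 + 1, k.2) y := by
  unfold powLog
  rw [Real.rpow_add_one hy.ne']
  push_cast
  ring

theorem mul_mem_of_forall {T : Set (ℝ × ℕ)} {M : ℝ} {φ : ℝ → ℂ} {N : Submodule ℂ (ℝ → ℂ)}
    (h1 : ∀ k ∈ T, (fun y => φ y * powLog k y) ∈ N)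
    (h2 : ∀ g : ℝ → ℂ, (g =O[𝓝[>] 0] fun y : ℝ => y ^ M) → (fun y => φ y * g y) ∈ N)
    {f : ℝ → ℂ} (hf : f ∈ expClass T M) : (fun y => φ y * f y) ∈ N := by
  have h : expClass T M ≤ N.comap (LinearMap.mulLeft ℂ φ) := by
    refine sup_le (Submodule.span_le.2 ?_) fun g hg => h2 g hg
    rintro _ ⟨k, hk, rfl⟩
    exact h1 k hk
  exact h hf

theorem mul_mem_expClass {T : Set (ℝ × ℕ)} {M : ℝ} {f : ℝ → ℂ} (hf : f ∈ expClass T M) :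
    (fun y : ℝ => (y : ℂ) * f y) ∈ expClass (shiftSet T) (M + 1) := by
  refine mul_mem_of_forall (fun k hk => ?_) (fun g hg => ?_) hf
  · exact expClass_congr (powLog_mem (k := (k.1 + 1, k.2)) (by simpa [shiftSet] using hk))
      fun y hy => powLog_shift k hy
  · refine mem_expClass_of_isBigO ?_
    have h1 : (fun y : ℝ => (y : ℂ)) =O[𝓝[>] 0] fun y : ℝ => y :=
      isBigO_ofReal_left.2 (isBigO_refl (fun y : ℝ => y) _)
    refine (h1.mul hg).congr' EventuallyEq.rfl ?_
    filter_upwards [self_mem_nhdsWithin] with y hy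
    rw [Real.rpow_add_one (ne_of_gt hy), mul_comm]

/-- Iterating 1/(1+y) = 1 - y/(1+y) raises the exponent by one each time, until the remaining term
is O(y^M). Only closure of T under unit shifts is used. -/
theorem inv_one_add_mul_mem_expClass {T : Set (ℝ × ℕ)} (hT : ∀ k ∈ T, (k.1 + 1, k.2) ∈ T) {M : ℝ}
    {f : ℝ → ℂ} (hf : f ∈ expClass T M) :
    (fun y : ℝ => ((1 + y)⁻¹ : ℝ) * f y) ∈ expClass T M := by
  have hone : (fun y : ℝ => (((1 + y)⁻¹ : ℝ) : ℂ)) =O[𝓝[>] 0] fun _ : ℝ => (1 : ℝ) := by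
    rw [isBigO_ofReal_left]
    refine IsBigO.of_bound 1 ?_
    filter_upwards [self_mem_nhdsWithin] with y hy
    have hy' : (0 : ℝ) < y := hy
    rw [Real.norm_of_nonneg (by positivity), norm_one, one_mul]
    exact inv_le_one_of_one_le₀ (by linarith)
  have hO : ∀ g : ℝ → ℂ, g =O[𝓝[>] 0] (fun y : ℝ => y ^ M) →
      (fun y : ℝ => ((1 + y)⁻¹ : ℝ) * g y) ∈ expClass T M := by
    intro g hg
    refine mem_expClass_of_isBigO ((hone.mul hg).congr' EventuallyEq.rfl ?_)
    filter_upwards with y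
    rw [one_mul]
  have hmono : ∀ n : ℕ, ∀ k ∈ T, M < k.1 + n →
      (fun y : ℝ => ((1 + y)⁻¹ : ℝ) * powLog k y) ∈ expClass T M := by
    intro n
    induction n with
    | zero =>
      intro k _ h
      exact hO _ (isBigO_powLog (by simpa using h))
    | succ n ih =>
      intro k hk h
      have h1 := ih (k.1 + 1, k.2) (hT k hk) (by push_cast at h; simp only; linarith)
      refine expClass_congr (sub_mem (powLog_mem hk) h1) fun y hy => ?_
      simp only [Pi.sub_apply]
      rw [← powLog_shift k hy]
      have : (1 + (y : ℂ)) ≠ 0 := by exact_mod_cast (by positivity : (1 + y) ≠ 0)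
      push_cast
      field_simp
      ring
  refine mul_mem_of_forall (fun k hk => ?_) hO hf
  obtain ⟨n, hn⟩ := exists_nat_gt (M - k.1)
  exact hmono n k hk (by linarith)

/-! ### First-order equations -/

/-- The equation `(y ∂_y + c) u = g` on the half line. -/
def EulerEq (c : ℝ) (u g : ℝ → ℂ) : Prop :=
  ∀ y : ℝ, 0 < y → HasDerivAt u ((y : ℂ)⁻¹ * (g y - c * u y)) y

/-- The integrating factor y^c gives (y^c w)' = y^{c-1} g, whose norm is at most the derivative of
the right-hand side. -/
theorem norm_sub_le_of_euler {w g : ℝ → ℂ} {c M C δ : ℝ} (hκ : c + M ≠ 0)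
    (hw : EulerEq c w g)
    (hg : ∀ y, 0 < y → y ≤ δ → ‖g y‖ ≤ C * y ^ M) {a b : ℝ} (ha : 0 < a) (hab : a ≤ b)
    (hb : b ≤ δ) :
    ‖((b ^ c : ℝ) : ℂ) * w b - ((a ^ c : ℝ) : ℂ) * w a‖ ≤
      C / (c + M) * (b ^ (c + M) - a ^ (c + M)) := by
  have hW : ∀ y > 0, HasDerivAt (fun y : ℝ => ((y ^ c : ℝ) : ℂ) * w y - ((a ^ c : ℝ) : ℂ) * w a)
      (((y ^ (c - 1) : ℝ) : ℂ) * g y) y := by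
    intro y hy
    have h1 := ((Real.hasDerivAt_rpow_const (x := y) (p := c) (Or.inl hy.ne')).ofReal_comp.mul
      (hw y hy)).sub_const (((a ^ c : ℝ) : ℂ) * w a)
    refine h1.congr_deriv ?_
    rw [Real.rpow_sub_one hy.ne']
    have : (y : ℂ) ≠ 0 := by exact_mod_cast hy.ne'
    push_cast
    field_simp
    ring
  have hB : ∀ y > 0, HasDerivAt (fun y : ℝ => C / (c + M) * (y ^ (c + M) - a ^ (c + M)))
      (C * y ^ (c + M - 1)) y := by
    intro y hy
    have h1 := ((Real.hasDerivAt_rpow_const (x := y) (p := c + M) (Or.inl hy.ne')).sub_const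
      (a ^ (c + M))).const_mul (C / (c + M))
    refine h1.congr_deriv ?_
    field_simp
  refine image_norm_le_of_norm_deriv_right_le_deriv_boundary'
    (f := fun y : ℝ => ((y ^ c : ℝ) : ℂ) * w y - ((a ^ c : ℝ) : ℂ) * w a)
    (f' := fun y => ((y ^ (c - 1) : ℝ) : ℂ) * g y)
    (B := fun y : ℝ => C / (c + M) * (y ^ (c + M) - a ^ (c + M)))
    (B' := fun y => C * y ^ (c + M - 1)) (a := a) (b := b) ?_ ?_ ?_ ?_ ?_ ?_ ⟨hab, le_rfl⟩
  · exact fun y hy => (hW y (ha.trans_le hy.1)).continuousAt.continuousWithinAt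
  · exact fun y hy => (hW y (ha.trans_le hy.1)).hasDerivWithinAt
  · simp
  · exact fun y hy => (hB y (ha.trans_le hy.1)).continuousAt.continuousWithinAt
  · exact fun y hy => (hB y (ha.trans_le hy.1)).hasDerivWithinAt
  · intro y hy
    have hy0 : 0 < y := ha.trans_le hy.1
    rw [norm_mul, Complex.norm_real, Real.norm_of_nonneg (by positivity)]
    calc y ^ (c - 1) * ‖g y‖ ≤ y ^ (c - 1) * (C * y ^ M) := by
          gcongr
          exact hg y hy0 (hy.2.le.trans hb)
      _ = C * (y ^ (c - 1) * y ^ M) := by ring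
      _ = _ := by
        rw [← Real.rpow_add hy0]
        congr 2
        ring

/-- If c + M < 0, integration from a fixed point bounds the solution and ℓ = 0 suffices. If c + M >
0, y^c w is Cauchy at the origin and its limit ℓ is the coefficient of the homogeneous solution. The
excluded case M = -c would bring a logarithm. -/
theorem exists_isBigO_of_euler {w g : ℝ → ℂ} {c M : ℝ} (hM : M ≠ -c)
    (hw : EulerEq c w g)
    (hg : g =O[𝓝[>] 0] fun y : ℝ => y ^ M) :
    ∃ ℓ : ℂ, (fun y => w y - ℓ * powLog (-c, 0) y) =O[𝓝[>] 0] fun y : ℝ => y ^ M := by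
  have hκ : c + M ≠ 0 := fun h => hM (by linarith)
  obtain ⟨C, hC, hb⟩ := hg.exists_pos
  rw [isBigOWith_iff] at hb
  obtain ⟨δ, hδ, hδb⟩ := mem_nhdsGT_iff_exists_Ioc_subset.1 hb
  have hδ0 : (0 : ℝ) < δ := hδ
  have hg' : ∀ y, 0 < y → y ≤ δ → ‖g y‖ ≤ C * y ^ M := by
    intro y hy hyδ
    have h1 : ‖g y‖ ≤ C * ‖y ^ M‖ := hδb (show y ∈ Set.Ioc 0 δ from ⟨hy, hyδ⟩)
    rwa [Real.norm_of_nonneg (by positivity)] at h1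
  set W : ℝ → ℂ := fun y => ((y ^ c : ℝ) : ℂ) * w y with hW
  have hWb : ∀ {a b : ℝ}, 0 < a → a ≤ b → b ≤ δ →
      ‖W b - W a‖ ≤ C / (c + M) * (b ^ (c + M) - a ^ (c + M)) :=
    fun ha hab hbδ => norm_sub_le_of_euler hκ hw hg' ha hab hbδ
  have hback : ∀ ℓ : ℂ, (fun y => W y - ℓ) =O[𝓝[>] 0] (fun y : ℝ => y ^ (c + M)) →
      (fun y => w y - ℓ * powLog (-c, 0) y) =O[𝓝[>] 0] fun y : ℝ => y ^ M := by
    intro ℓ h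
    have h1 : (fun y : ℝ => ((y ^ (-c) : ℝ) : ℂ)) =O[𝓝[>] 0] fun y : ℝ => y ^ (-c) :=
      isBigO_ofReal_left.2 (isBigO_refl _ _)
    refine (h1.mul h).congr' ?_ ?_
    · filter_upwards [self_mem_nhdsWithin] with y hy
      have hy0 : (0 : ℝ) < y := hy
      have e : ((y ^ (-c) : ℝ) : ℂ) * ((y ^ c : ℝ) : ℂ) = 1 := by
        rw [← Complex.ofReal_mul, ← Real.rpow_add hy0]
        simp
      simp only [hW, powLog, pow_zero, mul_one]
      rw [mul_sub, ← mul_assoc, e]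
      ring
    · filter_upwards [self_mem_nhdsWithin] with y hy
      rw [← Real.rpow_add hy]
      congr 1
      ring
  rcases lt_or_gt_of_ne hκ with hneg | hpos
  · refine ⟨0, hback 0 ?_⟩
    refine IsBigO.of_bound (‖W δ‖ * δ ^ (-(c + M)) + C / -(c + M)) ?_
    filter_upwards [Ioo_mem_nhdsGT hδ0] with y hy
    have hy0 := hy.1
    have h1 := hWb hy.1 hy.2.le le_rfl
    rw [sub_zero, Real.norm_of_nonneg (by positivity)]
    have h2 : ‖W y‖ ≤ ‖W δ‖ + ‖W δ - W y‖ := by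
      have := norm_sub_norm_le (W y) (W δ)
      rw [norm_sub_rev] at this
      linarith
    have h3 : 1 ≤ δ ^ (-(c + M)) * y ^ (c + M) := by
      rw [Real.rpow_neg hδ0.le, inv_mul_eq_div, one_le_div (by positivity)]
      exact Real.rpow_le_rpow_of_nonpos hy0 hy.2.le hneg.le
    have h4 : C / (c + M) * (δ ^ (c + M) - y ^ (c + M)) ≤ C / -(c + M) * y ^ (c + M) := by
      have e : C / (c + M) * (δ ^ (c + M) - y ^ (c + M)) =
          C / -(c + M) * y ^ (c + M) - C / -(c + M) * δ ^ (c + M) := by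
        rw [div_neg]; ring
      have : 0 ≤ C / -(c + M) * δ ^ (c + M) :=
        mul_nonneg (div_nonneg hC.le (by linarith)) (by positivity)
      linarith
    nlinarith [mul_le_mul_of_nonneg_left h3 (norm_nonneg (W δ))]
  · have hWb' : ∀ {a b : ℝ}, 0 < a → a ≤ b → b ≤ δ →
        ‖W b - W a‖ ≤ C / (c + M) * b ^ (c + M) := by
      intro a b ha hab hbδ
      refine (hWb ha hab hbδ).trans ?_
      gcongr
      have : 0 ≤ a ^ (c + M) := by positivity
      linarith
    set x : ℕ → ℝ := fun n => δ / (n + 1) with hx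
    have hx0 : ∀ n, 0 < x n := fun n => by positivity
    have hxδ : ∀ n, x n ≤ δ := fun n => by
      refine div_le_self hδ0.le ?_
      linarith [Nat.cast_nonneg (α := ℝ) n]
    have hxanti : Antitone x := by
      intro m n hmn
      have : (m : ℝ) ≤ n := by exact_mod_cast hmn
      simp only [hx]
      gcongr
    have hxlim : Tendsto x atTop (𝓝 0) := by
      have := tendsto_one_div_add_atTop_nhds_zero_nat (𝕜 := ℝ)
      have := this.const_mul δ
      simpa [hx, div_eq_mul_inv] using this
    have hlimb : Tendsto (fun n => C / (c + M) * x n ^ (c + M)) atTop (𝓝 0) := by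
      have h1 := (Real.continuousAt_rpow_const 0 (c + M) (Or.inr hpos.le)).tendsto.comp hxlim
      rw [Real.zero_rpow hpos.ne'] at h1
      simpa using h1.const_mul (C / (c + M))
    have hcau : CauchySeq fun n => W (x n) := by
      refine cauchySeq_of_le_tendsto_0' (fun n => C / (c + M) * x n ^ (c + M)) ?_ hlimb
      intro n m hnm
      rw [dist_eq_norm]
      exact hWb' (hx0 m) (hxanti hnm) (hxδ n)
    obtain ⟨ℓ, hℓ⟩ := cauchySeq_tendsto_of_complete hcau
    refine ⟨ℓ, hback ℓ (IsBigO.of_bound (C / (c + M)) ?_)⟩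
    filter_upwards [Ioo_mem_nhdsGT hδ0] with y hy
    have hy0 := hy.1
    rw [Real.norm_of_nonneg (by positivity)]
    refine le_of_tendsto ((tendsto_const_nhds.sub hℓ).norm) ?_
    filter_upwards [hxlim.eventually (gt_mem_nhds hy0)] with n hn
    exact hWb' (hx0 n) hn.le hy.2.le

theorem exists_euler_powLog {c ε : ℝ} (h : ε ≠ -c) (j : ℕ) :
    ∃ v ∈ Submodule.span ℂ (powLog '' {k | k.1 = ε ∧ k.2 ≤ j}),
      EulerEq c v (powLog (ε, j)) := by
  have hne : ((ε : ℂ) + c) ≠ 0 := by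
    exact_mod_cast (fun h' => h (by linarith) : ε + c ≠ 0)
  induction j with
  | zero =>
    refine ⟨(ε + c : ℂ)⁻¹ • powLog (ε, 0),
      Submodule.smul_mem _ _ (Submodule.subset_span ⟨(ε, 0), ⟨rfl, le_rfl⟩, rfl⟩), ?_⟩
    intro y hy
    refine ((hasDerivAt_powLog ε 0 hy).const_smul ((ε + c : ℂ)⁻¹)).congr_deriv ?_
    simp only [smul_eq_mul, Pi.smul_apply, Nat.cast_zero, zero_mul, add_zero]
    field_simp
    ring
  | succ j ih =>
    obtain ⟨v, hv, hd⟩ := ih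
    have hv' : v ∈ Submodule.span ℂ (powLog '' {k | k.1 = ε ∧ k.2 ≤ j + 1}) :=
      by
        refine Submodule.span_mono (Set.image_mono ?_) hv
        rintro k ⟨h1, h2⟩
        exact ⟨h1, by omega⟩
    refine ⟨(ε + c : ℂ)⁻¹ • (powLog (ε, j + 1) - ((j : ℂ) + 1) • v), ?_, ?_⟩
    · refine Submodule.smul_mem _ _ (sub_mem ?_ (Submodule.smul_mem _ _ hv'))
      exact Submodule.subset_span ⟨(ε, j + 1), ⟨rfl, le_rfl⟩, rfl⟩
    · intro y hy
      have h1 := (((hasDerivAt_powLog ε (j + 1) hy).sub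
        ((hd y hy).const_smul ((j : ℂ) + 1))).const_smul ((ε + c : ℂ)⁻¹))
      refine h1.congr_deriv ?_
      simp only [smul_eq_mul, Pi.smul_apply, Pi.sub_apply, Nat.add_sub_cancel]
      push_cast
      field_simp
      ring

/-- Solutions of `(y ∂_y + c) u = g` inherit an expansion from `g`. -/
theorem euler_mem_expClass {T T' : Set (ℝ × ℕ)} {c M : ℝ} (hM : M ≠ -c)
    (h1 : ∀ k ∈ T, k.1 ≠ -c → ∀ i ≤ k.2, (k.1, i) ∈ T')
    (h2 : ∀ j, (-c, j) ∈ T → (-c, j + 1) ∈ T') (h3 : (-c, 0) ∈ T') {u g : ℝ → ℂ}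
    (hu : EulerEq c u g) (hg : g ∈ expClass T M) :
    u ∈ expClass T' M := by
  obtain ⟨g₁, hg₁, g₂, hg₂, rfl⟩ := Submodule.mem_sup.1 hg
  have hv : ∃ v ∈ Submodule.span ℂ (powLog '' T'),
      EulerEq c v g₁ := by
    clear hu hg hg₂
    induction hg₁ using Submodule.span_induction with
    | mem x hx =>
      obtain ⟨⟨ε, j⟩, hk, rfl⟩ := hx
      -- At the exponent of the homogeneous solution the power of the logarithm goes up by one; at
      -- all other exponents the solution stays within the same logarithms.
      by_cases hε : ε = -c
      · subst hε
        refine ⟨((j : ℂ) + 1)⁻¹ • powLog (-c, j + 1),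
          Submodule.smul_mem _ _ (Submodule.subset_span ⟨_, h2 j hk, rfl⟩), fun y hy => ?_⟩
        refine ((hasDerivAt_powLog (-c) (j + 1) hy).const_smul (((j : ℂ) + 1)⁻¹)).congr_deriv ?_
        have : (j : ℂ) + 1 ≠ 0 := by exact_mod_cast Nat.succ_ne_zero j
        simp only [smul_eq_mul, Pi.smul_apply, Nat.add_sub_cancel]
        push_cast
        field_simp
        ring
      · obtain ⟨v, hv, hd⟩ := exists_euler_powLog hε j
        refine ⟨v, Submodule.span_mono (Set.image_mono ?_) hv, hd⟩
        rintro ⟨ε', i⟩ ⟨h, hi⟩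
        simp only at h hi
        subst h
        exact h1 _ hk hε i hi
    | zero =>
      refine ⟨0, zero_mem _, fun y _ => ?_⟩
      simp
    | add x x' _ _ h h' =>
      obtain ⟨v, hv, hd⟩ := h
      obtain ⟨v', hv', hd'⟩ := h'
      refine ⟨v + v', add_mem hv hv', fun y hy => ((hd y hy).add (hd' y hy)).congr_deriv ?_⟩
      simp only [Pi.add_apply]
      ring
    | smul a x _ h =>
      obtain ⟨v, hv, hd⟩ := h
      refine ⟨a • v, Submodule.smul_mem _ _ hv, fun y hy =>
        ((hd y hy).const_smul a).congr_deriv ?_⟩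
      simp only [Pi.smul_apply, smul_eq_mul]
      ring
  obtain ⟨v, hv, hd⟩ := hv
  obtain ⟨ℓ, hℓ⟩ := exists_isBigO_of_euler (w := u - v) (g := g₂) hM (fun y hy => by
    refine ((hu y hy).sub (hd y hy)).congr_deriv ?_
    simp only [Pi.add_apply, Pi.sub_apply]
    ring) hg₂
  have e : u = v + ℓ • powLog (-c, 0) + fun y => (u - v) y - ℓ * powLog (-c, 0) y := by
    funext y
    simp only [Pi.add_apply, Pi.sub_apply, Pi.smul_apply, smul_eq_mul]
    ring
  rw [e]
  exact add_mem (add_mem (Submodule.mem_sup_left hv) (Submodule.smul_mem _ _ (powLog_mem h3)))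
    (mem_expClass_of_isBigO hℓ)

/-! ### Casimir-regular expansions -/

/-- The exponents of the Casimir-regular terms. -/
def regSet (r s : ℝ) : Set (ℝ × ℕ) :=
  {k | (k.2 = 0 ∧ ((∃ n : ℕ, k.1 = n - r) ∨ ∃ n : ℕ, k.1 = n - s)) ∨
    (k.2 = 1 ∧ (∃ n : ℕ, k.1 = n - r) ∧ ∃ n : ℕ, k.1 = n - s)}

/-- The exponents that occur in `(y ∂_y + s)` of a Casimir-regular solution. -/
def regSetDeriv (r s : ℝ) : Set (ℝ × ℕ) :=
  shiftSet (regSet r s) ∪ ({(-r, 0)} ∪ {k | k = (-r, 1) ∧ ∃ n : ℕ, -r = n + 1 - s})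

theorem regSet_succ {r s : ℝ} {k : ℝ × ℕ} (hk : k ∈ regSet r s) : (k.1 + 1, k.2) ∈ regSet r s := by
  have key : ∀ {x : ℝ}, (∃ n : ℕ, k.1 = n - x) → ∃ n : ℕ, k.1 + 1 = n - x := by
    rintro x ⟨n, hn⟩
    exact ⟨n + 1, by rw [hn]; push_cast; ring⟩
  rcases hk with ⟨h0, h | h⟩ | ⟨h1, h, h'⟩
  · exact Or.inl ⟨h0, Or.inl (key h)⟩
  · exact Or.inl ⟨h0, Or.inr (key h)⟩
  · exact Or.inr ⟨h1, key h, key h'⟩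

theorem regSet_of_le {r s : ℝ} {k : ℝ × ℕ} (hk : k ∈ regSet r s) {i : ℕ} (hi : i ≤ k.2) :
    (k.1, i) ∈ regSet r s := by
  rcases hk with ⟨h0, h⟩ | ⟨h1, h, h'⟩
  · exact Or.inl ⟨by simp only; omega, h⟩
  · rcases Nat.lt_or_ge i 1 with h2 | h2
    · exact Or.inl ⟨by simp only; omega, Or.inl h⟩
    · exact Or.inr ⟨by simp only; omega, h, h'⟩

theorem shiftSet_regSet_subset (r s : ℝ) : shiftSet (regSet r s) ⊆ regSet r s := by
  intro k hk
  simpa using regSet_succ hk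

theorem neg_left_mem_regSet (r s : ℝ) : (-r, 0) ∈ regSet r s :=
  Or.inl ⟨rfl, Or.inl ⟨0, by simp⟩⟩

theorem neg_right_mem_regSet (r s : ℝ) : (-s, 0) ∈ regSet r s :=
  Or.inl ⟨rfl, Or.inr ⟨0, by simp⟩⟩

theorem regSetDeriv_subset (r s : ℝ) : regSetDeriv r s ⊆ regSet r s := by
  rintro k (hk | hk | ⟨rfl, n, hn⟩)
  · exact shiftSet_regSet_subset r s hk
  · rw [Set.mem_singleton_iff] at hk
    subst hk
    exact neg_left_mem_regSet r s
  · exact Or.inr ⟨rfl, ⟨0, by simp⟩, ⟨n + 1, by push_cast; exact hn⟩⟩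

/-- The source has an additional factor y, so it reaches the resonant exponent -r only through the
tower of -s, with no logarithm. This accounts for the possible term y^{-r} log y. -/
theorem euler_mem_regSetDeriv {r s M : ℝ} (hM : M ≠ -r) {u g : ℝ → ℂ} (hu : EulerEq r u g)
    (hg : g ∈ expClass (shiftSet (regSet r s)) M) : u ∈ expClass (regSetDeriv r s) M := by
  refine euler_mem_expClass hM ?_ ?_ (Or.inr (Or.inl rfl)) hu hg
  · intro k hk _ i hi
    exact Or.inl (regSet_of_le (k := (k.1 - 1, k.2)) hk hi)
  · rintro j (⟨h0, ⟨n, hn⟩ | ⟨n, hn⟩⟩ | ⟨h1, ⟨n, hn⟩, -⟩)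
    · simp only at hn
      linarith [Nat.cast_nonneg (α := ℝ) n]
    · simp only at hn h0
      subst h0
      exact Or.inr (Or.inr ⟨rfl, n, by linarith⟩)
    · simp only at hn
      linarith [Nat.cast_nonneg (α := ℝ) n]

/-- No squared logarithm can arise: a term y^{-r} log y in the source forces -r > -s, so it misses
the resonance at -s. A plain term at -s comes from the tower of -r, where y^{-s} log y is
Casimir-regular. -/
theorem euler_mem_regSet {r s M : ℝ} (hM : M ≠ -s) {u g : ℝ → ℂ} (hu : EulerEq s u g)
    (hg : g ∈ expClass (regSetDeriv r s) M) : u ∈ expClass (regSet r s) M := by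
  refine euler_mem_expClass hM ?_ ?_ (neg_right_mem_regSet r s) hu hg
  · intro k hk _ i hi
    exact regSet_of_le (regSetDeriv_subset r s hk) hi
  · rintro j ((⟨h0, ⟨n, hn⟩ | ⟨n, hn⟩⟩ | ⟨h1, -, n, hn⟩) | h | ⟨h, n, hn⟩)
    · simp only at hn h0
      subst h0
      exact Or.inr ⟨rfl, ⟨n + 1, by push_cast; linarith⟩, ⟨0, by simp⟩⟩
    · simp only at hn
      linarith [Nat.cast_nonneg (α := ℝ) n]
    · simp only at hn
      linarith [Nat.cast_nonneg (α := ℝ) n]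
    · rw [Set.mem_singleton_iff, Prod.mk.injEq] at h
      obtain ⟨h1, rfl⟩ := h
      exact Or.inr ⟨rfl, ⟨0, by simp [h1]⟩, ⟨0, by simp⟩⟩
    · rw [Prod.mk.injEq] at h
      linarith [Nat.cast_nonneg (α := ℝ) n, h.1]

/-- The order of truncation must avoid the resonant exponents -r and -s. The gain of a full order
per step is therefore weakened to at least one half. -/
theorem exists_between_avoiding (M a b : ℝ) : ∃ M', M + 1 / 2 ≤ M' ∧ M' ≤ M + 1 ∧ M' ≠ a ∧ M' ≠ b := by
  have hinf : (Set.Icc (M + 1 / 2) (M + 1)).Infinite := Set.Icc_infinite (by linarith)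
  obtain ⟨x, hx, hx'⟩ := hinf.exists_notMem_finite (Set.toFinite {a, b})
  simp only [Set.mem_insert_iff, Set.mem_singleton_iff, not_or] at hx'
  exact ⟨x, hx.1, hx.2, hx'.1, hx'.2⟩

/-- A finite chain of functions linked by the Casimir equation, all of them bounded by a power of
`y`, starts with functions that are Casimir-regular to high order. -/
theorem mem_expClass_of_chain {r s β B : ℝ} {K : ℕ} {Φ X : ℕ → ℝ → ℂ}
    (hΦ : ∀ k < K, EulerEq s (Φ k) (X k))
    (hX : ∀ k < K, EulerEq r (X k) fun y => (y : ℂ) * (((1 + y)⁻¹ : ℝ) * (Φ (k + 1) y + β * X k y)))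
    (hΦb : ∀ k ≤ K, Φ k =O[𝓝[>] 0] fun y : ℝ => y ^ (-B))
    (hXb : ∀ k ≤ K, X k =O[𝓝[>] 0] fun y : ℝ => y ^ (-B)) :
    Φ 0 ∈ expClass (regSet r s) (K / 2 - B) ∧ X 0 ∈ expClass (regSet r s) (K / 2 - B) := by
  -- Backward induction along the chain: the expansion of Φ_{k+1} and X_k feeds the source of X_k
  -- with a factor y, then X_k feeds Φ_k. After j links the order has improved by at least j/2.
  have main : ∀ j k : ℕ, k + j ≤ K → Φ k ∈ expClass (regSet r s) (j / 2 - B) ∧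
      X k ∈ expClass (regSet r s) (j / 2 - B) := by
    intro j
    induction j with
    | zero =>
      intro k hk
      simp only [Nat.cast_zero, zero_div, zero_sub]
      exact ⟨mem_expClass_of_isBigO (hΦb k (by omega)), mem_expClass_of_isBigO (hXb k (by omega))⟩
    | succ j ih =>
      intro k hk
      obtain ⟨M, hM1, hM2, hMr, hMs⟩ := exists_between_avoiding (j / 2 - B) (-r) (-s)
      have h1 := (ih (k + 1) (by omega)).1
      have h2 := (ih k (by omega)).2
      have h3 : (fun y => Φ (k + 1) y + β * X k y) ∈ expClass (regSet r s) (j / 2 - B) :=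
        add_mem h1 (Submodule.smul_mem _ (β : ℂ) h2)
      have h4 := mul_mem_expClass (inv_one_add_mul_mem_expClass (fun k hk => regSet_succ hk) h3)
      have h5 := expClass_mono (le_refl (shiftSet (regSet r s))) hM2 h4
      have h6 := euler_mem_regSetDeriv hMr (hX k (by omega)) h5
      have h7 := euler_mem_regSet hMs (hΦ k (by omega)) h6
      have hle : ((j + 1 : ℕ) : ℝ) / 2 - B ≤ M := by push_cast; linarith
      exact ⟨expClass_mono le_rfl hle h7, expClass_mono (regSetDeriv_subset r s) hle h6⟩
  exact main K 0 (by omega)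

/-! ### Single blocks are Casimir-regular -/

theorem norm_blockSeries_le {r μ C : ℝ} {P : ℕ} {c : ℕ → ℝ}
    (hc : ∀ n, ‖c n‖ ≤ C * ((n : ℝ) + 1) ^ P) {y : ℝ} (hy : 0 < y) :
    ‖blockSeries r μ c y‖ ≤ C * (P.factorial * (blockMono r μ y * ((1 + y) / y) ^ (P + 1))) := by
  have hx1 : (1 + y)⁻¹ < 1 := inv_lt_one_of_one_lt₀ (by linarith)
  have hC : 0 ≤ C := by simpa using (norm_nonneg _).trans (hc 0)
  have hb := (blockMono_pos r μ hy).le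
  have hs := summable_pow_mul_geometric P (x := (1 + y)⁻¹) (by positivity) hx1
  have h1 : ‖blockSeries r μ c y‖ ≤
      ∑' n : ℕ, C * blockMono r μ y * (((n : ℝ) + 1) ^ P * ((1 + y)⁻¹) ^ n) := by
    refine tsum_of_norm_bounded (hs.mul_left _).hasSum fun n => ?_
    rw [norm_mul, Real.norm_of_nonneg (blockMono_pos _ _ hy).le, blockMono_add_nat r μ n hy]
    calc ‖c n‖ * (blockMono r μ y * ((1 + y)⁻¹) ^ n)
        ≤ (C * ((n : ℝ) + 1) ^ P) * (blockMono r μ y * ((1 + y)⁻¹) ^ n) := by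
          gcongr
          exact hc n
      _ = _ := by ring
  rw [tsum_mul_left] at h1
  have h2 := tsum_pow_mul_geometric_le P (x := (1 + y)⁻¹) (by positivity) hx1
  have e : ((1 - (1 + y)⁻¹) ^ (P + 1))⁻¹ = ((1 + y) / y) ^ (P + 1) := by
    have : 1 - (1 + y)⁻¹ = y / (1 + y) := by field_simp; ring
    rw [this, ← inv_pow, inv_div]
  rw [e] at h2
  calc _ ≤ _ := h1
    _ ≤ C * blockMono r μ y * (P.factorial * ((1 + y) / y) ^ (P + 1)) := by gcongr
    _ = _ := by ring

theorem blockMono_mul_isBigO (r μ : ℝ) (P : ℕ) :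
    (fun y => blockMono r μ y * ((1 + y) / y) ^ P) =O[𝓝[>] 0] fun y : ℝ => y ^ (-(r + P)) := by
  have h1 : Tendsto (fun y : ℝ => (1 + y) ^ (-μ) * (1 + y) ^ P) (𝓝[>] 0) (𝓝 1) := by
    have h0 : Tendsto (fun y : ℝ => 1 + y) (𝓝[>] 0) (𝓝 1) := by
      have : Tendsto (fun y : ℝ => 1 + y) (𝓝 0) (𝓝 (1 + 0)) := tendsto_const_nhds.add tendsto_id
      rw [add_zero] at this
      exact this.mono_left nhdsWithin_le_nhds
    have := (h0.rpow_const (p := -μ) (Or.inl one_ne_zero)).mul (h0.pow P)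
    simpa using this
  refine ((h1.isBigO_one ℝ).mul (isBigO_refl (fun y : ℝ => y ^ (-(r + P))) (𝓝[>] 0))).congr' ?_ ?_
  · filter_upwards [self_mem_nhdsWithin] with y hy
    have hy0 : (0 : ℝ) < y := hy
    unfold blockMono
    rw [neg_add, Real.rpow_add hy0, Real.rpow_neg hy0.le (P : ℝ), Real.rpow_natCast, div_pow]
    ring
  · filter_upwards with y
    rw [one_mul]

theorem isBigO_blockSeries {r μ : ℝ} {c : ℕ → ℝ} (hc : PolyBdd c) :
    ∃ B : ℝ, ∀ B' ≥ B, blockSeries r μ c =O[𝓝[>] 0] fun y : ℝ => y ^ (-B') := by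
  obtain ⟨C, P, hC, hP⟩ := hc
  refine ⟨r + (P + 1 : ℕ), fun B' hB' => ?_⟩
  refine IsBigO.trans ?_ ((blockMono_mul_isBigO r μ (P + 1)).trans
    (rpow_isBigO_rpow_zero (by linarith)))
  refine IsBigO.of_bound (C * P.factorial) ?_
  filter_upwards [self_mem_nhdsWithin] with y hy
  have hy0 : (0 : ℝ) < y := hy
  have := (blockMono_pos r μ hy0).le
  rw [Real.norm_of_nonneg (by positivity : 0 ≤ blockMono r μ y * ((1 + y) / y) ^ (P + 1)), mul_assoc]
  exact norm_blockSeries_le hP hy0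

/-- Casimir-regular to all orders. -/
def IsRegular (r s : ℝ) (u : ℝ → ℂ) : Prop := ∀ M : ℝ, u ∈ expClass (regSet r s) M

theorem EulerEq.of_real {c : ℝ} {u g : ℝ → ℝ}
    (h : ∀ y > 0, HasDerivAt u (y⁻¹ * (g y - c * u y)) y) :
    EulerEq c (fun y => (u y : ℂ)) fun y => (g y : ℂ) := by
  intro y hy
  refine (h y hy).ofReal_comp.congr_deriv ?_
  push_cast
  ring

theorem EulerEq.const_mul {c : ℝ} {u g : ℝ → ℂ} (a : ℂ) (h : EulerEq c u g) :
    EulerEq c (fun y => a * u y) fun y => a * g y := by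
  intro y hy
  refine ((h y hy).const_mul a).congr_deriv ?_
  ring

theorem EulerEq.congr {c : ℝ} {u g g' : ℝ → ℂ} (h : EulerEq c u g) (hg : ∀ y > 0, g' y = g y) :
    EulerEq c u g' := by
  intro y hy
  rw [hg y hy]
  exact h y hy

/-- A block is an eigenfunction, so the chain Φ_k = α^k F with the eigenvalue α has arbitrary length
and gives regularity to every order. -/
theorem IsBlockSeq.isRegular {r s h : ℝ} {c : ℕ → ℝ} (hcs : IsBlockSeq r s h c) (hc : PolyBdd c) :
    IsRegular r s (fun y => (blockSeries r (h - r) c y : ℂ)) ∧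
    IsRegular r s (fun y => (blockSeries r (h - r) (casimirSeq r s h c) y : ℂ)) := by
  obtain ⟨B₁, hB₁⟩ := isBigO_blockSeries (r := r) (μ := h - r) hc
  obtain ⟨B₂, hB₂⟩ := isBigO_blockSeries (r := r) (μ := h - r)
    (polyBdd_casimirSeq (r := r) (s := s) (h := h) hc)
  set B := max B₁ B₂
  set α : ℂ := ((h * (h - 1) + s * (1 - s) : ℝ) : ℂ) with hα
  have key : ∀ M : ℝ, (fun y => (blockSeries r (h - r) c y : ℂ)) ∈ expClass (regSet r s) M ∧
      (fun y => (blockSeries r (h - r) (casimirSeq r s h c) y : ℂ)) ∈ expClass (regSet r s) M := by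
    intro M
    obtain ⟨K, hK⟩ := exists_nat_ge (2 * (M + B))
    have h1 := mem_expClass_of_chain (r := r) (s := s) (β := r + s - 1) (B := B) (K := K)
      (Φ := fun k y => α ^ k * (blockSeries r (h - r) c y : ℂ))
      (X := fun k y => α ^ k * (blockSeries r (h - r) (casimirSeq r s h c) y : ℂ)) ?_ ?_ ?_ ?_
    · simp only [pow_zero, one_mul] at h1
      have hM : M ≤ K / 2 - B := by linarith
      exact ⟨expClass_mono le_rfl hM h1.1, expClass_mono le_rfl hM h1.2⟩
    · intro k _
      refine EulerEq.const_mul _ (EulerEq.of_real fun y hy => ?_)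
      exact hasDerivAt_blockSeries_casimir hc hy
    · intro k _
      have h2 : EulerEq r (fun y => (blockSeries r (h - r) (casimirSeq r s h c) y : ℂ))
          (fun y => ((y / (1 + y) * ((h * (h - 1) + s * (1 - s)) * blockSeries r (h - r) c y +
          (r + s - 1) * blockSeries r (h - r) (casimirSeq r s h c) y) : ℝ) : ℂ)) := by
        refine EulerEq.of_real fun y hy => (hcs.hasDerivAt_casimir hc hy).congr_deriv ?_
        ring
      refine (EulerEq.const_mul (α ^ k) h2).congr fun y hy => ?_
      rw [pow_succ, hα]
      push_cast
      ring
    · intro k _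
      exact (isBigO_ofReal_left.2 (hB₁ B (le_max_left _ _))).const_mul_left _
    · intro k _
      exact (isBigO_ofReal_left.2 (hB₂ B (le_max_right _ _))).const_mul_left _
  exact ⟨fun M => (key M).1, fun M => (key M).2⟩

theorem isRegular_block {r s h : ℝ} (hh : 0 < h) :
    IsRegular r s fun y => (block r s h (1 / (1 + y)) : ℂ) := by
  have hcs := isBlockSeq_blockSeq (r := r) (s := s) (notPole_of_pos (by linarith : 0 < 2 * h))
  intro M
  exact expClass_congr ((hcs.isRegular (hcs.polyBdd hh)).1 M) fun y hy => by
    rw [block_eq_blockSeries hy]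

/-! ### Normalised blocks -/

/-- The coefficients of `Γ(h-r) Γ(h-s) / Γ(2h) k_{2h}^{r,s}` in powers of `1 / (1 + y)`. -/
noncomputable def normSeq (r s h : ℝ) (n : ℕ) : ℝ :=
  Real.Gamma (h - s) / Real.Gamma (h + s) *
    (Real.Gamma (h - r + n) * Real.Gamma (h + s + n) / (Real.Gamma (2 * h + n) * n.factorial))

theorem normSeq_eq {r s h : ℝ} (h0 : 0 < h) (hr : |r| < h) (hs : |s| < h) (n : ℕ) :
    normSeq r s h n =
      Real.Gamma (h - r) * Real.Gamma (h - s) / Real.Gamma (2 * h) * blockSeq r s h n := by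
  have h1 : 0 < h - r := by linarith [le_abs_self r]
  have h2 : 0 < h + s := by linarith [neg_abs_le s]
  have h3 : 0 < 2 * h := by linarith
  unfold normSeq blockSeq
  rw [Gamma_add_nat (notPole_of_pos h1), Gamma_add_nat (notPole_of_pos h2),
    Gamma_add_nat (notPole_of_pos h3)]
  have g2 := (Real.Gamma_pos_of_pos h2).ne'
  have g3 := (Real.Gamma_pos_of_pos h3).ne'
  have p3 := poch_ne_zero (notPole_of_pos h3) n
  field_simp

theorem normSeq_pos {r s h : ℝ} (h0 : 0 < h) (hr : |r| < h) (hs : |s| < h) (n : ℕ) :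
    0 < normSeq r s h n := by
  have hn : (0 : ℝ) ≤ n := Nat.cast_nonneg n
  have h1 : 0 < h - r + n := by linarith [le_abs_self r]
  have h2 : 0 < h + s := by linarith [neg_abs_le s]
  have h4 : 0 < h - s := by linarith [le_abs_self s]
  have := Real.Gamma_pos_of_pos h1
  have := Real.Gamma_pos_of_pos h2
  have := Real.Gamma_pos_of_pos h4
  have := Real.Gamma_pos_of_pos (by linarith : 0 < h + s + n)
  have := Real.Gamma_pos_of_pos (by linarith : 0 < 2 * h + n)
  unfold normSeq
  positivity

theorem isBlockSeq_normSeq {r s h : ℝ} (h0 : 0 < h) (hr : |r| < h) (hs : |s| < h) :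
    IsBlockSeq r s h (normSeq r s h) := by
  intro n
  rw [normSeq_eq h0 hr hs, normSeq_eq h0 hr hs]
  have := isBlockSeq_blockSeq (r := r) (s := s) (notPole_of_pos (by linarith : 0 < 2 * h)) n
  linear_combination Real.Gamma (h - r) * Real.Gamma (h - s) / Real.Gamma (2 * h) * this

/-- `Γ(h-r) Γ(h-s) / Γ(2h) k_{2h}^{r,s}(1/(1+y))`. -/
noncomputable def normBlock (r s h y : ℝ) : ℝ := blockSeries r (h - r) (normSeq r s h) y

/-- `(y ∂_y + s)` of `normBlock`. -/
noncomputable def normCasimir (r s h y : ℝ) : ℝ :=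
  blockSeries r (h - r) (casimirSeq r s h (normSeq r s h)) y

theorem blockWeight_mul_block {r s h y : ℝ} (h1 : 1 ≤ h) (hr : |r| < h) (hs : |s| < h)
    (hy : 0 < y) :
    blockWeight r s h * block r s h (1 / (1 + y)) = (2 * h - 1) * normBlock r s h y := by
  have e : normSeq r s h = fun n =>
      Real.Gamma (h - r) * Real.Gamma (h - s) / Real.Gamma (2 * h) * blockSeq r s h n :=
    funext fun n => normSeq_eq (by linarith) hr hs n
  rw [block_eq_blockSeries hy, normBlock, e, blockSeries_const_mul, blockWeight]
  have h2 : 2 * h - 1 ≠ 0 := by linarith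
  have e2 : Real.Gamma (2 * h) = (2 * h - 1) * Real.Gamma (2 * h - 1) := by
    rw [← Real.Gamma_add_one h2]
    congr 1
    ring
  have g := (Real.Gamma_pos_of_pos (by linarith : 0 < 2 * h - 1)).ne'
  rw [e2]
  generalize Real.Gamma (2 * h - 1) = G at *
  generalize 2 * h - 1 = t at *
  field_simp

theorem normBlock_pos {r s h y : ℝ} (h0 : 0 < h) (hr : |r| < h) (hs : |s| < h) (hy : 0 < y) :
    0 < normBlock r s h y := by
  have hc := (isBlockSeq_normSeq h0 hr hs).polyBdd h0
  refine (summable_blockSeries hc hy).tsum_pos (fun n => ?_) 0 ?_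
  · exact (mul_pos (normSeq_pos h0 hr hs n) (blockMono_pos _ _ hy)).le
  · exact mul_pos (normSeq_pos h0 hr hs 0) (blockMono_pos _ _ hy)

theorem eulerEq_normBlock {r s h : ℝ} (h0 : 0 < h) (hr : |r| < h) (hs : |s| < h) {y : ℝ}
    (hy : 0 < y) : HasDerivAt (normBlock r s h)
      (y⁻¹ * (normCasimir r s h y - s * normBlock r s h y)) y :=
  hasDerivAt_blockSeries_casimir ((isBlockSeq_normSeq h0 hr hs).polyBdd h0) hy

theorem eulerEq_normCasimir {r s h : ℝ} (h0 : 0 < h) (hr : |r| < h) (hs : |s| < h) {y : ℝ}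
    (hy : 0 < y) : HasDerivAt (normCasimir r s h)
      (y⁻¹ * (-r * normCasimir r s h y + y / (1 + y) * ((h * (h - 1) + s * (1 - s)) *
        normBlock r s h y + (r + s - 1) * normCasimir r s h y))) y :=
  (isBlockSeq_normSeq h0 hr hs).hasDerivAt_casimir ((isBlockSeq_normSeq h0 hr hs).polyBdd h0) hy

theorem isRegular_normBlock {r s h : ℝ} (h0 : 0 < h) (hr : |r| < h) (hs : |s| < h) :
    IsRegular r s (fun y => (normBlock r s h y : ℂ)) ∧
      IsRegular r s (fun y => (normCasimir r s h y : ℂ)) :=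
  (isBlockSeq_normSeq h0 hr hs).isRegular ((isBlockSeq_normSeq h0 hr hs).polyBdd h0)

/-- The contiguous relation between the blocks of weights `h` and `h + 1`. -/
theorem normBlock_contiguous {r s h y : ℝ} (h0 : 0 < h) (hr : |r| < h) (hs : |s| < h)
    (hy : 0 < y) :
    (h - s) * normBlock r s h y + normCasimir r s h y =
      (h + s) * normBlock r s (h + 1) y - normCasimir r s (h + 1) y := by
  have h0' : 0 < h + 1 := by linarith
  have hc := (isBlockSeq_normSeq h0 hr hs).polyBdd h0
  have hc' := (isBlockSeq_normSeq h0' (hr.trans (by linarith)) (hs.trans (by linarith))).polyBdd h0'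
  have hd := polyBdd_casimirSeq (r := r) (s := s) (h := h) hc
  have hd' := polyBdd_casimirSeq (r := r) (s := s) (h := h + 1) hc'
  have hneg : (h + s) * normBlock r s (h + 1) y - normCasimir r s (h + 1) y =
      (h + s) * normBlock r s (h + 1) y + -1 * normCasimir r s (h + 1) y := by ring
  rw [hneg]
  unfold normBlock normCasimir
  rw [show h + 1 - r = h - r + 1 by ring, ← blockSeries_shift hc' hy, ← blockSeries_shift hd' hy,
    ← blockSeries_const_mul, ← blockSeries_const_mul, ← blockSeries_const_mul,
    ← blockSeries_add ((polyBdd_const _).mul hc) hd hy,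
    ← blockSeries_add ((polyBdd_const _).mul hc'.shift) ((polyBdd_const _).mul hd'.shift) hy]
  congr 1
  funext n
  have hrs : h + s ≠ 0 := by linarith [neg_abs_le s]
  -- Both sides are series in the same powers after an index shift, so coefficients are compared.
  -- This relation between weight h+1 at index n and weight h at index n+1, together with the
  -- hypergeometric recursion, settles each coefficient.
  have key : ∀ n : ℕ, (2 * h + n + 1) * (h + s) * normSeq r s (h + 1) n =
      (h - s) * (n + 1) * normSeq r s h (n + 1) := by
    intro n
    have hn : (0 : ℝ) ≤ n := Nat.cast_nonneg n
    have h4 : 0 < h - s := by linarith [le_abs_self s]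
    have h5 : 0 < h + s := by linarith [neg_abs_le s]
    have g1 := (Real.Gamma_pos_of_pos h5).ne'
    have g2 := (Real.Gamma_pos_of_pos (by linarith : 0 < 2 * h + n + 1)).ne'
    unfold normSeq
    rw [show h + 1 - s = h - s + 1 by ring, Real.Gamma_add_one h4.ne',
      show h + 1 + s = h + s + 1 by ring, Real.Gamma_add_one h5.ne',
      show 2 * (h + 1) + (n : ℝ) = 2 * h + n + 1 + 1 by ring,
      Real.Gamma_add_one (by linarith : 2 * h + n + 1 ≠ 0), Nat.factorial_succ]
    push_cast
    rw [show h + 1 - r + n = h - r + (n + 1) by ring, show h + s + 1 + n = h + s + (n + 1) by ring,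
      show 2 * h + (n + 1 : ℝ) = 2 * h + n + 1 by ring]
    have : 2 * h + n + 1 ≠ 0 := by linarith
    field_simp
  unfold casimirSeq
  rcases n with _ | _ | n
  · simp
    ring
  · simp only [zero_add, one_ne_zero, if_false, Nat.sub_self, if_true, Nat.cast_zero,
      Nat.cast_one, add_zero]
    have k0 := key 0
    have r0 := isBlockSeq_normSeq h0 hr hs 0
    simp only [Nat.cast_zero, add_zero, zero_add, mul_one] at k0 r0
    refine mul_left_cancel₀ hrs ?_
    linear_combination -r0 - k0
  · simp only [Nat.add_eq_zero_iff, one_ne_zero, and_false, if_false, Nat.add_sub_cancel]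
    have k0 := key n
    have k1 := key (n + 1)
    have r1 := isBlockSeq_normSeq h0 hr hs (n + 1)
    have hne : (2 * h + n + 1) * (h + s) ≠ 0 := by
      refine mul_ne_zero ?_ hrs
      linarith [Nat.cast_nonneg (α := ℝ) n]
    push_cast at k1 r1 ⊢
    refine mul_left_cancel₀ hne ?_
    linear_combination -(2 * h + n + 1) * k1 + (h - r + n + 1) * k0 - 2 * h * r1

theorem eventually_Gamma_add_le {a : ℝ} {q : ℕ} (ha : |a| ≤ q) :
    ∀ᶠ z in atTop, Real.Gamma (z + a) ≤ 2 * z ^ q * Real.Gamma z ∧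
      Real.Gamma z ≤ 2 * z ^ q * Real.Gamma (z + a) := by
  have h := tendsto_Gamma_ratio a
  filter_upwards [h.eventually (gt_mem_nhds (by norm_num : (1 : ℝ) < 2)),
    h.eventually (lt_mem_nhds (by norm_num : (1 / 2 : ℝ) < 1)), eventually_ge_atTop 1,
    eventually_gt_atTop (-a)] with z h1 h2 hz hza
  have hz0 : 0 < z := by linarith
  have hG := Real.Gamma_pos_of_pos hz0
  have hG' := Real.Gamma_pos_of_pos (by linarith : 0 < z + a)
  have hp : 0 < z ^ a := by positivity
  rw [Real.rpow_neg hz0.le, ← div_eq_mul_inv, div_div] at h1 h2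
  rw [div_lt_iff₀ (by positivity)] at h1
  rw [lt_div_iff₀ (by positivity)] at h2
  have ha' := abs_le.1 ha
  have b1 : z ^ a ≤ z ^ q := by
    rw [← Real.rpow_natCast]
    exact Real.rpow_le_rpow_of_exponent_le hz ha'.2
  have b2 : 1 ≤ z ^ q * z ^ a := by
    rw [← Real.rpow_natCast, ← Real.rpow_add hz0]
    exact Real.one_le_rpow hz (by linarith)
  constructor
  · calc _ ≤ 2 * (Real.Gamma z * z ^ a) := h1.le
      _ ≤ 2 * (Real.Gamma z * z ^ q) := by gcongr
      _ = _ := by ring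
  · have h3 : z ^ q * (z ^ a * Real.Gamma z) ≤ z ^ q * (2 * Real.Gamma (z + a)) :=
      mul_le_mul_of_nonneg_left (by linarith) (by positivity)
    linarith [mul_le_mul_of_nonneg_right b2 hG.le]

/-- The point h+n+1/2 is the midpoint of 2h+n and n+1, so this is log-convexity. It makes the
coefficients of the normalised blocks polynomially bounded jointly in h and n. -/
theorem Gamma_add_half_sq_le {h : ℝ} (hh : 0 < h) (n : ℕ) :
    Real.Gamma (h + n + 1 / 2) ^ 2 ≤ Real.Gamma (2 * h + n) * n.factorial := by
  have hn : (0 : ℝ) ≤ n := Nat.cast_nonneg n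
  have h1 : 0 < 2 * h + n := by linarith
  have h2 : (0 : ℝ) < n + 1 := by linarith
  have hconv := Real.Gamma_mul_add_mul_le_rpow_Gamma_mul_rpow_Gamma h1 h2
    (by norm_num : (0 : ℝ) < 1 / 2) (by norm_num : (0 : ℝ) < 1 / 2) (by norm_num)
  rw [show 1 / 2 * (2 * h + n) + 1 / 2 * ((n : ℝ) + 1) = h + n + 1 / 2 by ring,
    Real.Gamma_nat_eq_factorial, ← Real.sqrt_eq_rpow, ← Real.sqrt_eq_rpow] at hconv
  have g1 := (Real.Gamma_pos_of_pos h1).le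
  have g2 := (Real.Gamma_pos_of_pos (by linarith : 0 < h + n + 1 / 2)).le
  calc _ ≤ (√(Real.Gamma (2 * h + n)) * √(n.factorial : ℝ)) ^ 2 := by gcongr
    _ = _ := by rw [mul_pow, Real.sq_sqrt g1, Real.sq_sqrt (by positivity)]

/-- Polynomial bounds for the coefficients of the normalised blocks, uniform in the weight. -/
structure BlockBound (r s H C : ℝ) (Q : ℕ) : Prop where
  one_le : 1 ≤ H
  left_lt : |r| < H
  right_lt : |s| < H
  nonneg : 0 ≤ C
  seq_le : ∀ h ≥ H, ∀ n : ℕ, ‖normSeq r s h n‖ ≤ C * h ^ Q * ((n : ℝ) + 1) ^ Q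
  casimir_le : ∀ h ≥ H, ∀ n : ℕ,
    ‖casimirSeq r s h (normSeq r s h) n‖ ≤ C * h ^ Q * ((n : ℝ) + 1) ^ Q

/-- Every Gamma function at h + n plus a bounded shift is compared with Γ(h+n+1/2) at the cost of a
power, and the square of the latter is absorbed by Γ(2h+n) n!. -/
theorem exists_blockBound (r s : ℝ) : ∃ H C Q, BlockBound r s H C Q := by
  obtain ⟨q, hq⟩ := exists_nat_ge (|r| + |s| + 1)
  have hr0 := abs_nonneg r
  have hs0 := abs_nonneg s
  obtain ⟨z₀, hz₀⟩ := eventually_atTop.1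
    (((eventually_Gamma_add_le (a := -r) (q := q) (by rw [abs_neg]; linarith)).and
    (eventually_Gamma_add_le (a := s) (q := q) (by linarith))).and
    ((eventually_Gamma_add_le (a := -s) (q := q) (by rw [abs_neg]; linarith)).and
    (eventually_Gamma_add_le (a := 1 / 2) (q := q) (by
      rw [abs_of_pos (by norm_num)]; linarith))))
  set H := max z₀ (|r| + |s| + 1) with hH
  have hHz : z₀ ≤ H := le_max_left _ _
  have hHrs : |r| + |s| + 1 ≤ H := le_max_right _ _
  have hseq : ∀ h ≥ H, ∀ n : ℕ, ‖normSeq r s h n‖ ≤ 64 * h ^ (6 * q) * ((n : ℝ) + 1) ^ (6 * q) := by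
    intro h hh n
    have hn : (0 : ℝ) ≤ n := Nat.cast_nonneg n
    have hh1 : 1 ≤ h := by linarith
    rw [Real.norm_of_nonneg (normSeq_pos (by linarith) (by linarith) (by linarith) n).le]
    obtain ⟨⟨-, ⟨-, b1⟩⟩, ⟨b2, -⟩, -⟩ := hz₀ h (by linarith)
    obtain ⟨⟨⟨c1, -⟩, ⟨c2, -⟩⟩, -, ⟨-, c3⟩⟩ := hz₀ (h + n) (by linarith)
    rw [← sub_eq_add_neg] at b2 c1
    have g0 := Real.Gamma_pos_of_pos (by linarith : 0 < h)
    have g1 := Real.Gamma_pos_of_pos (by linarith [neg_abs_le s] : 0 < h + s)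
    have g2 := Real.Gamma_pos_of_pos (by linarith [le_abs_self s] : 0 < h - s)
    have g3 := Real.Gamma_pos_of_pos (by linarith : 0 < 2 * h + n)
    have g4 := Real.Gamma_pos_of_pos (by linarith : 0 < h + n + 1 / 2)
    have g5 := Real.Gamma_pos_of_pos (by linarith : 0 < h + n)
    have g6 := Real.Gamma_pos_of_pos (by linarith [neg_abs_le s] : 0 < h + n + s)
    have g7 := Real.Gamma_pos_of_pos (by linarith [le_abs_self r] : 0 < h + n - r)
    have d1 : Real.Gamma (h - s) / Real.Gamma (h + s) ≤ 4 * h ^ (2 * q) := by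
      rw [div_le_iff₀ g1]
      calc _ ≤ 2 * h ^ q * Real.Gamma h := b2
        _ ≤ 2 * h ^ q * (2 * h ^ q * Real.Gamma (h + s)) := by gcongr
        _ = _ := by rw [two_mul q, pow_add]; ring
    have z0 : 0 < h + n := by linarith
    have d2 : Real.Gamma (h + n - r) ≤ 4 * (h + n) ^ (2 * q) * Real.Gamma (h + n + 1 / 2) := by
      calc _ ≤ 2 * (h + n) ^ q * Real.Gamma (h + n) := c1
        _ ≤ 2 * (h + n) ^ q * (2 * (h + n) ^ q * Real.Gamma (h + n + 1 / 2)) := by gcongr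
        _ = _ := by rw [two_mul q, pow_add]; ring
    have d3 : Real.Gamma (h + n + s) ≤ 4 * (h + n) ^ (2 * q) * Real.Gamma (h + n + 1 / 2) := by
      calc _ ≤ 2 * (h + n) ^ q * Real.Gamma (h + n) := c2
        _ ≤ 2 * (h + n) ^ q * (2 * (h + n) ^ q * Real.Gamma (h + n + 1 / 2)) := by gcongr
        _ = _ := by rw [two_mul q, pow_add]; ring
    have d4 : Real.Gamma (h + n - r) * Real.Gamma (h + n + s) /
        (Real.Gamma (2 * h + n) * n.factorial) ≤ 16 * (h + n) ^ (4 * q) := by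
      rw [div_le_iff₀ (by positivity)]
      calc _ ≤ (4 * (h + n) ^ (2 * q) * Real.Gamma (h + n + 1 / 2)) *
            (4 * (h + n) ^ (2 * q) * Real.Gamma (h + n + 1 / 2)) :=
              mul_le_mul d2 d3 g6.le (by positivity)
        _ = 16 * (h + n) ^ (4 * q) * Real.Gamma (h + n + 1 / 2) ^ 2 := by
            rw [show 4 * q = 2 * q + 2 * q by ring, pow_add]; ring
        _ ≤ _ := by
            gcongr
            exact Gamma_add_half_sq_le (by linarith) n
    have d5 : (h + n) ^ (4 * q) ≤ h ^ (4 * q) * ((n : ℝ) + 1) ^ (6 * q) := by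
      have e1 : h + n ≤ h * ((n : ℝ) + 1) := by nlinarith
      calc (h + n) ^ (4 * q) ≤ (h * ((n : ℝ) + 1)) ^ (4 * q) := by gcongr
        _ = h ^ (4 * q) * ((n : ℝ) + 1) ^ (4 * q) := mul_pow _ _ _
        _ ≤ _ := by
          gcongr
          · linarith
          · omega
    unfold normSeq
    rw [show h - r + n = h + n - r by ring, show h + s + n = h + n + s by ring]
    calc _ ≤ 4 * h ^ (2 * q) * (16 * (h + n) ^ (4 * q)) :=
          mul_le_mul d1 d4 (by positivity) (by positivity)
      _ ≤ 4 * h ^ (2 * q) * (16 * (h ^ (4 * q) * ((n : ℝ) + 1) ^ (6 * q))) := by gcongr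
      _ = _ := by rw [show 6 * q = 2 * q + 4 * q by ring, pow_add h]; ring
  -- 64 = 4 · 16 from the two Gamma quotients. The two terms of `casimirSeq` bring a factor 2q and
  -- one more power of h and n+1 each.
  refine ⟨H, 64 * (4 * q), 6 * q + 1, by linarith, by linarith, by linarith, by positivity, ?_, ?_⟩
  · intro h hh n
    have hh1 : 1 ≤ h := by linarith
    have hn : (1 : ℝ) ≤ (n : ℝ) + 1 := by linarith [Nat.cast_nonneg (α := ℝ) n]
    have hq1 : (1 : ℝ) ≤ 4 * q := by linarith
    calc _ ≤ _ := hseq h hh n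
      _ ≤ 64 * (4 * q) * h ^ (6 * q + 1) * ((n : ℝ) + 1) ^ (6 * q + 1) := by
        gcongr <;> first | omega | linarith
  · intro h hh n
    have hh1 : 1 ≤ h := by linarith
    have hn0 : (0 : ℝ) ≤ n := Nat.cast_nonneg n
    have hlin : ∀ (x : ℝ), |x| + 1 ≤ q → ∀ m : ℕ, m ≤ n →
        ‖h - x + m‖ ≤ 2 * q * (h * ((n : ℝ) + 1)) := by
      intro x hx m hm
      have hm0 : (0 : ℝ) ≤ m := Nat.cast_nonneg m
      have hm' : (m : ℝ) ≤ n := by exact_mod_cast hm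
      have hx0 := abs_nonneg x
      have h1 : ‖h - x + m‖ ≤ h + |x| + n := by
        rw [Real.norm_eq_abs, abs_le]
        constructor <;> linarith [neg_abs_le x, le_abs_self x]
      have h2 : h + n ≤ h * ((n : ℝ) + 1) := by nlinarith
      have h3 : |x| ≤ |x| * (h * ((n : ℝ) + 1)) := by
        have : 1 ≤ h * ((n : ℝ) + 1) := by nlinarith
        nlinarith
      have h4 : 0 ≤ h * ((n : ℝ) + 1) := by positivity
      nlinarith
    have e : ∀ m : ℕ, m ≤ n → ∀ x : ℝ, |x| + 1 ≤ q → ‖(h - x + m) * normSeq r s h m‖ ≤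
        2 * q * 64 * h ^ (6 * q + 1) * ((n : ℝ) + 1) ^ (6 * q + 1) := by
      intro m hm x hx
      rw [norm_mul]
      have hm' : (m : ℝ) ≤ n := by exact_mod_cast hm
      calc _ ≤ (2 * q * (h * ((n : ℝ) + 1))) * (64 * h ^ (6 * q) * ((n : ℝ) + 1) ^ (6 * q)) := by
            refine mul_le_mul (hlin x hx m hm) ((hseq h hh m).trans ?_) (norm_nonneg _)
              (by positivity)
            gcongr
        _ = _ := by rw [pow_succ, pow_succ]; ring
    unfold casimirSeq
    have e1 := e n le_rfl s (by linarith)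
    have e2 : ‖if n = 0 then 0 else (h - r + (n - 1 : ℕ)) * normSeq r s h (n - 1)‖ ≤
        2 * q * 64 * h ^ (6 * q + 1) * ((n : ℝ) + 1) ^ (6 * q + 1) := by
      split_ifs
      · rw [norm_zero]; positivity
      · exact e (n - 1) (Nat.sub_le _ _) r (by linarith)
    rw [neg_mul]
    refine (norm_add_le _ _).trans ?_
    rw [norm_neg]
    linarith

/-! ### Sums of blocks over the large weight -/

/-- `∑_ℓ u_ℓ G_{h₁+ℓ}(y)` for the normalised blocks `G`. -/
noncomputable def blockTotal (r s h₁ : ℝ) (u : ℕ → ℂ) (y : ℝ) : ℂ :=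
  ∑' ℓ : ℕ, u ℓ * (normBlock r s (h₁ + ℓ) y : ℂ)

/-- `(y ∂_y + s)` of `blockTotal`. -/
noncomputable def casimirTotal (r s h₁ : ℝ) (u : ℕ → ℂ) (y : ℝ) : ℂ :=
  ∑' ℓ : ℕ, u ℓ * (normCasimir r s (h₁ + ℓ) y : ℂ)

/-- The `y`-dependence of a uniform bound for the blocks `G_{h₁+ℓ}`. -/
noncomputable def boundFun (r h₁ : ℝ) (Q : ℕ) (y : ℝ) : ℝ :=
  blockMono r (h₁ - r) y * ((1 + y) / y) ^ (Q + 1)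

theorem boundFun_pos (r h₁ : ℝ) (Q : ℕ) {y : ℝ} (hy : 0 < y) : 0 < boundFun r h₁ Q y := by
  have := blockMono_pos r (h₁ - r) hy
  unfold boundFun
  positivity

theorem continuousOn_boundFun (r h₁ : ℝ) (Q : ℕ) : ContinuousOn (boundFun r h₁ Q) (Set.Ioi 0) := by
  refine (continuousOn_blockMono r (h₁ - r)).mul (ContinuousOn.pow ?_ _)
  exact ContinuousOn.div (by fun_prop) (by fun_prop) fun y hy => ne_of_gt hy

section Total

variable {r s H C h₁ : ℝ} {Q : ℕ} {u : ℕ → ℂ}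

theorem norm_series_add_nat_le (hh : 1 ≤ h₁) (hC : 0 ≤ C) (ℓ : ℕ) {c : ℕ → ℝ}
    (hc : ∀ n : ℕ, ‖c n‖ ≤ C * (h₁ + ℓ) ^ Q * ((n : ℝ) + 1) ^ Q) {y : ℝ} (hy : 0 < y) :
    ‖blockSeries r (h₁ + ℓ - r) c y‖ ≤ (C * h₁ ^ Q * Q.factorial) *
      (boundFun r h₁ Q y * (((ℓ : ℝ) + 1) ^ Q * ((1 + y)⁻¹) ^ ℓ)) := by
  have hb := (blockMono_pos r (h₁ - r) hy).le
  have hℓ : (0 : ℝ) ≤ ℓ := Nat.cast_nonneg ℓ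
  have h1 : h₁ + ℓ ≤ h₁ * ((ℓ : ℝ) + 1) := by nlinarith
  have h2 : (h₁ + ℓ) ^ Q ≤ h₁ ^ Q * ((ℓ : ℝ) + 1) ^ Q := by
    rw [← mul_pow]
    gcongr
  refine (norm_blockSeries_le hc hy).trans ?_
  rw [show h₁ + ℓ - r = h₁ - r + ℓ by ring, blockMono_add_nat _ _ _ hy]
  unfold boundFun
  calc _ ≤ C * (h₁ ^ Q * ((ℓ : ℝ) + 1) ^ Q) * (Q.factorial * (blockMono r (h₁ - r) y *
        ((1 + y)⁻¹) ^ ℓ * ((1 + y) / y) ^ (Q + 1))) := by gcongr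
    _ = _ := by ring

theorem BlockBound.exists_norm_le (hB : BlockBound r s H C Q) (hh : H ≤ h₁) :
    ∃ D, 0 ≤ D ∧ ∀ ℓ : ℕ, ∀ y > 0,
      ‖normBlock r s (h₁ + ℓ) y‖ ≤
        D * (boundFun r h₁ Q y * (((ℓ : ℝ) + 1) ^ Q * ((1 + y)⁻¹) ^ ℓ)) ∧
      ‖normCasimir r s (h₁ + ℓ) y‖ ≤
        D * (boundFun r h₁ Q y * (((ℓ : ℝ) + 1) ^ Q * ((1 + y)⁻¹) ^ ℓ)) := by
  have h1 := hB.one_le.trans hh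
  have hC := hB.nonneg
  refine ⟨C * h₁ ^ Q * Q.factorial, by positivity, fun ℓ y hy => ?_⟩
  have hℓ : H ≤ h₁ + ℓ := by linarith [Nat.cast_nonneg (α := ℝ) ℓ]
  exact ⟨norm_series_add_nat_le h1 hC ℓ (hB.seq_le _ hℓ) hy,
    norm_series_add_nat_le h1 hC ℓ (hB.casimir_le _ hℓ) hy⟩

theorem BlockBound.locSummable (hB : BlockBound r s H C Q) (hh : H ≤ h₁) (hu : PolyBdd u) :
    (LocSummable fun (ℓ : ℕ) y => u ℓ * (normBlock r s (h₁ + ℓ) y : ℂ)) ∧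
      LocSummable fun (ℓ : ℕ) y => u ℓ * (normCasimir r s (h₁ + ℓ) y : ℂ) := by
  obtain ⟨D, hD, hb⟩ := hB.exists_norm_le hh
  obtain ⟨A, P, hA, hP⟩ := hu
  have key : ∀ f : ℕ → ℝ → ℝ, (∀ ℓ : ℕ, ∀ y > 0, ‖f ℓ y‖ ≤
      D * (boundFun r h₁ Q y * (((ℓ : ℝ) + 1) ^ Q * ((1 + y)⁻¹) ^ ℓ))) →
      LocSummable fun (ℓ : ℕ) y => u ℓ * (f ℓ y : ℂ) := by
    intro f hf
    refine locSummable_of_geometric (φ := fun y => A * D * boundFun r h₁ Q y) (P := P + Q)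
      (continuousOn_const.mul (continuousOn_boundFun r h₁ Q)) fun ℓ y hy => ?_
    have := (boundFun_pos r h₁ Q hy).le
    rw [norm_mul, Complex.norm_real]
    calc _ ≤ (A * ((ℓ : ℝ) + 1) ^ P) *
          (D * (boundFun r h₁ Q y * (((ℓ : ℝ) + 1) ^ Q * ((1 + y)⁻¹) ^ ℓ))) :=
          mul_le_mul (hP ℓ) (hf ℓ y hy) (norm_nonneg _) (by positivity)
      _ = _ := by rw [pow_add]; ring
  exact ⟨key _ fun ℓ y hy => (hb ℓ y hy).1, key _ fun ℓ y hy => (hb ℓ y hy).2⟩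

theorem boundFun_isBigO (r h₁ : ℝ) (Q : ℕ) :
    boundFun r h₁ Q =O[𝓝[>] 0] fun y : ℝ => y ^ (-(r + (Q + 1 : ℕ))) :=
  blockMono_mul_isBigO r (h₁ - r) (Q + 1)

/-- A bound that is uniform in all sequences of sufficiently fast decay. -/
theorem BlockBound.isBigO_of_decay (hB : BlockBound r s H C Q) (hh : H ≤ h₁) {A : ℝ}
    (hu : ∀ ℓ : ℕ, ‖u ℓ‖ * ((ℓ : ℝ) + 1) ^ (Q + 2) ≤ A) :
    blockTotal r s h₁ u =O[𝓝[>] 0] (fun y : ℝ => y ^ (-(r + (Q + 1 : ℕ)))) ∧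
      casimirTotal r s h₁ u =O[𝓝[>] 0] fun y : ℝ => y ^ (-(r + (Q + 1 : ℕ))) := by
  obtain ⟨D, hD, hb⟩ := hB.exists_norm_le hh
  have hA : 0 ≤ A := le_trans (by positivity) (hu 0)
  have hs : Summable fun ℓ : ℕ => (((ℓ : ℝ) + 1) ^ 2)⁻¹ := by
    have := (summable_nat_add_iff 1).2 (Real.summable_nat_pow_inv.2 (one_lt_two))
    simpa using this
  have key : ∀ f : ℕ → ℝ → ℝ, (∀ ℓ : ℕ, ∀ y > 0, ‖f ℓ y‖ ≤
      D * (boundFun r h₁ Q y * (((ℓ : ℝ) + 1) ^ Q * ((1 + y)⁻¹) ^ ℓ))) →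
      (fun y => ∑' ℓ : ℕ, u ℓ * (f ℓ y : ℂ)) =O[𝓝[>] 0]
        fun y : ℝ => y ^ (-(r + (Q + 1 : ℕ))) := by
    intro f hf
    refine IsBigO.trans ?_ (boundFun_isBigO r h₁ Q)
    refine IsBigO.of_bound (A * D * ∑' ℓ : ℕ, (((ℓ : ℝ) + 1) ^ 2)⁻¹) ?_
    filter_upwards [self_mem_nhdsWithin] with y hy
    have hy0 : (0 : ℝ) < y := hy
    have hφ := (boundFun_pos r h₁ Q hy0).le
    rw [Real.norm_of_nonneg hφ]
    have h1 : ‖∑' ℓ : ℕ, u ℓ * (f ℓ y : ℂ)‖ ≤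
        ∑' ℓ : ℕ, A * D * boundFun r h₁ Q y * (((ℓ : ℝ) + 1) ^ 2)⁻¹ := by
      refine tsum_of_norm_bounded (hs.mul_left _).hasSum fun ℓ => ?_
      rw [norm_mul, Complex.norm_real]
      have hx : ((1 + y)⁻¹) ^ ℓ ≤ 1 :=
        pow_le_one₀ (by positivity) (inv_le_one_of_one_le₀ (by linarith))
      have hu' := hu ℓ
      rw [pow_add, ← mul_assoc, ← le_div_iff₀ (by positivity), div_eq_mul_inv] at hu'
      calc _ ≤ ‖u ℓ‖ * (D * (boundFun r h₁ Q y * (((ℓ : ℝ) + 1) ^ Q * ((1 + y)⁻¹) ^ ℓ))) := by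
            gcongr
            exact hf ℓ y hy0
        _ ≤ ‖u ℓ‖ * (D * (boundFun r h₁ Q y * (((ℓ : ℝ) + 1) ^ Q * 1))) := by gcongr
        _ = D * boundFun r h₁ Q y * (‖u ℓ‖ * ((ℓ : ℝ) + 1) ^ Q) := by ring
        _ ≤ D * boundFun r h₁ Q y * (A * (((ℓ : ℝ) + 1) ^ 2)⁻¹) := by gcongr
        _ = _ := by ring
    rw [tsum_mul_left] at h1
    calc _ ≤ _ := h1
      _ = _ := by ring
  exact ⟨key _ fun ℓ y hy => (hb ℓ y hy).1, key _ fun ℓ y hy => (hb ℓ y hy).2⟩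

/-- The eigenvalue of the operator with coefficients `casimirSeq`. -/
noncomputable def casimirValue (s h : ℝ) : ℝ := h * (h - 1) + s * (1 - s)

theorem PolyBdd.ofReal {c : ℕ → ℝ} (hc : PolyBdd c) : PolyBdd fun n => (c n : ℂ) := by
  obtain ⟨A, P, hA, hP⟩ := hc
  exact ⟨A, P, hA, fun n => by rw [Complex.norm_real]; exact hP n⟩

theorem exists_casimirValue_le (s h₁ : ℝ) :
    ∃ A, 0 ≤ A ∧ ∀ ℓ : ℕ, ‖(casimirValue s (h₁ + ℓ) : ℂ)‖ ≤ A * ((ℓ : ℝ) + 1) ^ 2 := by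
  refine ⟨(|h₁| + 1) ^ 2 + |s * (1 - s)|, by positivity, fun ℓ => ?_⟩
  have hℓ : (0 : ℝ) ≤ ℓ := Nat.cast_nonneg ℓ
  have h0 := abs_nonneg h₁
  rw [Complex.norm_real, Real.norm_eq_abs, casimirValue]
  have h1 : |h₁ + ℓ| ≤ (|h₁| + 1) * (ℓ + 1) := by
    refine (abs_add_le _ _).trans ?_
    rw [abs_of_nonneg hℓ]
    nlinarith
  have h2 : |h₁ + ℓ - 1| ≤ (|h₁| + 1) * (ℓ + 1) := by
    refine (abs_sub _ _).trans ?_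
    rw [abs_one]
    have := abs_add_le h₁ (ℓ : ℝ)
    rw [abs_of_nonneg hℓ] at this
    nlinarith
  have h3 : |s * (1 - s)| ≤ |s * (1 - s)| * ((ℓ : ℝ) + 1) ^ 2 :=
    le_mul_of_one_le_right (abs_nonneg _) (one_le_pow₀ (by linarith))
  calc _ ≤ |h₁ + ℓ| * |h₁ + ℓ - 1| + |s * (1 - s)| := by
        rw [← abs_mul]
        exact abs_add_le _ _
    _ ≤ ((|h₁| + 1) * (ℓ + 1)) * ((|h₁| + 1) * (ℓ + 1)) + |s * (1 - s)| * ((ℓ : ℝ) + 1) ^ 2 := by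
        gcongr
    _ = _ := by ring

theorem polyBdd_casimirValue (s h₁ : ℝ) :
    PolyBdd fun ℓ : ℕ => (casimirValue s (h₁ + ℓ) : ℂ) := by
  obtain ⟨A, hA, hb⟩ := exists_casimirValue_le s h₁
  exact ⟨A, 2, hA, hb⟩

theorem BlockBound.lt (hB : BlockBound r s H C Q) (hh : H ≤ h₁) (ℓ : ℕ) :
    0 < h₁ + ℓ ∧ |r| < h₁ + ℓ ∧ |s| < h₁ + ℓ := by
  have h1 : (0 : ℝ) ≤ ℓ := Nat.cast_nonneg ℓ
  have := hB.one_le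
  have := hB.left_lt
  have := hB.right_lt
  refine ⟨?_, ?_, ?_⟩ <;> linarith

theorem BlockBound.hasSum (hB : BlockBound r s H C Q) (hh : H ≤ h₁) (hu : PolyBdd u) {y : ℝ}
    (hy : 0 < y) :
    HasSum (fun ℓ : ℕ => u ℓ * (normBlock r s (h₁ + ℓ) y : ℂ)) (blockTotal r s h₁ u y) ∧
      HasSum (fun ℓ : ℕ => u ℓ * (normCasimir r s (h₁ + ℓ) y : ℂ)) (casimirTotal r s h₁ u y) :=
  ⟨((hB.locSummable hh hu).1.summable hy).hasSum, ((hB.locSummable hh hu).2.summable hy).hasSum⟩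

theorem continuousOn_inv_Ioi : ContinuousOn (fun y : ℝ => y⁻¹) (Set.Ioi 0) :=
  continuousOn_inv₀.mono fun _ hy => ne_of_gt hy

theorem BlockBound.eulerEq_blockTotal (hB : BlockBound r s H C Q) (hh : H ≤ h₁) (hu : PolyBdd u) :
    EulerEq s (blockTotal r s h₁ u) (casimirTotal r s h₁ u) := by
  intro y hy
  obtain ⟨l1, l2⟩ := hB.locSummable hh hu
  have l3 : LocSummable fun (ℓ : ℕ) (y : ℝ) => y⁻¹ • (u ℓ * (normCasimir r s (h₁ + ℓ) y : ℂ) +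
      (-s) • (u ℓ * (normBlock r s (h₁ + ℓ) y : ℂ))) :=
    LocSummable.smul continuousOn_inv_Ioi (l2.add (LocSummable.smul continuousOn_const l1))
  have h1 := l1.hasDerivAt l3 (fun ℓ y hy => by
    obtain ⟨a1, a2, a3⟩ := hB.lt hh ℓ
    refine ((eulerEq_normBlock a1 a2 a3 hy).ofReal_comp.const_mul (u ℓ)).congr_deriv ?_
    simp only [Complex.real_smul]
    push_cast
    ring) hy
  refine h1.congr_deriv ?_
  obtain ⟨s1, s2⟩ := hB.hasSum hh hu hy
  refine HasSum.tsum_eq ?_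
  simp only [Complex.real_smul]
  have := (s2.add (s1.mul_left ((-s : ℝ) : ℂ))).mul_left ((y⁻¹ : ℝ) : ℂ)
  rwa [show (y : ℂ)⁻¹ * (casimirTotal r s h₁ u y - s * blockTotal r s h₁ u y) =
    ((y⁻¹ : ℝ) : ℂ) * (casimirTotal r s h₁ u y + ((-s : ℝ) : ℂ) * blockTotal r s h₁ u y) by
      push_cast; ring]

theorem BlockBound.eulerEq_casimirTotal (hB : BlockBound r s H C Q) (hh : H ≤ h₁)
    (hu : PolyBdd u) :
    EulerEq r (casimirTotal r s h₁ u) fun y => (y : ℂ) * (((1 + y)⁻¹ : ℝ) *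
      (blockTotal r s h₁ (fun ℓ => casimirValue s (h₁ + ℓ) * u ℓ) y +
        ((r + s - 1 : ℝ) : ℂ) * casimirTotal r s h₁ u y)) := by
  intro y hy
  have hu' : PolyBdd fun ℓ : ℕ => (casimirValue s (h₁ + ℓ) : ℂ) * u ℓ :=
    (polyBdd_casimirValue s h₁).mul hu
  obtain ⟨-, l2⟩ := hB.locSummable hh hu
  obtain ⟨l1, -⟩ := hB.locSummable hh hu'
  have hcont : ContinuousOn (fun y : ℝ => (1 + y)⁻¹) (Set.Ioi 0) :=
    ContinuousOn.inv₀ (by fun_prop) fun y hy => by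
      have : (0 : ℝ) < y := hy
      positivity
  have l3 : LocSummable fun (ℓ : ℕ) (y : ℝ) =>
      (-r * y⁻¹) • (u ℓ * (normCasimir r s (h₁ + ℓ) y : ℂ)) + (1 + y)⁻¹ •
        ((casimirValue s (h₁ + ℓ) : ℂ) * u ℓ * (normBlock r s (h₁ + ℓ) y : ℂ) +
          (r + s - 1) • (u ℓ * (normCasimir r s (h₁ + ℓ) y : ℂ))) :=
    (LocSummable.smul (continuousOn_const.mul continuousOn_inv_Ioi) l2).add
      (LocSummable.smul hcont (l1.add (LocSummable.smul continuousOn_const l2)))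
  have h1 := l2.hasDerivAt l3 (fun ℓ y hy => by
    obtain ⟨a1, a2, a3⟩ := hB.lt hh ℓ
    refine ((eulerEq_normCasimir a1 a2 a3 hy).ofReal_comp.const_mul (u ℓ)).congr_deriv ?_
    have hy1 : (y : ℂ) ≠ 0 := by exact_mod_cast hy.ne'
    have hy2 : (1 + y : ℂ) ≠ 0 := by exact_mod_cast (by linarith : 0 < 1 + y).ne'
    simp only [Complex.real_smul, casimirValue]
    push_cast
    field_simp) hy
  refine h1.congr_deriv ?_
  obtain ⟨-, s2⟩ := hB.hasSum hh hu hy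
  obtain ⟨s1, -⟩ := hB.hasSum hh hu' hy
  simp only [Complex.real_smul]
  have h3 := (s2.mul_left ((-r * y⁻¹ : ℝ) : ℂ)).add
    ((s1.add (s2.mul_left ((r + s - 1 : ℝ) : ℂ))).mul_left (((1 + y)⁻¹ : ℝ) : ℂ))
  refine h3.tsum_eq.trans ?_
  have hy1 : (y : ℂ) ≠ 0 := by exact_mod_cast hy.ne'
  have hy2 : (1 + y : ℂ) ≠ 0 := by exact_mod_cast (by linarith : 0 < 1 + y).ne'
  push_cast
  field_simp
  ring

/-- Sums with coefficients of sufficiently fast decay are Casimir-regular to any given order. -/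
theorem BlockBound.exists_decay_mem (hB : BlockBound r s H C Q) (N : ℝ) :
    ∃ N' : ℕ, ∀ h₁ ≥ H, ∀ u : ℕ → ℂ, (∃ A, ∀ ℓ : ℕ, ‖u ℓ‖ * ((ℓ : ℝ) + 1) ^ N' ≤ A) →
      blockTotal r s h₁ u ∈ expClass (regSet r s) N := by
  set B : ℝ := r + (Q + 1 : ℕ) with hBdef
  obtain ⟨K, hK⟩ := exists_nat_ge (2 * (N + B))
  -- Each of the K applications of the Casimir operator costs two powers of ℓ. The remaining Q+2
  -- compensate the growth of the blocks and leave a summable ℓ^{-2}.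
  refine ⟨2 * K + (Q + 2), fun h₁ hh u ⟨A, hA⟩ => ?_⟩
  obtain ⟨A₀, hA₀, hP⟩ := exists_casimirValue_le s h₁
  have hA0 : 0 ≤ A := le_trans (by positivity) (hA 0)
  have hdec : ∀ k ≤ K, ∀ ℓ : ℕ, ‖(casimirValue s (h₁ + ℓ) : ℂ) ^ k * u ℓ‖ *
      ((ℓ : ℝ) + 1) ^ (Q + 2) ≤ A₀ ^ k * A := by
    intro k hk ℓ
    have h1 : (1 : ℝ) ≤ (ℓ : ℝ) + 1 := by linarith [Nat.cast_nonneg (α := ℝ) ℓ]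
    rw [norm_mul, norm_pow]
    calc _ ≤ (A₀ * ((ℓ : ℝ) + 1) ^ 2) ^ k * ‖u ℓ‖ * ((ℓ : ℝ) + 1) ^ (Q + 2) := by
          gcongr
          exact hP ℓ
      _ = A₀ ^ k * (‖u ℓ‖ * ((ℓ : ℝ) + 1) ^ (2 * k + (Q + 2))) := by
          rw [mul_pow, ← pow_mul, pow_add]; ring
      _ ≤ A₀ ^ k * (‖u ℓ‖ * ((ℓ : ℝ) + 1) ^ (2 * K + (Q + 2))) := by gcongr
      _ ≤ _ := by
          gcongr
          exact hA ℓ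
  have hpoly : ∀ k ≤ K, PolyBdd fun ℓ : ℕ => (casimirValue s (h₁ + ℓ) : ℂ) ^ k * u ℓ := by
    intro k hk
    refine ⟨A₀ ^ k * A, 0, by positivity, fun ℓ => ?_⟩
    rw [pow_zero, mul_one]
    refine le_trans ?_ (hdec k hk ℓ)
    have h1 : (1 : ℝ) ≤ (ℓ : ℝ) + 1 := by linarith [Nat.cast_nonneg (α := ℝ) ℓ]
    exact le_mul_of_one_le_right (norm_nonneg _) (one_le_pow₀ h1)
  have h1 := mem_expClass_of_chain (r := r) (s := s) (β := r + s - 1) (B := B) (K := K)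
    (Φ := fun k => blockTotal r s h₁ fun ℓ => (casimirValue s (h₁ + ℓ) : ℂ) ^ k * u ℓ)
    (X := fun k => casimirTotal r s h₁ fun ℓ => (casimirValue s (h₁ + ℓ) : ℂ) ^ k * u ℓ)
    (fun k hk => hB.eulerEq_blockTotal hh (hpoly k hk.le)) (fun k hk => ?_)
    (fun k hk => (hB.isBigO_of_decay hh (hdec k hk)).1)
    (fun k hk => (hB.isBigO_of_decay hh (hdec k hk)).2)
  · simp only [pow_zero, one_mul] at h1
    exact expClass_mono le_rfl (by linarith) h1.1
  · have := hB.eulerEq_casimirTotal hh (hpoly k hk.le)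
    simp only [← mul_assoc, ← pow_succ'] at this ⊢
    exact this

end Total

/-! ### Sampling a function on a lattice of weights -/

theorem tendsto_add_natCast_atTop (h₁ : ℝ) : Tendsto (fun ℓ : ℕ => h₁ + ℓ) atTop atTop :=
  tendsto_atTop_add_const_left _ _ tendsto_natCast_atTop_atTop

theorem isBigO_add_natCast (h₁ : ℝ) :
    (fun ℓ : ℕ => h₁ + ℓ) =O[atTop] (fun ℓ : ℕ => (ℓ : ℝ) + 1) ∧
      (fun ℓ : ℕ => (ℓ : ℝ) + 1) =O[atTop] fun ℓ : ℕ => h₁ + ℓ := by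
  have h := tendsto_add_const_div (1 - h₁)
  have h2 : Tendsto (fun ℓ : ℕ => ((ℓ : ℝ) + 1) / (h₁ + ℓ)) atTop (𝓝 1) := by
    refine (h.comp (tendsto_add_natCast_atTop h₁)).congr fun ℓ => ?_
    simp only [Function.comp]
    congr 1
    ring
  have hne : ∀ᶠ ℓ : ℕ in atTop, h₁ + (ℓ : ℝ) ≠ 0 :=
    ((tendsto_add_natCast_atTop h₁).eventually_gt_atTop 0).mono fun _ h => h.ne'
  have he := (isEquivalent_iff_tendsto_one hne).2 h2
  exact ⟨he.symm.isBigO, he.isBigO⟩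

theorem polyBdd_of_isBigO {f : ℝ → ℂ} {P : ℕ} (hf : f =O[atTop] fun h : ℝ => h ^ P) (h₁ : ℝ) :
    PolyBdd fun ℓ : ℕ => f (h₁ + ℓ) := by
  have h1 := (hf.comp_tendsto (tendsto_add_natCast_atTop h₁)).trans
    ((isBigO_add_natCast h₁).1.pow P)
  obtain ⟨C, hC, hb⟩ := bound_of_isBigO_nat_atTop h1
  refine ⟨C, P, hC.le, fun ℓ => ?_⟩
  have h0 : (0 : ℝ) < ((ℓ : ℝ) + 1) ^ P := by positivity
  have := hb (x := ℓ) h0.ne'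
  rwa [Real.norm_of_nonneg h0.le] at this

theorem exists_decay_of_isBigO {f : ℝ → ℂ} {N : ℕ} (hf : f =O[atTop] fun h : ℝ => (h ^ N)⁻¹)
    (h₁ : ℝ) : ∃ A, ∀ ℓ : ℕ, ‖f (h₁ + ℓ)‖ * ((ℓ : ℝ) + 1) ^ N ≤ A := by
  have h2 : (fun ℓ : ℕ => ((h₁ + ℓ) ^ N)⁻¹) =O[atTop] fun ℓ : ℕ => (((ℓ : ℝ) + 1) ^ N)⁻¹ := by
    refine ((isBigO_add_natCast h₁).2.pow N).inv_rev (Eventually.of_forall fun ℓ h => ?_)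
    exact absurd h (by positivity)
  have h1 := (hf.comp_tendsto (tendsto_add_natCast_atTop h₁)).trans h2
  obtain ⟨C, hC, hb⟩ := bound_of_isBigO_nat_atTop h1
  refine ⟨C, fun ℓ => ?_⟩
  have h0 : (0 : ℝ) < ((ℓ : ℝ) + 1) ^ N := by positivity
  have := hb (x := ℓ) (inv_pos.2 h0).ne'
  rwa [Real.norm_of_nonneg (inv_pos.2 h0).le, ← div_eq_mul_inv, le_div_iff₀ h0] at this

/-! ### Sums with the coefficients `T_e(h)` -/

theorem inv_Gamma_rec (x : ℝ) : (Real.Gamma x)⁻¹ = x * (Real.Gamma (x + 1))⁻¹ := by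
  rcases eq_or_ne x 0 with rfl | hx
  · simp
  · rw [Real.Gamma_add_one hx, mul_inv, mul_inv_cancel_left₀ hx]

theorem gammaQuot_sub_one' {e h : ℝ} (h1 : e + 1 < h) :
    gammaQuot (e - 1) h = (h - e - 1) * (h + e) * gammaQuot e h := by
  unfold gammaQuot
  rw [div_eq_mul_inv, div_eq_mul_inv, show h - (e - 1) - 1 = (h - e - 1) + 1 by ring,
    Real.Gamma_add_one (by linarith), show h + (e - 1) + 1 = h + e by ring, inv_Gamma_rec (h + e)]
  ring

/-- `∑_{h ∈ h₁ + ℕ} T_e(h) (2h - 1) G_h(y)`. -/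
noncomputable def quotSum (r s h₁ e y : ℝ) : ℝ :=
  ∑' ℓ : ℕ, gammaQuot e (h₁ + ℓ) * (2 * (h₁ + ℓ) - 1) * normBlock r s (h₁ + ℓ) y

/-- The coefficients of `quotSum`. -/
noncomputable def quotSeq (h₁ e : ℝ) (ℓ : ℕ) : ℂ :=
  ((gammaQuot e (h₁ + ℓ) * (2 * (h₁ + ℓ) - 1) : ℝ) : ℂ)

theorem ofReal_quotSum (r s h₁ e y : ℝ) :
    (quotSum r s h₁ e y : ℂ) = blockTotal r s h₁ (quotSeq h₁ e) y := by
  unfold quotSum blockTotal quotSeq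
  rw [Complex.ofReal_tsum]
  push_cast
  rfl

theorem exists_gammaQuot_isBigO (e : ℝ) :
    ∃ P : ℕ, (fun h => (gammaQuot e h : ℂ)) =O[atTop] fun h : ℝ => h ^ P := by
  obtain ⟨P, hP⟩ := exists_nat_ge (-(2 * e + 2))
  exact ⟨P, isBigO_ofReal_left.2 ((gammaQuot_isBigO e).trans (rpow_isBigO_natPow hP))⟩

theorem polyBdd_gammaQuot (h₁ e : ℝ) : PolyBdd fun ℓ : ℕ => (gammaQuot e (h₁ + ℓ) : ℂ) := by
  obtain ⟨P, hP⟩ := exists_gammaQuot_isBigO e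
  exact polyBdd_of_isBigO hP h₁

theorem polyBdd_linear (a b h₁ : ℝ) : PolyBdd fun ℓ : ℕ => ((a * (h₁ + ℓ) + b : ℝ) : ℂ) :=
  PolyBdd.ofReal (((polyBdd_const a).mul (polyBdd_add_natCast h₁)).add (polyBdd_const b))

theorem polyBdd_quotSeq (h₁ e : ℝ) : PolyBdd (quotSeq h₁ e) := by
  have := (polyBdd_gammaQuot h₁ e).mul (polyBdd_linear 2 (-1) h₁)
  refine (funext fun ℓ => ?_ : quotSeq h₁ e = _) ▸ this
  unfold quotSeq
  push_cast
  ring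

/-- The boundary term in the first-order equation of `quotSum`. -/
noncomputable def quotBdry (r s h e y : ℝ) : ℝ :=
  gammaQuot e h * (h + e) * ((h - 1 + s) * normBlock r s h y - normCasimir r s h y)

/-- `(y ∂_y + r)` of `quotBdry`. -/
noncomputable def quotBdryDeriv (r s h e y : ℝ) : ℝ :=
  gammaQuot e h * (h + e) * ((h - 1 + s) * (normCasimir r s h y + (r - s) * normBlock r s h y) -
    y * ((1 + y)⁻¹ * (casimirValue s h * normBlock r s h y + (r + s - 1) * normCasimir r s h y)))

section

variable {r s H C h₁ e : ℝ} {Q : ℕ}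

/-- The contiguous relation multiplied by T_e(h), with (h+1+e) T_e(h+1) = (h-e-1) T_e(h), makes the
action of e - y∂_y on each summand a difference of consecutive boundary terms. -/
theorem BlockBound.quotBdry_succ (hB : BlockBound r s H C Q) {h : ℝ} (hh : H ≤ h) (he : e + 1 < h)
    {y : ℝ} (hy : 0 < y) :
    gammaQuot e h * (2 * h - 1) * ((e + s) * normBlock r s h y - normCasimir r s h y) =
      quotBdry r s h e y - quotBdry r s (h + 1) e y := by
  obtain ⟨a1, a2, a3⟩ := hB.lt hh 0
  simp only [Nat.cast_zero, add_zero] at a1 a2 a3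
  have hc := normBlock_contiguous a1 a2 a3 hy
  have e1 : gammaQuot e (h + 1) * (h + 1 + e) = (h - e - 1) * gammaQuot e h := by
    unfold gammaQuot
    rw [div_mul_eq_mul_div, div_eq_mul_inv, div_eq_mul_inv,
      show h + 1 - e - 1 = (h - e - 1) + 1 by ring, Real.Gamma_add_one (by linarith),
      show h + 1 + e + 1 = h + e + 1 + 1 by ring, inv_Gamma_rec (h + e + 1)]
    ring
  unfold quotBdry
  rw [e1, show h + 1 - 1 + s = h + s by ring, ← hc]
  ring

/-- The sum over h telescopes. The boundary term at infinity vanishes because it is a combination of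
terms of convergent series. -/
theorem BlockBound.casimirTotal_quotSeq (hB : BlockBound r s H C Q) (hh : H ≤ h₁)
    (he : e + 1 < h₁) {y : ℝ} (hy : 0 < y) :
    casimirTotal r s h₁ (quotSeq h₁ e) y =
      (e + s) * blockTotal r s h₁ (quotSeq h₁ e) y - (quotBdry r s h₁ e y : ℂ) := by
  obtain ⟨s1, s2⟩ := hB.hasSum hh (polyBdd_quotSeq h₁ e) hy
  have h1 := (s1.mul_left (e + s : ℂ)).sub s2
  have hterm : ∀ ℓ : ℕ, (e + s : ℂ) * (quotSeq h₁ e ℓ * (normBlock r s (h₁ + ℓ) y : ℂ)) -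
      quotSeq h₁ e ℓ * (normCasimir r s (h₁ + ℓ) y : ℂ) =
      (quotBdry r s (h₁ + ℓ) e y : ℂ) - (quotBdry r s (h₁ + (ℓ + 1 : ℕ)) e y : ℂ) := by
    intro ℓ
    have hℓ : (0 : ℝ) ≤ ℓ := Nat.cast_nonneg ℓ
    have := hB.quotBdry_succ (h := h₁ + ℓ) (e := e) (by linarith) (by linarith) hy
    push_cast
    rw [← add_assoc]
    rw [← Complex.ofReal_sub, ← this, quotSeq]
    push_cast
    ring
  have hlim : Tendsto (fun ℓ : ℕ => (quotBdry r s (h₁ + ℓ) e y : ℂ)) atTop (𝓝 0) := by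
    have p1 := ((polyBdd_gammaQuot h₁ e).mul (polyBdd_linear 1 e h₁)).mul
      (polyBdd_linear 1 (s - 1) h₁)
    have p2 := (polyBdd_gammaQuot h₁ e).mul (polyBdd_linear 1 e h₁)
    have t1 := ((hB.hasSum hh p1 hy).1.summable.sub
      (hB.hasSum hh p2 hy).2.summable).tendsto_atTop_zero
    refine t1.congr fun ℓ => ?_
    unfold quotBdry
    push_cast
    ring
  have h2 := HasSum.tendsto_sum_nat h1
  simp only [hterm, Finset.sum_range_sub'] at h2
  have h3 := tendsto_nhds_unique h2 (tendsto_const_nhds.sub hlim)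
  simp only [Nat.cast_zero, add_zero, sub_zero] at h3
  rw [← h3]
  ring

theorem BlockBound.eulerEq_quotSum (hB : BlockBound r s H C Q) (hh : H ≤ h₁) (he : e + 1 < h₁) :
    EulerEq (-e) (fun y => (quotSum r s h₁ e y : ℂ)) fun y => -(quotBdry r s h₁ e y : ℂ) := by
  intro y hy
  simp only [ofReal_quotSum]
  refine (hB.eulerEq_blockTotal hh (polyBdd_quotSeq h₁ e) y hy).congr_deriv ?_
  rw [hB.casimirTotal_quotSeq hh he hy]
  push_cast
  ring

theorem BlockBound.eulerEq_quotBdry (hB : BlockBound r s H C Q) (hh : H ≤ h₁) :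
    EulerEq r (fun y => (quotBdry r s h₁ e y : ℂ)) fun y => (quotBdryDeriv r s h₁ e y : ℂ) := by
  obtain ⟨a1, a2, a3⟩ := hB.lt hh 0
  simp only [Nat.cast_zero, add_zero] at a1 a2 a3
  refine EulerEq.of_real fun y hy => ?_
  refine ((((eulerEq_normBlock a1 a2 a3 hy).const_mul (h₁ - 1 + s)).sub
    (eulerEq_normCasimir a1 a2 a3 hy)).const_mul (gammaQuot e h₁ * (h₁ + e))).congr_deriv ?_
  unfold quotBdryDeriv quotBdry casimirValue
  field_simp
  ring

theorem IsRegular.const_mul {u : ℝ → ℂ} (hu : IsRegular r s u) (a : ℂ) :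
    IsRegular r s fun y => a * u y := fun M => Submodule.smul_mem _ a (hu M)

theorem IsRegular.add {u v : ℝ → ℂ} (hu : IsRegular r s u) (hv : IsRegular r s v) :
    IsRegular r s fun y => u y + v y := fun M => add_mem (hu M) (hv M)

theorem IsRegular.sub {u v : ℝ → ℂ} (hu : IsRegular r s u) (hv : IsRegular r s v) :
    IsRegular r s fun y => u y - v y := fun M => sub_mem (hu M) (hv M)

theorem IsRegular.congr {u v : ℝ → ℂ} (hu : IsRegular r s u) (h : ∀ y > 0, v y = u y) :
    IsRegular r s v := fun M => expClass_congr (hu M) h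

theorem mul_mem_regClass {u : ℝ → ℂ} {M : ℝ} (hu : u ∈ expClass (regSet r s) M) :
    (fun y : ℝ => (y : ℂ) * u y) ∈ expClass (regSet r s) (M + 1) :=
  expClass_mono (shiftSet_regSet_subset r s) le_rfl (mul_mem_expClass hu)

theorem IsRegular.id_mul {u : ℝ → ℂ} (hu : IsRegular r s u) :
    IsRegular r s fun y => (y : ℂ) * u y := fun M =>
  expClass_mono le_rfl (by linarith) (mul_mem_regClass (hu M))

theorem IsRegular.inv_one_add_mul {u : ℝ → ℂ} (hu : IsRegular r s u) :
    IsRegular r s fun y => (((1 + y)⁻¹ : ℝ) : ℂ) * u y := fun M =>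
  inv_one_add_mul_mem_expClass (fun _ hk => regSet_succ hk) (hu M)

theorem BlockBound.isRegular_quotBdry (hB : BlockBound r s H C Q) (hh : H ≤ h₁) :
    IsRegular r s (fun y => (quotBdry r s h₁ e y : ℂ)) ∧
      IsRegular r s fun y => (quotBdryDeriv r s h₁ e y : ℂ) := by
  obtain ⟨a1, a2, a3⟩ := hB.lt hh 0
  simp only [Nat.cast_zero, add_zero] at a1 a2 a3
  obtain ⟨g1, g2⟩ := isRegular_normBlock a1 a2 a3
  constructor
  · refine (((g1.const_mul (h₁ - 1 + s)).sub g2).const_mul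
      (gammaQuot e h₁ * (h₁ + e))).congr fun y _ => ?_
    unfold quotBdry
    push_cast
    ring
  · refine ((((g2.add (g1.const_mul (r - s))).const_mul (h₁ - 1 + s)).sub
      ((g1.const_mul (casimirValue s h₁)).add
        (g2.const_mul (r + s - 1))).inv_one_add_mul.id_mul).const_mul
      (gammaQuot e h₁ * (h₁ + e))).congr fun y _ => ?_
    unfold quotBdryDeriv
    push_cast
    ring

/-- The eigenvalue splits as h(h-1)+s(1-s) = (h-e-1)(h+e) + (e+s)(e+1-s), and the first product
turns T_e into T_{e-1}. -/
theorem BlockBound.blockTotal_casimirValue (hB : BlockBound r s H C Q) (hh : H ≤ h₁)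
    (he : e + 1 < h₁) {y : ℝ} (hy : 0 < y) :
    blockTotal r s h₁ (fun ℓ => casimirValue s (h₁ + ℓ) * quotSeq h₁ e ℓ) y =
      blockTotal r s h₁ (quotSeq h₁ (e - 1)) y +
        (e + s) * (e + 1 - s) * blockTotal r s h₁ (quotSeq h₁ e) y := by
  have s1 := (hB.hasSum hh (polyBdd_quotSeq h₁ e) hy).1
  have s2 := (hB.hasSum hh (polyBdd_quotSeq h₁ (e - 1)) hy).1
  refine Eq.trans (tsum_congr fun ℓ => ?_) (s2.add (s1.mul_left ((e + s) * (e + 1 - s) : ℂ))).tsum_eq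
  have hℓ : (0 : ℝ) ≤ ℓ := Nat.cast_nonneg ℓ
  simp only [quotSeq, casimirValue]
  rw [gammaQuot_sub_one' (by linarith : e + 1 < h₁ + ℓ)]
  push_cast
  ring

/-- The recursion in `e` that follows from the Casimir equation. -/
theorem BlockBound.quotSum_rec (hB : BlockBound r s H C Q) (hh : H ≤ h₁) (he : e + 1 < h₁)
    {y : ℝ} (hy : 0 < y) :
    (e + r) * (e + s) * quotSum r s h₁ e y = y * quotSum r s h₁ (e - 1) y +
      ((1 + y) * ((e + s) * quotBdry r s h₁ e y + quotBdryDeriv r s h₁ e y) -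
        y * ((r + s - 1) * quotBdry r s h₁ e y)) := by
  have hu := polyBdd_quotSeq h₁ e
  have d1 := hB.eulerEq_casimirTotal hh hu y hy
  have d2 := ((hB.eulerEq_quotSum hh he y hy).const_mul (e + s : ℂ)).sub
    (hB.eulerEq_quotBdry (e := e) hh y hy)
  have heq : casimirTotal r s h₁ (quotSeq h₁ e) =ᶠ[𝓝 y] fun y =>
      (e + s : ℂ) * (quotSum r s h₁ e y : ℂ) - (quotBdry r s h₁ e y : ℂ) := by
    filter_upwards [lt_mem_nhds hy] with x hx
    rw [hB.casimirTotal_quotSeq hh he hx, ofReal_quotSum]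
  -- The derivative of (y∂_y + s)F_e is computed once from the Casimir equation and once from the
  -- telescoped first-order equation; equating the two is the recursion.
  have h1 := d1.unique (d2.congr_of_eventuallyEq heq)
  beta_reduce at h1
  rw [hB.casimirTotal_quotSeq hh he hy, hB.blockTotal_casimirValue hh he hy,
    ← ofReal_quotSum, ← ofReal_quotSum] at h1
  have hy1 : (y : ℂ) ≠ 0 := by exact_mod_cast hy.ne'
  have hy2 : (1 + y : ℂ) ≠ 0 := by exact_mod_cast (by linarith : 0 < 1 + y).ne'
  have h2 : ((e + r) * (e + s) * quotSum r s h₁ e y : ℂ) = y * quotSum r s h₁ (e - 1) y +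
      ((1 + y) * ((e + s) * quotBdry r s h₁ e y + quotBdryDeriv r s h₁ e y) -
        y * ((r + s - 1) * quotBdry r s h₁ e y)) := by
    push_cast at h1
    field_simp at h1
    linear_combination -h1
  exact_mod_cast h2

/-- `(e + r) (e + s) F_e = y F_{e-1}` up to Casimir-regular terms. -/
theorem BlockBound.isRegular_quotSum_sub (hB : BlockBound r s H C Q) (hh : H ≤ h₁)
    (he : e + 1 < h₁) :
    IsRegular r s fun y => ((e + r) * (e + s) : ℂ) * (quotSum r s h₁ e y : ℂ) -
      (y : ℂ) * (quotSum r s h₁ (e - 1) y : ℂ) := by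
  obtain ⟨b1, b2⟩ := hB.isRegular_quotBdry (e := e) hh
  have h1 := (b1.const_mul (e + s)).add b2
  refine ((h1.add h1.id_mul).sub (b1.const_mul (r + s - 1)).id_mul).congr fun y hy => ?_
  have := congrArg (fun x : ℝ => (x : ℂ)) (hB.quotSum_rec hh he hy)
  push_cast at this ⊢
  rw [this]
  ring

theorem BlockBound.quotSum_step (hB : BlockBound r s H C Q) (hh : H ≤ h₁)
    (he : e + 1 < h₁) (hr : e + r ≠ 0) (hs : e + s ≠ 0) {f : ℝ → ℂ} {M : ℝ}
    (hf : (fun y => (quotSum r s h₁ (e - 1) y : ℂ) - f y) ∈ expClass (regSet r s) M) :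
    (fun y => (quotSum r s h₁ e y : ℂ) - (y : ℂ) * f y / ((e + r) * (e + s) : ℂ)) ∈
      expClass (regSet r s) (M + 1) := by
  have hr' : (e + r : ℂ) ≠ 0 := by exact_mod_cast hr
  have hs' : (e + s : ℂ) ≠ 0 := by exact_mod_cast hs
  have h1 := add_mem (hB.isRegular_quotSum_sub hh he (M + 1)) (mul_mem_regClass hf)
  refine expClass_congr (Submodule.smul_mem _ ((e + r) * (e + s) : ℂ)⁻¹ h1) fun y _ => ?_
  simp only [Pi.smul_apply, Pi.add_apply, smul_eq_mul]
  field_simp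
  ring

end

/-! ### The leading coefficient of the sums `quotSum` -/

section

variable {r s H C h₁ e : ℝ} {Q : ℕ}

/-- No Casimir-regular exponent lies below -(|r|+|s|). For e under this threshold the term y^e
dominates all regular terms, so its coefficient is a limit. -/
theorem IsRegular.isBigO {u : ℝ → ℂ} (hu : IsRegular r s u) :
    u =O[𝓝[>] 0] fun y : ℝ => y ^ (-(|r| + |s| + 1)) := by
  have h1 : expClass (regSet r s) (-(|r| + |s| + 1)) ≤ bigOClass (-(|r| + |s| + 1)) := by
    refine sup_le (Submodule.span_le.2 ?_) le_rfl
    rintro _ ⟨k, hk, rfl⟩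
    refine isBigO_powLog ?_
    have key : ∀ {x : ℝ}, |x| ≤ |r| + |s| → (∃ n : ℕ, k.1 = n - x) → -(|r| + |s| + 1) < k.1 := by
      rintro x hx ⟨n, hn⟩
      rw [hn]
      linarith [le_abs_self x, Nat.cast_nonneg (α := ℝ) n]
    have hr : |r| ≤ |r| + |s| := by linarith [abs_nonneg s]
    have hs : |s| ≤ |r| + |s| := by linarith [abs_nonneg r]
    rcases hk with ⟨-, h | h⟩ | ⟨-, h, -⟩
    exacts [key hr h, key hs h, key hr h]
  exact h1 (hu _)

/-- `c` is the coefficient of `y^e` in the sum with coefficients `T_e(h) (2h - 1)`. -/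
def HasLead (r s h₁ e c : ℝ) : Prop :=
  Tendsto (fun y : ℝ => y ^ (-e) * quotSum r s h₁ e y) (𝓝[>] 0) (𝓝 c)

theorem rpow_neg_mul_tendsto_zero {u : ℝ → ℂ} {M : ℝ} (hu : u =O[𝓝[>] 0] fun y : ℝ => y ^ M)
    (he : e < M) : Tendsto (fun y : ℝ => ((y ^ (-e) : ℝ) : ℂ) * u y) (𝓝[>] 0) (𝓝 0) := by
  have h1 : (fun y : ℝ => ((y ^ (-e) : ℝ) : ℂ) * u y) =O[𝓝[>] 0] fun y : ℝ => y ^ (M - e) := by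
    refine ((isBigO_ofReal_left.2 (isBigO_refl (fun y : ℝ => y ^ (-e)) _)).mul hu).congr'
      EventuallyEq.rfl ?_
    filter_upwards [self_mem_nhdsWithin] with y hy
    rw [← Real.rpow_add hy]
    congr 1
    ring
  refine h1.trans_tendsto ?_
  have h2 : Tendsto (fun y : ℝ => y ^ (M - e)) (𝓝 0) (𝓝 (0 ^ (M - e))) :=
    (Real.continuousAt_rpow_const 0 (M - e) (Or.inr (by linarith))).tendsto
  rw [Real.zero_rpow (by linarith)] at h2
  exact h2.mono_left nhdsWithin_le_nhds

theorem BlockBound.exists_isBigO_lead (hB : BlockBound r s H C Q) (hh : H ≤ h₁)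
    (he : e < -(|r| + |s| + 1)) :
    ∃ c : ℂ, (fun y => (quotSum r s h₁ e y : ℂ) - c * powLog (e, 0) y) =O[𝓝[>] 0]
      fun y : ℝ => y ^ (-(|r| + |s| + 1)) := by
  have he1 : e + 1 < h₁ := by linarith [hB.one_le, abs_nonneg r, abs_nonneg s]
  have := exists_isBigO_of_euler (c := -e) (M := -(|r| + |s| + 1)) (by linarith)
    (hB.eulerEq_quotSum hh he1) (hB.isRegular_quotBdry hh).1.isBigO.neg_left
  simpa using this

theorem hasLead_of_isBigO (he : e < -(|r| + |s| + 1)) {c : ℂ}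
    (hc : (fun y => (quotSum r s h₁ e y : ℂ) - c * powLog (e, 0) y) =O[𝓝[>] 0]
      fun y : ℝ => y ^ (-(|r| + |s| + 1))) :
    Tendsto (fun y : ℝ => ((y ^ (-e) * quotSum r s h₁ e y : ℝ) : ℂ)) (𝓝[>] 0) (𝓝 c) := by
  have h1 := (rpow_neg_mul_tendsto_zero hc he).add_const c
  rw [zero_add] at h1
  refine h1.congr' ?_
  filter_upwards [self_mem_nhdsWithin] with y hy
  have hy0 : (0 : ℝ) < y := hy
  have e1 : ((y ^ (-e) : ℝ) : ℂ) * powLog (e, 0) y = 1 := by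
    rw [powLog, ← Complex.ofReal_mul]
    simp only [pow_zero, mul_one]
    rw [← Real.rpow_add hy0, neg_add_cancel, Real.rpow_zero, Complex.ofReal_one]
  rw [mul_sub, mul_left_comm, e1]
  push_cast
  ring

theorem BlockBound.exists_hasLead (hB : BlockBound r s H C Q) (hh : H ≤ h₁)
    (he : e < -(|r| + |s| + 1)) : ∃ c, HasLead r s h₁ e c := by
  obtain ⟨c, hc⟩ := hB.exists_isBigO_lead hh he
  exact ⟨c.re, (Complex.continuous_re.tendsto c).comp (hasLead_of_isBigO he hc)⟩

theorem HasLead.isBigO {c : ℝ} (h : HasLead r s h₁ e c) (hB : BlockBound r s H C Q) (hh : H ≤ h₁)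
    (he : e < -(|r| + |s| + 1)) :
    (fun y => (quotSum r s h₁ e y : ℂ) - c * powLog (e, 0) y) =O[𝓝[>] 0]
      fun y : ℝ => y ^ (-(|r| + |s| + 1)) := by
  obtain ⟨c', hc'⟩ := hB.exists_isBigO_lead hh he
  have h1 := tendsto_nhds_unique (hasLead_of_isBigO he hc')
    ((Complex.continuous_ofReal.tendsto c).comp h)
  rwa [← h1]

theorem HasLead.unique {c c' : ℝ} (h : HasLead r s h₁ e c) (h' : HasLead r s h₁ e c') : c = c' :=
  tendsto_nhds_unique h h'

theorem IsRegular.rpow_neg_mul_tendsto_zero {f : ℝ → ℝ} (hf : IsRegular r s fun y => (f y : ℂ))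
    (he : e < -(|r| + |s| + 1)) : Tendsto (fun y : ℝ => y ^ (-e) * f y) (𝓝[>] 0) (𝓝 0) := by
  have := (Complex.continuous_re.tendsto 0).comp
    (BoxDiagram.rpow_neg_mul_tendsto_zero hf.isBigO he)
  refine this.congr fun y => ?_
  simp only [Function.comp, ← Complex.ofReal_mul, Complex.ofReal_re]

theorem BlockBound.summable_quotSum (hB : BlockBound r s H C Q) (hh : H ≤ h₁) (e : ℝ) {y : ℝ}
    (hy : 0 < y) : Summable fun ℓ : ℕ =>
      gammaQuot e (h₁ + ℓ) * (2 * (h₁ + ℓ) - 1) * normBlock r s (h₁ + ℓ) y := by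
  have := (hB.hasSum hh (polyBdd_quotSeq h₁ e) hy).1.summable
  refine Complex.summable_ofReal.1 (this.congr fun ℓ => ?_)
  simp only [quotSeq]
  push_cast
  ring

theorem BlockBound.quotSum_eq_add (hB : BlockBound r s H C Q) (hh : H ≤ h₁) (e : ℝ) {y : ℝ}
    (hy : 0 < y) : quotSum r s h₁ e y =
      gammaQuot e h₁ * (2 * h₁ - 1) * normBlock r s h₁ y + quotSum r s (h₁ + 1) e y := by
  unfold quotSum
  rw [(hB.summable_quotSum hh e hy).tsum_eq_zero_add]
  simp only [Nat.cast_zero, add_zero, Nat.cast_add, Nat.cast_one]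
  congr 2
  funext ℓ
  rw [show h₁ + (ℓ + 1 : ℝ) = h₁ + 1 + ℓ by ring]

/-- The sums differ by one block, which is Casimir-regular and hence negligible against y^e. The
leading coefficient is therefore independent of the starting weight. -/
theorem BlockBound.hasLead_add_one (hB : BlockBound r s H C Q) (hh : H ≤ h₁)
    (he : e < -(|r| + |s| + 1)) {c : ℝ} : HasLead r s (h₁ + 1) e c ↔ HasLead r s h₁ e c := by
  obtain ⟨a1, a2, a3⟩ := hB.lt hh 0
  simp only [Nat.cast_zero, add_zero] at a1 a2 a3
  have h0 := ((isRegular_normBlock a1 a2 a3).1.rpow_neg_mul_tendsto_zero he).const_mul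
    (gammaQuot e h₁ * (2 * h₁ - 1))
  rw [mul_zero] at h0
  have hkey : ∀ᶠ y : ℝ in 𝓝[>] 0, y ^ (-e) * quotSum r s h₁ e y =
      gammaQuot e h₁ * (2 * h₁ - 1) * (y ^ (-e) * normBlock r s h₁ y) +
        y ^ (-e) * quotSum r s (h₁ + 1) e y := by
    filter_upwards [self_mem_nhdsWithin] with y hy
    rw [hB.quotSum_eq_add hh e hy]
    ring
  constructor
  · intro h
    have := h0.add h
    rw [zero_add] at this
    exact this.congr' (hkey.mono fun y hy => hy.symm)
  · intro h
    have := Tendsto.sub h h0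
    rw [sub_zero] at this
    refine this.congr' ?_
    filter_upwards [hkey] with y hy
    rw [hy]
    ring

theorem BlockBound.hasLead_add_nat (hB : BlockBound r s H C Q) (hh : H ≤ h₁)
    (he : e < -(|r| + |s| + 1)) {c : ℝ} (k : ℕ) :
    HasLead r s (h₁ + k) e c ↔ HasLead r s h₁ e c := by
  induction k with
  | zero => simp
  | succ k ih =>
    rw [← ih, ← hB.hasLead_add_one (by linarith [Nat.cast_nonneg (α := ℝ) k] : H ≤ h₁ + k) he]
    push_cast
    rw [add_assoc]

theorem HasLead.sub_one {c : ℝ} (h : HasLead r s h₁ e c) (hB : BlockBound r s H C Q) (hh : H ≤ h₁)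
    (he : e < -(|r| + |s| + 1)) : HasLead r s h₁ (e - 1) ((e + r) * (e + s) * c) := by
  have he1 : e + 1 < h₁ := by linarith [hB.one_le, abs_nonneg r, abs_nonneg s]
  have hreg := hB.isRegular_quotSum_sub hh he1
  have hreg' : IsRegular r s fun y => (((e + r) * (e + s) * quotSum r s h₁ e y -
      y * quotSum r s h₁ (e - 1) y : ℝ) : ℂ) := by
    refine hreg.congr fun y _ => ?_
    push_cast
    ring
  have h1 := (Tendsto.const_mul ((e + r) * (e + s)) h).sub (hreg'.rpow_neg_mul_tendsto_zero he)
  rw [sub_zero] at h1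
  refine h1.congr' ?_
  filter_upwards [self_mem_nhdsWithin] with y hy
  rw [show -(e - 1) = -e + 1 by ring, Real.rpow_add_one (ne_of_gt hy)]
  ring

/-- A log-convexity estimate in e that is linear and so can be summed over h. Wendel bounds T_{e-λ}
by X^λ T_e with X = (h-e-1)(h+e+1-λ), weighted AM–GM with a free parameter μ linearises X^λ, and X
T_e is nearly T_{e-1}. -/
theorem gammaQuot_sub_le {h lam η μ : ℝ} (hlam : 0 ≤ lam) (hlam1 : lam ≤ 1) (he : e < -1)
    (h1 : 0 < h + e) (hη : 1 ≤ η * (h + e)) (hη0 : 0 ≤ η) (hμ : 0 < μ) :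
    gammaQuot (e - lam) h ≤ (1 - lam) * μ ^ lam * gammaQuot e h +
      lam * μ ^ (lam - 1) * ((1 + η) * gammaQuot (e - 1) h) := by
  have hp : 0 < h - e - 1 := by linarith
  have hq : 0 < h + e + 1 - lam := by linarith
  have hT : 0 < gammaQuot e h := gammaQuot_pos (by linarith) (by linarith)
  have g1 := Gamma_add_le hp hlam hlam1
  have g2 := Gamma_add_le hq hlam hlam1
  rw [show h + e + 1 - lam + lam = h + e + 1 by ring] at g2
  have p1 := Real.Gamma_pos_of_pos hq
  have p2 := Real.Gamma_pos_of_pos (by linarith : 0 < h + e + 1)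
  have p3 := Real.Gamma_pos_of_pos hp
  set X := (h - e - 1) * (h + e + 1 - lam) with hX
  have hX0 : 0 < X := mul_pos hp hq
  have hTX : gammaQuot (e - lam) h ≤ X ^ lam * gammaQuot e h := by
    unfold gammaQuot
    rw [show h - (e - lam) - 1 = h - e - 1 + lam by ring, show h + (e - lam) + 1 = h + e + 1 - lam by ring,
      hX, Real.mul_rpow hp.le hq.le, div_le_iff₀ p1]
    calc _ ≤ _ := g1
      _ = Real.Gamma (h - e - 1) * (h - e - 1) ^ lam / Real.Gamma (h + e + 1) *
          Real.Gamma (h + e + 1) := by field_simp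
      _ ≤ Real.Gamma (h - e - 1) * (h - e - 1) ^ lam / Real.Gamma (h + e + 1) *
          (Real.Gamma (h + e + 1 - lam) * (h + e + 1 - lam) ^ lam) := by gcongr
      _ = _ := by ring
  have hyoung : X ^ lam ≤ (1 - lam) * μ ^ lam + lam * μ ^ (lam - 1) * X := by
    have := Real.geom_mean_le_arith_mean2_weighted (by linarith : 0 ≤ 1 - lam) hlam hμ.le hX0.le
      (by ring)
    have h2 := mul_le_mul_of_nonneg_left this (by positivity : 0 ≤ μ ^ (lam - 1))
    rw [← mul_assoc, ← Real.rpow_add hμ, show lam - 1 + (1 - lam) = 0 by ring, Real.rpow_zero,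
      one_mul] at h2
    have h3 : μ ^ (lam - 1) * μ = μ ^ lam := by
      rw [← Real.rpow_add_one hμ.ne']
      congr 1
      ring
    calc _ ≤ _ := h2
      _ = (1 - lam) * (μ ^ (lam - 1) * μ) + lam * μ ^ (lam - 1) * X := by ring
      _ = _ := by rw [h3]
  have hX1 : X * gammaQuot e h ≤ (1 + η) * gammaQuot (e - 1) h := by
    rw [gammaQuot_sub_one' (by linarith), hX]
    have : h + e + 1 - lam ≤ (1 + η) * (h + e) := by linarith
    calc _ ≤ (h - e - 1) * ((1 + η) * (h + e)) * gammaQuot e h := by gcongr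
      _ = _ := by ring
  calc _ ≤ _ := hTX
    _ ≤ ((1 - lam) * μ ^ lam + lam * μ ^ (lam - 1) * X) * gammaQuot e h := by gcongr
    _ = (1 - lam) * μ ^ lam * gammaQuot e h + lam * μ ^ (lam - 1) * (X * gammaQuot e h) := by ring
    _ ≤ _ := by gcongr

theorem HasLead.nonneg {c : ℝ} (h : HasLead r s h₁ e c) (hB : BlockBound r s H C Q) (hh : H ≤ h₁)
    (he : e < 0) (h1 : 0 < h₁ + e) : 0 ≤ c := by
  refine ge_of_tendsto h ?_
  filter_upwards [self_mem_nhdsWithin] with y hy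
  have hy0 : (0 : ℝ) < y := hy
  refine mul_nonneg (by positivity) (tsum_nonneg fun ℓ => ?_)
  obtain ⟨a1, a2, a3⟩ := hB.lt hh ℓ
  have hℓ : (0 : ℝ) ≤ ℓ := Nat.cast_nonneg ℓ
  have := hB.one_le
  exact mul_nonneg (mul_nonneg (gammaQuot_pos (by linarith) (by linarith)).le (by linarith))
    (normBlock_pos a1 a2 a3 hy0).le

theorem HasLead.le {c c' lam η : ℝ} (h : HasLead r s h₁ e c) (h' : HasLead r s h₁ (e - lam) c')
    (hB : BlockBound r s H C Q) (hh : H ≤ h₁) (he : e < -(|r| + |s| + 1)) (hlam : 0 ≤ lam)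
    (hlam1 : lam ≤ 1) (h1 : 0 < h₁ + e) (hη0 : 0 ≤ η) (hη : 1 ≤ η * (h₁ + e)) :
    c' ≤ (1 + η) * (((e + r) * (e + s)) ^ lam * c) := by
  have hr := neg_abs_le r
  have hr' := le_abs_self r
  have hs' := le_abs_self s
  have hr0 := abs_nonneg r
  have hs0 := abs_nonneg s
  have hm1 : 0 < -(e + r) := by linarith
  have hm2 : 0 < -(e + s) := by linarith
  have hm0 : 0 < (e + r) * (e + s) := by nlinarith
  set μ₀ := (e + r) * (e + s) with hμ₀
  have h2 := h.sub_one hB hh he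
  have hlim := (Tendsto.const_mul ((1 - lam) * μ₀ ^ lam) h).add
    (Tendsto.const_mul (lam * μ₀ ^ (lam - 1) * (1 + η)) h2)
  have hle : c' ≤ (1 - lam) * μ₀ ^ lam * c + lam * μ₀ ^ (lam - 1) * (1 + η) * (μ₀ * c) := by
    refine le_of_tendsto_of_tendsto h' hlim ?_
    filter_upwards [self_mem_nhdsWithin] with y hy
    have hy0 : (0 : ℝ) < y := hy
    -- With μ = μ₀/y both terms of the bound scale like y^{e-λ}; with μ₀ = (e+r)(e+s) their limits
    -- combine to μ₀^λ c up to the factor 1 + η.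
    have hμ : 0 < μ₀ / y := by positivity
    have s0 := hB.summable_quotSum hh (e - lam) hy0
    have s1 := (hB.summable_quotSum hh e hy0).mul_left ((1 - lam) * (μ₀ / y) ^ lam)
    have s2 := (hB.summable_quotSum hh (e - 1) hy0).mul_left
      (lam * (μ₀ / y) ^ (lam - 1) * (1 + η))
    have hs : quotSum r s h₁ (e - lam) y ≤ (1 - lam) * (μ₀ / y) ^ lam * quotSum r s h₁ e y +
        lam * (μ₀ / y) ^ (lam - 1) * (1 + η) * quotSum r s h₁ (e - 1) y := by
      unfold quotSum
      rw [← tsum_mul_left, ← tsum_mul_left, ← s1.tsum_add s2]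
      refine s0.tsum_le_tsum (fun ℓ => ?_) (s1.add s2)
      obtain ⟨a1, a2, a3⟩ := hB.lt hh ℓ
      have hℓ : (0 : ℝ) ≤ ℓ := Nat.cast_nonneg ℓ
      have h21 := hB.one_le
      have hG := (normBlock_pos a1 a2 a3 hy0).le
      have hq := gammaQuot_sub_le (h := h₁ + ℓ) (μ := μ₀ / y) hlam hlam1 (by linarith : e < -1)
        (by linarith) (by nlinarith : 1 ≤ η * (h₁ + ℓ + e)) hη0 hμ
      have hw : 0 ≤ (2 * (h₁ + ℓ) - 1) * normBlock r s (h₁ + ℓ) y :=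
        mul_nonneg (by linarith) hG
      have := mul_le_mul_of_nonneg_right hq hw
      linarith
    have hya : y ^ (-(e - lam)) * (μ₀ / y) ^ lam = μ₀ ^ lam * y ^ (-e) := by
      rw [Real.div_rpow hm0.le hy0.le, show -(e - lam) = -e + lam by ring, Real.rpow_add hy0]
      field_simp
    have hyb : y ^ (-(e - lam)) * (μ₀ / y) ^ (lam - 1) = μ₀ ^ (lam - 1) * y ^ (-(e - 1)) := by
      rw [Real.div_rpow hm0.le hy0.le, show -(e - lam) = -(e - 1) + (lam - 1) by ring,
        Real.rpow_add hy0]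
      field_simp
    have hm := mul_le_mul_of_nonneg_left hs (by positivity : 0 ≤ y ^ (-(e - lam)))
    calc _ ≤ _ := hm
      _ = (1 - lam) * (y ^ (-(e - lam)) * (μ₀ / y) ^ lam) * quotSum r s h₁ e y +
        lam * (y ^ (-(e - lam)) * (μ₀ / y) ^ (lam - 1)) * (1 + η) * quotSum r s h₁ (e - 1) y := by
          ring
      _ = _ := by rw [hya, hyb]; ring
  have hc := h.nonneg hB hh (by linarith) h1
  have e1 : μ₀ ^ (lam - 1) * μ₀ = μ₀ ^ lam := by
    rw [← Real.rpow_add_one hm0.ne']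
    congr 1
    ring
  have e2 : 0 ≤ μ₀ ^ lam * c := by positivity
  calc c' ≤ _ := hle
    _ = (1 - lam) * (μ₀ ^ lam * c) + lam * (1 + η) * ((μ₀ ^ (lam - 1) * μ₀) * c) := by ring
    _ = (1 + lam * η) * (μ₀ ^ lam * c) := by rw [e1]; ring
    _ ≤ _ := by
      gcongr
      nlinarith

theorem tendsto_tsum_of_geometric {f : ℕ → ℝ → ℝ} {A a : ℝ} {P : ℕ}
    (hf : ∀ᶠ y in atTop, ∀ n : ℕ, ‖f n y‖ ≤ A * (((n : ℝ) + 1) ^ P * ((1 + y)⁻¹) ^ n))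
    (h0 : Tendsto (f 0) atTop (𝓝 a)) :
    Tendsto (fun y => ∑' n, f n y) atTop (𝓝 a) := by
  have hA : 0 ≤ A := by
    obtain ⟨y, hy, hy0⟩ := (hf.and (eventually_gt_atTop 0)).exists
    have := (norm_nonneg _).trans (hy 0)
    simpa using this
  have h1 : Tendsto (fun y => ∑' n, f n y) atTop (𝓝 (∑' n : ℕ, if n = 0 then a else 0)) := by
    refine tendsto_tsum_of_dominated_convergence
      (bound := fun n : ℕ => A * (((n : ℝ) + 1) ^ P * (1 / 2) ^ n))
      ((summable_pow_mul_geometric P (by norm_num) (by norm_num)).mul_left A) ?_ ?_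
    · intro n
      rcases n with _ | n
      · simpa using h0
      · simp only [Nat.add_eq_zero_iff, one_ne_zero, and_false, if_false]
        have hlim : Tendsto (fun y : ℝ => A * ((((n + 1 : ℕ) : ℝ) + 1) ^ P *
            ((1 + y)⁻¹) ^ (n + 1))) atTop (𝓝 0) := by
          have h2 : Tendsto (fun y : ℝ => (1 + y)⁻¹) atTop (𝓝 0) :=
            tendsto_inv_atTop_zero.comp (tendsto_atTop_add_const_left _ _ tendsto_id)
          have := ((h2.pow (n + 1)).const_mul ((((n + 1 : ℕ) : ℝ) + 1) ^ P)).const_mul A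
          simpa using this
        exact squeeze_zero_norm' (hf.mono fun y hy => hy (n + 1)) hlim
    · filter_upwards [hf, eventually_ge_atTop 1] with y hy hy1 n
      refine (hy n).trans ?_
      gcongr
      rw [one_div]
      exact inv_anti₀ (by norm_num) (by linarith)
  rwa [tsum_ite_eq] at h1

theorem tendsto_rpow_mul_blockMono (h r : ℝ) :
    Tendsto (fun y : ℝ => y ^ h * blockMono r (h - r) y) atTop (𝓝 1) := by
  have h1 := (tendsto_add_const_div 1).rpow_const (p := -(h - r)) (Or.inl one_ne_zero)
  rw [Real.one_rpow] at h1
  refine h1.congr' ?_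
  filter_upwards [eventually_gt_atTop 0] with y hy
  unfold blockMono
  rw [Real.div_rpow (by linarith) hy.le, add_comm y 1, ← mul_assoc, ← Real.rpow_add hy,
    Real.rpow_neg hy.le (h - r), div_inv_eq_mul, mul_comm, sub_eq_add_neg]

theorem tendsto_rpow_mul_blockSeries {h : ℝ} {c : ℕ → ℝ} (hc : PolyBdd c) :
    Tendsto (fun y : ℝ => y ^ h * blockSeries r (h - r) c y) atTop (𝓝 (c 0)) := by
  obtain ⟨A, P, hA, hP⟩ := hc
  have hm := tendsto_rpow_mul_blockMono h r
  simp only [blockSeries, ← tsum_mul_left]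
  refine tendsto_tsum_of_geometric (A := A * 2) (P := P) ?_ ?_
  · filter_upwards [hm.eventually (gt_mem_nhds (by norm_num : (1 : ℝ) < 2)),
      eventually_gt_atTop 0] with y hy hy0 n
    have hb := blockMono_pos r (h - r) hy0
    have hx : 0 < y ^ h * blockMono r (h - r) y := by positivity
    rw [blockMono_add_nat _ _ _ hy0, show y ^ h * (c n * (blockMono r (h - r) y * ((1 + y)⁻¹) ^ n)) =
      c n * ((y ^ h * blockMono r (h - r) y) * ((1 + y)⁻¹) ^ n) by ring, norm_mul,
      Real.norm_of_nonneg (by positivity : 0 ≤ y ^ h * blockMono r (h - r) y * ((1 + y)⁻¹) ^ n)]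
    calc _ ≤ (A * ((n : ℝ) + 1) ^ P) * (2 * ((1 + y)⁻¹) ^ n) := by
          gcongr
          exact hP n
      _ = _ := by ring
  · have := hm.const_mul (c 0)
    rw [mul_one] at this
    refine this.congr fun y => ?_
    rw [Nat.cast_zero, add_zero]
    ring

/-- As y → ∞ only the first term of the lowest block survives. This fixes the absolute normalisation
of the leading coefficients. -/
theorem BlockBound.tendsto_quotSum_atTop (hB : BlockBound r s H C Q) (hh : H ≤ h₁) :
    Tendsto (fun y : ℝ => y ^ h₁ * quotSum r s h₁ e y) atTop
      (𝓝 (gammaQuot e h₁ * (2 * h₁ - 1) * normSeq r s h₁ 0)) := by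
  obtain ⟨D, hD, hb⟩ := hB.exists_norm_le hh
  obtain ⟨A, P, hA, hP⟩ := polyBdd_quotSeq h₁ e
  obtain ⟨a1, a2, a3⟩ := hB.lt hh 0
  simp only [Nat.cast_zero, add_zero] at a1 a2 a3
  have hm : Tendsto (fun y : ℝ => y ^ h₁ * boundFun r h₁ Q y) atTop (𝓝 1) := by
    have h1 := (tendsto_rpow_mul_blockMono h₁ r).mul ((tendsto_add_const_div 1).pow (Q + 1))
    rw [one_pow, one_mul] at h1
    refine h1.congr fun y => ?_
    unfold boundFun
    rw [add_comm y 1]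
    ring
  simp only [quotSum, ← tsum_mul_left]
  refine tendsto_tsum_of_geometric (A := A * (D * 2)) (P := P + Q) ?_ ?_
  · filter_upwards [hm.eventually (gt_mem_nhds (by norm_num : (1 : ℝ) < 2)),
      eventually_gt_atTop 0] with y hy hy0 ℓ
    have hbf := boundFun_pos r h₁ Q hy0
    have h1 := hP ℓ
    rw [quotSeq, Complex.norm_real] at h1
    rw [mul_left_comm, norm_mul, norm_mul (y ^ h₁), Real.norm_of_nonneg (by positivity : 0 ≤ y ^ h₁)]
    calc _ ≤ (A * ((ℓ : ℝ) + 1) ^ P) * (y ^ h₁ *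
          (D * (boundFun r h₁ Q y * (((ℓ : ℝ) + 1) ^ Q * ((1 + y)⁻¹) ^ ℓ)))) := by
          gcongr
          exact (hb ℓ y hy0).1
      _ = A * ((ℓ : ℝ) + 1) ^ P * (D * ((y ^ h₁ * boundFun r h₁ Q y) *
          (((ℓ : ℝ) + 1) ^ Q * ((1 + y)⁻¹) ^ ℓ))) := by ring
      _ ≤ A * ((ℓ : ℝ) + 1) ^ P * (D * (2 * (((ℓ : ℝ) + 1) ^ Q * ((1 + y)⁻¹) ^ ℓ))) := by gcongr
      _ = _ := by rw [pow_add]; ring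
  · have h1 := (tendsto_rpow_mul_blockSeries (r := r) (h := h₁)
      ((isBlockSeq_normSeq a1 a2 a3).polyBdd a1)).const_mul (gammaQuot e h₁ * (2 * h₁ - 1))
    refine h1.congr fun y => ?_
    rw [Nat.cast_zero, add_zero, normBlock]
    ring

/-- The sum is a pure power if it starts at `h₁ = -e`. -/
theorem BlockBound.hasLead_neg (hB : BlockBound r s H C Q) (hh : H ≤ h₁) :
    HasLead r s h₁ (-h₁) (Real.Gamma (h₁ - r) * Real.Gamma (h₁ - s)) := by
  obtain ⟨a1, a2, a3⟩ := hB.lt hh 0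
  simp only [Nat.cast_zero, add_zero] at a1 a2 a3
  have h1 := hB.one_le.trans hh
  have hval : gammaQuot (-h₁) h₁ * (2 * h₁ - 1) * normSeq r s h₁ 0 =
      Real.Gamma (h₁ - r) * Real.Gamma (h₁ - s) := by
    rw [normSeq_eq a1 a2 a3, gammaQuot, show h₁ - -h₁ - 1 = 2 * h₁ - 1 by ring,
      show h₁ + -h₁ + 1 = 1 by ring, Real.Gamma_one, blockSeq]
    have e1 : Real.Gamma (2 * h₁) = (2 * h₁ - 1) * Real.Gamma (2 * h₁ - 1) := by
      rw [← Real.Gamma_add_one (by linarith)]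
      congr 1
      ring
    have e2 := Real.Gamma_pos_of_pos (by linarith : 0 < 2 * h₁ - 1)
    have e3 : 2 * h₁ - 1 ≠ 0 := by linarith
    rw [e1]
    simp only [poch, ascPochhammer_zero, Polynomial.eval_one, Nat.factorial_zero, Nat.cast_one]
    field_simp
  -- The boundary term contains the factor h₁ + e = 0, so y^{h₁} F is constant and can be evaluated
  -- at y → ∞.
  have hb : ∀ y, quotBdry r s h₁ (-h₁) y = 0 := fun y => by
    unfold quotBdry
    rw [add_neg_cancel]
    ring
  have hE := hB.eulerEq_quotSum (e := -h₁) hh (by linarith)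
  rw [neg_neg] at hE
  have hconst : ∀ a b : ℝ, 0 < a → a ≤ b →
      b ^ h₁ * quotSum r s h₁ (-h₁) b = a ^ h₁ * quotSum r s h₁ (-h₁) a := by
    intro a b ha hab
    have := norm_sub_le_of_euler (c := h₁) (M := 0) (C := 0) (δ := b) (by linarith) hE
      (fun y _ _ => by simp [hb]) ha hab le_rfl
    rw [zero_div, zero_mul, norm_le_zero_iff, sub_eq_zero] at this
    exact_mod_cast this
  have hall : ∀ a : ℝ, 0 < a → a ^ h₁ * quotSum r s h₁ (-h₁) a =
      Real.Gamma (h₁ - r) * Real.Gamma (h₁ - s) := by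
    intro a ha
    have h2 := hB.tendsto_quotSum_atTop (e := -h₁) hh
    rw [hval] at h2
    refine tendsto_nhds_unique (tendsto_const_nhds.congr' ?_) h2
    filter_upwards [eventually_ge_atTop a] with b hab
    exact (hconst a b ha hab).symm
  refine tendsto_const_nhds.congr' ?_
  filter_upwards [self_mem_nhdsWithin] with y hy
  rw [neg_neg]
  exact (hall y hy).symm

theorem tendsto_Gamma_mul_rpow_div (x lam : ℝ) :
    Tendsto (fun k : ℕ => Real.Gamma (x + k) * (x + k) ^ lam / Real.Gamma (x + k + lam)) atTop
      (𝓝 1) := by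
  have h1 := ((tendsto_Gamma_ratio lam).inv₀ one_ne_zero).comp (tendsto_add_natCast_atTop x)
  rw [inv_one] at h1
  refine h1.congr' ?_
  filter_upwards [(tendsto_add_natCast_atTop x).eventually_gt_atTop 0] with k hk
  simp only [Function.comp]
  rw [Real.rpow_neg hk.le]
  have := Real.Gamma_pos_of_pos hk
  field_simp

/-- The coefficient of `y^e`, for sufficiently negative `e`. -/
theorem BlockBound.hasLead (hB : BlockBound r s H C Q) (hh : H ≤ h₁)
    (hh' : |r| + |s| + 1 < h₁) (he : e < -(|r| + |s| + 1)) :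
    HasLead r s h₁ e (Real.Gamma (-e - r) * Real.Gamma (-e - s)) := by
  set B := |r| + |s| + 1 with hBdef
  have hr := le_abs_self r
  have hs := le_abs_self s
  have hr0 := abs_nonneg r
  have hs0 := abs_nonneg s
  -- A Bohr–Mollerup argument: c/ψ has period 1 by the Casimir recursion, is decreasing over short
  -- steps by log-convexity, hence is constant, and equals 1 at e = -h₁.
  choose! c hc using fun e (he : e < -B) => hB.exists_hasLead hh he
  set ψ : ℝ → ℝ := fun e => Real.Gamma (-e - r) * Real.Gamma (-e - s) with hψ
  have hψ0 : ∀ e < -B, 0 < ψ e := fun e he =>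
    mul_pos (Real.Gamma_pos_of_pos (by linarith)) (Real.Gamma_pos_of_pos (by linarith))
  have hψ1 : ∀ e < -B, ψ (e - 1) = (e + r) * (e + s) * ψ e := by
    intro e he
    simp only [hψ]
    rw [show -(e - 1) - r = -e - r + 1 by ring, show -(e - 1) - s = -e - s + 1 by ring,
      Real.Gamma_add_one (by linarith), Real.Gamma_add_one (by linarith)]
    ring
  have hper : ∀ e < -B, ∀ k : ℕ, c (e - k) / ψ (e - k) = c e / ψ e := by
    intro e he k
    induction k with
    | zero => simp
    | succ k ih =>
      have hk : e - k < -B := by linarith [Nat.cast_nonneg (α := ℝ) k]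
      rw [← ih]
      push_cast
      rw [show e - (k + 1 : ℝ) = e - k - 1 by ring, hψ1 _ hk,
        (hc (e - k - 1) (by linarith)).unique ((hc _ hk).sub_one hB hh hk)]
      have h1 : (e - k + r) * (e - k + s) ≠ 0 :=
        mul_ne_zero (by linarith) (by linarith)
      exact mul_div_mul_left _ _ h1
  have hineq : ∀ e < -B, ∀ lam, 0 ≤ lam → lam ≤ 1 →
      c (e - lam) ≤ ((e + r) * (e + s)) ^ lam * c e := by
    intro e he lam hlam hlam1
    -- The error η is made small by starting the sum at h₁ + k with k large, which does not change
    -- the coefficients.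
    have key : ∀ η > 0, c (e - lam) ≤ (1 + η) * (((e + r) * (e + s)) ^ lam * c e) := by
      intro η hη
      obtain ⟨k, hk⟩ := exists_nat_gt (-e + η⁻¹)
      have hη' : 0 < η⁻¹ := inv_pos.2 hη
      have hk0 : (0 : ℝ) ≤ k := Nat.cast_nonneg k
      refine HasLead.le (h₁ := h₁ + k) ((hB.hasLead_add_nat hh he k).2 (hc e he))
        ((hB.hasLead_add_nat hh (by linarith) k).2 (hc (e - lam) (by linarith))) hB (by linarith) he
        hlam hlam1 (by linarith) hη.le ?_
      rw [← inv_le_iff_one_le_mul₀' hη]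
      linarith
    have hlim : Tendsto (fun η : ℝ => (1 + η) * (((e + r) * (e + s)) ^ lam * c e)) (𝓝[>] 0)
        (𝓝 ((1 + 0) * (((e + r) * (e + s)) ^ lam * c e))) :=
      ((tendsto_const_nhds.add tendsto_id).mul_const _).mono_left nhdsWithin_le_nhds
    rw [add_zero, one_mul] at hlim
    exact ge_of_tendsto hlim (by filter_upwards [self_mem_nhdsWithin] with η hη using key η hη)
  have hanti : ∀ e < -B, ∀ lam, 0 ≤ lam → lam ≤ 1 →
      c (e - lam) / ψ (e - lam) ≤ c e / ψ e := by
    intro e he lam hlam hlam1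
    -- Periodicity allows the inequality to be used at e - k; as k → ∞ the Gamma quotients approach
    -- powers and the factor ((e-k+r)(e-k+s))^λ drops out against ψ.
    have hlim := ((tendsto_Gamma_mul_rpow_div (-e - r) lam).mul
      (tendsto_Gamma_mul_rpow_div (-e - s) lam)).mul_const (c e / ψ e)
    rw [one_mul, one_mul] at hlim
    refine ge_of_tendsto' hlim fun k => ?_
    have hk0 : (0 : ℝ) ≤ k := Nat.cast_nonneg k
    have hek : e - k < -B := by linarith
    rw [← hper e he k, ← hper (e - lam) (by linarith) k, show e - lam - (k : ℝ) = e - k - lam by ring,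
      div_le_iff₀ (hψ0 _ (by linarith))]
    refine (hineq _ hek lam hlam hlam1).trans (le_of_eq ?_)
    have g1 := (Real.Gamma_pos_of_pos (by linarith : 0 < -e - r + k + lam)).ne'
    have g2 := (Real.Gamma_pos_of_pos (by linarith : 0 < -e - s + k + lam)).ne'
    have g3 := (Real.Gamma_pos_of_pos (by linarith : 0 < -e - r + k)).ne'
    have g4 := (Real.Gamma_pos_of_pos (by linarith : 0 < -e - s + k)).ne'
    have e1 : (e - k + r) * (e - k + s) = (-e - r + k) * (-e - s + k) := by ring
    rw [e1, Real.mul_rpow (by linarith) (by linarith)]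
    simp only [hψ]
    rw [show -(e - k - lam) - r = -e - r + k + lam by ring,
      show -(e - k - lam) - s = -e - s + k + lam by ring,
      show -(e - k) - r = -e - r + k by ring, show -(e - k) - s = -e - s + k by ring]
    field_simp
  have hle : ∀ e < -B, ∀ e' < -B, c e' / ψ e' ≤ c e / ψ e := by
    intro e he e' he'
    -- After integer shifts the two points differ by a fractional part in [0,1), so the short-step
    -- inequality holds for any pair in either order and forces equality.
    have h1 := Int.toNat_sub_toNat_neg ⌊e - e'⌋
    set k := (⌊e - e'⌋).toNat
    set j := (-⌊e - e'⌋).toNat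
    have h2 : e' - j = e - k - Int.fract (e - e') := by
      have h3 : (k : ℝ) - j = (⌊e - e'⌋ : ℝ) := by exact_mod_cast h1
      have h4 := Int.floor_add_fract (e - e')
      linarith
    have hk0 : (0 : ℝ) ≤ k := Nat.cast_nonneg k
    rw [← hper e' he' j, ← hper e he k, h2]
    exact hanti _ (by linarith) _ (Int.fract_nonneg _) (Int.fract_lt_one _).le
  have hone : c (-h₁) / ψ (-h₁) = 1 := by
    have h2 : -h₁ < -B := by linarith
    have h3 : ψ (-h₁) = Real.Gamma (h₁ - r) * Real.Gamma (h₁ - s) := by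
      simp only [hψ, neg_neg]
    rw [(hc _ h2).unique (hB.hasLead_neg hh), ← h3]
    exact div_self (hψ0 _ h2).ne'
  have hfin : c e / ψ e = 1 := by
    rw [← hone]
    exact le_antisymm (hle _ (by linarith) _ he) (hle _ he _ (by linarith))
  have h5 := hc e he
  rwa [(div_eq_one_iff_eq (hψ0 e he).ne').1 hfin] at h5

end

/-! ### Casimir-singular terms of the sums `quotSum` -/

section

variable {r s H C h₁ e : ℝ} {Q : ℕ}

/-- Induction on the number of unit steps that bring e below the threshold where
`BlockBound.hasLead` applies. Each step back gains one order, and Γ(-e-r) Γ(-e-s) obeys the same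
recursion as the sums. -/
theorem BlockBound.quotSum_sub_mem (hB : BlockBound r s H C Q) (hh : H ≤ h₁)
    (hh' : |r| + |s| + 1 < h₁) (k : ℕ) : ∀ e : ℝ, e - k < -(|r| + |s| + 1) → e + 1 < h₁ →
      NotPole (-e - r) → NotPole (-e - s) →
      (fun y => (quotSum r s h₁ e y : ℂ) -
        ((Real.Gamma (-e - r) * Real.Gamma (-e - s) : ℝ) : ℂ) * powLog (e, 0) y) ∈
        expClass (regSet r s) (k - (|r| + |s| + 1)) := by
  induction k with
  | zero =>
    intro e he _ _ _
    rw [Nat.cast_zero, sub_zero] at he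
    rw [Nat.cast_zero, zero_sub]
    exact mem_expClass_of_isBigO ((hB.hasLead hh hh' he).isBigO hB hh he)
  | succ k ih =>
    intro e he he1 hr hs
    have hr0 : -e - r ≠ 0 := by simpa using hr 0
    have hs0 : -e - s ≠ 0 := by simpa using hs 0
    push_cast at he
    have h1 := ih (e - 1) (by linarith) (by linarith)
      (fun j hj => hr (j + 1) (by push_cast; linarith))
      (fun j hj => hs (j + 1) (by push_cast; linarith))
    have h2 := hB.quotSum_step hh he1 (fun h => hr0 (by linarith)) (fun h => hs0 (by linarith)) h1
    push_cast
    rw [show (k : ℝ) + 1 - (|r| + |s| + 1) = k - (|r| + |s| + 1) + 1 by ring]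
    refine expClass_congr h2 fun y hy => ?_
    have e1 : (y : ℂ) * powLog (e - 1, 0) y = powLog (e, 0) y := by
      rw [powLog_shift _ hy]
      simp
    have e2 : Real.Gamma (-(e - 1) - r) * Real.Gamma (-(e - 1) - s) =
        (e + r) * (e + s) * (Real.Gamma (-e - r) * Real.Gamma (-e - s)) := by
      rw [show -(e - 1) - r = -e - r + 1 by ring, show -(e - 1) - s = -e - s + 1 by ring,
        Real.Gamma_add_one hr0, Real.Gamma_add_one hs0]
      ring
    rw [e2, ← e1]
    have h3 : (e + r : ℂ) ≠ 0 := by exact_mod_cast fun h : e + r = 0 => hr0 (by linarith)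
    have h4 : (e + s : ℂ) ≠ 0 := by exact_mod_cast fun h : e + s = 0 => hs0 (by linarith)
    push_cast
    field_simp

theorem BlockBound.isRegular_quotSum_generic (hB : BlockBound r s H C Q) (hh : H ≤ h₁)
    (hh' : |r| + |s| + 1 < h₁) (he : e + 1 < h₁) (hr : NotPole (-e - r)) (hs : NotPole (-e - s)) :
    IsRegular r s fun y => (quotSum r s h₁ e y : ℂ) -
      ((Real.Gamma (-e - r) * Real.Gamma (-e - s) : ℝ) : ℂ) * powLog (e, 0) y := by
  intro M
  obtain ⟨k, hk⟩ := exists_nat_gt (max (M + (|r| + |s| + 1)) (e + (|r| + |s| + 1)))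
  have h1 := (le_max_left _ _).trans_lt hk
  have h2 := (le_max_right _ _).trans_lt hk
  exact expClass_mono le_rfl (by linarith)
    (hB.quotSum_sub_mem hh hh' k e (by linarith) he hr hs)

theorem isRegular_powLog {k : ℝ × ℕ} (hk : k ∈ regSet r s) : IsRegular r s (powLog k) :=
  fun _ => powLog_mem hk

/-! ### Resonant exponents and the logarithms they produce. -/

/-- The right-hand side of the equation for the boundary term at a resonance. -/
noncomputable def bdrySource (r s h e y : ℝ) : ℂ :=
  (y : ℂ) * ((((1 + y)⁻¹ : ℝ) : ℂ) * (-(quotSum r s h (e - 1) y : ℂ) +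
    ((r + s - 1 : ℝ) : ℂ) * (quotBdry r s h e y : ℂ)))

/-- At e = -x the factor (e+r)(e+s) vanishes, so the recursion expresses the derivative of the
boundary term through F_{e-1}, whose expansion is not resonant. -/
theorem BlockBound.eulerEq_quotBdry_resonant (hB : BlockBound r s H C Q) (hh : H ≤ h₁)
    {x x' : ℝ} (hx : (x = r ∧ x' = s) ∨ (x = s ∧ x' = r)) (he : -x + 1 < h₁) :
    EulerEq x' (fun y => (quotBdry r s h₁ (-x) y : ℂ)) (bdrySource r s h₁ (-x)) := by
  intro y hy
  refine (hB.eulerEq_quotBdry (e := -x) hh y hy).congr_deriv ?_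
  have h1 := congrArg (fun x : ℝ => (x : ℂ)) (hB.quotSum_rec hh he hy)
  have hy2 : (1 + y : ℂ) ≠ 0 := by exact_mod_cast (by linarith : 0 < 1 + y).ne'
  have hx0 : (-x + r) * (-x + s) = 0 := by rcases hx with ⟨rfl, rfl⟩ | ⟨rfl, rfl⟩ <;> simp
  have hx1 : -x + s = x' - r := by rcases hx with ⟨rfl, rfl⟩ | ⟨rfl, rfl⟩ <;> ring
  rw [hx0, hx1] at h1
  congr 1
  unfold bdrySource
  push_cast at h1 ⊢
  field_simp
  linear_combination -h1

/-- F_{-x-1} has the generic leading coefficient Γ(1) Γ(1+x-x'). Multiplied by y it gives the term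
in y^{-x}; all other parts of the source are y times something Casimir-regular. -/
theorem BlockBound.bdrySource_add_mem (hB : BlockBound r s H C Q) (hh : H ≤ h₁)
    (hh' : |r| + |s| + 1 < h₁)
    {x x' : ℝ} (hx : (x = r ∧ x' = s) ∨ (x = s ∧ x' = r)) (he : -x + 1 < h₁)
    (hp : NotPole (1 + x - x')) (M : ℝ) :
    (fun y => bdrySource r s h₁ (-x) y + (Real.Gamma (1 + x - x') : ℂ) * powLog (-x, 0) y) ∈
      expClass (shiftSet (regSet r s)) M := by
  have hp1 : NotPole (-(-x - 1) - r) ∧ NotPole (-(-x - 1) - s) ∧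
      Real.Gamma (-(-x - 1) - r) * Real.Gamma (-(-x - 1) - s) = Real.Gamma (1 + x - x') := by
    have h1 : NotPole 1 := notPole_of_pos one_pos
    rcases hx with ⟨rfl, rfl⟩ | ⟨rfl, rfl⟩
    · rw [show -(-x - 1) - x = 1 by ring, show -(-x - 1) - x' = 1 + x - x' by ring, Real.Gamma_one,
        one_mul]
      exact ⟨h1, hp, rfl⟩
    · rw [show -(-x - 1) - x = 1 by ring, show -(-x - 1) - x' = 1 + x - x' by ring, Real.Gamma_one,
        mul_one]
      exact ⟨hp, h1, rfl⟩
  have hmem : ((-x, 0) : ℝ × ℕ) ∈ regSet r s := by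
    rcases hx with ⟨rfl, rfl⟩ | ⟨rfl, rfl⟩
    exacts [neg_left_mem_regSet _ _, neg_right_mem_regSet _ _]
  have h1 := hB.isRegular_quotSum_generic hh hh' (e := -x - 1) (by linarith) hp1.1 hp1.2.1
  rw [hp1.2.2] at h1
  have h2 := ((((hB.isRegular_quotBdry (e := -x) hh).1.const_mul ((r + s - 1 : ℝ) : ℂ)).sub h1).add
    ((isRegular_powLog hmem).const_mul (Real.Gamma (1 + x - x') : ℂ))).inv_one_add_mul
  refine expClass_mono le_rfl (by linarith : M ≤ M + 1) (expClass_congr (mul_mem_expClass (h2 M)) ?_)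
  intro y hy
  have e1 : powLog (-x, 0) y = (y : ℂ) * powLog (-x - 1, 0) y := by
    rw [powLog_shift _ hy]
    simp
  have hy2 : (1 + y : ℂ) ≠ 0 := by exact_mod_cast (by linarith : 0 < 1 + y).ne'
  unfold bdrySource
  rw [e1]
  push_cast
  field_simp
  ring

theorem EulerEq.sub {c : ℝ} {u v g k : ℝ → ℂ} (hu : EulerEq c u g) (hv : EulerEq c v k) :
    EulerEq c (fun y => u y - v y) fun y => g y - k y := by
  intro y hy
  refine ((hu y hy).sub (hv y hy)).congr_deriv ?_
  ring

theorem eulerEq_powLog_zero (c x : ℝ) :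
    EulerEq c (powLog (x, 0)) fun y => ((x + c : ℝ) : ℂ) * powLog (x, 0) y := by
  intro y hy
  refine (hasDerivAt_powLog x 0 hy).congr_deriv ?_
  simp only [Nat.cast_zero, zero_mul, add_zero]
  push_cast
  ring

theorem eulerEq_powLog_succ (x : ℝ) (j : ℕ) :
    EulerEq (-x) (powLog (x, j + 1)) fun y => ((j + 1 : ℝ) : ℂ) * powLog (x, j) y := by
  intro y hy
  refine (hasDerivAt_powLog x (j + 1) hy).congr_deriv ?_
  simp only [Nat.add_sub_cancel]
  push_cast
  ring

theorem exists_ge_ne (M a b : ℝ) : ∃ M' ≥ M, M' ≠ a ∧ M' ≠ b := by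
  obtain ⟨M', h1, -, h2, h3⟩ := exists_between_avoiding M a b
  exact ⟨M', by linarith, h2, h3⟩

/-- Solving for the boundary term gives Γ(1+x-x')/(x-x') = Γ(x-x') as its coefficient of y^{-x}. The
equation (y∂_y + x)F = -boundary is resonant there and turns it into -Γ(x-x') y^{-x} log y. -/
theorem BlockBound.isRegular_quotSum_single (hB : BlockBound r s H C Q) (hh : H ≤ h₁)
    (hh' : |r| + |s| + 1 < h₁)
    {x x' : ℝ} (hx : (x = r ∧ x' = s) ∨ (x = s ∧ x' = r)) (he : -x + 1 < h₁)
    (hni : ∀ k : ℤ, x - x' ≠ k) :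
    IsRegular r s fun y => (quotSum r s h₁ (-x) y : ℂ) +
      (Real.Gamma (x - x') : ℂ) * powLog (-x, 1) y := by
  intro M
  obtain ⟨M', hM', hM1, hM2⟩ := exists_ge_ne M (-x') (-x)
  refine expClass_mono le_rfl hM' ?_
  have hp : NotPole (1 + x - x') := fun k hk => hni (-(k + 1)) (by push_cast; linarith)
  have h0 : x - x' ≠ 0 := by simpa using hni 0
  have hreg : ∀ k : ℝ × ℕ, k ∈ regSet r s → (∃ n : ℕ, k.1 = n - x) ∨ ∃ n : ℕ, k.1 = n - x' := by
    rintro k (⟨-, h⟩ | ⟨-, h, h'⟩) <;> rcases hx with ⟨rfl, rfl⟩ | ⟨rfl, rfl⟩ <;> tauto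
  have hmem : ((-x, 0) : ℝ × ℕ) ∈ regSet r s ∧ ((-x', 0) : ℝ × ℕ) ∈ regSet r s := by
    rcases hx with ⟨rfl, rfl⟩ | ⟨rfl, rfl⟩
    exacts [⟨neg_left_mem_regSet _ _, neg_right_mem_regSet _ _⟩,
      ⟨neg_right_mem_regSet _ _, neg_left_mem_regSet _ _⟩]
  -- The rest of the boundary term must miss the exponent -x, so that the second equation creates no
  -- further logarithm.
  set T' : Set (ℝ × ℕ) := {k | k ∈ regSet r s ∧ k.1 ≠ -x}
  have hb : (fun y => (quotBdry r s h₁ (-x) y : ℂ) - (Real.Gamma (x - x') : ℂ) * powLog (-x, 0) y) ∈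
      expClass T' M' := by
    have hE := (hB.eulerEq_quotBdry_resonant hh hx he).sub
      ((eulerEq_powLog_zero x' (-x)).const_mul (Real.Gamma (x - x') : ℂ))
    refine euler_mem_expClass (T := shiftSet (regSet r s)) hM1 ?_ ?_ ?_ hE ?_
    · rintro k hk - i hi
      refine ⟨regSet_of_le (shiftSet_regSet_subset r s hk) hi, fun h => ?_⟩
      simp only at h
      rcases hreg _ hk with ⟨n, hn⟩ | ⟨n, hn⟩
      · simp only at hn
        linarith [Nat.cast_nonneg (α := ℝ) n]
      · simp only at hn
        exact hni (-(n + 1)) (by push_cast; linarith)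
    · intro j hj
      exfalso
      rcases hreg _ hj with ⟨n, hn⟩ | ⟨n, hn⟩
      · simp only at hn
        exact hni (n + 1) (by push_cast; linarith)
      · simp only at hn
        linarith [Nat.cast_nonneg (α := ℝ) n]
    · exact ⟨hmem.2, fun h => h0 (by simp only at h; linarith)⟩
    · refine expClass_congr (hB.bdrySource_add_mem hh hh' hx he hp M') fun y hy => ?_
      have e1 : Real.Gamma (1 + x - x') = (x - x') * Real.Gamma (x - x') := by
        rw [← Real.Gamma_add_one h0]
        congr 1
        ring
      rw [e1]
      push_cast
      ring
  have hE := (hB.eulerEq_quotSum (e := -x) hh he).sub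
    ((eulerEq_powLog_succ (-x) 0).const_mul (-(Real.Gamma (x - x') : ℂ)))
  rw [neg_neg] at hE
  have h2 : (fun y => (quotSum r s h₁ (-x) y : ℂ) -
      -(Real.Gamma (x - x') : ℂ) * powLog (-x, 0 + 1) y) ∈ expClass (regSet r s) M' := by
    refine euler_mem_expClass (T := T') hM2 ?_ ?_ hmem.1 hE ?_
    · rintro k hk - i hi
      exact regSet_of_le hk.1 hi
    · rintro j hj
      exact absurd rfl hj.2
    · refine expClass_congr (neg_mem hb) fun y hy => ?_
      simp
      ring
  refine expClass_congr h2 fun y hy => ?_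
  ring

/-- For r = s both Euler equations are resonant at -r: the boundary term acquires -log y, and
integrating once more gives log²y / 2. -/
theorem BlockBound.isRegular_quotSum_double (hB : BlockBound r s H C Q) (hh : H ≤ h₁)
    (hh' : |r| + |s| + 1 < h₁) (he : -r + 1 < h₁) (hrs : r = s) :
    IsRegular r s fun y => (quotSum r s h₁ (-r) y : ℂ) - 2⁻¹ * powLog (-r, 2) y := by
  subst hrs
  intro M
  obtain ⟨M', hM', hM1, -⟩ := exists_ge_ne M (-r) (-r)
  refine expClass_mono le_rfl hM' ?_
  have hp : NotPole (1 + r - r) := notPole_of_pos (by linarith)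
  have hreg : ∀ k : ℝ × ℕ, k ∈ regSet r r → ∃ n : ℕ, k.1 = n - r := by
    rintro k (⟨-, h | h⟩ | ⟨-, h, h'⟩) <;> assumption
  set T' : Set (ℝ × ℕ) := {k | k ∈ regSet r r ∧ (k.1 = -r → k.2 = 0)}
  have hx : (r = r ∧ r = r) ∨ (r = r ∧ r = r) := Or.inl ⟨rfl, rfl⟩
  have hb : (fun y => (quotBdry r r h₁ (-r) y : ℂ) - -1 * powLog (-r, 0 + 1) y) ∈
      expClass T' M' := by
    have hE := (eulerEq_powLog_succ (-r) 0).const_mul (-1 : ℂ)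
    rw [neg_neg] at hE
    refine euler_mem_expClass (T := shiftSet (regSet r r)) hM1 ?_ ?_ ?_
      ((hB.eulerEq_quotBdry_resonant hh hx he).sub hE) ?_
    · rintro k hk hk' i hi
      exact ⟨regSet_of_le (shiftSet_regSet_subset r r hk) hi, fun h => absurd h hk'⟩
    · intro j hj
      exfalso
      obtain ⟨n, hn⟩ := hreg _ hj
      simp only at hn
      linarith [Nat.cast_nonneg (α := ℝ) n]
    · exact ⟨neg_left_mem_regSet _ _, fun _ => rfl⟩
    · refine expClass_congr (hB.bdrySource_add_mem hh hh' hx he hp M') fun y hy => ?_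
      rw [show 1 + r - r = 1 by ring, Real.Gamma_one]
      push_cast
      ring
  have hE := (hB.eulerEq_quotSum (e := -r) hh he).sub
    ((eulerEq_powLog_succ (-r) 1).const_mul (2⁻¹ : ℂ))
  rw [neg_neg] at hE
  refine euler_mem_expClass (T := T') hM1 ?_ ?_ (neg_left_mem_regSet r r) hE ?_
  · rintro k hk - i hi
    exact regSet_of_le hk.1 hi
  · rintro j hj
    have : j = 0 := hj.2 rfl
    subst this
    exact Or.inr ⟨rfl, ⟨0, by simp⟩, ⟨0, by simp⟩⟩
  · refine expClass_congr (neg_mem hb) fun y hy => ?_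
    simp
    ring

theorem gammaShift_zero_zero : gammaShift 0 0 = -1 := by
  simp [gammaShift, omega]

theorem gammaShift_succ {σ : ℝ} (hσ : Resonant σ) (m : ℕ) :
    (m + 1 - σ) * gammaShift σ (m + 1) = -gammaShift σ m := by
  have h1 : (1 - σ + m : ℝ) ≠ 0 := fun h => hσ.notPole m (by linarith)
  unfold gammaShift
  push_cast
  rw [← add_assoc, Real.Gamma_add_one h1, mul_inv, pow_succ]
  rw [show (m : ℝ) + 1 - σ = 1 - σ + m by ring]
  field_simp

/-- The Casimir-singular part of the sum with coefficients `T_{a+m}(h) (2h - 1)`. -/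
theorem BlockBound.isRegular_quotSum (hB : BlockBound r s H C Q) (hh : H ≤ h₁)
    (hh' : |r| + |s| + 1 < h₁) {a : ℝ} (hσ : Resonant (-a - r)) (hσ' : Resonant (-a - s)) (m : ℕ)
    (hm : a + m + 1 < h₁) {q : ℕ}
    (hq : q = (if -a - r = 0 then 1 else 0) + (if -a - s = 0 then 1 else 0)) :
    IsRegular r s fun y => (quotSum r s h₁ (a + m) y : ℂ) -
      ((gammaShift (-a - r) m * gammaShift (-a - s) m / q.factorial : ℝ) : ℂ) *
        powLog (a + m, q) y := by
  -- The starting exponent a carries the possible resonances, one case for each combination of the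
  -- two conditions. Higher exponents follow from the recursion in e, whose divisors do not vanish
  -- there and which `gammaShift` shares.
  induction m with
  | zero =>
    simp only [Nat.cast_zero, add_zero] at hm ⊢
    by_cases h1 : -a - r = 0 <;> by_cases h2 : -a - s = 0
    · have ha : a = -r := by linarith
      have hrs : r = s := by linarith
      rw [if_pos h1, if_pos h2] at hq
      subst hq
      rw [h1, h2, gammaShift_zero_zero, ha]
      refine (hB.isRegular_quotSum_double hh hh' (by linarith) hrs).congr fun y _ => ?_
      norm_num [Nat.factorial]
    · have ha : a = -r := by linarith
      rw [if_pos h1, if_neg h2] at hq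
      subst hq
      have hni := hσ'.resolve_left h2
      rw [h1, gammaShift_zero_zero, gammaShift_eq hni, ha]
      rw [ha, neg_neg] at hni
      refine (hB.isRegular_quotSum_single hh hh' (Or.inl ⟨rfl, rfl⟩) (by linarith) hni).congr
        fun y _ => ?_
      simp
    · have ha : a = -s := by linarith
      rw [if_neg h1, if_pos h2] at hq
      subst hq
      have hni := hσ.resolve_left h1
      rw [h2, gammaShift_zero_zero, gammaShift_eq hni, ha]
      rw [ha, neg_neg] at hni
      refine (hB.isRegular_quotSum_single hh hh' (Or.inr ⟨rfl, rfl⟩) (by linarith) hni).congr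
        fun y _ => ?_
      simp
    · rw [if_neg h1, if_neg h2] at hq
      subst hq
      have hni := hσ.resolve_left h1
      have hni' := hσ'.resolve_left h2
      refine (hB.isRegular_quotSum_generic hh hh' hm (fun k hk => hni (-k) (by push_cast; exact hk))
        (fun k hk => hni' (-k) (by push_cast; exact hk))).congr fun y _ => ?_
      rw [gammaShift_eq hni, gammaShift_eq hni']
      simp
  | succ m ih =>
    push_cast at hm ⊢
    have h1 := ih (by linarith)
    have hr : a + (m + 1) + r ≠ 0 := fun h => hσ.notPole m (by linarith)
    have hs : a + (m + 1) + s ≠ 0 := fun h => hσ'.notPole m (by linarith)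
    intro M
    rw [show a + (m : ℝ) = a + (m + 1) - 1 by ring] at h1
    have h2 := hB.quotSum_step hh (e := a + (m + 1)) (by linarith) hr hs (h1 M)
    refine expClass_mono le_rfl (by linarith) (expClass_congr h2 fun y hy => ?_)
    have e1 : (y : ℂ) * powLog (a + (m + 1) - 1, q) y = powLog (a + (m + 1), q) y := by
      rw [powLog_shift _ hy]
      simp
    have g1 := gammaShift_succ hσ m
    have g2 := gammaShift_succ hσ' m
    rw [← neg_eq_iff_eq_neg] at g1 g2
    have hr' : ((a : ℂ) + (m + 1) + r) ≠ 0 := by exact_mod_cast hr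
    have hs' : ((a : ℂ) + (m + 1) + s) ≠ 0 := by exact_mod_cast hs
    rw [← e1, ← g1, ← g2, show (m : ℝ) + 1 - (-a - r) = a + (m + 1) + r by ring,
      show (m : ℝ) + 1 - (-a - s) = a + (m + 1) + s by ring]
    push_cast
    field_simp

end

/-! ### Asymptotic independence of powers and logarithms -/

theorem tendsto_norm_log_nhdsGT : Tendsto (fun y : ℝ => ‖Real.log y‖) (𝓝[>] 0) atTop :=
  tendsto_abs_atBot_atTop.comp Real.tendsto_log_nhdsGT_zero

theorem eventually_powLog_ne_zero (k : ℝ × ℕ) : ∀ᶠ y in 𝓝[>] 0, powLog k y ≠ 0 := by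
  filter_upwards [self_mem_nhdsWithin, tendsto_norm_log_nhdsGT.eventually_ge_atTop 1] with y hy hl
  have hy0 : (0 : ℝ) < y := hy
  have : Real.log y ≠ 0 := fun h => by rw [h, norm_zero] at hl; linarith
  rw [powLog, Complex.ofReal_ne_zero]
  positivity

theorem powLog_isLittleO {k k₀ : ℝ × ℕ} (h : k₀.1 < k.1 ∨ (k₀.1 = k.1 ∧ k.2 < k₀.2)) :
    powLog k =o[𝓝[>] 0] powLog k₀ := by
  have hlog := tendsto_norm_log_nhdsGT
  rcases h with h | ⟨h, h'⟩
  · have h1 : powLog k =O[𝓝[>] 0] fun y : ℝ => y ^ ((k₀.1 + k.1) / 2) :=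
      isBigO_powLog (by linarith)
    have h2 : (fun y : ℝ => y ^ ((k₀.1 + k.1) / 2)) =o[𝓝[>] 0] fun y : ℝ => y ^ k₀.1 := by
      have h3 : Tendsto (fun y : ℝ => y ^ ((k.1 - k₀.1) / 2)) (𝓝[>] 0) (𝓝 0) := by
        have := (Real.continuousAt_rpow_const 0 ((k.1 - k₀.1) / 2) (Or.inr (by linarith))).tendsto
        rw [Real.zero_rpow (by linarith)] at this
        exact this.mono_left nhdsWithin_le_nhds
      have h4 := (isLittleO_one_iff ℝ).2 h3
      refine (h4.mul_isBigO (isBigO_refl (fun y : ℝ => y ^ k₀.1) _)).congr' ?_ ?_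
      · filter_upwards [self_mem_nhdsWithin] with y hy
        rw [← Real.rpow_add hy]
        congr 1
        ring
      · filter_upwards with y
        rw [one_mul]
    refine (h1.trans_isLittleO h2).trans_isBigO (IsBigO.of_bound 1 ?_)
    filter_upwards [hlog.eventually_ge_atTop 1] with y hy
    rw [powLog, Complex.norm_real, norm_mul, norm_pow, one_mul]
    exact le_mul_of_one_le_right (norm_nonneg _) (one_le_pow₀ hy)
  · have h1 : Tendsto (fun y : ℝ => ‖Real.log y‖ ^ (k₀.2 - k.2)) (𝓝[>] 0) atTop :=
      (tendsto_pow_atTop (by omega)).comp hlog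
    refine isLittleO_of_tendsto' ?_ ?_
    · filter_upwards [eventually_powLog_ne_zero k₀] with y hy h0
      exact absurd h0 hy
    · rw [tendsto_zero_iff_norm_tendsto_zero]
      refine (tendsto_inv_atTop_zero.comp h1).congr' ?_
      filter_upwards [self_mem_nhdsWithin, hlog.eventually_ge_atTop 1] with y hy hl
      have hy0 : (0 : ℝ) < y := hy
      have hl0 : 0 < ‖Real.log y‖ := by linarith
      have e1 : ‖Real.log y‖ ^ k₀.2 = ‖Real.log y‖ ^ (k₀.2 - k.2) * ‖Real.log y‖ ^ k.2 := by
        rw [← pow_add]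
        congr 1
        omega
      rw [norm_div, powLog, powLog, Complex.norm_real, Complex.norm_real, norm_mul, norm_mul,
        norm_pow, norm_pow, h, e1, Real.norm_of_nonneg (by positivity : 0 ≤ y ^ k.1)]
      simp only [Function.comp]
      have : 0 < y ^ k.1 := by positivity
      field_simp

theorem coeff_eq_zero_of_isBigO {S : Finset (ℝ × ℕ)} {c : ℝ × ℕ → ℂ} {N : ℝ}
    (h : (fun y => ∑ k ∈ S, c k * powLog k y) =O[𝓝[>] 0] fun y : ℝ => y ^ N) :
    ∀ k ∈ S, k.1 < N → c k = 0 := by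
  classical
  by_contra hcon
  push Not at hcon
  obtain ⟨k₁, hk₁, hk₁N, hk₁c⟩ := hcon
  -- The dominant term at the origin has the smallest exponent and, among those, the largest power
  -- of the logarithm; hence the lexicographic order with the second entry reversed.
  obtain ⟨k₀, hk₀, hmin⟩ := (S.filter fun k => c k ≠ 0).exists_min_image
    (fun k => toLex (k.1, OrderDual.toDual k.2)) ⟨k₁, Finset.mem_filter.2 ⟨hk₁, hk₁c⟩⟩
  rw [Finset.mem_filter] at hk₀
  have hlt : ∀ k ∈ S, k ≠ k₀ → c k ≠ 0 → k₀.1 < k.1 ∨ (k₀.1 = k.1 ∧ k.2 < k₀.2) := by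
    intro k hk hne hc
    have h1 := hmin k (Finset.mem_filter.2 ⟨hk, hc⟩)
    rw [Prod.Lex.toLex_le_toLex] at h1
    rcases h1 with h1 | ⟨h1, h2⟩
    · exact Or.inl h1
    · refine Or.inr ⟨h1, lt_of_le_of_ne h2 fun h3 => hne (Prod.ext h1.symm h3)⟩
  have hk₀N : k₀.1 < N := by
    by_cases hk : k₁ = k₀
    · rwa [← hk]
    · rcases hlt k₁ hk₁ hk hk₁c with h1 | ⟨h1, -⟩ <;> linarith
  have hN : (fun y : ℝ => y ^ N) =o[𝓝[>] 0] powLog k₀ := by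
    have := powLog_isLittleO (k := (N, 0)) (k₀ := k₀) (Or.inl hk₀N)
    refine IsBigO.trans_isLittleO (IsBigO.of_bound 1 ?_) this
    filter_upwards with y
    simp [powLog]
  have h1 : (fun y => ∑ k ∈ S.erase k₀, c k * powLog k y) =o[𝓝[>] 0] powLog k₀ := by
    refine IsLittleO.fun_sum fun k hk => ?_
    by_cases hc : c k = 0
    · simp only [hc, zero_mul]
      exact (isLittleO_zero (powLog k₀) _ : (fun _ => (0 : ℂ)) =o[_] _)
    · exact (powLog_isLittleO
        (hlt k (Finset.mem_of_mem_erase hk) (Finset.ne_of_mem_erase hk) hc)).const_mul_left _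
  have h2 : (fun y => c k₀ * powLog k₀ y) =o[𝓝[>] 0] powLog k₀ := by
    refine ((h.trans_isLittleO hN).sub h1).congr' ?_ EventuallyEq.rfl
    filter_upwards with y
    rw [← Finset.add_sum_erase S _ hk₀.1]
    ring
  rw [isLittleO_const_mul_left_iff hk₀.2] at h2
  exact isLittleO_irrefl (eventually_powLog_ne_zero k₀).frequently h2

/-! ### From expansions at each finite order to one set of Casimir-regular coefficients. -/

/-- A function with expansions modulo Casimir-regular terms to any finite order. -/
def ModRegular {ι : Type*} (r s : ℝ) (f : ℝ → ℂ) (I : Finset ι) (a : ι → ℝ) (q : ι → ℕ)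
    (c : ι → ℕ → ℂ) : Prop :=
  ∀ N : ℕ, ∃ M₀ : ℕ, ∀ M ≥ M₀, (fun y => f y - ∑ i ∈ I, ∑ m ∈ Finset.range M,
    c i m * powLog (a i + m, q i) y) ∈ expClass (regSet r s) N

theorem exists_sum_powLog {T : Set (ℝ × ℕ)} {M : ℝ} {f : ℝ → ℂ} (hf : f ∈ expClass T M) :
    ∃ (S : Finset (ℝ × ℕ)) (c : ℝ × ℕ → ℂ), (∀ k ∈ S, k ∈ T) ∧ (∀ k ∉ S, c k = 0) ∧
      (fun y => f y - ∑ k ∈ S, c k * powLog k y) =O[𝓝[>] 0] fun y : ℝ => y ^ M := by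
  obtain ⟨g, hg, g', hg', rfl⟩ := Submodule.mem_sup.1 hf
  obtain ⟨l, hl, rfl⟩ := (Finsupp.mem_span_image_iff_linearCombination ℂ).1 hg
  refine ⟨l.support, l, fun k hk => (Finsupp.mem_supported _ _).1 hl hk,
    fun k hk => Finsupp.notMem_support_iff.1 hk, ?_⟩
  refine (mem_bigOClass.1 hg').congr' ?_ EventuallyEq.rfl
  filter_upwards with y
  simp [Finsupp.linearCombination_apply, Finsupp.sum, Finset.sum_apply]

section

variable {ι : Type*} {r s : ℝ} {f : ℝ → ℂ} {I : Finset ι} {a : ι → ℝ} {q : ι → ℕ} {c : ι → ℕ → ℂ}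

theorem sum_powLog_isBigO (S : Finset (ℝ × ℕ)) (c : ℝ × ℕ → ℂ) {N : ℝ}
    (h : ∀ k ∈ S, c k ≠ 0 → N < k.1) :
    (fun y => ∑ k ∈ S, c k * powLog k y) =O[𝓝[>] 0] fun y : ℝ => y ^ N := by
  refine IsBigO.fun_sum fun k hk => ?_
  by_cases hc : c k = 0
  · simp only [hc, zero_mul]
    exact (isBigO_zero (fun y : ℝ => y ^ N) (𝓝[>] 0) : (fun _ => (0 : ℂ)) =O[_] _)
  · exact (isBigO_powLog (h k hk hc)).const_mul_left _

theorem singular_tail_isBigO (I : Finset ι) (a : ι → ℝ) (q : ι → ℕ) (c : ι → ℕ → ℂ) (N : ℝ) :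
    ∃ M₀ : ℕ, ∀ M ≥ M₀, ∀ M' ≥ M₀, (fun y => ∑ i ∈ I, ∑ m ∈ Finset.range M,
        c i m * powLog (a i + m, q i) y - ∑ i ∈ I, ∑ m ∈ Finset.range M',
        c i m * powLog (a i + m, q i) y) =O[𝓝[>] 0] fun y : ℝ => y ^ N := by
  obtain ⟨M₀, hM₀⟩ : ∃ M₀ : ℕ, ∀ i ∈ I, N < a i + M₀ := by
    obtain ⟨M₀, h⟩ := exists_nat_gt (∑ i ∈ I, |N - a i|)
    refine ⟨M₀, fun i hi => ?_⟩
    have h1 := Finset.single_le_sum (f := fun i => |N - a i|) (fun i _ => abs_nonneg _) hi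
    have h2 := le_abs_self (N - a i)
    linarith
  have key : ∀ M ≥ M₀, (fun y => ∑ i ∈ I, ∑ m ∈ Finset.range M,
        c i m * powLog (a i + m, q i) y - ∑ i ∈ I, ∑ m ∈ Finset.range M₀,
        c i m * powLog (a i + m, q i) y) =O[𝓝[>] 0] fun y : ℝ => y ^ N := by
    intro M hM
    have : (fun y => ∑ i ∈ I, ∑ m ∈ Finset.Ico M₀ M, c i m * powLog (a i + m, q i) y)
        =O[𝓝[>] 0] fun y : ℝ => y ^ N := by
      refine IsBigO.fun_sum fun i hi => IsBigO.fun_sum fun m hm => ?_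
      refine (isBigO_powLog ?_).const_mul_left _
      have : (M₀ : ℝ) ≤ m := by exact_mod_cast (Finset.mem_Ico.1 hm).1
      have := hM₀ i hi
      simp only
      linarith
    refine this.congr' ?_ EventuallyEq.rfl
    filter_upwards with y
    rw [← Finset.sum_sub_distrib]
    exact Finset.sum_congr rfl fun i _ => Finset.sum_Ico_eq_sub _ hM
  refine ⟨M₀, fun M hM M' hM' => ((key M hM).sub (key M' hM')).congr' ?_ EventuallyEq.rfl⟩
  filter_upwards with y
  ring

/-- The Casimir-regular coefficients can be chosen independently of the order. -/
theorem ModRegular.exists_coeff (h : ModRegular r s f I a q c) :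
    ∃ C : ℝ × ℕ → ℂ, (∀ k ∉ regSet r s, C k = 0) ∧ ∀ N : ℕ, ∃ (M₀ : ℕ) (S : Finset (ℝ × ℕ)),
      (∀ k ∈ S, k ∈ regSet r s) ∧ ∀ M ≥ M₀, ∀ S' ⊇ S,
        (fun y => f y - ∑ i ∈ I, ∑ m ∈ Finset.range M, c i m * powLog (a i + m, q i) y -
          ∑ k ∈ S', C k * powLog k y) =O[𝓝[>] 0] fun y : ℝ => y ^ (N : ℝ) := by
  classical
  choose M₁ hM₁ using h
  choose M₂ hM₂ using fun N : ℕ => singular_tail_isBigO I a q c N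
  set Mx : ℕ → ℕ := fun N => max (M₁ N) (M₂ N)
  choose S l hS hl hO using fun N : ℕ => exists_sum_powLog (hM₁ N (Mx N) (le_max_left _ _))
  set sing : ℕ → ℝ → ℂ := fun M y =>
    ∑ i ∈ I, ∑ m ∈ Finset.range M, c i m * powLog (a i + m, q i) y
  have hpow : ∀ {N N' : ℕ}, N ≤ N' →
      (fun y : ℝ => y ^ (N' : ℝ)) =O[𝓝[>] 0] fun y : ℝ => y ^ (N : ℝ) := fun hN =>
    rpow_isBigO_rpow_zero (by exact_mod_cast hN)
  have hsumS : ∀ (N : ℕ) (S' : Finset (ℝ × ℕ)), S N ⊆ S' → ∀ y,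
      ∑ k ∈ S', l N k * powLog k y = ∑ k ∈ S N, l N k * powLog k y := by
    intro N S' hS' y
    refine (Finset.sum_subset hS' fun k _ hk => ?_).symm
    rw [hl N k hk, zero_mul]
  -- Two truncations of the same function agree below the lower order, by the asymptotic
  -- independence of powers and logarithms.
  have hcoh : ∀ {N N' : ℕ}, N ≤ N' → ∀ k : ℝ × ℕ, k.1 < N → l N' k = l N k := by
    intro N N' hN k hk
    have h3 : (fun y => ∑ k ∈ insert k (S N ∪ S N'), (l N' k - l N k) * powLog k y) =O[𝓝[>] 0]
        fun y : ℝ => y ^ (N : ℝ) := by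
      -- compare the two expansions beyond both truncation orders
      have ht1 := hM₂ N (max (Mx N) (Mx N')) (le_max_of_le_left (le_max_right _ _)) (Mx N)
        (le_max_right _ _)
      have ht2 := (hM₂ N' (max (Mx N) (Mx N')) (le_max_of_le_right (le_max_right _ _)) (Mx N')
        (le_max_right _ _)).trans (hpow hN)
      refine ((((hO N).sub ((hO N').trans (hpow hN))).sub ht1).add ht2).congr' ?_ EventuallyEq.rfl
      filter_upwards with y
      have e1 := hsumS N (insert k (S N ∪ S N'))
        (Finset.subset_union_left.trans (Finset.subset_insert _ _)) y
      have e2 := hsumS N' (insert k (S N ∪ S N'))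
        (Finset.subset_union_right.trans (Finset.subset_insert _ _)) y
      simp only [sub_mul, Finset.sum_sub_distrib]
      rw [e1, e2]
      ring
    exact sub_eq_zero.1 (coeff_eq_zero_of_isBigO h3 k (Finset.mem_insert_self _ _) hk)
  -- Any order above the exponent gives the same coefficient; the natural floor plus one is such an
  -- order, also for negative exponents.
  set C : ℝ × ℕ → ℂ := fun k => l (⌊k.1⌋₊ + 1) k with hC
  have hCl : ∀ (N : ℕ) (k : ℝ × ℕ), k.1 < N → C k = l N k := by
    intro N k hk
    have h4 : k.1 < ((⌊k.1⌋₊ + 1 : ℕ) : ℝ) := by exact_mod_cast Nat.lt_floor_add_one k.1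
    rcases le_total N (⌊k.1⌋₊ + 1) with h5 | h5
    · exact hcoh h5 k hk
    · exact (hcoh h5 k h4).symm
  refine ⟨C, fun k hk => hl _ _ fun h5 => hk (hS _ _ h5), fun N => ?_⟩
  refine ⟨Mx (N + 1), S (N + 1), hS (N + 1), fun M hM S' hS' => ?_⟩
  have ht := (hM₂ (N + 1) M ((le_max_right _ _).trans hM) (Mx (N + 1)) (le_max_right _ _)).trans
    (hpow (Nat.le_succ N))
  have h6 : (fun y => ∑ k ∈ S', (C k - l (N + 1) k) * powLog k y) =O[𝓝[>] 0]
      fun y : ℝ => y ^ (N : ℝ) := by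
    refine sum_powLog_isBigO S' _ fun k _ hne => ?_
    by_contra h7
    push Not at h7
    refine hne (sub_eq_zero.2 (hCl (N + 1) k ?_))
    push_cast
    linarith
  refine ((((hO (N + 1)).trans (hpow (Nat.le_succ N))).sub ht).sub h6).congr' ?_ EventuallyEq.rfl
  filter_upwards with y
  simp only [sub_mul, Finset.sum_sub_distrib]
  rw [hsumS (N + 1) S' hS' y]
  ring

theorem exists_range_bound (S : Finset (ℝ × ℕ)) {P : ℝ × ℕ → ℕ → Prop}
    (h : ∀ k ∈ S, ∃ n, P k n) : ∃ M : ℕ, ∀ k ∈ S, ∃ n < M, P k n := by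
  classical
  induction S using Finset.induction_on with
  | empty => exact ⟨0, by simp⟩
  | insert k S _ ih =>
    obtain ⟨M, hM⟩ := ih fun k hk => h k (Finset.mem_insert_of_mem hk)
    obtain ⟨n, hn⟩ := h k (Finset.mem_insert_self _ _)
    refine ⟨max M (n + 1), fun k' hk' => ?_⟩
    rcases Finset.mem_insert.1 hk' with rfl | hk'
    · exact ⟨n, by omega, hn⟩
    · obtain ⟨n', hn', hp⟩ := hM k' hk'
      exact ⟨n', by omega, hp⟩

theorem ModRegular.hasCasimirSingularPart
    (h : ModRegular r s f I a q fun i m => c i m / ((q i).factorial : ℂ)) :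
    HasCasimirSingularPart r s (fun _ => f) I a q c := by
  classical
  obtain ⟨C, hC0, hC⟩ := h.exists_coeff
  -- An exponent that lies in both towers is assigned to the tower of -r, so that its coefficient is
  -- counted once.
  refine ⟨fun k => C (k - r, 0), fun k => if ∃ j : ℕ, (k : ℝ) - s = j - r then 0 else C (k - s, 0),
    fun k => C (k - r, 1), fun k hk => ?_, fun N => ?_⟩
  · refine hC0 _ ?_
    rintro (⟨h0, -⟩ | ⟨-, -, n, hn⟩)
    · exact one_ne_zero h0
    · exact hk ⟨n, hn⟩
  · obtain ⟨M₀, S, hS, hO⟩ := hC N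
    set A : ℕ → Finset (ℝ × ℕ) := fun M => (Finset.range M).image fun k : ℕ => ((k : ℝ) - r, 0)
    set B : ℕ → Finset (ℝ × ℕ) := fun M => ((Finset.range M).filter
      fun k : ℕ => ¬ ∃ j : ℕ, (k : ℝ) - s = j - r).image fun k : ℕ => ((k : ℝ) - s, 0)
    set L : ℕ → Finset (ℝ × ℕ) := fun M => (Finset.range M).image fun k : ℕ => ((k : ℝ) - r, 1)
    have hAB : ∀ M, Disjoint (A M) (B M) := by
      intro M
      rw [Finset.disjoint_left]
      intro k hk hk'
      obtain ⟨n, hn, rfl⟩ := Finset.mem_image.1 hk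
      obtain ⟨n', hn', he⟩ := Finset.mem_image.1 hk'
      exact (Finset.mem_filter.1 hn').2 ⟨n, congrArg Prod.fst he⟩
    have hABL : ∀ M, Disjoint (A M ∪ B M) (L M) := by
      intro M
      rw [Finset.disjoint_left]
      intro k hk hk'
      obtain ⟨n, hn, rfl⟩ := Finset.mem_image.1 hk'
      rcases Finset.mem_union.1 hk with hk | hk <;> obtain ⟨n', -, he⟩ := Finset.mem_image.1 hk <;>
        exact absurd (congrArg Prod.snd he) (by simp)
    have hinj : ∀ (x : ℝ) (j : ℕ) (S : Set ℕ), Set.InjOn (fun k : ℕ => (((k : ℝ) - x, j) : ℝ × ℕ)) S := by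
      intro x j S k _ k' _ he
      have := congrArg Prod.fst he
      simpa using this
    have hsum : ∀ M y, ∑ k ∈ A M ∪ B M ∪ L M, C k * powLog k y =
        ∑ k ∈ Finset.range M, (C (k - r, 0) * ((y ^ ((k : ℝ) - r) : ℝ) : ℂ) +
          (if ∃ j : ℕ, (k : ℝ) - s = j - r then 0 else C (k - s, 0)) *
            ((y ^ ((k : ℝ) - s) : ℝ) : ℂ) +
          C (k - r, 1) * ((y ^ ((k : ℝ) - r) * Real.log y : ℝ) : ℂ)) := by
      intro M y
      rw [Finset.sum_union (hABL M), Finset.sum_union (hAB M), Finset.sum_image (hinj r 0 _),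
        Finset.sum_image (hinj s 0 _), Finset.sum_image (hinj r 1 _), Finset.sum_filter,
        Finset.sum_add_distrib, Finset.sum_add_distrib]
      congr 1
      · congr 1
        · simp [powLog]
        · refine Finset.sum_congr rfl fun k _ => ?_
          split_ifs <;> simp_all [powLog]
      · simp [powLog]
    have hex : ∃ M₁ : ℕ, ∀ M ≥ M₁, S ⊆ A M ∪ B M ∪ L M := by
      have hP : ∀ k ∈ S, ∃ n : ℕ, ∀ M > n, k ∈ A M ∪ B M ∪ L M := by
        rintro ⟨x, j⟩ hk
        have hr : (∃ n : ℕ, x = n - r) → j = 0 → ∃ n, ∀ M > n, (x, j) ∈ A M ∪ B M ∪ L M := by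
          rintro ⟨n, hn⟩ rfl
          exact ⟨n, fun M hM => Finset.mem_union_left _ (Finset.mem_union_left _
            (Finset.mem_image.2 ⟨n, Finset.mem_range.2 hM, by rw [hn]⟩))⟩
        rcases hS _ hk with ⟨h0, h1 | ⟨n, hn⟩⟩ | ⟨h0, ⟨n, hn⟩, -⟩
        · exact hr h1 h0
        · simp only at h0 hn
          by_cases h2 : ∃ m : ℕ, x = m - r
          · exact hr h2 h0
          · subst h0
            refine ⟨n, fun M hM => Finset.mem_union_left _ (Finset.mem_union_right _
              (Finset.mem_image.2 ⟨n, Finset.mem_filter.2 ⟨Finset.mem_range.2 hM, ?_⟩, by rw [hn]⟩))⟩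
            rwa [← hn]
        · simp only at h0 hn
          subst h0
          exact ⟨n, fun M hM => Finset.mem_union_right _
            (Finset.mem_image.2 ⟨n, Finset.mem_range.2 hM, by rw [hn]⟩)⟩
      obtain ⟨M₁, hM₁⟩ := exists_range_bound S hP
      refine ⟨M₁, fun M hM k hk => ?_⟩
      obtain ⟨n, hn, hp⟩ := hM₁ k hk
      exact hp M (by omega)
    obtain ⟨M₁, hM₁⟩ := hex
    refine ⟨max M₀ M₁, fun M hM => ?_⟩
    refine (hO M ((le_max_left _ _).trans hM) _ (hM₁ M ((le_max_right _ _).trans hM))).congr' ?_ ?_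
    · filter_upwards with y
      rw [hsum M y]
      congr 2
      refine Finset.sum_congr rfl fun i _ => Finset.sum_congr rfl fun m _ => ?_
      simp only [powLog]
      push_cast
      ring
    · filter_upwards with y
      rw [Real.rpow_natCast]

end

/-! ### Sums over the large weight: convergence and Casimir-singular part -/

section

variable {ι : Type*} {r s H C h₁ : ℝ} {Q : ℕ} {p : ℝ → ℂ} {I : Finset ι} {a : ι → ℝ}
  {c : ι → ℕ → ℂ}

theorem BlockBound.mul_block (hB : BlockBound r s H C Q) (hh : H ≤ h₁) {y : ℝ} (hy : 0 < y) :
    p h₁ * (block r s h₁ (1 / (1 + y)) : ℂ) =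
      p h₁ / (blockWeight r s h₁ : ℂ) * ((2 * h₁ - 1 : ℝ) : ℂ) * (normBlock r s h₁ y : ℂ) := by
  obtain ⟨a1, a2, a3⟩ := hB.lt hh 0
  simp only [Nat.cast_zero, add_zero] at a1 a2 a3
  have h1 := hB.one_le.trans hh
  have hw : 0 < blockWeight r s h₁ := by
    have := Real.Gamma_pos_of_pos (by linarith [le_abs_self r] : 0 < h₁ - r)
    have := Real.Gamma_pos_of_pos (by linarith [le_abs_self s] : 0 < h₁ - s)
    have := Real.Gamma_pos_of_pos (by linarith : 0 < 2 * h₁ - 1)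
    unfold blockWeight
    positivity
  have hw' : (blockWeight r s h₁ : ℂ) ≠ 0 := by exact_mod_cast hw.ne'
  rw [mul_assoc, ← Complex.ofReal_mul, ← blockWeight_mul_block h1 a2 a3 hy]
  push_cast
  field_simp

theorem isBigO_mul_linear {f : ℝ → ℂ} {g : ℝ → ℝ} (hf : f =O[atTop] g) :
    (fun h => f h * ((2 * h - 1 : ℝ) : ℂ)) =O[atTop] fun h : ℝ => g h * h := by
  refine hf.mul (isBigO_ofReal_left.2 ?_)
  have h1 := ((isBigO_refl (fun h : ℝ => h) atTop).const_mul_left 2)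
  refine h1.sub (IsBigO.of_bound 1 ?_)
  filter_upwards [eventually_ge_atTop 1] with h hh
  rw [norm_one, one_mul, Real.norm_of_nonneg (by linarith)]
  exact hh

theorem HasQuotExpansion.polyBdd
    (hp : HasQuotExpansion (fun h => p h / (blockWeight r s h : ℂ)) I a c) (h₁ : ℝ) :
    PolyBdd fun ℓ : ℕ => p (h₁ + ℓ) / (blockWeight r s (h₁ + ℓ) : ℂ) *
      ((2 * (h₁ + ℓ) - 1 : ℝ) : ℂ) := by
  obtain ⟨P, hP⟩ := hp.isBigO
  have h1 := isBigO_mul_linear hP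
  simp only [← pow_succ] at h1
  exact polyBdd_of_isBigO h1 h₁

theorem exists_nat_add_gt (h₀ x : ℝ) : ∃ k : ℕ, x < h₀ + k := by
  obtain ⟨k, hk⟩ := exists_nat_gt (x - h₀)
  exact ⟨k, by linarith⟩

theorem BlockBound.mul_block_eq (hB : BlockBound r s H C Q) (hh : H ≤ h₁) {y : ℝ} (hy : 0 < y)
    (ℓ : ℕ) : p (h₁ + ℓ) * (block r s (h₁ + ℓ) (1 / (1 + y)) : ℂ) =
      p (h₁ + ℓ) / (blockWeight r s (h₁ + ℓ) : ℂ) * ((2 * (h₁ + ℓ) - 1 : ℝ) : ℂ) *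
        (normBlock r s (h₁ + ℓ) y : ℂ) :=
  hB.mul_block (by linarith [Nat.cast_nonneg (α := ℝ) ℓ]) hy

theorem HasQuotExpansion.summable
    (hp : HasQuotExpansion (fun h => p h / (blockWeight r s h : ℂ)) I a c) (h₀ : ℝ) {y : ℝ}
    (hy : 0 < y) :
    Summable fun ℓ : ℕ => p (h₀ + ℓ) * (block r s (h₀ + ℓ) (1 / (1 + y)) : ℂ) := by
  obtain ⟨H, C, Q, hB⟩ := exists_blockBound r s
  obtain ⟨k, hk⟩ := exists_nat_add_gt h₀ H
  rw [← summable_nat_add_iff k]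
  refine (hB.hasSum hk.le (hp.polyBdd (h₀ + k)) hy).1.summable.congr fun ℓ => ?_
  rw [← hB.mul_block_eq hk.le hy]
  push_cast
  rw [show h₀ + k + (ℓ : ℝ) = h₀ + (ℓ + k) by ring]

/-- The sum splits into finitely many single blocks, which are Casimir-regular, the sums `quotSum`
of the truncated expansion, whose singular terms are known, and a remainder that decays fast enough
to be regular to order N. -/
theorem HasQuotExpansion.modRegular
    (hp : HasQuotExpansion (fun h => p h / (blockWeight r s h : ℂ)) I a c)
    (ha : ∀ i ∈ I, Resonant (-a i - r) ∧ Resonant (-a i - s)) {q : ι → ℕ}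
    (hq : ∀ i ∈ I, q i = (if -a i - r = 0 then 1 else 0) + (if -a i - s = 0 then 1 else 0))
    {h₀ : ℝ} (hh₀ : 0 < h₀) :
    ModRegular r s
      (fun y => ∑' ℓ : ℕ, p (h₀ + ℓ) * (block r s (h₀ + ℓ) (1 / (1 + y)) : ℂ)) I a q
      (fun i m => c i m * ((gammaShift (-a i - r) m * gammaShift (-a i - s) m : ℝ) : ℂ) /
        ((q i).factorial : ℂ)) := by
  intro N
  obtain ⟨H, C, Q, hB⟩ := exists_blockBound r s
  obtain ⟨N', hN'⟩ := hB.exists_decay_mem N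
  -- The additional order pays for the factor 2h - 1 in the change to normalised blocks.
  obtain ⟨M₀, hM₀⟩ := hp (N' + 1)
  refine ⟨M₀, fun M hM => ?_⟩
  -- The sums must start above every exponent a_i + m that occurs, so the number k of split-off
  -- blocks depends on M.
  obtain ⟨k, hk⟩ := exists_nat_add_gt h₀
    (|H| + (|r| + |s| + 1) + ∑ i ∈ I, |a i| + M + 1)
  set h₁ := h₀ + k with hh₁
  have hsum0 : 0 ≤ ∑ i ∈ I, |a i| := Finset.sum_nonneg fun i _ => abs_nonneg _
  have hM0 : (0 : ℝ) ≤ M := Nat.cast_nonneg M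
  have hH : H ≤ h₁ := by linarith [le_abs_self H, abs_nonneg r, abs_nonneg s]
  have hrs : |r| + |s| + 1 < h₁ := by linarith [abs_nonneg H]
  have hai : ∀ i ∈ I, ∀ m ∈ Finset.range M, a i + m + 1 < h₁ := by
    intro i hi m hm
    have h1 := Finset.single_le_sum (f := fun i => |a i|) (fun i _ => abs_nonneg _) hi
    have h2 : (m : ℝ) ≤ M := by exact_mod_cast (Finset.mem_range.1 hm).le
    linarith [le_abs_self (a i), abs_nonneg H, abs_nonneg r, abs_nonneg s]
  -- the remainder of the large-weight expansion
  set ρ : ℝ → ℂ := fun h => p h / (blockWeight r s h : ℂ) -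
    ∑ i ∈ I, ∑ m ∈ Finset.range M, c i m * (gammaQuot (a i + m) h : ℂ) with hρ
  have hρO : (fun h => ρ h * ((2 * h - 1 : ℝ) : ℂ)) =O[atTop] fun h : ℝ => (h ^ N')⁻¹ := by
    refine (isBigO_mul_linear (hM₀ M hM)).congr' EventuallyEq.rfl ?_
    filter_upwards [eventually_gt_atTop 0] with h hh
    rw [pow_succ]
    field_simp
  have hdec := exists_decay_of_isBigO hρO h₁
  have hρmem := hN' h₁ hH _ hdec
  have hρpoly : PolyBdd fun ℓ : ℕ => ρ (h₁ + ℓ) * ((2 * (h₁ + ℓ) - 1 : ℝ) : ℂ) := by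
    obtain ⟨A, hA⟩ := hdec
    refine ⟨A, 0, le_trans (by positivity) (hA 0), fun ℓ => ?_⟩
    rw [pow_zero, mul_one]
    refine le_trans ?_ (hA ℓ)
    have h1 : (1 : ℝ) ≤ (ℓ : ℝ) + 1 := by linarith [Nat.cast_nonneg (α := ℝ) ℓ]
    exact le_mul_of_one_le_right (norm_nonneg _) (one_le_pow₀ h1)
  have hsplit : ∀ y > 0, ∑' ℓ : ℕ, p (h₀ + ℓ) * (block r s (h₀ + ℓ) (1 / (1 + y)) : ℂ) =
      ∑ ℓ ∈ Finset.range k, p (h₀ + ℓ) * (block r s (h₀ + ℓ) (1 / (1 + y)) : ℂ) +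
      (∑ i ∈ I, ∑ m ∈ Finset.range M, c i m * (quotSum r s h₁ (a i + m) y : ℂ) +
        blockTotal r s h₁ (fun ℓ => ρ (h₁ + ℓ) * ((2 * (h₁ + ℓ) - 1 : ℝ) : ℂ)) y) := by
    intro y hy
    rw [← (hp.summable h₀ hy).sum_add_tsum_nat_add k]
    congr 1
    have t1 := (hB.hasSum hH hρpoly hy).1
    have t2 : HasSum (fun ℓ : ℕ => ∑ i ∈ I, ∑ m ∈ Finset.range M,
        c i m * (quotSeq h₁ (a i + m) ℓ * (normBlock r s (h₁ + ℓ) y : ℂ)))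
        (∑ i ∈ I, ∑ m ∈ Finset.range M, c i m * (quotSum r s h₁ (a i + m) y : ℂ)) := by
      refine hasSum_sum fun i _ => hasSum_sum fun m _ => ?_
      rw [ofReal_quotSum]
      exact (hB.hasSum hH (polyBdd_quotSeq h₁ _) hy).1.mul_left _
    rw [← (t2.add t1).tsum_eq]
    refine tsum_congr fun ℓ => ?_
    have e1 : h₀ + ((ℓ + k : ℕ) : ℝ) = h₁ + ℓ := by
      rw [hh₁]
      push_cast
      ring
    rw [e1, hB.mul_block_eq hH hy]
    simp only [hρ, quotSeq, sub_mul, Finset.sum_mul, ← mul_assoc]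
    push_cast
    simp only [← mul_assoc]
    ring
  have hfin : (fun y => ∑ ℓ ∈ Finset.range k,
      p (h₀ + ℓ) * (block r s (h₀ + ℓ) (1 / (1 + y)) : ℂ)) ∈ expClass (regSet r s) N := by
    have : (∑ ℓ ∈ Finset.range k, fun y : ℝ =>
        p (h₀ + ℓ) * (block r s (h₀ + ℓ) (1 / (1 + y)) : ℂ)) ∈ expClass (regSet r s) N :=
      sum_mem fun ℓ _ => (isRegular_block (by positivity)).const_mul _ _
    refine expClass_congr this fun y _ => ?_
    rw [Finset.sum_apply]
  have hsing : (∑ i ∈ I, ∑ m ∈ Finset.range M, fun y : ℝ => c i m *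
      ((quotSum r s h₁ (a i + m) y : ℂ) -
      ((gammaShift (-a i - r) m * gammaShift (-a i - s) m / (q i).factorial : ℝ) : ℂ) *
        powLog (a i + m, q i) y)) ∈ expClass (regSet r s) N :=
    sum_mem fun i hi => sum_mem fun m hm =>
      (hB.isRegular_quotSum hH hrs (ha i hi).1 (ha i hi).2 m (hai i hi m hm) (hq i hi)).const_mul _ _
  refine expClass_congr (add_mem (add_mem hfin hsing) hρmem) fun y hy => ?_
  beta_reduce
  rw [hsplit y hy]
  simp only [Pi.add_apply, Finset.sum_apply, mul_sub, Finset.sum_sub_distrib]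
  have e2 : ∀ i ∈ I, ∑ m ∈ Finset.range M, c i m *
      ((gammaShift (-a i - r) m * gammaShift (-a i - s) m : ℝ) : ℂ) / ((q i).factorial : ℂ) *
        powLog (a i + m, q i) y = ∑ m ∈ Finset.range M, c i m *
      (((gammaShift (-a i - r) m * gammaShift (-a i - s) m / (q i).factorial : ℝ) : ℂ) *
        powLog (a i + m, q i) y) := by
    intro i _
    refine Finset.sum_congr rfl fun m _ => ?_
    push_cast
    ring
  rw [Finset.sum_congr rfl e2]
  ring

end

/-! ### Expansion of a block and of its derivatives in the weight at small cross ratio -/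

theorem hasSum_one_add_rpow_neg (a : ℝ) {y : ℝ} (hy : 0 < y) (hy1 : y < 1) :
    HasSum (fun k : ℕ => poch a k / (k.factorial : ℝ) * (-y) ^ k) ((1 + y) ^ (-a)) := by
  have h := (Real.one_div_one_sub_rpow_hasFPowerSeriesOnBall_zero a).hasSum (y := -y) (by
    simp [enorm_eq_nnnorm, ← NNReal.coe_lt_coe, abs_of_pos hy, hy1])
  rw [Real.rpow_neg (by linarith)]
  simp only [zero_add, sub_neg_eq_add, one_div] at h
  refine h.congr_fun fun k => ?_
  rw [FormalMultilinearSeries.ofScalars_apply_eq, ← Ring.multichoose_eq, smul_eq_mul]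
  congr 1
  have h2 := Ring.factorial_nsmul_multichoose_eq_ascPochhammer a k
  rw [Polynomial.ascPochhammer_smeval_eq_eval, nsmul_eq_mul] at h2
  unfold poch
  rw [← h2, mul_div_cancel_left₀ _ (by positivity)]

theorem abs_poch_div_factorial_le {a : ℝ} {A : ℕ} (ha : |a| ≤ A) (n k : ℕ) :
    |poch (a + n) k / (k.factorial : ℝ)| ≤ 2 ^ (A + n + k) := by
  have h1 : ∀ k : ℕ, |poch (a + n) k| ≤ ((A + n).ascFactorial k : ℝ) := by
    intro k
    induction k with
    | zero => simp [poch]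
    | succ k ih =>
      rw [poch_succ, abs_mul, Nat.ascFactorial_succ, mul_comm]
      push_cast
      refine mul_le_mul ?_ ih (abs_nonneg _) (by positivity)
      refine (abs_add_le _ _).trans (add_le_add ((abs_add_le _ _).trans ?_) (by simp))
      simpa using ha
  rw [abs_div, Nat.abs_cast, div_le_iff₀ (by positivity)]
  refine (h1 k).trans ?_
  rcases Nat.eq_zero_or_pos (A + n) with h0 | h0
  · rw [h0]
    rcases k with _ | k
    · simp
    · rw [Nat.zero_ascFactorial]; simp
  · obtain ⟨B, hB⟩ : ∃ B, A + n = B + 1 := ⟨A + n - 1, by omega⟩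
    rw [hB, Nat.ascFactorial_eq_factorial_mul_choose, Nat.cast_mul, mul_comm]
    refine mul_le_mul_of_nonneg_right ?_ (by positivity)
    have : (B + k).choose k ≤ 2 ^ (B + 1 + k) :=
      (Nat.choose_le_two_pow _ _).trans (Nat.pow_le_pow_right (by norm_num) (by omega))
    exact_mod_cast this

/-- Re-expanding powers of y/(1+y) in powers of y mixes the hypergeometric coefficients.
Chu–Vandermonde evaluates the sum, which is Pfaff's transformation coefficientwise. -/
theorem sum_antidiagonal_blockCoeff {r s x : ℝ} (hx : NotPole (2 * x)) (N : ℕ) :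
    ∑ p ∈ Finset.HasAntidiagonal.antidiagonal N, blockSeq r s x p.1 * (-1) ^ p.2 *
      (poch (x - r + p.1) p.2 / (p.2.factorial : ℝ)) = blockCoeff r s x N := by
  rw [Finset.Nat.sum_antidiagonal_eq_sum_range_succ_mk]
  have h := sum_choose_poch_div (b := x + s) hx N
  rw [show 2 * x - (x + s) = x - s by ring] at h
  have h' : blockCoeff r s x N = poch (x - r) N * (-1) ^ N / (N.factorial : ℝ) *
      (poch (x - s) N / poch (2 * x) N) := by
    have := poch_ne_zero hx N
    unfold blockCoeff
    field_simp
  rw [h', ← h, Finset.mul_sum]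
  refine Finset.sum_congr rfl fun n hn => ?_
  obtain ⟨k, rfl⟩ := Nat.exists_eq_add_of_le (Nat.lt_succ_iff.1 (Finset.mem_range.1 hn))
  have h1 := poch_ne_zero hx n
  have e : (-1 : ℝ) ^ (n + k) * (-1) ^ n = (-1) ^ k := by
    rw [pow_add, mul_right_comm, ← mul_pow]; simp
  rw [Nat.cast_add_choose, poch_add, Nat.add_sub_cancel_left]
  unfold blockSeq
  dsimp only
  rw [← e]
  field_simp

/-- Binomial coefficients bounded by powers of 2 make the double series absolutely convergent for
2Ty < 1, so it may be summed either along the antidiagonals or row by row. -/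
theorem block_small {r s x y T : ℝ} {A : ℕ} (hx : NotPole (2 * x)) (hA : |x - r| ≤ A) (hT : 1 ≤ T)
    (hc : ∀ n, |blockSeq r s x n| ≤ T ^ n) (hy : 0 < y) (hyT : y * (4 * T) < 1) :
    block r s x (y / (1 + y)) = y ^ x * ∑' j, blockCoeff r s x j * y ^ j := by
  have hy1 : y * 4 < 1 := by nlinarith
  set F : ℕ × ℕ → ℝ := fun p => blockSeq r s x p.1 * (-1) ^ p.2 *
      (poch (x - r + p.1) p.2 / (p.2.factorial : ℝ)) * y ^ (p.1 + p.2) with hF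
  have hsum : Summable F := by
    have g1 : Summable fun n : ℕ => (2 * T * y) ^ n :=
      summable_geometric_of_lt_one (by positivity) (by nlinarith)
    have g2 : Summable fun n : ℕ => (2 * y) ^ n :=
      summable_geometric_of_lt_one (by positivity) (by nlinarith)
    refine Summable.of_norm_bounded ((g1.mul_of_nonneg g2 (fun n => by positivity)
      (fun n => by positivity)).mul_left (2 ^ A)) fun p => ?_
    rw [hF]
    simp only [norm_mul, norm_pow, norm_neg, norm_one, one_pow, mul_one, Real.norm_eq_abs,
      abs_of_pos hy]
    calc _ ≤ T ^ p.1 * 2 ^ (A + p.1 + p.2) * y ^ (p.1 + p.2) := by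
          gcongr
          · exact hc p.1
          · exact abs_poch_div_factorial_le hA p.1 p.2
      _ = _ := by simp only [pow_add, mul_pow]; ring
  have h1 : ∑' p, F p = ∑' j, blockCoeff r s x j * y ^ j := by
    rw [← (Finset.HasAntidiagonal.sigmaAntidiagonalEquivProd (A := ℕ)).tsum_eq F]
    refine (((Finset.HasAntidiagonal.sigmaAntidiagonalEquivProd (A := ℕ)).summable_iff.2
      hsum).tsum_sigma' fun n => (hasSum_fintype _).summable).trans (tsum_congr fun N => ?_)
    rw [tsum_fintype, ← sum_antidiagonal_blockCoeff hx N, Finset.sum_mul,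
      ← Finset.sum_coe_sort (Finset.HasAntidiagonal.antidiagonal N)]
    refine Finset.sum_congr rfl fun p _ => ?_
    rw [Function.comp_apply, hF]
    simp only [Finset.HasAntidiagonal.sigmaAntidiagonalEquivProd_apply]
    rw [(Finset.HasAntidiagonal.mem_antidiagonal.1 p.2)]
  have h2 : ∑' p, F p = (1 + y) ^ (-(x - r)) * ∑' n, blockSeq r s x n * (y / (1 + y)) ^ n := by
    rw [hsum.tsum_prod, ← tsum_mul_left]
    refine tsum_congr fun n => ?_
    have h3 := ((hasSum_one_add_rpow_neg (x - r + n) hy (by linarith)).mul_left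
      (blockSeq r s x n * y ^ n)).tsum_eq
    rw [show -(x - r + (n : ℝ)) = -(x - r) + -(n : ℝ) by ring, Real.rpow_add (by linarith),
      Real.rpow_neg (by linarith) (n : ℝ), Real.rpow_natCast] at h3
    rw [div_pow, div_eq_mul_inv, mul_comm ((1 + y) ^ (-(x - r)))]
    refine Eq.trans (tsum_congr fun k => ?_) (h3.trans (by ring))
    rw [hF]
    simp only
    rw [neg_pow, pow_add]
    ring
  rw [← h1, h2]
  unfold block
  rw [ordinaryHypergeometric_eq_tsum]
  have e1 : 1 - y / (1 + y) = (1 + y)⁻¹ := by field_simp; ring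
  rw [e1, Real.div_rpow hy.le (by linarith), Real.inv_rpow (by linarith),
    ← Real.rpow_neg (by linarith), neg_neg, neg_sub, Real.rpow_sub (by linarith), ← mul_assoc]
  congr 1
  · ring
  · refine tsum_congr fun n => ?_
    unfold blockSeq poch
    rw [smul_eq_mul, div_eq_mul_inv (_ * _) (_ * (n.factorial : ℝ)), mul_inv]
    ring

/-- `f` is twice differentiable on `U` and, with its first two derivatives, bounded by `K`. -/
def JetBound (U : Set ℝ) (K : ℝ) (f f₁ f₂ : ℝ → ℝ) : Prop :=
  ∀ x ∈ U, HasDerivAt f (f₁ x) x ∧ HasDerivAt f₁ (f₂ x) x ∧ |f x| ≤ K ∧ |f₁ x| ≤ K ∧ |f₂ x| ≤ K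

theorem JetBound.mul {U : Set ℝ} {K L : ℝ} {f f₁ f₂ g g₁ g₂ : ℝ → ℝ} (hf : JetBound U K f f₁ f₂)
    (hg : JetBound U L g g₁ g₂) : JetBound U (4 * (K * L)) (fun x => f x * g x)
      (fun x => f₁ x * g x + f x * g₁ x)
      (fun x => f₂ x * g x + f₁ x * g₁ x + (f₁ x * g₁ x + f x * g₂ x)) := by
  intro x hx
  obtain ⟨a1, a2, a3, a4, a5⟩ := hf x hx
  obtain ⟨b1, b2, b3, b4, b5⟩ := hg x hx
  have hK : 0 ≤ K := (abs_nonneg _).trans a3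
  have hKL : 0 ≤ K * L := mul_nonneg hK ((abs_nonneg _).trans b3)
  have key : ∀ {u v : ℝ}, |u| ≤ K → |v| ≤ L → |u * v| ≤ K * L := fun hu hv => by
    rw [abs_mul]; exact mul_le_mul hu hv (abs_nonneg _) hK
  refine ⟨a1.mul b1, (a2.mul b1).add (a1.mul b2), (key a3 b3).trans (by linarith), ?_, ?_⟩
  · exact (abs_add_le _ _).trans (by linarith [key a4 b3, key a3 b4])
  · refine (abs_add_le _ _).trans ?_
    linarith [abs_add_le (f₂ x * g x) (f₁ x * g₁ x), abs_add_le (f₁ x * g₁ x) (f x * g₂ x),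
      key a5 b3, key a4 b4, key a3 b5]

theorem JetBound.mono {U : Set ℝ} {K L : ℝ} {f f₁ f₂ : ℝ → ℝ} (hf : JetBound U K f f₁ f₂)
    (h : K ≤ L) : JetBound U L f f₁ f₂ := fun x hx =>
  let ⟨a1, a2, a3, a4, a5⟩ := hf x hx
  ⟨a1, a2, a3.trans h, a4.trans h, a5.trans h⟩

/-- Near a point that is not a pole, `2 x + j` stays away from zero uniformly in `j`. -/
theorem NotPole.exists_nhds {x₀ : ℝ} (h : NotPole (2 * x₀)) :
    ∃ ρ > 0, ∃ δ > 0, ρ ≤ 1 ∧ δ ≤ 1 ∧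
      ∀ x ∈ Metric.ball x₀ ρ, ∀ j : ℕ, δ * (j + 1) ≤ |2 * x + j| := by
  have hlim : Tendsto (fun j : ℕ => ((j : ℝ) + 1) / (2 * x₀ + j)) atTop (𝓝 (1 + 0)) := by
    have : Tendsto (fun j : ℕ => 1 + (1 - 2 * x₀) / (2 * x₀ + j)) atTop (𝓝 (1 + 0)) :=
      tendsto_const_nhds.add (tendsto_const_nhds.div_atTop
        (tendsto_atTop_add_const_left _ _ tendsto_natCast_atTop_atTop))
    refine this.congr fun j => ?_
    have := h.add_ne_zero j
    field_simp
    ring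
  obtain ⟨C, hC⟩ := (Metric.isBounded_range_of_tendsto _ hlim).exists_norm_le
  set C' := max C 1
  have hC' : 1 ≤ C' := le_max_right _ _
  have h0 : ∀ j : ℕ, 1 / C' * ((j : ℝ) + 1) ≤ |2 * x₀ + j| := fun j => by
    have h1 := (hC _ ⟨j, rfl⟩).trans (le_max_left C 1)
    have h2 := abs_pos.2 (h.add_ne_zero j)
    rw [Real.norm_eq_abs, abs_div, div_le_iff₀ h2, abs_of_pos (by positivity)] at h1
    rw [one_div_mul_eq_div, div_le_iff₀ (by linarith)]
    linarith [h1]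
  have hd : 1 / C' ≤ 1 := by rw [div_le_one (by linarith)]; exact hC'
  have hd0 : 0 < 1 / C' := by positivity
  refine ⟨1 / C' / 4, by positivity, 1 / C' / 2, by positivity, by linarith, by linarith,
    fun x hx j => ?_⟩
  rw [Metric.mem_ball, Real.dist_eq] at hx
  have h1 := h0 j
  have h2 : |2 * x₀ + j| ≤ |2 * x + j| + 2 * |x - x₀| := by
    have := abs_sub_abs_le_abs_sub (2 * x₀ + j) (2 * x + j)
    rw [show 2 * x₀ + j - (2 * x + j) = 2 * (x₀ - x) by ring, abs_mul, abs_sub_comm x₀ x] at this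
    norm_num at this
    linarith
  have hj : (0 : ℝ) ≤ j := Nat.cast_nonneg j
  nlinarith [mul_nonneg hd0.le hj]

theorem jetBound_factor {U : Set ℝ} (r P : ℝ) (hP : ∀ x ∈ U, |x - r| ≤ P) (j : ℕ) :
    JetBound U (P + 1) (fun x => (x - r + j) / (j + 1)) (fun _ => 1 / (j + 1)) (fun _ => 0) := by
  intro x hx
  have hP0 : 0 ≤ P := (abs_nonneg _).trans (hP x hx)
  have hj : (0 : ℝ) ≤ j := Nat.cast_nonneg j
  refine ⟨(((hasDerivAt_id x).sub_const r).add_const (j : ℝ)).div_const _,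
    hasDerivAt_const _ _, ?_, ?_, by simpa using by linarith⟩
  · rw [abs_div, abs_of_pos (by positivity : (0 : ℝ) < j + 1), div_le_iff₀ (by positivity)]
    refine (abs_add_le _ _).trans ?_
    rw [Nat.abs_cast]
    nlinarith [hP x hx, mul_nonneg hP0 hj]
  · rw [abs_of_pos (by positivity), div_le_iff₀ (by positivity)]
    nlinarith [mul_nonneg hP0 hj]

theorem jetBound_inv {U : Set ℝ} {δ : ℝ} (hδ : 0 < δ) (hδ1 : δ ≤ 1) {j : ℕ}
    (hU : ∀ x ∈ U, δ * (j + 1) ≤ |2 * x + j|) :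
    JetBound U (8 / δ ^ 3) (fun x => -((j + 1) / (2 * x + j)))
      (fun x => 2 * ((j + 1) / (2 * x + j) ^ 2)) (fun x => -(8 * ((j + 1) / (2 * x + j) ^ 3))) := by
  intro x hx
  have hj : (0 : ℝ) ≤ j := Nat.cast_nonneg j
  have hj1 : (0 : ℝ) < j + 1 := by positivity
  have h0 : 0 < |2 * x + j| := lt_of_lt_of_le (by positivity) (hU x hx)
  have hne : 2 * x + j ≠ 0 := abs_pos.1 h0
  have hd : HasDerivAt (fun x : ℝ => 2 * x + (j : ℝ)) 2 x := by
    simpa using ((hasDerivAt_id x).const_mul 2).add_const (j : ℝ)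
  have hb : ∀ k : ℕ, 1 ≤ k → |((j : ℝ) + 1) / (2 * x + j) ^ k| ≤ 1 / δ ^ k := by
    intro k hk
    rw [abs_div, abs_pow, abs_of_pos hj1, div_le_div_iff₀ (by positivity) (by positivity)]
    calc ((j : ℝ) + 1) * δ ^ k ≤ (j + 1) ^ k * δ ^ k := by
          gcongr; exact le_self_pow₀ (by linarith) (by omega)
      _ = (δ * (j + 1)) ^ k := by rw [mul_pow]; ring
      _ ≤ 1 * |2 * x + j| ^ k := by rw [one_mul]; gcongr; exact hU x hx
  have hδk : ∀ k : ℕ, k ≤ 3 → 1 / δ ^ k ≤ 1 / δ ^ 3 := fun k hk =>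
    one_div_le_one_div_of_le (by positivity) (pow_le_pow_of_le_one hδ.le hδ1 hk)
  have h3 : 0 < 1 / δ ^ 3 := by positivity
  have e8 : 8 / δ ^ 3 = 8 * (1 / δ ^ 3) := by ring
  refine ⟨?_, ?_, ?_, ?_, ?_⟩
  · refine ((hd.fun_inv hne).const_mul (-((j : ℝ) + 1))).congr_deriv (by field_simp)
      |>.congr_of_eventuallyEq (Eventually.of_forall fun z => by simp only; ring)
  · refine (((hd.pow 2).fun_inv (pow_ne_zero 2 hne)).const_mul (2 * ((j : ℝ) + 1))).congr_deriv
      (by simp only [Pi.pow_apply]; field_simp; norm_num; ring) |>.congr_of_eventuallyEq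
      (Eventually.of_forall fun z => by simp only [Pi.pow_apply]; ring)
  · rw [abs_neg]
    have := hb 1 le_rfl
    rw [pow_one] at this
    linarith [hδk 1 (by norm_num)]
  · rw [abs_mul, abs_two]
    linarith [hb 2 (by norm_num), hδk 2 (by norm_num)]
  · rw [abs_neg, abs_mul, abs_of_pos (by norm_num : (0 : ℝ) < 8)]
    linarith [hb 3 (by norm_num)]

theorem blockCoeff_succ {r s x : ℝ} (j : ℕ) : blockCoeff r s x (j + 1) = blockCoeff r s x j *
    ((x - r + j) / (j + 1) * ((x - s + j) / (j + 1)) * -((j + 1) / (2 * x + j))) := by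
  unfold blockCoeff
  rw [poch_succ, poch_succ, poch_succ, Nat.factorial_succ]
  push_cast
  have : (j : ℝ) + 1 ≠ 0 := by positivity
  field_simp
  ring

/-- Consecutive coefficients differ by three factors whose values and first two derivatives are
bounded uniformly in j. Each product costs a factor 4 by the Leibniz rule, so the bounds grow only
geometrically. -/
theorem exists_jetBound_blockCoeff (r s : ℝ) {U : Set ℝ} {δ P : ℝ} (hδ : 0 < δ) (hδ1 : δ ≤ 1)
    (hU : ∀ x ∈ U, ∀ j : ℕ, δ * (j + 1) ≤ |2 * x + j|) (hr : ∀ x ∈ U, |x - r| ≤ P)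
    (hs : ∀ x ∈ U, |x - s| ≤ P) :
    ∃ T ≥ 1, ∃ f₁ f₂ : ℕ → ℝ → ℝ,
      ∀ j, JetBound U (T ^ j) (fun x => blockCoeff r s x j) (f₁ j) (f₂ j) := by
  set T₀ := 4 * (4 * (4 * ((P + 1) * (P + 1)) * (8 / δ ^ 3)))
  have hj : ∀ j, ∃ f₁ f₂, JetBound U (max T₀ 1 ^ j) (fun x => blockCoeff r s x j) f₁ f₂ := by
    intro j
    induction j with
    | zero =>
      refine ⟨fun _ => 0, fun _ => 0, fun x _ => ?_⟩
      have : (fun x => blockCoeff r s x 0) = fun _ => 1 := by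
        funext x; simp [blockCoeff, poch]
      have h1 : blockCoeff r s x 0 = 1 := congrFun this x
      simp only [this]
      refine ⟨hasDerivAt_const _ _, hasDerivAt_const _ _, ?_, ?_, ?_⟩ <;> simp [h1]
    | succ j ih =>
      obtain ⟨f₁, f₂, hf⟩ := ih
      have := hf.mul (((jetBound_factor r P hr j).mul (jetBound_factor s P hs j)).mul
        (jetBound_inv hδ hδ1 (fun x hx => hU x hx j)))
      simp only [← blockCoeff_succ] at this
      refine ⟨_, _, this.mono ?_⟩
      rw [pow_succ]
      have h1 : 0 ≤ max T₀ 1 ^ j := by positivity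
      have h2 := mul_le_mul_of_nonneg_left (le_max_left T₀ 1) h1
      refine le_trans (le_of_eq ?_) h2
      ring
  choose f₁ f₂ hf using hj
  exact ⟨max T₀ 1, le_max_right _ _, f₁, f₂, hf⟩

theorem summable_of_abs_le_pow {g : ℕ → ℝ} {T y : ℝ} (hg : ∀ j, |g j| ≤ T ^ j) (hT : 1 ≤ T)
    (hy : 0 < y) (hyT : T * y < 1) : Summable fun j => g j * y ^ j := by
  refine Summable.of_norm_bounded (summable_geometric_of_lt_one (by positivity) hyT) fun j => ?_
  rw [norm_mul, norm_pow, Real.norm_eq_abs, Real.norm_eq_abs, abs_of_pos hy, mul_pow]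
  exact mul_le_mul_of_nonneg_right (hg j) (by positivity)

theorem tsum_sub_sum_isBigO {g : ℕ → ℝ} {T : ℝ} (hg : ∀ j, |g j| ≤ T ^ j) (hT : 1 ≤ T) (J : ℕ) :
    (fun y : ℝ => ∑' j, g j * y ^ j - ∑ j ∈ Finset.range J, g j * y ^ j) =O[𝓝[>] 0]
      fun y : ℝ => y ^ J := by
  refine IsBigO.of_bound (T ^ J * 2) ?_
  filter_upwards [Ioo_mem_nhdsGT (show (0 : ℝ) < 1 / (2 * T) by positivity)] with y hy
  have hyT : T * y < 1 / 2 := by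
    have := hy.2
    rw [lt_div_iff₀ (by positivity)] at this
    linarith
  have hs := summable_of_abs_le_pow hg hT hy.1 (by linarith)
  rw [← hs.sum_add_tsum_nat_add J, add_sub_cancel_left, norm_pow, Real.norm_eq_abs y,
    abs_of_pos hy.1]
  have h0 : 0 ≤ T * y := mul_nonneg (by linarith) hy.1.le
  refine (tsum_of_norm_bounded ((hasSum_geometric_of_lt_one h0 (by linarith)).mul_left
    (T ^ J * y ^ J)) fun j => ?_).trans ?_
  · rw [norm_mul, norm_pow, Real.norm_eq_abs, Real.norm_eq_abs, abs_of_pos hy.1]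
    refine (mul_le_mul_of_nonneg_right (hg _) (pow_nonneg hy.1.le _)).trans (le_of_eq ?_)
    rw [pow_add, pow_add, mul_pow]
    ring
  · have : (1 - T * y)⁻¹ ≤ 2 := by
      rw [inv_le_comm₀ (by linarith) (by norm_num)]
      linarith
    have hp : 0 ≤ T ^ J * y ^ J := mul_nonneg (by positivity) (pow_nonneg hy.1.le _)
    nlinarith [mul_le_mul_of_nonneg_left this hp]

theorem JetBound.hasDerivAt_tsum {x₀ ρ T y : ℝ} {f f₁ f₂ : ℕ → ℝ → ℝ}
    (h : ∀ j, JetBound (Metric.ball x₀ ρ) (T ^ j) (f j) (f₁ j) (f₂ j)) (hT : 1 ≤ T) (hy : 0 < y)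
    (hyT : T * y < 1) {x : ℝ} (hx : x ∈ Metric.ball x₀ ρ) :
    HasDerivAt (fun x => ∑' j, f j x * y ^ j) (∑' j, f₁ j x * y ^ j) x ∧
      HasDerivAt (fun x => ∑' j, f₁ j x * y ^ j) (∑' j, f₂ j x * y ^ j) x := by
  have hu : Summable fun j : ℕ => (T * y) ^ j := summable_geometric_of_lt_one (by positivity) hyT
  have hpc : IsPreconnected (Metric.ball x₀ ρ) := (convex_ball x₀ ρ).isPreconnected
  have hb : ∀ {a : ℝ} {j : ℕ}, |a| ≤ T ^ j → ‖a * y ^ j‖ ≤ (T * y) ^ j := fun {a j} ha => by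
    rw [norm_mul, norm_pow, Real.norm_eq_abs, Real.norm_eq_abs, abs_of_pos hy, mul_pow]
    exact mul_le_mul_of_nonneg_right ha (by positivity)
  exact ⟨hasDerivAt_tsum_of_isPreconnected hu Metric.isOpen_ball hpc
      (fun j z hz => (h j z hz).1.mul_const _) (fun j z hz => hb (h j z hz).2.2.2.1) hx
      (summable_of_abs_le_pow (fun j => (h j x hx).2.2.1) hT hy hyT) hx,
    hasDerivAt_tsum_of_isPreconnected hu Metric.isOpen_ball hpc
      (fun j z hz => (h j z hz).2.1.mul_const _) (fun j z hz => hb (h j z hz).2.2.2.2) hx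
      (summable_of_abs_le_pow (fun j => (h j x hx).2.2.2.1) hT hy hyT) hx⟩

/-- Expansion of the derivatives of order at most two of a block with respect to the weight. -/
theorem exists_iteratedDeriv_block (r s : ℝ) {x₀ : ℝ} (h₀ : NotPole (2 * x₀)) :
    ∃ g : ℕ → ℕ → ℝ, g 0 = blockCoeff r s x₀ ∧ ∀ q ≤ 2, ∀ J : ℕ,
      (fun y : ℝ => iteratedDeriv q (fun x => block r s x (y / (1 + y))) x₀ / (q.factorial : ℝ) -
        ∑ i ∈ Finset.range (q + 1), ∑ j ∈ Finset.range J,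
          g (q - i) j * (y ^ (x₀ + j) * Real.log y ^ i / (i.factorial : ℝ))) =O[𝓝[>] 0]
        fun y : ℝ => y ^ (x₀ + J - 1) := by
  obtain ⟨ρ, hρ, δ, hδ, hρ1, hδ1, hU⟩ := h₀.exists_nhds
  have hP : ∀ t : ℝ, |t| ≤ |r| + |s| → ∀ x ∈ Metric.ball x₀ ρ, |x - t| ≤ |x₀| + 1 + (|r| + |s|) := by
    intro t ht x hx
    rw [Metric.mem_ball, Real.dist_eq] at hx
    have := abs_sub_abs_le_abs_sub x x₀
    linarith [abs_sub x t]
  have hr := hP r (by linarith [abs_nonneg s])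
  obtain ⟨T, hT, f₁, f₂, hf⟩ := exists_jetBound_blockCoeff r s hδ hδ1 hU hr
    (hP s (by linarith [abs_nonneg r]))
  -- Up to sign the coefficients `blockSeq` are block coefficients with -s in place of s, so the
  -- same lemma supplies the growth bound that `block_small` needs.
  obtain ⟨T', hT', _, _, hf'⟩ := exists_jetBound_blockCoeff r (-s) hδ hδ1 hU hr
    (hP (-s) (by rw [abs_neg]; linarith [abs_nonneg r]))
  have hx₀ : x₀ ∈ Metric.ball x₀ ρ := Metric.mem_ball_self hρ
  -- The Taylor coefficients of order k in the weight, with the factorial 1/k! included.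
  set g : ℕ → ℕ → ℝ := fun k j =>
    if k = 0 then blockCoeff r s x₀ j else if k = 1 then f₁ j x₀ else f₂ j x₀ / 2 with hg
  have hgb : ∀ k j, |g k j| ≤ T ^ j := fun k j => by
    obtain ⟨-, -, h3, h4, h5⟩ := hf j x₀ hx₀
    simp only [hg]
    split_ifs
    · exact h3
    · exact h4
    · rw [abs_div, abs_two]; linarith [abs_nonneg (f₂ j x₀)]
  refine ⟨g, by funext j; simp [hg], fun q hq J => ?_⟩
  -- The Leibniz rule for y^x times the power series: i derivatives on y^x give log^i y, and the
  -- other q - i act on the coefficients.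
  have key : ∀ᶠ y in 𝓝[>] (0 : ℝ),
      iteratedDeriv q (fun x => block r s x (y / (1 + y))) x₀ / (q.factorial : ℝ) =
        ∑ i ∈ Finset.range (q + 1), (y ^ x₀ * Real.log y ^ i / (i.factorial : ℝ)) *
          ∑' j, g (q - i) j * y ^ j := by
    filter_upwards [Ioo_mem_nhdsGT (show (0 : ℝ) < 1 / (4 * (T * T')) by positivity)] with y hy
    have hy0 := hy.1
    have hy1 : y * (4 * (T * T')) < 1 := by
      have := hy.2
      rwa [lt_div_iff₀ (by positivity)] at this
    have hyT : T * y < 1 := by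
      nlinarith [mul_le_mul_of_nonneg_left hT' (by positivity : 0 ≤ T * y)]
    have hyT' : y * (4 * T') < 1 := by
      nlinarith [mul_le_mul_of_nonneg_left hT (by positivity : 0 ≤ T' * y)]
    have hblock : ∀ x ∈ Metric.ball x₀ ρ,
        block r s x (y / (1 + y)) = y ^ x * ∑' j, blockCoeff r s x j * y ^ j := by
      intro x hx
      refine block_small (A := ⌈|x₀| + 1 + (|r| + |s|)⌉₊) (fun k hk => ?_)
        ((hr x hx).trans (Nat.le_ceil _)) hT' (fun n => ?_) hy0 hyT'
      · have := hU x hx k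
        rw [hk, neg_add_cancel, abs_zero] at this
        nlinarith [(Nat.cast_nonneg k : (0 : ℝ) ≤ k)]
      · have e : |blockSeq r s x n| = |blockCoeff r (-s) x n| := by
          unfold blockSeq blockCoeff
          rw [abs_mul _ ((-1 : ℝ) ^ n), abs_neg_one_pow, mul_one, sub_neg_eq_add]
        rw [e]
        exact (hf' n x hx).2.2.1
    have hpow : ∀ x, HasDerivAt (fun x : ℝ => y ^ x) (y ^ x * Real.log y) x := fun x => by
      simpa [mul_comm] using (hasDerivAt_id x).const_rpow hy0
    have hG := fun x hx => JetBound.hasDerivAt_tsum hf hT hy0 hyT (x := x) hx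
    have hd1 : ∀ x ∈ Metric.ball x₀ ρ, HasDerivAt (fun x => block r s x (y / (1 + y)))
        (y ^ x * Real.log y * ∑' j, blockCoeff r s x j * y ^ j + y ^ x * ∑' j, f₁ j x * y ^ j) x :=
      fun x hx => ((hpow x).mul (hG x hx).1).congr_of_eventuallyEq
        ((Metric.isOpen_ball.mem_nhds hx |> eventually_of_mem) hblock)
    have hd2 := (((hpow x₀).mul_const (Real.log y)).mul (hG x₀ hx₀).1).add
      ((hpow x₀).mul (hG x₀ hx₀).2)
    have hd2' := hd2.congr_of_eventuallyEq (f₁ := deriv fun x => block r s x (y / (1 + y)))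
        ((Metric.isOpen_ball.mem_nhds hx₀ |> eventually_of_mem) fun x hx => (hd1 x hx).deriv)
    interval_cases q
    · simp [hg, hblock x₀ hx₀]
    · rw [iteratedDeriv_one, (hd1 x₀ hx₀).deriv]
      simp [Finset.sum_range_succ, hg]
      ring
    · rw [iteratedDeriv_succ, iteratedDeriv_one, hd2'.deriv]
      simp [Finset.sum_range_succ, hg, div_mul_eq_mul_div, tsum_div_const]
      ring
  have hsum : (fun y : ℝ => ∑ i ∈ Finset.range (q + 1),
      (y ^ x₀ * Real.log y ^ i / (i.factorial : ℝ)) *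
        (∑' j, g (q - i) j * y ^ j - ∑ j ∈ Finset.range J, g (q - i) j * y ^ j)) =O[𝓝[>] 0]
      fun y : ℝ => y ^ (x₀ + J - 1) := by
    refine IsBigO.fun_sum fun i _ => ?_
    -- One power of y is given up to absorb the logarithms; this is the loss in the stated order.
    have h1 : (fun y : ℝ => y ^ x₀ * Real.log y ^ i) =O[𝓝[>] 0] fun y : ℝ => y ^ (x₀ - 1) := by
      have := isBigO_powLog (k := (x₀, i)) (M := x₀ - 1) (by simp)
      unfold powLog at this
      rwa [isBigO_ofReal_left] at this
    have h2 := (h1.const_mul_left ((i.factorial : ℝ)⁻¹)).mul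
      (tsum_sub_sum_isBigO (hgb (q - i)) hT J)
    refine h2.congr' (Eventually.of_forall fun y => by simp only; ring) ?_
    filter_upwards [self_mem_nhdsWithin] with y hy
    rw [← Real.rpow_natCast, ← Real.rpow_add hy]
    congr 1
    ring
  refine hsum.congr' ?_ EventuallyEq.rfl
  filter_upwards [key, self_mem_nhdsWithin] with y hy hy0
  rw [hy, ← Finset.sum_sub_distrib]
  refine Finset.sum_congr rfl fun i _ => ?_
  rw [mul_sub, Finset.mul_sum]
  congr 1
  refine Finset.sum_congr rfl fun j _ => ?_
  rw [Real.rpow_add hy0, Real.rpow_natCast]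
  ring

/-- The sum over `n` of the exchanged families, expanded order by order in the small cross ratio. -/
theorem hasCasimirSingularPart_sum_block {r s r' s' τ t₁ t₃ : ℝ} {q : ℕ}
    (hq : q = 0 ∨ (q = 1 ∧ (τ - t₁ - t₃ = -r' ∨ τ - t₁ - t₃ = -s')) ∨
      (q = 2 ∧ τ - t₁ - t₃ = -r' ∧ τ - t₁ - t₃ = -s'))
    (hτ : NotPole (2 * τ)) (A : ℕ → ℂ) (κ : ℂ) :
    HasCasimirSingularPart r' s' (fun M y => κ * ∑ n ∈ Finset.range M,
        ((y ^ (-t₁ - t₃) : ℝ) : ℂ) * A n *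
          ((iteratedDeriv q (fun x => block r s x (y / (1 + y))) (τ + n) / (q.factorial : ℝ) : ℝ) : ℂ))
      (Finset.univ : Finset Unit) (fun _ => τ - t₁ - t₃) (fun _ => q)
      (fun _ m => κ * ∑ n ∈ Finset.range (m + 1), A n * (blockCoeff r s (τ + n) (m - n) : ℂ)) := by
  have hτn : ∀ n : ℕ, NotPole (2 * (τ + n)) := fun n => by
    have := hτ.add_nat (2 * n)
    rwa [show 2 * τ + ((2 * n : ℕ) : ℝ) = 2 * (τ + n) by push_cast; ring] at this
  choose g hg0 hg using fun n => exists_iteratedDeriv_block r s (hτn n)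
  have hq2 : q ≤ 2 := by rcases hq with h | h | h <;> omega
  set Ψ : ℕ → ℕ → ℂ := fun i m =>
    κ * ∑ n ∈ Finset.range (m + 1), A n * (g n (q - i) (m - n) : ℂ) with hΨ
  set P : ℕ → ℕ → ℝ → ℝ := fun i m y =>
    y ^ (τ - t₁ - t₃ + m) * Real.log y ^ i / (i.factorial : ℝ) with hP
  have main : ∀ M : ℕ, (fun y : ℝ => κ * ∑ n ∈ Finset.range M, ((y ^ (-t₁ - t₃) : ℝ) : ℂ) * A n *
        ((iteratedDeriv q (fun x => block r s x (y / (1 + y))) (τ + n) / (q.factorial : ℝ) : ℝ) : ℂ)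
      - ∑ i ∈ Finset.range (q + 1), ∑ m ∈ Finset.range M, Ψ i m * (P i m y : ℂ)) =O[𝓝[>] 0]
      fun y : ℝ => y ^ (τ - t₁ - t₃ + M - 1) := by
    intro M
    have h1 : (fun y : ℝ => ∑ n ∈ Finset.range M, κ * A n * (((y ^ (-t₁ - t₃) *
        (iteratedDeriv q (fun x => block r s x (y / (1 + y))) (τ + n) / (q.factorial : ℝ) -
          ∑ i ∈ Finset.range (q + 1), ∑ j ∈ Finset.range (M - n),
          g n (q - i) j * (y ^ (τ + n + j) * Real.log y ^ i / (i.factorial : ℝ)))) : ℝ) : ℂ))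
        =O[𝓝[>] 0] fun y : ℝ => y ^ (τ - t₁ - t₃ + M - 1) := by
      refine IsBigO.fun_sum fun n hn => IsBigO.const_mul_left ?_ _
      rw [isBigO_ofReal_left]
      refine ((isBigO_refl (fun y : ℝ => y ^ (-t₁ - t₃)) (𝓝[>] 0)).mul
        (hg n q hq2 (M - n))).congr' EventuallyEq.rfl ?_
      filter_upwards [self_mem_nhdsWithin] with y hy
      rw [← Real.rpow_add hy, Nat.cast_sub (Finset.mem_range.1 hn).le]
      congr 1
      ring
    refine h1.congr' ?_ EventuallyEq.rfl
    filter_upwards [self_mem_nhdsWithin] with y hy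
    have h2 : ∑ i ∈ Finset.range (q + 1), ∑ m ∈ Finset.range M, Ψ i m * (P i m y : ℂ) =
        ∑ n ∈ Finset.range M, κ * A n * ((y ^ (-t₁ - t₃) * ∑ i ∈ Finset.range (q + 1),
          ∑ j ∈ Finset.range (M - n),
          g n (q - i) j * (y ^ (τ + n + j) * Real.log y ^ i / (i.factorial : ℝ)) : ℝ) : ℂ) := by
      have h3 : ∀ i, ∑ m ∈ Finset.range M, Ψ i m * (P i m y : ℂ) = ∑ n ∈ Finset.range M,
          ∑ j ∈ Finset.range (M - n), κ * A n * ((y ^ (-t₁ - t₃) *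
            (g n (q - i) j * (y ^ (τ + n + j) * Real.log y ^ i / (i.factorial : ℝ))) : ℝ) : ℂ) := by
        intro i
        rw [← Finset.sum_range_diag_flip M fun n j => κ * A n * ((y ^ (-t₁ - t₃) *
            (g n (q - i) j * (y ^ (τ + n + j) * Real.log y ^ i / (i.factorial : ℝ))) : ℝ) : ℂ)]
        refine Finset.sum_congr rfl fun m _ => ?_
        rw [hΨ]
        simp only [Finset.mul_sum, Finset.sum_mul]
        refine Finset.sum_congr rfl fun n hn => ?_
        have hn' := Nat.lt_succ_iff.1 (Finset.mem_range.1 hn)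
        have e : P i m y = y ^ (-t₁ - t₃) *
            (y ^ (τ + n + (m - n : ℕ)) * Real.log y ^ i / (i.factorial : ℝ)) := by
          rw [hP]
          simp only
          rw [Nat.cast_sub hn', show τ - t₁ - t₃ + (m : ℝ) = -t₁ - t₃ + (τ + n + (m - n)) by ring,
            Real.rpow_add hy]
          ring
        rw [e]
        push_cast
        ring
      rw [Finset.sum_congr rfl fun i _ => h3 i, Finset.sum_comm]
      refine Finset.sum_congr rfl fun n _ => ?_
      simp only [Finset.mul_sum, Complex.ofReal_sum]
    rw [h2, Finset.mul_sum, ← Finset.sum_sub_distrib]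
    refine Finset.sum_congr rfl fun n _ => ?_
    push_cast
    ring
  -- Only the top power of the logarithm is singular, and it multiplies the undifferentiated
  -- coefficients g 0. The lower powers have to be matched with Casimir-regular terms.
  have fin : ∀ u v w : ℕ → ℂ, (∀ M : ℕ, ∀ y > 0,
      ∑ i ∈ Finset.range q, ∑ m ∈ Finset.range M, Ψ i m * (P i m y : ℂ) =
        ∑ k ∈ Finset.range M,
          (u k * ((y ^ ((k : ℝ) - r') : ℝ) : ℂ) + v k * ((y ^ ((k : ℝ) - s') : ℝ) : ℂ)
            + w k * ((y ^ ((k : ℝ) - r') * Real.log y : ℝ) : ℂ))) →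
      (∀ k : ℕ, (¬ ∃ j : ℕ, (k : ℝ) - r' = (j : ℝ) - s') → w k = 0) → HasCasimirSingularPart r' s'
      (fun M y => κ * ∑ n ∈ Finset.range M, ((y ^ (-t₁ - t₃) : ℝ) : ℂ) * A n *
          ((iteratedDeriv q (fun x => block r s x (y / (1 + y))) (τ + n) / (q.factorial : ℝ) : ℝ) : ℂ))
      (Finset.univ : Finset Unit) (fun _ => τ - t₁ - t₃) (fun _ => q)
      (fun _ m => κ * ∑ n ∈ Finset.range (m + 1), A n * (blockCoeff r s (τ + n) (m - n) : ℂ)) := by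
    intro u v w h hw
    refine ⟨u, v, w, hw, fun N => ⟨⌈N + 1 - (τ - t₁ - t₃)⌉₊, fun M hM => ?_⟩⟩
    have hM' : (N : ℝ) ≤ τ - t₁ - t₃ + M - 1 := by
      have := (Nat.le_ceil (N + 1 - (τ - t₁ - t₃))).trans (Nat.cast_le.2 hM)
      linarith
    have h1 := (main M).trans (rpow_isBigO_rpow_zero hM')
    refine h1.congr' ?_ (Eventually.of_forall fun y => by simp)
    filter_upwards [self_mem_nhdsWithin] with y hy
    rw [← h M y hy, Finset.sum_range_succ, Finset.univ_unique, Finset.sum_singleton]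
    have e : ∀ m, Ψ q m = κ * ∑ n ∈ Finset.range (m + 1),
        A n * (blockCoeff r s (τ + n) (m - n) : ℂ) := fun m => by
      simp only [hΨ, Nat.sub_self, hg0]
    simp only [e, hP]
    ring
  have hsh : ∀ {i : ℕ} {ρ y : ℝ} (m : ℕ), τ - t₁ - t₃ = -ρ → P i m y =
      y ^ ((m : ℝ) - ρ) * Real.log y ^ i / (i.factorial : ℝ) := fun {i ρ y} m h => by
    simp only [hP, h]
    rw [neg_add_eq_sub]
  -- One degeneracy places all exponents in one tower, which makes the terms without logarithm
  -- regular. Two degeneracies place them in both, so that the terms with a single logarithm are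
  -- regular as well.
  rcases hq with rfl | ⟨rfl, h | h⟩ | ⟨rfl, h, h'⟩
  · exact fin 0 0 0 (by simp) (by simp)
  · exact fin (Ψ 0) 0 0 (fun M y _ => by simp [hsh _ h]) (by simp)
  · exact fin 0 (Ψ 0) 0 (fun M y _ => by simp [hsh _ h]) (by simp)
  · refine fin (Ψ 0) 0 (Ψ 1) (fun M y _ => ?_) fun k hk => absurd ⟨k, by linarith⟩ hk
    rw [Finset.sum_range_succ, Finset.sum_range_one, ← Finset.sum_add_distrib]
    refine Finset.sum_congr rfl fun k _ => ?_
    rw [hsh _ h, hsh _ h]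
    simp

section

variable {ι : Type*} {r s : ℝ} {I : Finset ι} {a : ι → ℝ} {q : ι → ℕ}

theorem ModRegular.linear_combination {f : ℕ → ℝ → ℂ} {c : ℕ → ι → ℕ → ℂ}
    (h : ∀ n, ModRegular r s (f n) I a q (c n)) (T : Finset ℕ) (k : ℕ → ℂ) :
    ModRegular r s (fun y => ∑ n ∈ T, k n * f n y) I a q
      (fun i m => ∑ n ∈ T, k n * c n i m) := by
  intro N
  choose M₀ hM using fun n => h n N
  refine ⟨T.sup M₀, fun M hM' => ?_⟩
  have := Submodule.sum_mem (expClass (regSet r s) N) fun n hn =>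
    Submodule.smul_mem _ (k n) (hM n M ((Finset.le_sup hn).trans hM'))
  convert this using 1
  funext y
  simp only [Finset.sum_apply, Pi.smul_apply, smul_eq_mul, mul_sub, Finset.sum_sub_distrib,
    Finset.mul_sum, Finset.sum_mul]
  congr 1
  symm
  rw [Finset.sum_comm]
  refine Finset.sum_congr rfl fun i _ => ?_
  rw [Finset.sum_comm]
  exact Finset.sum_congr rfl fun m _ => Finset.sum_congr rfl fun n _ => (mul_assoc _ _ _).symm

theorem ModRegular.congr_coeff {f : ℝ → ℂ} {c c' : ι → ℕ → ℂ} (h : ModRegular r s f I a q c)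
    (hc : ∀ i ∈ I, ∀ m, c i m = c' i m) : ModRegular r s f I a q c' := by
  intro N
  obtain ⟨M₀, hM⟩ := h N
  refine ⟨M₀, fun M hM' => ?_⟩
  have := hM M hM'
  rwa [show (fun y => f y - ∑ i ∈ I, ∑ m ∈ Finset.range M, c i m * powLog (a i + m, q i) y) =
    fun y => f y - ∑ i ∈ I, ∑ m ∈ Finset.range M, c' i m * powLog (a i + m, q i) y from
    funext fun y => by
      rw [Finset.sum_congr rfl fun i hi => Finset.sum_congr rfl fun m _ => by rw [hc i hi m]]]
    at this

theorem HasCasimirSingularPart.congr_coeff {F : ℕ → ℝ → ℂ} {c c' : ι → ℕ → ℂ}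
    (h : HasCasimirSingularPart r s F I a q c) (hc : ∀ i ∈ I, ∀ m, c i m = c' i m) :
    HasCasimirSingularPart r s F I a q c' := by
  obtain ⟨u, v, w, hw, h⟩ := h
  refine ⟨u, v, w, hw, fun N => ?_⟩
  obtain ⟨M₀, hM⟩ := h N
  refine ⟨M₀, fun M hM' => (hM M hM').congr_left fun y => ?_⟩
  rw [Finset.sum_congr rfl fun i hi => Finset.sum_congr rfl fun m _ => by rw [hc i hi m]]

end

theorem Admissible.S_ne_zero {w : Box ℝ} (hw : Admissible w) (n : ℕ) :
    S (w.b - w.d) (w.d - w.b) (-w.b - w.d) (w.b + w.d + n) ≠ 0 := by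
  rw [S_norm_eq hw.b hw.d hw.bd]
  have h3 := poch_ne_zero (hw.bd.add_nat n) n
  exact div_ne_zero (mul_ne_zero (poch_ne_zero hw.d n) (poch_ne_zero hw.b n))
    (mul_ne_zero h3 (by positivity))

/-! ### Crossing of the box coefficient and the exchange of double-twist families. -/

theorem mult_map {α : Type*} (g : α → ℝ) (B : Box α) :
    mult (B.map g) = (if g B.b + g B.d = g B.e₁ + g B.e₂ then 1 else 0) +
      (if g B.d + g B.b = g B.e₃ + g B.e₄ then 1 else 0) := rfl

namespace OPEData

variable {Op : Type*} (D : OPEData Op)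

theorem f_reverse (i j k : Op) :
    D.f i j k = (-1) ^ D.spin i * (-1) ^ D.spin j * (-1) ^ D.spin k * D.f k j i := by
  have hne : (-1 : ℂ) ≠ 0 := by norm_num
  rw [D.f_cyc i j k, D.f_swap k i j, zpow_add₀ hne, zpow_add₀ hne, D.f_cyc i k j, D.f_cyc j i k]
  ring

/-- Crossing reverses all four three-point couplings. The sign of every internal leg occurs at two
vertices and cancels, while the external signs make up the phase; the two γ factors only change
places. -/
theorem boxCoeff_cross (B : Box Op) (m n : ℕ) :
    D.boxCoeff B m n = D.phase B * D.conj.boxCoeff B.cross n m := by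
  have hne : (-1 : ℂ) ≠ 0 := by norm_num
  have sq : ∀ o, (-1 : ℂ) ^ D.spin o * (-1) ^ D.spin o = 1 := fun o => by
    rw [← mul_zpow]; norm_num
  have ha := sq B.a
  have hb := sq B.b
  have hc := sq B.c
  have hd := sq B.d
  show D.f B.d B.e₁ B.a * D.f B.a B.e₂ B.b * D.f B.b B.e₃ B.c * D.f B.c B.e₄ B.d *
    (gammaLead (B.map D.h).cross m : ℂ) * (gammaLead (B.map D.hbar) n : ℂ) = D.phase B *
    (D.f B.c B.e₃ B.b * D.f B.b B.e₂ B.a * D.f B.a B.e₁ B.d * D.f B.d B.e₄ B.c *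
    (gammaLead (B.map D.hbar) n : ℂ) * (gammaLead (B.map D.h).cross m : ℂ))
  rw [D.f_reverse B.d B.e₁ B.a, D.f_reverse B.a B.e₂ B.b, D.f_reverse B.b B.e₃ B.c,
    D.f_reverse B.c B.e₄ B.d]
  unfold phase
  rw [zpow_add₀ hne, zpow_add₀ hne, zpow_add₀ hne]
  set G := D.f B.a B.e₁ B.d * D.f B.b B.e₂ B.a * D.f B.c B.e₃ B.b * D.f B.d B.e₄ B.c *
    (gammaLead (B.map D.h).cross m : ℂ) * (gammaLead (B.map D.hbar) n : ℂ) *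
    ((-1) ^ D.spin B.e₁ * (-1) ^ D.spin B.e₂ * (-1) ^ D.spin B.e₃ * (-1) ^ D.spin B.e₄) with hG
  have h1 : G * ((-1) ^ D.spin B.a * (-1) ^ D.spin B.a) * ((-1) ^ D.spin B.b * (-1) ^ D.spin B.b) *
    ((-1) ^ D.spin B.c * (-1) ^ D.spin B.c) * ((-1) ^ D.spin B.d * (-1) ^ D.spin B.d) = G := by
    rw [ha, hb, hc, hd]
    ring
  rw [hG] at h1
  linear_combination h1

variable {D} {B : Box Op} {κ : ℂ} {Xa Xc : Finset Op} {L R W δ : ℕ → ℝ → ℂ} {h₀ : ℕ → ℝ}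

theorem HasExchangeSingularPart.congr {q : ℕ} {p : ℕ → ℝ → ℂ} {X : Finset (Op × Op)}
    {C C' : Op × Op → ℕ → ℕ → ℂ} (h : D.HasExchangeSingularPart B q p h₀ κ X C)
    (hC : ∀ x ∈ X, ∀ m n, C x m n = C' x m n) : D.HasExchangeSingularPart B q p h₀ κ X C' := by
  obtain ⟨h1, Φ, h2, h3⟩ := h
  exact ⟨h1, Φ, h2, fun n => (h3 n).congr_coeff fun x hx m => hC x hx m n⟩

/-- The power of δ is shared between the two sides: each degeneracy attaches one δ to the product, L
or R, that only the logarithm determines. Hence the known combinations Lδ^ε and Rδ^{ε'} are all that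
enters, divided by W. -/
theorem IsDoubleTwistFamily.hasQuotExpansion (hF : D.IsDoubleTwistFamily B Xa Xc L R W δ)
    (hb : NotPole (2 * D.h B.b)) (hd : NotPole (2 * D.h B.d)) (n : ℕ)
    (hS : S (D.hbar B.b - D.hbar B.d) (D.hbar B.d - D.hbar B.b) (-D.hbar B.b - D.hbar B.d)
        (D.hbar B.b + D.hbar B.d + n) ≠ 0) :
    HasQuotExpansion (fun h => L n h * R n h / W n h * δ n h ^ mult (B.map D.hbar) /
        (blockWeight (D.h B.e₁ - D.h B.e₂) (D.h B.e₃ - D.h B.e₄) h : ℂ))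
      (Xa ×ˢ Xc) (fun x => D.h x.1 + D.h x.2 - D.h B.e₁ - D.h B.e₃)
      (fun x M =>
        (D.f B.d B.e₁ x.1 * D.f x.1 B.e₂ B.b *
          (leadBeta (D.hbar B.b) (D.hbar B.d) (D.hbar B.e₁) (D.hbar B.e₂) (D.hbar x.1) n : ℂ)) *
        (D.f B.b B.e₃ x.2 * D.f x.2 B.e₄ B.d *
          (leadBeta (D.hbar B.d) (D.hbar B.b) (D.hbar B.e₃) (D.hbar B.e₄) (D.hbar x.2) n : ℂ)) /
        (S (D.hbar B.b - D.hbar B.d) (D.hbar B.d - D.hbar B.b) (-D.hbar B.b - D.hbar B.d)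
          (D.hbar B.b + D.hbar B.d + n) : ℂ) *
        ((boxConst ((B.withAC x.1 x.2).map D.h).cross *
          boxProd ((B.withAC x.1 x.2).map D.h).cross M : ℝ) : ℂ)) := by
  have hL := hF.left n
  have hR := hF.right n
  simp only [mul_right_comm _ ((blockCoeff _ _ _ _ : ℝ) : ℂ)] at hL hR
  have h := hasQuotExpansion_box (I := Xa) (J := Xc) (B.map D.h) hb hd (xa := D.h) (xc := D.h)
    (fa := fun a => D.f B.d B.e₁ a * D.f a B.e₂ B.b *
          (leadBeta (D.hbar B.b) (D.hbar B.d) (D.hbar B.e₁) (D.hbar B.e₂) (D.hbar a) n : ℂ))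
    (fc := fun c => D.f B.b B.e₃ c * D.f c B.e₄ B.d *
          (leadBeta (D.hbar B.d) (D.hbar B.b) (D.hbar B.e₃) (D.hbar B.e₄) (D.hbar c) n : ℂ))
    (Complex.ofReal_ne_zero.2 hS) hL hR (hF.norm n)
  rw [show (fun h => L n h * R n h / W n h * δ n h ^ mult (B.map D.hbar) /
        (blockWeight (D.h B.e₁ - D.h B.e₂) (D.h B.e₃ - D.h B.e₄) h : ℂ)) = _ from
    funext fun h => ?_]
  · exact h
  · rw [mult_map, pow_add]
    generalize (if D.hbar B.b + D.hbar B.d = D.hbar B.e₁ + D.hbar B.e₂ then 1 else 0 : ℕ) = ε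
    generalize (if D.hbar B.d + D.hbar B.b = D.hbar B.e₃ + D.hbar B.e₄ then 1 else 0 : ℕ) = ε'
    simp only [Box.map]
    ring

/-- The exchange of the families `[bd]_n` in the `12 → 34` channel. -/
theorem IsDoubleTwistFamily.hasExchangeSingularPart
    (hF : D.IsDoubleTwistFamily B Xa Xc L R W δ) (hXa : Xa.Nonempty) (hXc : Xc.Nonempty)
    (hadm : ∀ a ∈ Xa, ∀ c ∈ Xc, Admissible ((B.withAC a c).map D.h).cross ∧
      Admissible ((B.withAC a c).map D.hbar)) (hh₀ : ∀ n, 0 < h₀ n) (κ : ℂ) :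
    D.HasExchangeSingularPart B (mult (B.map D.hbar))
      (fun n h => L n h * R n h / W n h * δ n h ^ mult (B.map D.hbar)) h₀ κ (Xa ×ˢ Xc)
      (fun x m n => κ * D.boxCoeff (B.withAC x.1 x.2) m n) := by
  obtain ⟨a₀, ha₀⟩ := hXa
  obtain ⟨c₀, hc₀⟩ := hXc
  obtain ⟨hw, hwbar⟩ := hadm a₀ ha₀ c₀ hc₀
  have hS := fun n => hwbar.S_ne_zero n
  have hQ := fun n => hF.hasQuotExpansion hw.a hw.c n (hS n)
  have hmod := fun n => (hQ n).modRegular (q := fun x => mult ((B.withAC x.1 x.2).map D.h).cross)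
    (fun x hx => by
      have hx' := (hadm x.1 (Finset.mem_product.1 hx).1 x.2 (Finset.mem_product.1 hx).2).1
      refine ⟨?_, ?_⟩
      · convert hx'.resonant12 using 1
        simp only [Box.cross, Box.map, Box.withAC]
        ring
      · convert hx'.resonant34 using 1
        simp only [Box.cross, Box.map, Box.withAC]
        ring)
    (fun x _ => by
      simp only [mult, Box.cross, Box.map, Box.withAC]
      congr 1
      · exact if_congr ⟨fun h => by linarith, fun h => by linarith⟩ rfl rfl
      · exact if_congr ⟨fun h => by linarith, fun h => by linarith⟩ rfl rfl) (hh₀ n)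
  -- The coefficient of ȳ at order n collects the families n' ≤ n, each weighted with the block
  -- coefficient of order n - n'.
  refine ⟨fun n y hy => (hQ n).summable _ hy, fun n y => κ * ∑ n' ∈ Finset.range (n + 1),
    D.blockSum B (fun h => L n' h * R n' h / W n' h * δ n' h ^ mult (B.map D.hbar)) (h₀ n') y *
      (blockCoeff (D.hbar B.e₁ - D.hbar B.e₂) (D.hbar B.e₃ - D.hbar B.e₄)
        (D.hbar B.b + D.hbar B.d + n') (n - n') : ℂ), fun y hy => ?_, fun n => ?_⟩
  · refine hasCasimirSingularPart_sum_block ?_ ?_ (fun n => D.blockSum B (fun h =>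
      L n h * R n h / W n h * δ n h ^ mult (B.map D.hbar)) (h₀ n) y) κ
    · rw [mult_map]
      by_cases h1 : D.hbar B.b + D.hbar B.d = D.hbar B.e₁ + D.hbar B.e₂ <;>
        by_cases h2 : D.hbar B.d + D.hbar B.b = D.hbar B.e₃ + D.hbar B.e₄
      · rw [if_pos h1, if_pos h2]
        exact Or.inr (Or.inr ⟨rfl, by linarith, by linarith⟩)
      · rw [if_pos h1, if_neg h2]
        exact Or.inr (Or.inl ⟨rfl, Or.inl (by linarith)⟩)
      · rw [if_neg h1, if_pos h2]
        exact Or.inr (Or.inl ⟨rfl, Or.inr (by linarith)⟩)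
      · rw [if_neg h1, if_neg h2]
        exact Or.inl rfl
    · have := hwbar.bd.add_nat 1
      rw [Nat.cast_one, sub_add_cancel] at this
      exact this
  · refine ModRegular.hasCasimirSingularPart ?_
    have h := ModRegular.linear_combination hmod (Finset.range (n + 1)) fun n' =>
      κ * (blockCoeff (D.hbar B.e₁ - D.hbar B.e₂) (D.hbar B.e₃ - D.hbar B.e₄)
        (D.hbar B.b + D.hbar B.d + n') (n - n') : ℂ)
    beta_reduce
    rw [show (fun y => κ * ∑ n' ∈ Finset.range (n + 1), D.blockSum B (fun h =>
          L n' h * R n' h / W n' h * δ n' h ^ mult (B.map D.hbar)) (h₀ n') y *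
        (blockCoeff (D.hbar B.e₁ - D.hbar B.e₂) (D.hbar B.e₃ - D.hbar B.e₄)
        (D.hbar B.b + D.hbar B.d + n') (n - n') : ℂ)) = _ from funext fun y => ?_]
    · refine h.congr_coeff fun x hx m => ?_
      have hx' := (hadm x.1 (Finset.mem_product.1 hx).1 x.2 (Finset.mem_product.1 hx).2).1
      -- The sum over h contributed the two `gammaShift` factors and the large-weight series
      -- contributed `boxConst` and `boxProd`; together they are γ̂ of the crossed box. The sum over
      -- n' is γ̂ in the barred weights by definition.
      have hlead := gammaLead_eq hx' m
      have e1 : -(D.h x.1 + D.h x.2 - D.h B.e₁ - D.h B.e₃) - (D.h B.e₁ - D.h B.e₂) =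
        D.h B.e₃ + D.h B.e₂ - D.h x.1 - D.h x.2 := by ring
      have e2 : -(D.h x.1 + D.h x.2 - D.h B.e₁ - D.h B.e₃) - (D.h B.e₃ - D.h B.e₄) =
        D.h B.e₁ + D.h B.e₄ - D.h x.2 - D.h x.1 := by ring
      rw [e1, e2]
      unfold boxCoeff
      rw [hlead]
      unfold gammaLead
      push_cast
      simp only [Finset.mul_sum, Finset.sum_div]
      refine Finset.sum_congr rfl fun n' _ => ?_
      simp only [Box.cross, Box.map, Box.withAC]
      ring
    · rw [Finset.mul_sum]
      refine Finset.sum_congr rfl fun n' _ => ?_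
      simp only [blockSum]
      ring

theorem readingHasSingularPart (hw : Admissible (B.map D.h).cross)
    (hwbar : Admissible (B.map D.hbar)) (κ : ℂ) :
    D.ReadingHasSingularPart B κ (fun m n => κ * D.boxCoeff B m n) := by
  intro L R W δ h₀ hh₀ hF
  have h := hF.hasExchangeSingularPart (Finset.singleton_nonempty _) (Finset.singleton_nonempty _)
    (fun a ha c hc => by
      rw [Finset.mem_singleton.1 ha, Finset.mem_singleton.1 hc]
      exact ⟨hw, hwbar⟩) hh₀ κ
  rw [Finset.singleton_product_singleton] at h
  refine h.congr fun x hx m n => ?_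
  rw [Finset.mem_singleton.1 hx]
  rfl

/-- This is the first reading for the conjugate data and the crossed box. Crossing twice restores
the box, so the two admissibility conditions just trade places. -/
theorem readingHasSingularPart_cross (hw : Admissible (B.map D.h).cross)
    (hwbar : Admissible (B.map D.hbar)) :
    D.conj.ReadingHasSingularPart B.cross (D.phase B) (fun n m => D.boxCoeff B m n) := by
  simp only [D.boxCoeff_cross B]
  exact readingHasSingularPart (D := D.conj) (B := B.cross) hwbar hw (D.phase B)

end OPEData
end BoxDiagram

open BoxDiagram Filter Topology in
theorem mainTheorem2 {Op : Type*} (D : OPEData Op) :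
    -- the large-weight identity with coefficients `γ_{3214;badc}(m)`
    (∀ B : Box Op, Admissible (B.map D.h).cross → mult (B.map D.h).cross = 0 →
        ∀ A C : ℝ → ℂ,
          HasLargeWeightExpansion (D.h B.b - D.h B.d) (D.h B.e₁ - D.h B.e₂) A
            (Finset.univ : Finset Unit) (fun _ => D.h B.a - D.h B.b - D.h B.e₁)
            (fun _ m =>
              (blockCoeff (D.h B.e₁ - D.h B.d) (D.h B.b - D.h B.e₂) (D.h B.a) m : ℂ)) →
          HasLargeWeightExpansion (D.h B.d - D.h B.b) (D.h B.e₃ - D.h B.e₄) C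
            (Finset.univ : Finset Unit) (fun _ => D.h B.c - D.h B.d - D.h B.e₃)
            (fun _ m =>
              (blockCoeff (D.h B.e₃ - D.h B.b) (D.h B.d - D.h B.e₄) (D.h B.c) m : ℂ)) →
          HasLargeWeightExpansion (D.h B.e₁ - D.h B.e₂) (D.h B.e₃ - D.h B.e₄)
            (fun h => A h * C h /
              (S (D.h B.b - D.h B.d) (D.h B.d - D.h B.b) (-D.h B.b - D.h B.d) h : ℂ))
            (Finset.univ : Finset Unit)
            (fun _ => D.h B.a + D.h B.c - D.h B.e₁ - D.h B.e₃)
            (fun _ m => (gamma (B.map D.h).cross m : ℂ))) ∧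
    -- a single box diagram
    (∀ B : Box Op, Admissible (B.map D.h).cross → Admissible (B.map D.hbar) →
      -- the coefficients, including the degenerate cases, as limits of the generic ones
      (∀ m, Tendsto
        (fun t : ℝ × ℝ => (t.1 + t.2) ^ mult (B.map D.h).cross *
          gamma (shiftBD (B.map D.h).cross t) m)
        (𝓝[{t | t.1 + t.2 ≠ 0}] 0) (𝓝 (gammaLead (B.map D.h).cross m))) ∧
      (∀ n, Tendsto
        (fun t : ℝ × ℝ => (t.1 + t.2) ^ mult (B.map D.hbar) *
          gamma (shiftBD (B.map D.hbar) t) n)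
        (𝓝[{t | t.1 + t.2 ≠ 0}] 0) (𝓝 (gammaLead (B.map D.hbar) n))) ∧
      -- `[bd]_n` exchange in the `12 → 34` channel
      D.ReadingHasSingularPart B 1 (fun m n => D.boxCoeff B m n) ∧
      -- `[ac]_m` exchange in the `23 → 14` channel: the same double series
      D.conj.ReadingHasSingularPart B.cross (D.phase B) (fun n m => D.boxCoeff B m n) ∧
      -- invariance of the summand under crossing
      (∀ m n, D.boxCoeff B m n = D.phase B * D.conj.boxCoeff B.cross n m)) ∧
    -- second order in the anomalous dimensions: `[bd]`, `[12]`, `[34]` of equal twist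
    (∀ (B : Box Op) (Xa Xc : Finset Op), Xa.Nonempty → Xc.Nonempty →
      D.hbar B.b + D.hbar B.d = D.hbar B.e₁ + D.hbar B.e₂ →
      D.hbar B.d + D.hbar B.b = D.hbar B.e₃ + D.hbar B.e₄ →
      (∀ a ∈ Xa, ∀ c ∈ Xc, Admissible ((B.withAC a c).map D.h).cross ∧
        Admissible ((B.withAC a c).map D.hbar)) →
      (∀ (L R W δ : ℕ → ℝ → ℂ) (h₀ : ℕ → ℝ), (∀ n, 0 < h₀ n) →
        D.IsDoubleTwistFamily B Xa Xc L R W δ →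
        D.HasExchangeSingularPart B 2 (fun n h => L n h * R n h / W n h * δ n h ^ 2) h₀ 1
          (Xa ×ˢ Xc) (fun x => D.boxCoeff (B.withAC x.1 x.2))) ∧
      (∀ a ∈ Xa, ∀ c ∈ Xc, D.conj.ReadingHasSingularPart (B.withAC a c).cross (D.phase B)
        (fun n m => D.boxCoeff (B.withAC a c) m n))) ∧
    -- exponentiation for `[12]_n` exchange in `⟨1 2 2 1⟩`
    (∀ (B : Box Op) (X : Finset Op), X.Nonempty →
      B.e₃ = B.e₂ → B.e₄ = B.e₁ → B.b = B.e₂ → B.d = B.e₁ →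
      (∀ a ∈ X, ∀ c ∈ X, Admissible ((B.withAC a c).map D.h).cross ∧
        Admissible ((B.withAC a c).map D.hbar)) →
      (∀ (lamSq δ : ℕ → ℝ → ℂ) (h₀ : ℕ → ℝ), (∀ n, 0 < h₀ n) →
        D.IsDoubleTwistFamily B X X lamSq lamSq lamSq δ →
        D.HasExchangeSingularPart B 2 (fun n h => lamSq n h * δ n h ^ 2) h₀ 1
          (X ×ˢ X) (fun x => D.boxCoeff (B.withAC x.1 x.2))) ∧
      (∀ a ∈ X, ∀ c ∈ X, D.conj.ReadingHasSingularPart (B.withAC a c).cross (D.phase B)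
        (fun n m => D.boxCoeff (B.withAC a c) m n))) := by
  refine ⟨fun B hw h0 A C hA hC => hasLargeWeightExpansion_gamma (w := B.map D.h) hw h0 hA hC,
    fun B hw hwbar => ⟨tendsto_gamma hw, tendsto_gamma hwbar, ?_,
      OPEData.readingHasSingularPart_cross hw hwbar, D.boxCoeff_cross B⟩,
    fun B Xa Xc hXa hXc h12 h34 hadm => ⟨fun L R W δ h₀ hh₀ hF => ?_, fun a ha c hc =>
      OPEData.readingHasSingularPart_cross (B := B.withAC a c) (hadm a ha c hc).1
        (hadm a ha c hc).2⟩,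
    fun B X hX h3 h4 hb hd hadm => ⟨fun lamSq δ h₀ hh₀ hF => ?_, fun a ha c hc =>
      OPEData.readingHasSingularPart_cross (B := B.withAC a c) (hadm a ha c hc).1
        (hadm a ha c hc).2⟩⟩
  · simpa only [one_mul] using OPEData.readingHasSingularPart hw hwbar 1
  · have h := hF.hasExchangeSingularPart hXa hXc hadm hh₀ 1
    simp only [one_mul] at h
    rwa [show mult (B.map D.hbar) = 2 by rw [mult_map, if_pos h12, if_pos h34]] at h
  -- With L = R = W the quotient LR/W is λ² itself, also where λ² vanishes. Both degeneracies hold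
  -- automatically because b = 2 and d = 1.
  · have h := hF.hasExchangeSingularPart hX hX hadm hh₀ 1
    simp only [one_mul, mul_self_div_self] at h
    rwa [show mult (B.map D.hbar) = 2 by
      rw [mult_map, h3, h4, hb, hd, if_pos (add_comm _ _), if_pos (add_comm _ _)]] at h
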